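/- **Setting.** Let $q=e^{\hbar}\in\mathbb C^*$ be not a root of unity, $q^x:=e^{\hbar x}$, $[x]_q=\frac{q^x-q^{-x}}{q-q^{-1}}$, let $k\in\mathbb C\setminus\{0,-1\}$, $\beta,\gamma\in\mathbb C$, and $(a_{ij})_{i,j=1,2}=\begin{pmatrix}2&-1\\-1&0\end{pmatrix}$. *Algebra.* $U_q=U_q[\widehat{sl(2|1)}]$ is the associative superalgebra generated by the Drinfeld generators $X^{\pm,i}_m$ ($m\in\mathbb Z$), $h^i_n$ ($n\neq0$), $q^{\pm h^i_0}$, central $q^{\pm c/2}$, and $d$ ($i=1,2$); $X^{\pm,2}_m$ are odd, all other generators are even. With $[X,Y]_\xi=XY-(-1)^{[X][Y]}\xi YX$, $[X,Y]=[X,Y]_1$, the relations are: $q^{h}q^{-h}=1$, $q^{c/2}q^{-c/2}=1$, the $q^{h^i_0}$ commute with each other, with $h^j_m$ and with $d$; $[d,h^j_m]=mh^j_m$; $[d,X^{\pm,j}_m]=mX^{\pm,j}_m$; $$[h^i_m,h^j_n]=\delta_{m+n,0}\tfrac{[a_{ij}m]_q[mc]_q}{m},\quad q^{h^i_0}X^{\pm,j}_mq^{-h^i_0}=q^{\pm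 a_{ij}}X^{\pm,j}_m,\quad [h^i_m,X^{\pm,j}_n]=\pm\tfrac{[a_{ij}m]_q}{m}q^{\mp|m|c/2}X^{\pm,j}_{n+m},$$ $$[X^{+,i}_m,X^{-,j}_n]=\tfrac{\delta_{ij}}{q-q^{-1}}\bigl(q^{(m-n)c/2}\psi^{+,j}_{m+n}-q^{-(m-n)c/2}\psi^{-,j}_{m+n}\bigr),\quad [X^{\pm,2}_m,X^{\pm,2}_n]=0,$$ $$[X^{\pm,i}_{m+1},X^{\pm,j}_n]_{q^{\pm a_{ij}}}+[X^{\pm,j}_{n+1},X^{\pm,i}_m]_{q^{\pm a_{ij}}}=0\ (a_{ij}\ne0),\quad [X^{\pm,1}_{n_1},[X^{\pm,1}_{n_2},X^{\pm,2}_m]_{q^{-1}}]_q+(n_1\leftrightarrow n_2)=0,$$ where $\sum_n\psi^{\pm,i}_nz^{-n}=q^{\pm h^i_0}\exp\bigl(\pm(q-q^{-1})\sum_{n>0}h^i_{\pm n}z^{\mp n}\bigr)$. *Fock space.* Take oscillators $a^i_n$ ($i=1,2$), $b^{12}_n,b^{13}_n,b^{23}_n,c_n$ and the conjugate $Q$'s,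 whose only nonzero commutators are $[a^i_m,a^j_n]=\delta_{m+n,0}\frac{[a_{ij}m]_q[(k+1)m]_q}{m}$, $[a^i_0,Q_{a^j}]=(k+1)a_{ij}$, $[b^{ij}_m,b^{ij}_n]=(-1)^{\delta_{j2}}\delta_{m+n,0}\frac{[m]_q^2}{m}$, $[b^{ij}_0,Q_{b^{ij}}]=(-1)^{\delta_{j2}}$, $[c_m,c_n]=\delta_{m+n,0}\frac{[m]_q^2}{m}$, $[c_0,Q_c]=1$. Let $F_{\mu_1,\mu_2,\lambda_{12},\lambda_{13},\lambda_{23},\lambda_c}$ be the Fock module generated by the negative modes over the vector $e^{\mu_1Q_{a^1}+\mu_2Q_{a^2}+\lambda_{12}Q_{b^{12}}+\lambda_{13}Q_{b^{13}}+\lambda_{23}Q_{b^{23}}+\lambda_cQ_c}|0\rangle$, where $|0\rangle$ is killed by all non-negative modes. Put, for $s\in\mathbb Z$, $$F^{(s)}_{(\beta,\gamma)}=\bigoplus_{i,j,l\in\mathbb Z}F_{\frac{\beta}{k+1},\frac{2\gamma}{k+1},\,i+j,\,j,\,l,\,i+j+s},\qquad F_{(\beta,\gamma)}=F^{(0)}_{(\beta,\gamma)}.$$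 For each boson $t$ (that is, $t=a^1,a^2,b^{12},b^{13},b^{23},c$) put $t(z;\kappa)=-\sum_{n\ne0}\frac{t_n}{[n]_q}q^{-\kappa|n|}z^{-n}+Q_t+t_0\ln z$ and $t_\pm(z)=\pm(q-q^{-1})\sum_{n>0}t_{\pm n}z^{\mp n}\pm t_0\ln q$. Normal ordering $:\ :$ puts negative modes and $Q$'s to the left of positive modes and zero modes. *Action.* The generators act on $\bigoplus_sF^{(s)}_{(\beta,\gamma)}$ by $c=k$, $h^1_0=a^1_0+2b^{12}_0+b^{13}_0-b^{23}_0$, $h^2_0=a^2_0-b^{12}_0-b^{13}_0$, and for $m\neq0$ $$h^1_m=a^1_mq^{-\frac{|m|}2}+b^{12}_mq^{-(\frac k2+1)|m|}(q^{|m|}+q^{-|m|})+b^{13}_mq^{-(\frac k2+2)|m|}-b^{23}_mq^{-(\frac k2+1)|m|},$$ $$h^2_m=a^2_mq^{-\frac{|m|}2}-b^{12}_mq^{-(\frac k2+1)|m|}-b^{13}_mq^{-(\frac k2+1)|m|},$$ while $X^{\pm,i}(z)=\sum_nX^{\pm,i}_nz^{-n-1}$ is given by $$X^{+,1}(z)=-\tfrac1{(q-q^{-1})z}:e^{-b^{12}(z;-1)}(e^{-c(qz;0)}-e^{-c(q^{-1}z;0)}):e^{\sqrt{-1}\pi(c_0+b^{12}_0)},$$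 $$X^{+,2}(z)=-:e^{-b^{12}_+(qz)-b^{13}_+(qz)+b^{23}(qz;0)}:e^{\sqrt{-1}\pi(c_0+b^{12}_0+b^{13}_0+b^{23}_0)}+:e^{b^{12}(z;0)+b^{13}(z;0)+c(z;0)}:,$$ $$\begin{aligned}X^{-,1}(z)=\tfrac1{(q-q^{-1})z}:\bigl(&e^{a^1_+(q^{\frac{k+1}2}z)+b^{12}(q^{k+2}z;1)+b^{13}_+(q^{k+2}z)-b^{23}_+(q^{k+1}z)+c(q^{k+1}z;0)}\\&-e^{a^1_-(q^{-\frac{k+1}2}z)+b^{12}(q^{-k-2}z;1)+b^{13}_-(q^{-k-2}z)-b^{23}_-(q^{-k-1}z)+c(q^{-k-1}z;0)}\bigr):e^{-\sqrt{-1}\pi(c_0+b^{12}_0)}\\&+q^{k+1}:e^{a^1_+(q^{\frac{k+1}2}z)-b^{13}(q^{k+1}z;0)+b^{23}(q^{k+1}z;-1)}:e^{\sqrt{-1}\pi(b^{13}_0+b^{23}_0)},\end{aligned}$$ $$\begin{aligned}X^{-,2}(z)=\tfrac1{(q-q^{-1})z}\Bigl(&q:\bigl(e^{a^2_+(q^{\frac{k+1}2}z)-b^{23}(q^{k+1}z;0)}-e^{a^2_-(q^{-\frac{k+1}2}z)-b^{23}(q^{-k-1}z;0)}\bigr):e^{-\sqrt{-1}\pi(c_0+b^{12}_0+b^{13}_0+b^{23}_0)}\\&-:e^{a^2_-(q^{-\frac{k+1}2}z)-b^{12}(q^{-k-1}z;1)-b^{13}(q^{-k-1}z;1)}(e^{-c(q^{-k}z;0)}-e^{-c(q^{-k-2}z;0)}):\Bigr),\end{aligned}$$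 and $d=-N+\frac{a^1_0a^2_0+(a^2_0)^2+a^1_0+3a^2_0}{k+1}+\frac12\bigl(b^{12}_0(b^{12}_0-1)-b^{13}_0(b^{13}_0+1)-b^{23}_0(b^{23}_0+1)-c_0(c_0+1)\bigr)$, where $N$ is the degree operator which counts a creation operator $t_{-n}$ with degree $n$. *Ghosts.* $\eta(z)=\sum_n\eta_nz^{-n-1}=:e^{c(z;0)}:$ and $\xi(z)=\sum_n\xi_nz^{-n}=:e^{-c(z;0)}:$; the zero modes $\eta_0$ and $\xi_0$ map $F^{(s)}_{(\beta,\gamma)}$ to $F^{(s+1)}_{(\beta,\gamma)}$ and $F^{(s-1)}_{(\beta,\gamma)}$, respectively. On $F_{(\beta,\gamma)}$ let $\mathrm{Ker}_{\eta_0}$ be the kernel of $\eta_0$ and $\mathrm{Coker}_{\eta_0}=F_{(\beta,\gamma)}/\mathrm{Ker}_{\eta_0}$. **Proposition 4.** One has $F_{(\beta,\gamma)}=\eta_0\xi_0F_{(\beta,\gamma)}\oplus\xi_0\eta_0F_{(\beta,\gamma)}$ with $\mathrm{Ker}_{\eta_0}=\eta_0\xi_0F_{(\beta,\gamma)}$ (so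 that $\mathrm{Coker}_{\eta_0}\cong\xi_0\eta_0F_{(\beta,\gamma)}$). The formulas above define a representation $\rho$ of $U_q$ on $\bigoplus_sF^{(s)}_{(\beta,\gamma)}$ which preserves $F_{(\beta,\gamma)}$, and $\eta_0$ commutes with the action of the even elements and anticommutes with the action of the odd elements of $U_q$: $\eta_0\,\rho(x)=(-1)^{[x]}\rho(x)\,\eta_0$ for homogeneous $x\in U_q$. Hence $\mathrm{Ker}_{\eta_0}$ and $\mathrm{Coker}_{\eta_0}$, with the induced action, are both $U_q$-modules. -/

import Mathlib

noncomputable section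

namespace SL21

/-! ### Preliminaries: `q`-powers, `q`-numbers, coefficients of exponential series -/

/-- The power `q ^ x` for `q = exp lq` (so `lq` is a chosen value of `ln q`). -/
def qp (lq x : ℂ) : ℂ := Complex.exp (lq * x)

/-- The `q`-number `[x]_q = (q ^ x - q ^ (-x)) / (q - q⁻¹)`. -/
def qnum (lq x : ℂ) : ℂ := (qp lq x - qp lq (-x)) / (qp lq 1 - qp lq (-1))

/-- The coefficient of `w ^ n` in `exp (∑_{m > 0} A m * w ^ m) = ∑_r (1 / r!) (∑_{m > 0} A m w ^ m) ^ r`,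
with coefficients in a possibly noncommutative `ℂ`-algebra; the terms with `r > n` do not
contribute. -/
def expCoeff {R : Type*} [Ring R] [Algebra ℂ R] (A : ℕ → R) (n : ℕ) : R :=
  ∑ r ∈ Finset.range (n + 1), ((r.factorial : ℂ)⁻¹) •
    PowerSeries.coeff n ((PowerSeries.mk fun m => if m = 0 then 0 else A m) ^ r)

/-- The symmetric Cartan matrix `a_{ij}`, `i, j = 1, 2`, of `sl(2|1)`
(the index `0 : Fin 2` stands for the node `1`, the index `1 : Fin 2` for the node `2`). -/
def cartan : Matrix (Fin 2) (Fin 2) ℤ := !![2, -1; -1, 0]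

/-! ### The quantum affine superalgebra in its Drinfeld presentation -/

/-- A sign, the superscript of `X^{±,i}_m`. -/
inductive PM where
  | plus
  | minus

/-- The sign as an integer. -/
def PM.toInt : PM → ℤ
  | .plus => 1
  | .minus => -1

/-- The Drinfeld generators: `X^{±,i}_m`, `h^i_n` for `n ≠ 0`, `q^{h^i_0}` and its inverse,
the central `q^{c/2}` and its inverse, and the derivation `d`. -/
inductive Gen where
  | X (e : PM) (i : Fin 2) (m : ℤ)
  | h (i : Fin 2) (n : {n : ℤ // n ≠ 0})
  | K (i : Fin 2)
  | Kinv (i : Fin 2)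
  | C
  | Cinv
  | d

/-- The `ℤ/2`-grading: `X^{±,2}_m` is odd, all other generators are even. -/
def Gen.parity : Gen → ZMod 2
  | .X _ i _ => (i.val : ZMod 2)
  | _ => 0

/-- The free algebra on the Drinfeld generators. -/
abbrev FA := FreeAlgebra ℂ Gen

namespace FA

/-- The element `X^{±,i}_m` of the free algebra. -/
def X (e : PM) (i : Fin 2) (m : ℤ) : FA := FreeAlgebra.ι ℂ (Gen.X e i m)

/-- The element `h^i_n` of the free algebra (`0` for the unused value `n = 0`). -/
def h (i : Fin 2) (n : ℤ) : FA := if hn : n ≠ 0 then FreeAlgebra.ι ℂ (Gen.h i ⟨n, hn⟩) else 0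

/-- The element `q^{h^i_0}`. -/
def K (i : Fin 2) : FA := FreeAlgebra.ι ℂ (Gen.K i)

/-- The element `q^{-h^i_0}`. -/
def Kinv (i : Fin 2) : FA := FreeAlgebra.ι ℂ (Gen.Kinv i)

/-- The element `q^{n c / 2}`. -/
def C (n : ℤ) : FA :=
  if 0 ≤ n then FreeAlgebra.ι ℂ Gen.C ^ n.natAbs else FreeAlgebra.ι ℂ Gen.Cinv ^ n.natAbs

/-- The element `d`. -/
def d : FA := FreeAlgebra.ι ℂ Gen.d

/-- `[X, Y]_ξ = X Y - (-1)^{[X][Y]} ξ Y X`, the exponent `[X][Y]` being given as `p`. -/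
def br (p : ℕ) (ξ : ℂ) (x y : FA) : FA := x * y - ((-1) ^ p * ξ) • (y * x)

/-- `[n c]_q = (q^{n c} - q^{-n c}) / (q - q⁻¹)`. -/
def qnumC (lq : ℂ) (n : ℤ) : FA := (qp lq 1 - qp lq (-1))⁻¹ • (C (2 * n) - C (-(2 * n)))

/-- `ψ^{±,i}_n`, defined by
`∑_n ψ^{±,i}_n z^{-n} = q^{± h^i_0} exp (± (q - q⁻¹) ∑_{n > 0} h^i_{± n} z^{∓ n})`. -/
def psi (lq : ℂ) : PM → Fin 2 → ℤ → FA
  | .plus, i, n => if 0 ≤ n then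
      K i * expCoeff (fun m => (qp lq 1 - qp lq (-1)) • h i m) n.natAbs else 0
  | .minus, i, n => if n ≤ 0 then
      Kinv i * expCoeff (fun m => (-(qp lq 1 - qp lq (-1))) • h i (-m)) n.natAbs else 0

end FA

open FA in
/-- The defining relations between the Drinfeld generators. -/
inductive Rel (lq : ℂ) : FA → FA → Prop
  | C_Cinv : Rel lq (C 1 * C (-1)) 1
  | Cinv_C : Rel lq (C (-1) * C 1) 1
  | C_central (g : Gen) : Rel lq (C 1 * FreeAlgebra.ι ℂ g) (FreeAlgebra.ι ℂ g * C 1)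
  | K_Kinv (i : Fin 2) : Rel lq (K i * Kinv i) 1
  | Kinv_K (i : Fin 2) : Rel lq (Kinv i * K i) 1
  | K_K (i j : Fin 2) : Rel lq (K i * K j) (K j * K i)
  | K_h (i j : Fin 2) (m : ℤ) (hm : m ≠ 0) : Rel lq (K i * h j m) (h j m * K i)
  | d_K (i : Fin 2) : Rel lq (d * K i) (K i * d)
  | d_h (j : Fin 2) (m : ℤ) (hm : m ≠ 0) : Rel lq (d * h j m - h j m * d) ((m : ℂ) • h j m)
  | h_h (i j : Fin 2) (m n : ℤ) (hm : m ≠ 0) (hn : n ≠ 0) :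
      Rel lq (h i m * h j n - h j n * h i m)
        (if m + n = 0 then (qnum lq (cartan i j * m) / m) • qnumC lq m else 0)
  | K_X (i j : Fin 2) (e : PM) (m : ℤ) :
      Rel lq (K i * X e j m * Kinv i) (qp lq (e.toInt * cartan i j) • X e j m)
  | d_X (e : PM) (j : Fin 2) (m : ℤ) : Rel lq (d * X e j m - X e j m * d) ((m : ℂ) • X e j m)
  | h_X (i j : Fin 2) (e : PM) (m n : ℤ) (hm : m ≠ 0) :
      Rel lq (h i m * X e j n - X e j n * h i m)
        ((e.toInt * qnum lq (cartan i j * m) / m) • (C (-(e.toInt * |m|)) * X e j (n + m)))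
  | X_X (i j : Fin 2) (m n : ℤ) :
      Rel lq (br (i.val * j.val) 1 (X .plus i m) (X .minus j n))
        (if i = j then (qp lq 1 - qp lq (-1))⁻¹ •
          (C (m - n) * psi lq .plus j (m + n) - C (n - m) * psi lq .minus j (m + n)) else 0)
  | X2_X2 (e : PM) (m n : ℤ) : Rel lq (br 1 1 (X e 1 m) (X e 1 n)) 0
  | quad (e : PM) (i j : Fin 2) (hij : cartan i j ≠ 0) (m n : ℤ) :
      Rel lq (br (i.val * j.val) (qp lq (e.toInt * cartan i j)) (X e i (m + 1)) (X e j n)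
        + br (i.val * j.val) (qp lq (e.toInt * cartan i j)) (X e j (n + 1)) (X e i m)) 0
  | serre (e : PM) (n₁ n₂ m : ℤ) :
      Rel lq (br 0 (qp lq 1) (X e 0 n₁) (br 0 (qp lq (-1)) (X e 0 n₂) (X e 1 m))
        + br 0 (qp lq 1) (X e 0 n₂) (br 0 (qp lq (-1)) (X e 0 n₁) (X e 1 m))) 0

/-- The quantum affine superalgebra `U_q[sl(2|1)^]`, `q = exp lq`. -/
abbrev Uq (lq : ℂ) := RingQuot (Rel lq)

/-- The image of a Drinfeld generator in `U_q`. -/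
def Uq.gen (lq : ℂ) (g : Gen) : Uq lq := RingQuot.mkAlgHom ℂ (Rel lq) (FreeAlgebra.ι ℂ g)

/-- The homogeneous part of `U_q` of parity `p`: the span of the words of parity `p` in the
generators. -/
def Uq.part (lq : ℂ) (p : ZMod 2) : Submodule ℂ (Uq lq) :=
  Submodule.span ℂ {x | ∃ l : List Gen,
    (l.map Gen.parity).sum = p ∧ x = (l.map (Uq.gen lq)).prod}

/-! ### Oscillators and Fock space -/

/-- The labels of the bosons `b^{12}`, `b^{13}`, `b^{23}`, `c`. -/
inductive Gh where
  | b12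
  | b13
  | b23
  | c
deriving DecidableEq

instance : Fintype Gh where
  elems := {.b12, .b13, .b23, .c}
  complete := by intro g; cases g <;> decide

/-- All bosons: `Sum.inl i` is `a^i`, and `Sum.inr g` is one of `b^{12}, b^{13}, b^{23}, c`. -/
abbrev Boson := Fin 2 ⊕ Gh

/-- The sign in the commutator of the bosons `b^{ij}` and `c`. -/
def Gh.sgn : Gh → ℤ
  | .b12 => -1
  | _ => 1

/-- The parameters: a logarithm `lq` of `q`, the level `k`, and the weight `(β, γ)`. -/
structure Params where
  lq : ℂ
  k : ℂ
  β : ℂ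
  γ : ℂ

/-- The basis of the Fock space: `(lam, μ)` is the product, over the pairs `(t, n)`, of
the powers `(t_{-n})^{μ (t, n)}` of the creation operators, applied to the vector
`exp (β/(k+1) Q_{a^1} + 2γ/(k+1) Q_{a^2} + ∑_g lam g * Q_g) |0>`. -/
abbrev Idx := (Gh → ℤ) × (Boson × ℕ+ →₀ ℕ)

/-- The total Fock space `⊕_{lam ∈ ℤ^4} F_{β/(k+1), 2γ/(k+1), lam}`, with basis indexed by `Idx`. -/
def Fock : Type := Idx →₀ ℂ

instance : AddCommGroup Fock := inferInstanceAs (AddCommGroup (Idx →₀ ℂ))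

instance : Module ℂ Fock := inferInstanceAs (Module ℂ (Idx →₀ ℂ))

/-- The standard basis of the Fock space. -/
def ket : Module.Basis Idx ℂ Fock := Module.Basis.ofRepr (LinearEquiv.refl ℂ (Idx →₀ ℂ))

/-- The linear operator with prescribed values on the basis vectors. -/
def onKets (f : Idx → Fock) : Module.End ℂ Fock := ket.constr ℂ f

/-- The subspace
`F^{(s)}_{(β,γ)} = ⊕_{i,j,l} F_{β/(k+1), 2γ/(k+1), i+j, j, l, i+j+s}`; `F_{(β,γ)}` is the
case `s = 0`. -/
def sector (s : ℤ) : Submodule ℂ Fock :=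
  Submodule.span ℂ (ket '' {p : Idx | p.1 .c = p.1 .b12 + s})

/-- The operator that is diagonal in the basis, with given eigenvalues. -/
def diag (f : Idx → ℂ) : Module.End ℂ Fock := onKets fun p => f p • ket p

/-- The creation operator `t_{-n}`, `n > 0`. -/
def create (t : Boson) (n : ℕ+) : Module.End ℂ Fock :=
  onKets fun p => ket (p.1, p.2 + Finsupp.single (t, n) 1)

/-- The partial derivative with respect to the creation operator `t_{-n}`. -/
def pderiv (t : Boson) (n : ℕ+) : Module.End ℂ Fock :=
  onKets fun p => (p.2 (t, n) : ℂ) • ket (p.1, p.2 - Finsupp.single (t, n) 1)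

/-- The translation by `exp (∑_g chg g * Q_g)`. -/
def translate (chg : Gh → ℤ) : Module.End ℂ Fock := onKets fun p => ket (p.1 + chg, p.2)

namespace Params

variable (P : Params)

/-- The commutator `[t_n, u_{-n}]`, `n > 0`. -/
def comm : Boson → Boson → ℕ+ → ℂ
  | .inl i, .inl j, n => qnum P.lq (cartan i j * n) * qnum P.lq ((P.k + 1) * n) / n
  | .inr g, .inr g', n => if g = g' then g.sgn * qnum P.lq n ^ 2 / n else 0
  | _, _, _ => 0

/-- The annihilation operator `t_n`, `n > 0`. -/
def annih (t : Boson) (n : ℕ+) : Module.End ℂ Fock :=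
  ∑ u : Boson, P.comm t u n • pderiv u n

/-- The coefficients of `Q_{a^1}` and `Q_{a^2}` in the Fock space. -/
def mom : Fin 2 → ℂ := ![P.β / (P.k + 1), 2 * P.γ / (P.k + 1)]

/-- The eigenvalue of the zero mode `t_0`, from `[a^i_0, Q_{a^j}] = (k+1) a_{ij}`,
`[b^{ij}_0, Q_{b^{ij}}] = (-1)^{δ_{j2}}`, `[c_0, Q_c] = 1`. -/
def zm : Boson → (Gh → ℤ) → ℂ
  | .inl i, _ => (P.k + 1) * ∑ j, cartan i j * P.mom j
  | .inr g, lam => (g.sgn * lam g : ℤ)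

/-- The oscillator `t_n`, `n ∈ ℤ`. -/
def osc (t : Boson) : ℤ → Module.End ℂ Fock
  | .ofNat 0 => diag fun p => P.zm t p.1
  | .ofNat (n + 1) => P.annih t n.succPNat
  | .negSucc n => create t n.succPNat

/-- The exponents of vertex operators, as linear expressions
`∑_t (∑_{n ≠ 0} e.1 t n * t_n * z^{-n}) + ∑_g e.2.1 g * (Q_g + g_0 ln z) + ∑_t e.2.2 t * t_0 ln q`. -/
abbrev Expo := (Boson → ℤ → ℂ) × (Gh → ℤ) × (Boson → ℂ)

/-- The exponent `g(q^x z; κ)`, where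
`g(z; κ) = - ∑_{n ≠ 0} g_n / [n]_q * q^{-κ |n|} z^{-n} + Q_g + g_0 ln z`. -/
def field (g : Gh) (x κ : ℂ) : Expo :=
  (Pi.single (.inr g) fun n =>
      if n = 0 then 0 else -(qp P.lq (-κ * (|n| : ℤ)) * qp P.lq (-x * n) / qnum P.lq n),
    Pi.single g 1, Pi.single (.inr g) x)

/-- The exponent `t_+(q^x z)`, where `t_+(z) = (q - q⁻¹) ∑_{n > 0} t_n z^{-n} + t_0 ln q`. -/
def fplus (t : Boson) (x : ℂ) : Expo :=
  (Pi.single t fun n =>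
      if 0 < n then (qp P.lq 1 - qp P.lq (-1)) * qp P.lq (-x * n) else 0,
    0, Pi.single t 1)

/-- The exponent `t_-(q^x z)`, where `t_-(z) = -(q - q⁻¹) ∑_{n > 0} t_{-n} z^n - t_0 ln q`. -/
def fminus (t : Boson) (x : ℂ) : Expo :=
  (Pi.single t fun n =>
      if n < 0 then -((qp P.lq 1 - qp P.lq (-1)) * qp P.lq (-x * n)) else 0,
    0, Pi.single t (-1))

/-- The coefficient of `z ^ n` in the exponential of the creation part of the exponent. -/
def creCoeff (e : Expo) : ℤ → Module.End ℂ Fock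
  | .ofNat n => expCoeff (fun m => ∑ t, e.1 t (-m) • P.osc t (-m)) n
  | .negSucc _ => 0

/-- The coefficient of `z ^ (-n)` in the exponential of the annihilation part of the exponent. -/
def annCoeff (e : Expo) (n : ℕ) : Module.End ℂ Fock :=
  expCoeff (fun m => ∑ t, e.1 t m • P.osc t m) n

/-- The exponent of `z` in `z ^ (∑_g e_g g_0)` on a basis vector. -/
def zpow (e : Expo) (p : Idx) : ℤ := ∑ g, e.2.1 g * (g.sgn * p.1 g)

/-- The coefficient of `z ^ N` in the normal ordered exponential `:exp e:`, that is, in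
`exp(creation part) * exp(∑ e_g Q_g) * z^{∑ e_g g_0} * q^{zero modes} * exp(annihilation part)`.
On each basis vector the sum over `n` has only finitely many non-zero terms. -/
def vertex (e : Expo) (N : ℤ) : Module.End ℂ Fock :=
  onKets fun p =>
    ∑ᶠ n : ℕ, P.creCoeff e (N - zpow e p + n)
      (translate e.2.1 (qp P.lq (∑ t, e.2.2 t * P.zm t p.1) •
        P.annCoeff e n (ket p)))

/-- The operator `exp (√-1 π ∑_g w g * g_0)`. -/
def phase (w : Gh → ℤ) : Module.End ℂ Fock :=
  diag fun p => Complex.exp (Complex.I * Real.pi * ∑ g, w g * P.zm (.inr g) p.1)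

/-! ### The bosonized Drinfeld generators -/

/-- `1 / (q - q⁻¹)`. -/
def iq : ℂ := (qp P.lq 1 - qp P.lq (-1))⁻¹

/-- `X^{±,i}_n`, the coefficient of `z ^ (-n-1)` in the bosonized current `X^{±,i}(z)`. -/
def current : PM → Fin 2 → ℤ → Module.End ℂ Fock
  | .plus, 0, n =>
      (-P.iq) • ((P.vertex (-P.field .b12 0 (-1) - P.field .c 1 0) (-n)
          - P.vertex (-P.field .b12 0 (-1) - P.field .c (-1) 0) (-n))
        * P.phase (Pi.single .c 1 + Pi.single .b12 1))
  | .plus, 1, n =>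
      -(P.vertex (-P.fplus (.inr .b12) 1 - P.fplus (.inr .b13) 1 + P.field .b23 1 0) (-n - 1)
        * P.phase (Pi.single .c 1 + Pi.single .b12 1 + Pi.single .b13 1 + Pi.single .b23 1))
      + P.vertex (P.field .b12 0 0 + P.field .b13 0 0 + P.field .c 0 0) (-n - 1)
  | .minus, 0, n =>
      P.iq • ((P.vertex (P.fplus (.inl 0) ((P.k + 1) / 2) + P.field .b12 (P.k + 2) 1
            + P.fplus (.inr .b13) (P.k + 2) - P.fplus (.inr .b23) (P.k + 1)
            + P.field .c (P.k + 1) 0) (-n)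
          - P.vertex (P.fminus (.inl 0) (-(P.k + 1) / 2) + P.field .b12 (-P.k - 2) 1
            + P.fminus (.inr .b13) (-P.k - 2) - P.fminus (.inr .b23) (-P.k - 1)
            + P.field .c (-P.k - 1) 0) (-n))
        * P.phase (-(Pi.single .c 1 + Pi.single .b12 1)))
      + qp P.lq (P.k + 1) • (P.vertex (P.fplus (.inl 0) ((P.k + 1) / 2)
            - P.field .b13 (P.k + 1) 0 + P.field .b23 (P.k + 1) (-1)) (-n - 1)
        * P.phase (Pi.single .b13 1 + Pi.single .b23 1))
  | .minus, 1, n =>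
      P.iq • (qp P.lq 1 • ((P.vertex (P.fplus (.inl 1) ((P.k + 1) / 2)
              - P.field .b23 (P.k + 1) 0) (-n)
            - P.vertex (P.fminus (.inl 1) (-(P.k + 1) / 2) - P.field .b23 (-P.k - 1) 0) (-n))
          * P.phase (-(Pi.single .c 1 + Pi.single .b12 1 + Pi.single .b13 1 + Pi.single .b23 1)))
        - (P.vertex (P.fminus (.inl 1) (-(P.k + 1) / 2) - P.field .b12 (-P.k - 1) 1
              - P.field .b13 (-P.k - 1) 1 - P.field .c (-P.k) 0) (-n)
            - P.vertex (P.fminus (.inl 1) (-(P.k + 1) / 2) - P.field .b12 (-P.k - 1) 1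
              - P.field .b13 (-P.k - 1) 1 - P.field .c (-P.k - 2) 0) (-n)))

/-- The bosonized `h^i_n`, `n ≠ 0`. -/
def hmode (i : Fin 2) (n : ℤ) : Module.End ℂ Fock :=
  let a : ℂ := (|n| : ℤ)
  match i with
  | 0 => qp P.lq (-a / 2) • P.osc (.inl 0) n
      + (qp P.lq (-(P.k / 2 + 1) * a) * (qp P.lq a + qp P.lq (-a))) • P.osc (.inr .b12) n
      + qp P.lq (-(P.k / 2 + 2) * a) • P.osc (.inr .b13) n
      - qp P.lq (-(P.k / 2 + 1) * a) • P.osc (.inr .b23) n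
  | 1 => qp P.lq (-a / 2) • P.osc (.inl 1) n
      - qp P.lq (-(P.k / 2 + 1) * a) • P.osc (.inr .b12) n
      - qp P.lq (-(P.k / 2 + 1) * a) • P.osc (.inr .b13) n

/-- The eigenvalues of
`h^1_0 = a^1_0 + 2 b^{12}_0 + b^{13}_0 - b^{23}_0` and `h^2_0 = a^2_0 - b^{12}_0 - b^{13}_0`. -/
def hzero (i : Fin 2) (p : Idx) : ℂ :=
  match i with
  | 0 => P.zm (.inl 0) p.1 + 2 * P.zm (.inr .b12) p.1 + P.zm (.inr .b13) p.1
      - P.zm (.inr .b23) p.1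
  | 1 => P.zm (.inl 1) p.1 - P.zm (.inr .b12) p.1 - P.zm (.inr .b13) p.1

/-- The eigenvalue of `d` on a basis vector: minus the oscillator degree `∑ n * μ (t, n)`, plus
`(a^1_0 a^2_0 + (a^2_0)^2 + a^1_0 + 3 a^2_0) / (k+1)
  + (b^{12}_0 (b^{12}_0 - 1) - b^{13}_0 (b^{13}_0 + 1) - b^{23}_0 (b^{23}_0 + 1)
  - c_0 (c_0 + 1)) / 2`. -/
def dval (p : Idx) : ℂ :=
  let a1 := P.zm (.inl 0) p.1
  let a2 := P.zm (.inl 1) p.1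
  let b12 := P.zm (.inr .b12) p.1
  let b13 := P.zm (.inr .b13) p.1
  let b23 := P.zm (.inr .b23) p.1
  let c := P.zm (.inr .c) p.1
  (a1 * a2 + a2 ^ 2 + a1 + 3 * a2) / (P.k + 1)
    + (b12 * (b12 - 1) - b13 * (b13 + 1) - b23 * (b23 + 1) - c * (c + 1)) / 2
    - p.2.sum fun tn e => (tn.2 : ℂ) * e

/-- The bosonized Drinfeld generators, at level `c = k`. -/
def bos : Gen → Module.End ℂ Fock
  | .X e i m => P.current e i m
  | .h i n => P.hmode i n.1
  | .K i => diag fun p => qp P.lq (P.hzero i p)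
  | .Kinv i => diag fun p => qp P.lq (-P.hzero i p)
  | .C => qp P.lq (P.k / 2) • (1 : Module.End ℂ Fock)
  | .Cinv => qp P.lq (-P.k / 2) • (1 : Module.End ℂ Fock)
  | .d => diag P.dval

/-! ### The ghost system -/

/-- `η_n`, where `η(z) = ∑ η_n z^{-n-1} = :exp c(z;0):`. -/
def eta (n : ℤ) : Module.End ℂ Fock := P.vertex (P.field .c 0 0) (-n - 1)

/-- `ξ_n`, where `ξ(z) = ∑ ξ_n z^{-n} = :exp (-c(z;0)):`. -/
def xi (n : ℤ) : Module.End ℂ Fock := P.vertex (-P.field .c 0 0) (-n)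

/-- `Ker η_0`, the kernel of `η_0` on `F_{(β,γ)}`, as a subspace of `F_{(β,γ)}`. -/
def kerEta : Submodule ℂ (sector 0) := (LinearMap.ker (P.eta 0)).submoduleOf (sector 0)

/-- `Coker η_0 = F_{(β,γ)} / Ker η_0`. -/
abbrev cokerEta := sector 0 ⧸ P.kerEta

end Params

end SL21

end

/-!
The generators act through vertex operators `:exp φ(z):`, and everything rests on Wick's theorem: moving
the annihilation part of one vertex operator past the creation part of another one produces the
exponential of a series in `w / z`, and for all fields that occur this is the expansion of a rational
function whose zeros and poles lie at `z = q ^ (a + b k) w` with integers `a`, `b`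
(`vertex_vertex`, `lin_mul_expSeries`). The product in the opposite order is the expansion of such a
function in the region `|z| < |w|`. If the two rational functions agree up to the factors that occur
in a relation, the relation holds up to delta functions supported at the poles that are left over
(`exchange_regular`, `exchange_delta`), and the coefficient of such a delta function is a vertex operator
again, whose exponent is the sum of the two exponents (`evalSeq_normalSeq`).

The exponents are represented by symbols `Sym` with integer parameters. Contractions, positions of
poles, and the coincidence of two fused vertex operators (`SameOp`) are then decidable, and only the
coefficients of the delta functions have to be compared by a computation in `ℂ`.

For the quadratic relations and for the brackets of different currents the delta functions cancel in pairs
(`minus_mixed_cancel`, `plus_minus_cancel`, `minus_plus_cancel`, `odd_cancel`), and those which are left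
in the brackets of `X^{+,i}` and `X^{-,i}` are `ψ^{±,i}` (`brHom_zero_zero`, `brHom_one_one`). The relations
with `h^i_m` are contractions with the exponents of `ψ^{±,i}`, the same for all terms of a current
(`hmode_cur`, `hmode_neg_cur`, `hmode_hmode`).

The Serre relations are not computed term by term: they follow from the quadratic relations
(`serre_of_quadratic`) as soon as the common numerator of the products of two currents `X^{±,1}` and one
current `X^{±,2}` vanishes at one point. This wheel condition involves the fusion of only two currents at
a time (`wheel_plus`, `wheel_minus`).

The zero modes `η_0` and `ξ_0` square to zero, and their anticommutator is one because the product of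
`η(z)` and `ξ(w)` has a simple pole at `z = w` with residue one (`eta_xi_add`); the decomposition of
the Fock space is formal from there (`ghost_splitting`). The (anti)commutators of `η(z)` with the currents
are zero or differences of two delta functions with the same vertex operator, which do not contribute to
the zero mode in `z` (`eta_plus_cancel`, `eta_minus_cancel`), so that `η_0` (anti)commutes with the action
and its kernel is invariant.
-/

noncomputable section

set_option linter.unusedSectionVars false

namespace SL21

/-! ### Exponentials of formal series with commuting coefficients -/

section ExpSeries

open PowerSeries Finset

variable {R : Type*} [Ring R] [Algebra ℂ R]

/-- The Euler operator `x d/dx` on power series over a possibly noncommutative algebra. -/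
def euler (F : PowerSeries R) : PowerSeries R := mk fun n => (n : ℂ) • coeff n F

@[simp] lemma coeff_euler (F : PowerSeries R) (n : ℕ) :
    coeff n (euler F) = (n : ℂ) • coeff n F := by simp [euler]

lemma euler_mul (F G : PowerSeries R) : euler (F * G) = euler F * G + F * euler G := by
  ext n
  simp only [coeff_euler, coeff_mul, map_add, Finset.smul_sum]
  rw [← Finset.sum_add_distrib]
  refine Finset.sum_congr rfl fun x hx => ?_
  have h : x.1 + x.2 = n := by simpa using hx
  rw [smul_mul_assoc, mul_smul_comm, ← add_smul, ← h]
  push_cast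
  rfl

lemma euler_add (F G : PowerSeries R) : euler (F + G) = euler F + euler G := by
  ext n; simp

lemma euler_C (r : R) : euler (C r) = 0 := by
  ext n
  rcases n with _ | n <;> simp [coeff_C]

/-- The power series `∑_{m > 0} A m x ^ m`. -/
def posPart (A : ℕ → R) : PowerSeries R := mk fun m => if m = 0 then 0 else A m

lemma coeff_posPart (A : ℕ → R) (n : ℕ) :
    coeff n (posPart A) = if n = 0 then 0 else A n := by simp [posPart]

lemma commute_series {F G : PowerSeries R}
    (h : ∀ i j, Commute (coeff i F) (coeff j G)) : Commute F G := by
  ext n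
  rw [coeff_mul, coeff_mul, ← Finset.Nat.sum_antidiagonal_swap]
  exact Finset.sum_congr rfl fun x _ => (h _ _).eq

/-- The coefficients `A m`, `m > 0`, commute with each other. -/
def CommFam (A : ℕ → R) : Prop := ∀ i j, i ≠ 0 → j ≠ 0 → Commute (A i) (A j)

lemma euler_pow {F : PowerSeries R} (h : Commute F (euler F)) (r : ℕ) :
    euler (F ^ (r + 1)) = ((r + 1 : ℕ) : ℂ) • (euler F * F ^ r) := by
  induction r with
  | zero => simp
  | succ r ih =>
    rw [pow_succ, euler_mul, ih, smul_mul_assoc, mul_assoc, ← pow_succ,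
      ((h.pow_left (r + 1)).eq), Nat.cast_succ (r + 1), add_smul, one_smul]

lemma coeff_pow_posPart (A : ℕ → R) {n r : ℕ} (h : n < r) : coeff n (posPart A ^ r) = 0 := by
  induction r generalizing n with
  | zero => omega
  | succ r ih =>
    rw [pow_succ', coeff_mul]
    refine Finset.sum_eq_zero fun x hx => ?_
    have hx' : x.1 + x.2 = n := by simpa using hx
    rw [coeff_posPart]
    split_ifs with h0
    · simp
    · rw [ih (by omega), mul_zero]

lemma expCoeff_eq (A : ℕ → R) {n K : ℕ} (h : n < K) :
    expCoeff A n = ∑ r ∈ range K, ((r.factorial : ℂ)⁻¹) • coeff n (posPart A ^ r) := by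
  rw [expCoeff]
  refine Finset.sum_subset (fun x hx => ?_) fun x _ hx => ?_
  · simp only [mem_range] at hx ⊢; omega
  · simp only [mem_range, not_lt] at hx
    have := coeff_pow_posPart A (n := n) (r := x) (by omega)
    rw [posPart] at this
    rw [this, smul_zero]

/-- The exponential of `∑_{m > 0} A m x ^ m` as a power series. -/
def expSeries (A : ℕ → R) : PowerSeries R := mk (expCoeff A)

@[simp] lemma coeff_expSeries (A : ℕ → R) (n : ℕ) : coeff n (expSeries A) = expCoeff A n := by
  simp [expSeries]

@[simp] lemma expCoeff_zero (A : ℕ → R) : expCoeff A 0 = 1 := by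
  simp [expCoeff]

lemma expCoeff_congr {A B : ℕ → R} (h : ∀ m, m ≠ 0 → A m = B m) (n : ℕ) :
    expCoeff A n = expCoeff B n := by
  have : (fun m => if m = 0 then 0 else A m) = fun m => if m = 0 then 0 else B m := by
    funext m; split_ifs with hm
    · rfl
    · exact h m hm
  rw [expCoeff, expCoeff, this]

lemma map_expCoeff {S : Type*} [Ring S] [Algebra ℂ S] (φ : R →ₐ[ℂ] S) (A : ℕ → R) (n : ℕ) :
    φ (expCoeff A n) = expCoeff (fun m => φ (A m)) n := by
  simp only [expCoeff, map_sum, map_smul]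
  refine Finset.sum_congr rfl fun r _ => ?_
  have : PowerSeries.map (φ : R →+* S) (mk fun m => if m = 0 then 0 else A m)
      = mk fun m => if m = 0 then 0 else φ (A m) := by
    ext m; simp only [coeff_map, coeff_mk]; split_ifs <;> simp
  rw [← this, ← map_pow, coeff_map]
  rfl

/-- The differential equation of the exponential series. -/
lemma euler_expSeries {A : ℕ → R} (hA : CommFam A) :
    euler (expSeries A) = euler (posPart A) * expSeries A := by
  have hc : Commute (posPart A) (euler (posPart A)) := by
    refine commute_series fun i j => ?_
    rw [coeff_euler, coeff_posPart, coeff_posPart]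
    refine Commute.smul_right ?_ _
    split_ifs with h1 h2 h2
    · exact Commute.zero_left _
    · exact Commute.zero_left _
    · exact Commute.zero_right _
    · exact hA _ _ h1 h2
  ext n
  rw [coeff_euler, coeff_expSeries, expCoeff_eq A (Nat.lt_succ_self n), Finset.sum_range_succ',
    smul_add, Finset.smul_sum]
  have h0 : (n : ℂ) • ((Nat.factorial 0 : ℂ)⁻¹ • coeff n (posPart A ^ 0)) = 0 := by
    rcases n with _ | n <;> simp [coeff_one]
  rw [h0, add_zero, coeff_mul]
  have h1 : ∀ x ∈ antidiagonal n, coeff x.1 (euler (posPart A)) * coeff x.2 (expSeries A)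
      = ∑ r ∈ range n, ((r.factorial : ℂ)⁻¹) •
        (coeff x.1 (euler (posPart A)) * coeff x.2 (posPart A ^ r)) := by
    intro x hx
    have hx' : x.1 + x.2 = n := by simpa using hx
    rcases Nat.eq_zero_or_pos x.1 with h | h
    · simp [h]
    · rw [coeff_expSeries, expCoeff_eq A (show x.2 < n by omega), Finset.mul_sum]
      exact Finset.sum_congr rfl fun r _ => by rw [mul_smul_comm]
  rw [Finset.sum_congr rfl h1, Finset.sum_comm]
  refine Finset.sum_congr rfl fun r _ => ?_
  rw [smul_comm, ← coeff_euler, euler_pow hc, ← Finset.smul_sum, ← coeff_mul]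
  rw [PowerSeries.coeff_smul, smul_smul]
  congr 1
  rw [Nat.factorial_succ]
  push_cast
  have : (r : ℂ) + 1 ≠ 0 := Nat.cast_add_one_ne_zero r
  have h2 : (r.factorial : ℂ) ≠ 0 := Nat.cast_ne_zero.2 r.factorial_ne_zero
  field_simp

/-- A first order linear differential equation has at most one solution with given constant
coefficient. -/
lemma euler_unique {a Y Z : PowerSeries R} (ha : coeff 0 a = 0) (hY : euler Y = a * Y)
    (hZ : euler Z = a * Z) (h0 : coeff 0 Y = coeff 0 Z) : Y = Z := by
  ext n
  induction n using Nat.strong_induction_on with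
  | _ n ih =>
    rcases Nat.eq_zero_or_pos n with rfl | hn
    · exact h0
    · have h1 : (n : ℂ) • coeff n Y = (n : ℂ) • coeff n Z := by
        rw [← coeff_euler, ← coeff_euler, hY, hZ, coeff_mul, coeff_mul]
        refine Finset.sum_congr rfl fun x hx => ?_
        have hx' : x.1 + x.2 = n := by simpa using hx
        rcases Nat.eq_zero_or_pos x.1 with h | h
        · simp [h, ha]
        · rw [ih x.2 (by omega)]
      have hn' : (n : ℂ) ≠ 0 := Nat.cast_ne_zero.2 hn.ne'
      simpa [smul_smul, hn'] using congrArg (fun t => (n : ℂ)⁻¹ • t) h1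

lemma coeff_zero_euler (F : PowerSeries R) : coeff 0 (euler F) = 0 := by simp

lemma eq_expSeries {A : ℕ → R} (hA : CommFam A) {Y : PowerSeries R} (h0 : coeff 0 Y = 1)
    (hY : euler Y = euler (posPart A) * Y) : Y = expSeries A :=
  euler_unique (coeff_zero_euler _) hY (euler_expSeries hA) (by simp [h0])

/-- An element that commutes with the exponent commutes with the exponential. -/
lemma commute_expCoeff {A : ℕ → R} (x : R) (h : ∀ m, m ≠ 0 → Commute x (A m)) (n : ℕ) :
    Commute x (expCoeff A n) := by
  have hp : Commute (C x) (posPart A) := by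
    refine commute_series fun i j => ?_
    rw [coeff_posPart, coeff_C]
    split_ifs with h1 h2 h2 <;> first | exact Commute.zero_left _ | exact Commute.zero_right _ | skip
    exact h _ h2
  rw [expCoeff]
  refine Commute.sum_right _ _ _ fun r _ => Commute.smul_right ?_ _
  have := congrArg (coeff n) ((hp.pow_right r).eq)
  rw [coeff_C_mul, coeff_mul_C] at this
  exact this

lemma expCoeff_commute_expCoeff {A B : ℕ → R}
    (h : ∀ i j, i ≠ 0 → j ≠ 0 → Commute (A i) (B j)) (m n : ℕ) :
    Commute (expCoeff A m) (expCoeff B n) :=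
  commute_expCoeff _ (fun j hj => (commute_expCoeff _ (fun i hi => (h i j hi hj).symm) m).symm) n

lemma posPart_add (A B : ℕ → R) : posPart (A + B) = posPart A + posPart B := by
  ext n; simp only [coeff_posPart, map_add, Pi.add_apply]; split_ifs <;> simp

/-- The exponential of a sum of commuting series is the product of the exponentials. -/
lemma expSeries_add {A B : ℕ → R} (hA : CommFam A) (hB : CommFam B)
    (h : ∀ i j, i ≠ 0 → j ≠ 0 → Commute (A i) (B j)) :
    expSeries (A + B) = expSeries A * expSeries B := by
  symm
  refine eq_expSeries ?_ (by simp [coeff_mul]) ?_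
  · intro i j hi hj
    exact ((hA i j hi hj).add_right (h i j hi hj)).add_left
      ((h j i hj hi).symm.add_right (hB i j hi hj))
  · rw [euler_mul, euler_expSeries hA, euler_expSeries hB, posPart_add, euler_add, add_mul,
      mul_assoc, ← mul_assoc (expSeries A)]
    have : Commute (expSeries A) (euler (posPart B)) := by
      refine commute_series fun i j => ?_
      rw [coeff_euler, coeff_posPart, coeff_expSeries]
      refine Commute.smul_right ?_ _
      split_ifs with hj
      · exact Commute.zero_right _
      · exact (commute_expCoeff _ (fun i hi => (h i j hi hj).symm) i).symm
    rw [this.eq, mul_assoc]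

lemma expCoeff_add {A B : ℕ → R} (hA : CommFam A) (hB : CommFam B)
    (h : ∀ i j, i ≠ 0 → j ≠ 0 → Commute (A i) (B j)) (n : ℕ) :
    expCoeff (A + B) n = ∑ x ∈ antidiagonal n, expCoeff A x.1 * expCoeff B x.2 := by
  rw [← coeff_expSeries, expSeries_add hA hB h, coeff_mul]
  simp

/-- Rescaling the variable. -/
lemma expCoeff_rescale {A : ℕ → R} (a : ℂ) (n : ℕ) :
    expCoeff (fun m => a ^ m • A m) n = a ^ n • expCoeff A n := by
  have key : ∀ r n, coeff n (posPart (fun m => a ^ m • A m) ^ r)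
      = a ^ n • coeff n (posPart A ^ r) := by
    intro r
    induction r with
    | zero => intro n; rcases n with _ | n <;> simp [coeff_one]
    | succ r ih =>
      intro n
      rw [pow_succ, pow_succ, coeff_mul, coeff_mul, Finset.smul_sum]
      refine Finset.sum_congr rfl fun x hx => ?_
      have hx' : x.1 + x.2 = n := by simpa using hx
      rw [ih, coeff_posPart, coeff_posPart, ← hx', pow_add]
      split_ifs <;> simp [smul_smul, mul_comm]
  rw [expCoeff_eq _ (Nat.lt_succ_self n), expCoeff_eq _ (Nat.lt_succ_self n), Finset.smul_sum]
  refine Finset.sum_congr rfl fun r _ => ?_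
  rw [key, smul_comm]

lemma expCoeff_of_zero {A : ℕ → R} (h : ∀ m, m ≠ 0 → A m = 0) (n : ℕ) :
    expCoeff A n = if n = 0 then 1 else 0 := by
  rw [expCoeff_congr (B := fun _ => 0) h n]
  rcases n with _ | n
  · simp
  · rw [expCoeff]
    refine Finset.sum_eq_zero fun r _ => ?_
    have : (mk fun m => if m = 0 then 0 else (0 : R)) = 0 := by ext; simp
    rw [this]
    rcases r with _ | r <;> simp [coeff_one]

/-- A series of scalars, viewed as a series with coefficients in the algebra. -/
def scal (c : ℕ → ℂ) : PowerSeries R := mk fun n => c n • (1 : R)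

lemma coeff_scal (c : ℕ → ℂ) (n : ℕ) : coeff n (scal c : PowerSeries R) = c n • (1 : R) := by
  simp [scal]

lemma commute_scal (c : ℕ → ℂ) (F : PowerSeries R) : Commute (scal c) F :=
  commute_series fun i j => by
    rw [coeff_scal]; exact (Commute.one_left _).smul_left _

/-- If the commutators `[x, A m]` are scalars `c m`, then `x` acts on the exponential as a
derivation. -/
lemma mul_expCoeff {A : ℕ → R} (hA : CommFam A) (x : R) (c : ℕ → ℂ) (hc0 : c 0 = 0)
    (h : ∀ m, m ≠ 0 → x * A m = A m * x + c m • (1 : R)) (n : ℕ) :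
    x * expCoeff A n = expCoeff A n * x + ∑ y ∈ antidiagonal n, c y.1 • expCoeff A y.2 := by
  set E := expSeries A
  set a := euler (posPart A)
  have hE : euler E = a * E := euler_expSeries hA
  have hxa : C x * a = a * C x + euler (scal c) := by
    ext n
    simp only [a, coeff_C_mul, map_add, coeff_mul_C, coeff_euler, coeff_posPart, coeff_scal]
    split_ifs with hn
    · simp [hn]
    · rw [mul_smul_comm, h n hn, smul_add, smul_mul_assoc]
  have hca : scal c * a = a * scal c := (commute_scal c a).eq
  have hu : C x * E - (E * C x + scal c * E) = 0 := by
    refine euler_unique (a := a) (coeff_zero_euler _) ?_ (by ext; simp) ?_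
    · have e : ∀ F G : PowerSeries R, euler (F - G) = euler F - euler G := fun F G => by
        ext n; simp [smul_sub]
      rw [e, euler_add, euler_mul, euler_mul, euler_mul, euler_C, hE, zero_mul, zero_add,
        mul_zero, add_zero, ← mul_assoc, hxa, ← mul_assoc (scal c), hca]
      noncomm_ring
    · have h1 : constantCoeff (expSeries A) = 1 := by
        rw [← coeff_zero_eq_constantCoeff_apply]; simp
      have h2 : constantCoeff (scal c : PowerSeries R) = 0 := by
        rw [← coeff_zero_eq_constantCoeff_apply, coeff_scal, hc0, zero_smul]
      simp [E, h1, h2]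
  have := congrArg (coeff n) (sub_eq_zero.1 hu)
  rw [coeff_C_mul, map_add, coeff_mul_C, coeff_mul] at this
  simpa [E, coeff_scal] using this

/-- Extension of a sequence by zero to negative indices. -/
def zext (f : ℕ → R) : ℤ → R
  | .ofNat n => f n
  | .negSucc _ => 0

lemma zext_neg (f : ℕ → R) {m : ℤ} (h : m < 0) : zext f m = 0 := by
  rcases m with m | m
  · simp only [Int.ofNat_eq_natCast] at h; omega
  · rfl

@[simp] lemma zext_natCast (f : ℕ → R) (n : ℕ) : zext f (n : ℤ) = f n := rfl

/-- The normal ordering formula `exp A(x) * exp B(y) = g(x y) * exp B(y) * exp A(x)` for families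
with `[A i, B j] = δ_{ij} c_i`, where `g` is the exponential of `∑ c_i x ^ i`. -/
lemma expCoeff_mul_expCoeff {A B : ℕ → R} (hA : CommFam A) (hB : CommFam B) (c : ℕ → ℂ)
    (h : ∀ i j, i ≠ 0 → j ≠ 0 → A i * B j = B j * A i + (if i = j then c i else 0) • (1 : R))
    (n : ℕ) (m : ℤ) :
    expCoeff A n * zext (expCoeff B) m
      = ∑ x ∈ antidiagonal n,
        expCoeff c x.1 • (zext (expCoeff B) (m - x.1) * expCoeff A x.2) := by
  set a := euler (posPart A)
  set G : PowerSeries R := mk fun j => expCoeff c j • zext (expCoeff B) (m - j)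
  have hcomm : ∀ l, l ≠ 0 → ∀ k : ℤ, A l * zext (expCoeff B) k
      = zext (expCoeff B) k * A l + c l • zext (expCoeff B) (k - l) := by
    intro l hl k
    rcases lt_or_ge k 0 with hk | hk
    · rw [zext_neg _ hk, zext_neg _ (by omega)]; simp
    · lift k to ℕ using hk
      rw [zext_natCast, mul_expCoeff hB (A l) (fun j => if l = j then c l else 0) (by simp [hl])
        (fun j hj => h l j hl hj)]
      congr 1
      rcases lt_or_ge k l with hkl | hkl
      · rw [zext_neg _ (by omega), smul_zero]
        refine Finset.sum_eq_zero fun y hy => ?_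
        have hy' : y.1 + y.2 = k := by simpa using hy
        rw [if_neg (by omega), zero_smul]
      · rw [show ((k : ℤ) - l) = ((k - l : ℕ) : ℤ) by omega, zext_natCast,
          Finset.sum_eq_single (l, k - l)]
        · simp
        · intro y hy hne
          have hy' : y.1 + y.2 = k := by simpa using hy
          rw [if_neg, zero_smul]
          intro hly
          exact hne (Prod.ext hly.symm (by simp only; omega))
        · intro hn
          exact absurd (by rw [HasAntidiagonal.mem_antidiagonal]; simp only; omega) hn
  have hg : euler (expSeries c) = euler (posPart c) * expSeries c :=
    euler_expSeries fun i j _ _ => Commute.all _ _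
  have haG : a * G = G * a + euler G := by
    ext k
    rw [map_add, coeff_euler, coeff_mul, coeff_mul, ← Finset.Nat.sum_antidiagonal_swap (n := k)
      (f := fun x => coeff x.1 G * coeff x.2 a)]
    have hk : (k : ℂ) • coeff k G = ∑ x ∈ antidiagonal k,
        ((x.1 : ℂ) * (if x.1 = 0 then 0 else c x.1) * expCoeff c x.2) •
          zext (expCoeff B) (m - k) := by
      rw [← Finset.sum_smul]
      have := congrArg (coeff k) hg
      simp only [coeff_euler, coeff_mul, coeff_expSeries, coeff_posPart, smul_eq_mul] at this
      rw [← this]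
      simp [G, smul_smul]
    rw [hk, ← Finset.sum_add_distrib]
    refine Finset.sum_congr rfl fun x hx => ?_
    have hx' : x.1 + x.2 = k := by simpa using hx
    simp only [a, G, coeff_euler, coeff_posPart, coeff_mk, Prod.fst_swap, Prod.snd_swap]
    split_ifs with h0
    · simp
    · rw [smul_mul_smul_comm, smul_mul_smul_comm, hcomm _ h0, smul_add, smul_smul,
        show m - (x.2 : ℤ) - (x.1 : ℤ) = m - k by omega, mul_comm (expCoeff c x.2) (x.1 : ℂ)]
      congr 2
      ring
  have hY : expSeries A * C (zext (expCoeff B) m) = G * expSeries A := by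
    refine euler_unique (a := a) (coeff_zero_euler _) ?_ ?_ ?_
    · rw [euler_mul, euler_C, euler_expSeries hA, mul_zero, add_zero, mul_assoc]
    · rw [euler_mul, euler_expSeries hA, ← mul_assoc a, haG, add_mul, mul_assoc, add_comm]
    · simp [G, coeff_mul]
  have := congrArg (coeff n) hY
  rw [coeff_mul_C, coeff_mul] at this
  simpa [G, smul_mul_assoc] using this

end ExpSeries

/-! ### Operators on the Fock space -/

section Operators

open Finset

@[simp] lemma onKets_ket (f : Idx → Fock) (p : Idx) : onKets f (ket p) = f p :=
  ket.constr_basis ℂ f p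

@[simp] lemma diag_ket (f : Idx → ℂ) (p : Idx) : diag f (ket p) = f p • ket p := by simp [diag]

@[simp] lemma create_ket (t : Boson) (n : ℕ+) (p : Idx) :
    create t n (ket p) = ket (p.1, p.2 + Finsupp.single (t, n) 1) := by simp [create]

@[simp] lemma pderiv_ket (t : Boson) (n : ℕ+) (p : Idx) :
    pderiv t n (ket p) = (p.2 (t, n) : ℂ) • ket (p.1, p.2 - Finsupp.single (t, n) 1) := by
  simp [pderiv]

@[simp] lemma translate_ket (chg : Gh → ℤ) (p : Idx) :
    translate chg (ket p) = ket (p.1 + chg, p.2) := by simp [translate]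

lemma op_ext {S T : Module.End ℂ Fock} (h : ∀ p, S (ket p) = T (ket p)) : S = T := ket.ext h

lemma commute_of_ket {S T : Module.End ℂ Fock} (h : ∀ p, S (T (ket p)) = T (S (ket p))) :
    Commute S T := op_ext h

lemma create_comm (t u : Boson) (n m : ℕ+) : Commute (create t n) (create u m) :=
  commute_of_ket fun p => by simp [add_assoc, add_comm (Finsupp.single (t, n) 1)]

lemma translate_create (chg : Gh → ℤ) (t : Boson) (n : ℕ+) :
    Commute (translate chg) (create t n) :=
  commute_of_ket fun p => by simp

lemma translate_pderiv (chg : Gh → ℤ) (t : Boson) (n : ℕ+) :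
    Commute (translate chg) (pderiv t n) :=
  commute_of_ket fun p => by simp

lemma pderiv_comm (t u : Boson) (n m : ℕ+) : Commute (pderiv t n) (pderiv u m) := by
  refine commute_of_ket fun p => ?_
  by_cases h : (t, n) = (u, m)
  · rw [Prod.mk.injEq] at h
    rw [h.1, h.2]
  · simp only [pderiv_ket, map_smul, smul_smul, Finsupp.tsub_apply,
      Finsupp.single_eq_of_ne (Ne.symm h), Finsupp.single_eq_of_ne h, tsub_zero,
      tsub_right_comm (b := Finsupp.single (t, n) 1)]
    rw [mul_comm]

/-- The canonical commutation relations of the Fock space. -/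
lemma pderiv_create (t u : Boson) (n m : ℕ+) :
    pderiv t n * create u m
      = create u m * pderiv t n + (if (t, n) = (u, m) then (1 : ℂ) else 0) • 1 := by
  refine op_ext fun p => ?_
  by_cases h : (t, n) = (u, m)
  · simp only [h, if_true, Module.End.mul_apply, LinearMap.add_apply, create_ket, pderiv_ket,
      Finsupp.add_apply, Finsupp.single_eq_same, map_smul,
      Module.End.one_apply, one_smul, add_tsub_cancel_right]
    rcases Nat.eq_zero_or_pos (p.2 (u, m)) with h0 | h0
    · simp [h0]
    · rw [tsub_add_cancel_of_le]
      · push_cast; rw [add_smul, one_smul]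
      · rw [Finsupp.single_le_iff]; exact h0
  · simp only [if_neg h, Module.End.mul_apply, create_ket, pderiv_ket,
      Finsupp.add_apply, Finsupp.single_eq_of_ne h, map_smul,
      zero_smul, add_zero]
    rcases Nat.eq_zero_or_pos (p.2 (t, n)) with h0 | h0
    · simp [h0]
    · rw [tsub_add_eq_add_tsub]
      rw [Finsupp.single_le_iff]; exact h0

namespace Params

variable (P : Params)

lemma annih_comm (t u : Boson) (n m : ℕ+) : Commute (P.annih t n) (P.annih u m) := by
  refine Commute.sum_left _ _ _ fun i _ => Commute.sum_right _ _ _ fun j _ => ?_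
  exact ((pderiv_comm i j n m).smul_left _).smul_right _

lemma translate_annih (chg : Gh → ℤ) (t : Boson) (n : ℕ+) :
    Commute (translate chg) (P.annih t n) :=
  Commute.sum_right _ _ _ fun j _ => (translate_pderiv chg j n).smul_right _

lemma annih_create (t u : Boson) (n m : ℕ+) :
    P.annih t n * create u m
      = create u m * P.annih t n + (if n = m then P.comm t u n else 0) • 1 := by
  rw [annih, Finset.sum_mul, Finset.mul_sum]
  have : ∀ i : Boson, (P.comm t i n • pderiv i n) * create u m
      = create u m * (P.comm t i n • pderiv i n)
        + (if i = u then (if n = m then P.comm t u n else 0) else 0) • 1 := by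
    intro i
    rw [smul_mul_assoc, pderiv_create, smul_add, mul_smul_comm, smul_smul]
    congr 2
    by_cases h1 : i = u <;> by_cases h2 : n = m <;> simp [h1, h2]
  simp only [this, Finset.sum_add_distrib, ← Finset.sum_smul]
  simp

lemma osc_pos (t : Boson) (n : ℕ+) : P.osc t (n : ℕ) = P.annih t n := by
  obtain ⟨k, hk⟩ : ∃ k, (n : ℕ) = k + 1 := ⟨n.natPred, by simp⟩
  have : n = k.succPNat := PNat.eq (by simpa using hk)
  rw [this]; rfl

lemma osc_neg (t : Boson) (n : ℕ+) : P.osc t (-(n : ℕ) : ℤ) = create t n := by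
  obtain ⟨k, hk⟩ : ∃ k, (n : ℕ) = k + 1 := ⟨n.natPred, by simp⟩
  have : n = k.succPNat := PNat.eq (by simpa using hk)
  rw [this]; rfl

/-- The commutator `[t_n, u_{-n}]`, extended by zero to `n = 0`. -/
def comm0 (t u : Boson) (n : ℕ) : ℂ := if h : 0 < n then P.comm t u ⟨n, h⟩ else 0

lemma comm0_pos (t u : Boson) (n : ℕ+) : P.comm0 t u n = P.comm t u n := by
  rw [comm0, dif_pos n.pos]; rfl

lemma osc_ann_ann (t u : Boson) {n m : ℕ} (hn : n ≠ 0) (hm : m ≠ 0) :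
    Commute (P.osc t n) (P.osc u m) := by
  lift n to ℕ+ using Nat.pos_of_ne_zero hn
  lift m to ℕ+ using Nat.pos_of_ne_zero hm
  rw [osc_pos, osc_pos]; exact P.annih_comm t u n m

lemma osc_cre_cre (t u : Boson) {n m : ℕ} (hn : n ≠ 0) (hm : m ≠ 0) :
    Commute (P.osc t (-n)) (P.osc u (-m)) := by
  lift n to ℕ+ using Nat.pos_of_ne_zero hn
  lift m to ℕ+ using Nat.pos_of_ne_zero hm
  rw [osc_neg, osc_neg]; exact create_comm t u n m

lemma osc_ann_cre (t u : Boson) {n m : ℕ} (hn : n ≠ 0) (hm : m ≠ 0) :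
    P.osc t n * P.osc u (-m)
      = P.osc u (-m) * P.osc t n + (if n = m then P.comm0 t u n else 0) • 1 := by
  lift n to ℕ+ using Nat.pos_of_ne_zero hn
  lift m to ℕ+ using Nat.pos_of_ne_zero hm
  rw [osc_neg, osc_pos, annih_create, comm0_pos]
  simp

lemma translate_osc (chg : Gh → ℤ) (t : Boson) {n : ℤ} (hn : n ≠ 0) :
    Commute (translate chg) (P.osc t n) := by
  obtain ⟨m, rfl | rfl⟩ := n.eq_nat_or_neg
  · lift m to ℕ+ using Nat.pos_of_ne_zero (by simpa using hn)
    rw [osc_pos]; exact P.translate_annih chg t m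
  · lift m to ℕ+ using Nat.pos_of_ne_zero (by simpa using hn)
    rw [osc_neg]; exact translate_create chg t m

end Params

/-! ### The grading by charge and oscillator degree -/

/-- The oscillator degree of a basis vector. -/
def deg (p : Idx) : ℕ := p.2.sum fun tn e => (tn.2 : ℕ) * e

lemma deg_add_single (lam : Gh → ℤ) (μ : Boson × ℕ+ →₀ ℕ) (t : Boson) (n : ℕ+) :
    deg (lam, μ + Finsupp.single (t, n) 1) = deg (lam, μ) + n := by
  simp only [deg]
  rw [Finsupp.sum_add_index' (by simp) (by intros; ring), Finsupp.sum_single_index (by simp)]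
  simp

lemma deg_sub_single (lam : Gh → ℤ) (μ : Boson × ℕ+ →₀ ℕ) (t : Boson) (n : ℕ+)
    (h : μ (t, n) ≠ 0) :
    deg (lam, μ - Finsupp.single (t, n) 1) + n = deg (lam, μ) := by
  rw [← deg_add_single lam _ t n, tsub_add_cancel_of_le]
  rw [Finsupp.single_le_iff]; exact Nat.pos_of_ne_zero h

/-- The span of the basis vectors of charge `lam` and oscillator degree `d`. -/
def grade (lam : Gh → ℤ) (d : ℤ) : Submodule ℂ Fock :=
  Submodule.span ℂ (ket '' {p : Idx | p.1 = lam ∧ (deg p : ℤ) = d})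

lemma ket_mem_grade (p : Idx) : ket p ∈ grade p.1 (deg p) :=
  Submodule.subset_span ⟨p, ⟨rfl, rfl⟩, rfl⟩

lemma ket_mem_grade' {p : Idx} {lam : Gh → ℤ} {d : ℤ} (h1 : p.1 = lam) (h2 : (deg p : ℤ) = d) :
    ket p ∈ grade lam d := Submodule.subset_span ⟨p, ⟨h1, h2⟩, rfl⟩

lemma grade_neg {lam : Gh → ℤ} {d : ℤ} (h : d < 0) {v : Fock} (hv : v ∈ grade lam d) : v = 0 := by
  have : {p : Idx | p.1 = lam ∧ (deg p : ℤ) = d} = ∅ := by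
    ext p; simp only [Set.mem_ofPred_eq, Set.mem_empty_iff_false, iff_false, not_and]; omega
  rw [grade, this, Set.image_empty, Submodule.span_empty] at hv
  simpa using hv

/-- To map a graded piece into a subspace, it suffices to do so on basis vectors. -/
lemma map_grade {T : Module.End ℂ Fock} {lam : Gh → ℤ} {d : ℤ} {W : Submodule ℂ Fock}
    (h : ∀ p : Idx, p.1 = lam → (deg p : ℤ) = d → T (ket p) ∈ W) {v : Fock}
    (hv : v ∈ grade lam d) : T v ∈ W := by
  have : grade lam d ≤ W.comap T := by
    rw [grade, Submodule.span_le]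
    rintro _ ⟨p, ⟨h1, h2⟩, rfl⟩
    exact h p h1 h2
  exact this hv

lemma eqOn_grade {S T : Module.End ℂ Fock} {lam : Gh → ℤ} {d : ℤ}
    (h : ∀ p : Idx, p.1 = lam → (deg p : ℤ) = d → S (ket p) = T (ket p)) {v : Fock}
    (hv : v ∈ grade lam d) : S v = T v := by
  have := map_grade (T := S - T) (W := ⊥) (fun p h1 h2 => by simp [h p h1 h2]) hv
  simpa [sub_eq_zero] using this

lemma translate_mem (chg : Gh → ℤ) {lam : Gh → ℤ} {d : ℤ} {v : Fock} (hv : v ∈ grade lam d) :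
    translate chg v ∈ grade (lam + chg) d :=
  map_grade (fun p h1 h2 => by
    rw [translate_ket]; exact ket_mem_grade' (by rw [h1]) h2) hv

/-- `T` shifts the oscillator degree by `n` and preserves the charge. -/
def Shifts (T : Module.End ℂ Fock) (n : ℤ) : Prop :=
  ∀ lam d, ∀ v ∈ grade lam d, T v ∈ grade lam (d + n)

lemma Shifts.mul {S T : Module.End ℂ Fock} {m n : ℤ} (hS : Shifts S m) (hT : Shifts T n) :
    Shifts (S * T) (m + n) := fun _ _ _ hv => by
  have := hS _ _ _ (hT _ _ _ hv)
  rwa [add_assoc, add_comm n] at this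

lemma Shifts.smul {S : Module.End ℂ Fock} {m : ℤ} (hS : Shifts S m) (c : ℂ) :
    Shifts (c • S) m := fun _ _ _ hv => Submodule.smul_mem _ _ (hS _ _ _ hv)

lemma Shifts.sum {ι : Type*} {s : Finset ι} {S : ι → Module.End ℂ Fock} {m : ℤ}
    (hS : ∀ i ∈ s, Shifts (S i) m) : Shifts (∑ i ∈ s, S i) m := fun lam d v hv => by
  rw [LinearMap.sum_apply]
  exact Submodule.sum_mem _ fun i hi => hS i hi _ _ _ hv

lemma Shifts.zero (m : ℤ) : Shifts 0 m := fun _ _ _ _ => Submodule.zero_mem _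

lemma Shifts.one : Shifts 1 0 := fun lam d v hv => by simpa using hv

lemma create_shifts (t : Boson) (n : ℕ+) : Shifts (create t n) n := fun lam d v hv =>
  map_grade (fun p h1 h2 => by
    rw [create_ket]
    exact ket_mem_grade' h1 (by rw [deg_add_single, Nat.cast_add]; exact congrArg (· + _) h2)) hv

lemma pderiv_shifts (t : Boson) (n : ℕ+) : Shifts (pderiv t n) (-n) := fun lam d v hv =>
  map_grade (fun p h1 h2 => by
    rw [pderiv_ket]
    by_cases h : p.2 (t, n) = 0
    · simp [h]
    · refine Submodule.smul_mem _ _ (ket_mem_grade' h1 ?_)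
      have := deg_sub_single p.1 p.2 t n h
      rw [← h2, ← this]; push_cast; ring) hv

namespace Params

variable (P : Params)

lemma osc_shifts (t : Boson) (n : ℤ) : Shifts (P.osc t n) (-n) := by
  obtain ⟨m, rfl | rfl⟩ := n.eq_nat_or_neg
  · rcases Nat.eq_zero_or_pos m with rfl | hm
    · intro lam d v hv
      exact map_grade (fun p h1 h2 => by
        change diag _ (ket p) ∈ _
        rw [diag_ket]
        exact Submodule.smul_mem _ _ (ket_mem_grade' h1 (by simpa using h2))) hv
    · lift m to ℕ+ using hm
      rw [osc_pos]
      exact Shifts.sum fun u _ => (pderiv_shifts u m).smul _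
  · rcases Nat.eq_zero_or_pos m with rfl | hm
    · intro lam d v hv
      exact map_grade (fun p h1 h2 => by
        change diag _ (ket p) ∈ _
        rw [diag_ket]
        exact Submodule.smul_mem _ _ (ket_mem_grade' h1 (by simpa using h2))) hv
    · lift m to ℕ+ using hm
      rw [osc_neg, neg_neg]
      exact create_shifts t m

end Params

lemma expCoeff_shifts {A : ℕ → Module.End ℂ Fock} (σ : ℤ)
    (h : ∀ m, m ≠ 0 → Shifts (A m) (σ * m)) (n : ℕ) : Shifts (expCoeff A n) (σ * n) := by
  have key : ∀ r n, Shifts (PowerSeries.coeff n (posPart A ^ r)) (σ * n) := by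
    intro r
    induction r with
    | zero =>
      intro n
      rw [pow_zero, PowerSeries.coeff_one]
      split_ifs with h0
      · simpa [h0] using Shifts.one
      · exact Shifts.zero _
    | succ r ih =>
      intro n
      rw [pow_succ', PowerSeries.coeff_mul]
      refine Shifts.sum fun x hx => ?_
      have hx' : x.1 + x.2 = n := by simpa using hx
      rw [← hx', Nat.cast_add, mul_add, coeff_posPart]
      split_ifs with h0
      · rw [zero_mul]; exact Shifts.zero _
      · exact (h _ h0).mul (ih _)
  rw [expCoeff_eq A (Nat.lt_succ_self n)]
  exact Shifts.sum fun r _ => (key r n).smul _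

end Operators

/-! ### Two-sided sequences and the action of polynomials by shifts -/

section Sequences

open Finset Polynomial

variable {V : Type*} [AddCommGroup V] [Module ℂ V]

/-- The shift `(S φ) n = φ (n - 1)` of two-sided sequences, that is, multiplication of the formal
distribution `∑ φ n x ^ n` by `x`. -/
def shiftSeq : Module.End ℂ (ℤ → V) where
  toFun φ n := φ (n - 1)
  map_add' _ _ := rfl
  map_smul' _ _ := rfl

/-- Multiplication of the formal distribution `∑ φ n x ^ n` by a polynomial in `x`. -/
def act (p : ℂ[X]) : Module.End ℂ (ℤ → V) := aeval shiftSeq p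

lemma act_mul (p q : ℂ[X]) (φ : ℤ → V) : act (p * q) φ = act p (act q φ) := by
  simp [act]

lemma act_add (p q : ℂ[X]) (φ : ℤ → V) : act (p + q) φ = act p φ + act q φ := by
  simp [act]

lemma act_sub (p q : ℂ[X]) (φ : ℤ → V) : act (p - q) φ = act p φ - act q φ := by
  simp [act]

@[simp] lemma act_one (φ : ℤ → V) : act 1 φ = φ := by simp [act]

@[simp] lemma act_zero (φ : ℤ → V) : act 0 φ = 0 := by simp [act]

@[simp] lemma act_C (c : ℂ) (φ : ℤ → V) : act (C c) φ = c • φ := by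
  simp [act, Module.algebraMap_end_apply]

@[simp] lemma act_X (φ : ℤ → V) (n : ℤ) : act X φ n = φ (n - 1) := by simp [act, shiftSeq]

lemma act_C_mul_X (c : ℂ) (φ : ℤ → V) (n : ℤ) : act (C c * X) φ n = c • φ (n - 1) := by
  rw [act_mul, act_C, Pi.smul_apply, act_X]

lemma act_one_sub (b : ℂ) (φ : ℤ → V) (n : ℤ) :
    act (1 - C b * X) φ n = φ n - b • φ (n - 1) := by
  rw [act_sub, act_one, Pi.sub_apply, act_C_mul_X]

lemma act_X_sub (b : ℂ) (φ : ℤ → V) (n : ℤ) : act (X - C b) φ n = φ (n - 1) - b • φ n := by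
  rw [act_sub, Pi.sub_apply, act_X, act_C, Pi.smul_apply]

/-- `∏ (1 - b x)`. -/
def lin (l : List ℂ) : ℂ[X] := (l.map fun b => 1 - C b * X).prod

/-- `∏ (x - b)`. -/
def lin' (l : List ℂ) : ℂ[X] := (l.map fun b => X - C b).prod

@[simp] lemma lin_nil : lin [] = 1 := rfl
@[simp] lemma lin'_nil : lin' [] = 1 := rfl
@[simp] lemma lin_cons (b : ℂ) (l : List ℂ) : lin (b :: l) = (1 - C b * X) * lin l := rfl
@[simp] lemma lin'_cons (b : ℂ) (l : List ℂ) : lin' (b :: l) = (X - C b) * lin' l := rfl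

/-- Reflection of a sequence about `L / 2`. -/
def refl (L : ℤ) (φ : ℤ → V) : ℤ → V := fun n => φ (L - n)

/-- Reflection turns the factors `1 - b x` into `x - b`; this relates the products of two vertex
operators in the two orders. -/
lemma act_lin'_refl (l : List ℂ) (L : ℤ) (φ : ℤ → V) :
    act (lin' l) (refl L φ) = refl (L + l.length) (act (lin l) φ) := by
  induction l with
  | nil => simp
  | cons b l ih =>
    funext n
    rw [lin'_cons, lin_cons, act_mul, ih, act_X_sub, act_mul]
    simp only [refl, act_one_sub, List.length_cons, Nat.cast_add, Nat.cast_one]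
    congr 2
    · ring_nf
    · ring_nf

/-- The formal distribution of `φ` is the product of that of `ν` with the power series `g`,
all the sums involved being finite. -/
def IsConv (g : PowerSeries ℂ) (φ ν : ℤ → V) : Prop :=
  ∀ N : ℤ, ∃ J₀ : ℕ, ∀ J ≥ J₀, φ N = ∑ j ∈ range J, PowerSeries.coeff j g • ν (N - j)

lemma IsConv.one (ν : ℤ → V) : IsConv 1 ν ν := fun N => ⟨1, fun J hJ => by
  obtain ⟨K, rfl⟩ : ∃ K, J = K + 1 := ⟨J - 1, by omega⟩
  rw [Finset.sum_range_succ', Finset.sum_eq_zero]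
  · simp
  · intro j _
    simp [PowerSeries.coeff_one]⟩

lemma IsConv.unique {g : PowerSeries ℂ} {φ φ' ν : ℤ → V} (h : IsConv g φ ν)
    (h' : IsConv g φ' ν) : φ = φ' := by
  funext N
  obtain ⟨J, hJ⟩ := h N
  obtain ⟨J', hJ'⟩ := h' N
  rw [hJ (max J J') (le_max_left _ _), hJ' (max J J') (le_max_right _ _)]

lemma IsConv.factor {g : PowerSeries ℂ} {φ ν : ℤ → V} (h : IsConv g φ ν) (b : ℂ) :
    IsConv ((1 - PowerSeries.C b * PowerSeries.X) * g) (act (1 - C b * X) φ) ν := fun N => by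
  obtain ⟨J, hJ⟩ := h N
  obtain ⟨J', hJ'⟩ := h (N - 1)
  refine ⟨max J J' + 1, fun K hK => ?_⟩
  obtain ⟨K, rfl⟩ : ∃ k, K = k + 1 := ⟨K - 1, by omega⟩
  have h1 : J ≤ K + 1 := by have := le_max_left J J'; omega
  have h2 : J' ≤ K := by have := le_max_right J J'; omega
  rw [act_one_sub, hJ _ h1, hJ' _ h2]
  simp only [sub_mul, one_mul, map_sub, sub_smul, Finset.sum_sub_distrib]
  congr 1
  rw [Finset.sum_range_succ', Finset.smul_sum]
  simp only [mul_assoc, PowerSeries.coeff_C_mul, PowerSeries.coeff_succ_X_mul,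
    PowerSeries.coeff_zero_X_mul, mul_zero, zero_smul, add_zero]
  refine Finset.sum_congr rfl fun j _ => ?_
  rw [smul_smul, show N - 1 - (j : ℤ) = N - ((j + 1 : ℕ) : ℤ) by push_cast; ring]

lemma IsConv.factors {g : PowerSeries ℂ} {φ ν : ℤ → V} (h : IsConv g φ ν) (l : List ℂ) :
    IsConv ((lin l : PowerSeries ℂ) * g) (act (lin l) φ) ν := by
  induction l with
  | nil => simpa using h
  | cons b l ih =>
    have := ih.factor b
    rw [lin_cons, act_mul, Polynomial.coe_mul, mul_assoc]
    convert this using 2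
    simp

/-- A product with a rational function, after multiplication by the denominator. -/
lemma IsConv.rational {g : PowerSeries ℂ} {φ ν : ℤ → V} (h : IsConv g φ ν) {den num : List ℂ}
    (hg : (lin den : PowerSeries ℂ) * g = lin num) : act (lin den) φ = act (lin num) ν := by
  have h1 := h.factors den
  have h2 := (IsConv.one ν).factors num
  rw [mul_one] at h2
  rw [hg] at h1
  exact h1.unique h2

/-- A two-sided sequence with finite support. -/
def FinSeq (ν : ℤ → V) : Prop := ∃ B : ℕ, ∀ i : ℤ, B < |i| → ν i = 0

lemma FinSeq.finite {ν : ℤ → V} (h : FinSeq ν) : (Function.support ν).Finite := by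
  obtain ⟨B, hB⟩ := h
  refine (Set.finite_Icc (-(B : ℤ)) B).subset fun i hi => ?_
  rw [Set.mem_Icc, ← abs_le]
  by_contra hc
  exact hi (hB i (by omega))

lemma FinSeq.add {ν ν' : ℤ → V} (h : FinSeq ν) (h' : FinSeq ν') : FinSeq (ν + ν') := by
  obtain ⟨B, hB⟩ := h
  obtain ⟨B', hB'⟩ := h'
  exact ⟨B + B', fun i hi => by
    rw [Pi.add_apply, hB i (by push_cast at hi; omega), hB' i (by push_cast at hi; omega),
      add_zero]⟩

lemma FinSeq.smul {ν : ℤ → V} (h : FinSeq ν) (c : ℂ) : FinSeq (c • ν) := by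
  obtain ⟨B, hB⟩ := h
  exact ⟨B, fun i hi => by rw [Pi.smul_apply, hB i hi, smul_zero]⟩

lemma FinSeq.shift {ν : ℤ → V} (h : FinSeq ν) : FinSeq (act X ν) := by
  obtain ⟨B, hB⟩ := h
  refine ⟨B + 1, fun i hi => ?_⟩
  rw [act_X]
  refine hB _ ?_
  push_cast at hi
  have := abs_sub_abs_le_abs_sub i 1
  rw [abs_one] at this
  omega

lemma FinSeq.act {ν : ℤ → V} (h : FinSeq ν) (p : ℂ[X]) : FinSeq (act p ν) := by
  induction p using Polynomial.induction_on with
  | C a => rw [act_C]; exact h.smul a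
  | add p q hp hq => rw [act_add]; exact hp.add hq
  | monomial n a ih =>
    rw [pow_succ, ← mul_assoc, mul_comm, act_mul]
    exact ih.shift

/-- The value at `x = b⁻¹` of the Laurent polynomial `∑ ν i x ^ i`. -/
def evalSeq (b : ℂ) (ν : ℤ → V) : V := ∑ᶠ i : ℤ, b ^ (-i) • ν i

lemma evalSeq_add (b : ℂ) {ν ν' : ℤ → V} (h : FinSeq ν) (h' : FinSeq ν') :
    evalSeq b (ν + ν') = evalSeq b ν + evalSeq b ν' := by
  rw [evalSeq, evalSeq, evalSeq, ← finsum_add_distrib]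
  · simp only [Pi.add_apply, smul_add]
  · exact h.finite.subset fun i hi hc => hi (by simp [hc])
  · exact h'.finite.subset fun i hi hc => hi (by simp [hc])

lemma evalSeq_smul (b c : ℂ) (ν : ℤ → V) : evalSeq b (c • ν) = c • evalSeq b ν := by
  rw [evalSeq, evalSeq, smul_finsum]
  exact finsum_congr fun i => by rw [Pi.smul_apply, smul_comm]

/-- `evalSeq b` is evaluation at `x = b⁻¹`. -/
lemma evalSeq_act {b : ℂ} (hb : b ≠ 0) {ν : ℤ → V} (h : FinSeq ν) (p : ℂ[X]) :
    evalSeq b (act p ν) = p.eval b⁻¹ • evalSeq b ν := by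
  induction p using Polynomial.induction_on with
  | C a => rw [act_C, evalSeq_smul, eval_C]
  | add p q hp hq => rw [act_add, evalSeq_add b (h.act p) (h.act q), hp, hq, eval_add, add_smul]
  | monomial n a ih =>
    rw [pow_succ, ← mul_assoc, mul_comm, act_mul, eval_mul, mul_smul, ← ih, eval_X]
    rw [evalSeq, evalSeq, smul_finsum, ← finsum_comp_equiv (Equiv.addRight (1 : ℤ))]
    refine finsum_congr fun i => ?_
    simp only [Equiv.coe_addRight, act_X, add_sub_cancel_right, smul_smul]
    rw [neg_add, zpow_add₀ hb, zpow_neg_one, mul_comm]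

lemma seq_telescope {b : ℂ} {φ ρ : ℤ → V} (h : act (1 - C b * X) φ = ρ) (m : ℤ) (K : ℕ) :
    φ (m + K) = b ^ K • φ m + ∑ i ∈ range K, b ^ i • ρ (m + K - i) := by
  induction K with
  | zero => simp
  | succ K ih =>
    have h1 := congrFun h (m + (K + 1 : ℕ))
    rw [act_one_sub, sub_eq_iff_eq_add] at h1
    rw [h1, show m + ((K + 1 : ℕ) : ℤ) - 1 = m + K by push_cast; ring, ih,
      Finset.sum_range_succ', smul_add, smul_smul, ← pow_succ', Finset.smul_sum]
    simp only [pow_zero, one_smul, Nat.cast_zero, sub_zero, smul_smul, ← pow_succ']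
    rw [add_comm (ρ _), add_assoc]
    congr 2
    refine Finset.sum_congr rfl fun i _ => ?_
    congr 2; push_cast; ring

/-- Two expansions of the same rational function with a simple pole at `x = b⁻¹`, one bounded below
and the other one bounded above, differ by a multiple of the delta distribution. -/
lemma delta_seq {b : ℂ} (hb : b ≠ 0) {φ ψ ρ : ℤ → V} (hφ : act (1 - C b * X) φ = ρ)
    (hψ : act (1 - C b * X) ψ = ρ) (hρ : FinSeq ρ) (h1 : ∃ m, ∀ n < m, φ n = 0)
    (h2 : ∃ m, ∀ n > m, ψ n = 0) (N : ℤ) : φ N - ψ N = b ^ N • evalSeq b ρ := by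
  have hχ : ∀ n, φ n - ψ n = b • (φ (n - 1) - ψ (n - 1)) := by
    intro n
    have e1 := congrFun hφ n
    have e2 := congrFun hψ n
    rw [act_one_sub] at e1 e2
    rw [sub_eq_iff_eq_add] at e1 e2
    rw [e1, e2, smul_sub]; abel
  have hup : ∀ (K : ℕ) n, φ (n + K) - ψ (n + K) = b ^ K • (φ n - ψ n) := by
    intro K
    induction K with
    | zero => intro n; simp
    | succ K ih =>
      intro n
      rw [hχ, show n + ((K + 1 : ℕ) : ℤ) - 1 = n + K by push_cast; ring, ih, smul_smul, pow_succ']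
  obtain ⟨m1, hm1⟩ := h1
  obtain ⟨m2, hm2⟩ := h2
  obtain ⟨B, hB⟩ := hρ
  set m : ℤ := min (m1 - 1) (-(B : ℤ) - 1)
  obtain ⟨T, hT1, hT2, hT3⟩ : ∃ T : ℤ, N ≤ T ∧ m2 < T ∧ max (B : ℤ) m < T :=
    ⟨max N (max m2 (max (B : ℤ) m)) + 1, by omega, by omega, by omega⟩
  obtain ⟨K, hK⟩ : ∃ K : ℕ, T = m + K := ⟨(T - m).toNat, by omega⟩
  obtain ⟨K', hK'⟩ : ∃ K' : ℕ, T = N + K' := ⟨(T - N).toNat, by omega⟩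
  have e := seq_telescope hφ m K
  rw [hm1 m (by omega), smul_zero, zero_add, ← hK] at e
  have e2 : φ T = b ^ T • evalSeq b ρ := by
    rw [e, evalSeq, smul_finsum, finsum_eq_sum_of_support_subset (s := (range K).image
      fun i : ℕ => T - i), Finset.sum_image (fun i _ j _ h => by simpa using h)]
    · refine Finset.sum_congr rfl fun i _ => ?_
      rw [smul_smul]
      rw [← zpow_add₀ hb, show T + -(T - (i : ℤ)) = i by ring, zpow_natCast]
    · intro i hi
      have hi' : ρ i ≠ 0 := fun hc => hi (by simp [hc])
      have hi2 : ¬ ((B : ℤ) < |i|) := fun hc => hi' (hB i hc)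
      rw [not_lt, abs_le] at hi2
      simp only [coe_image, coe_range, Set.mem_image, Set.mem_Iio]
      exact ⟨(T - i).toNat, by omega, by omega⟩
  have e3 := hup K' N
  rw [← hK', hm2 T hT2, sub_zero, e2] at e3
  rw [hK', zpow_add₀ hb, zpow_natCast, mul_comm, mul_smul] at e3
  have hbK : b ^ K' ≠ 0 := pow_ne_zero _ hb
  exact (smul_right_injective V hbK e3).symm

/-- A sequence bounded below is determined by its product with `1 - b x`. -/
lemma act_one_sub_injective {b : ℂ} {φ ψ : ℤ → V}
    (h : act (1 - C b * X) φ = act (1 - C b * X) ψ) (h1 : ∃ m, ∀ n < m, φ n = 0)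
    (h2 : ∃ m, ∀ n < m, ψ n = 0) : φ = ψ := by
  obtain ⟨m1, hm1⟩ := h1
  obtain ⟨m2, hm2⟩ := h2
  funext N
  set m : ℤ := min (min m1 m2) N - 1
  obtain ⟨K, hK⟩ : ∃ K : ℕ, N = m + K := ⟨(N - m).toNat, by omega⟩
  have e1 := seq_telescope h m K
  have e2 := seq_telescope (b := b) (φ := ψ) rfl m K
  rw [hm1 m (by omega), ← hK] at e1
  rw [hm2 m (by omega), ← hK] at e2
  rw [e1, e2]

/-- If `φ` and `ψ` are expansions of the rational functions `P / D` and `P' / D'` times the same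
Laurent polynomial, then `α φ + β ψ = 0` as soon as this holds for the rational functions and
`α`, `β` cancel the poles. -/
lemma exchange_seq {φ ψ ν : ℤ → V} {D P D' P' α β : ℂ[X]} (hφ : act D φ = act P ν)
    (hψ : act D' ψ = act P' ν) (hD : D ∣ α) (hD' : D' ∣ β) (h0 : D ≠ 0) (h0' : D' ≠ 0)
    (h : α * P * D' + β * P' * D = 0) : act α φ + act β ψ = 0 := by
  obtain ⟨A, rfl⟩ := hD
  obtain ⟨A', rfl⟩ := hD'
  have : A * P + A' * P' = 0 := by
    have h1 : (D * D') * (A * P + A' * P') = 0 := by rw [← h]; ring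
    exact (mul_eq_zero.1 h1).resolve_left (mul_ne_zero h0 h0')
  rw [mul_comm D, mul_comm D', act_mul, act_mul, hφ, hψ, ← act_mul, ← act_mul, ← act_add, this,
    act_zero]

end Sequences

/-! ### Products of two vertex operators -/

lemma qp_add (lq x y : ℂ) : qp lq (x + y) = qp lq x * qp lq y := by
  rw [qp, qp, qp, mul_add, Complex.exp_add]

lemma qp_ne_zero (lq x : ℂ) : qp lq x ≠ 0 := Complex.exp_ne_zero _

@[simp] lemma qp_zero (lq : ℂ) : qp lq 0 = 1 := by simp [qp]

lemma qp_neg (lq x : ℂ) : qp lq (-x) = (qp lq x)⁻¹ := by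
  rw [qp, qp, mul_neg, Complex.exp_neg]

lemma qp_mul_int (lq x : ℂ) (n : ℤ) : qp lq (x * n) = qp lq x ^ n := by
  rw [qp, qp, ← Complex.exp_int_mul]; congr 1; ring

lemma qp_mul_nat (lq x : ℂ) (n : ℕ) : qp lq (x * n) = qp lq x ^ n := by
  rw [qp, qp, ← Complex.exp_nat_mul]; congr 1; ring

lemma sum_mul_sum_comm {R ι : Type*} [Ring R] [Algebra ℂ R] [Fintype ι] {a b : ι → R}
    {k : ι → ι → ℂ} (h : ∀ t u, a t * b u = b u * a t + k t u • (1 : R)) :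
    (∑ t, a t) * ∑ u, b u = (∑ u, b u) * (∑ t, a t) + (∑ t, ∑ u, k t u) • (1 : R) := by
  rw [Finset.sum_mul_sum, Finset.sum_mul_sum]
  simp only [h, Finset.sum_add_distrib, Finset.sum_smul]
  rw [Finset.sum_comm]

namespace Params

open Finset

variable (P : Params)

/-- The coefficients of the creation part of an exponent. -/
def creA (e : Expo) (m : ℕ) : Module.End ℂ Fock := ∑ t, e.1 t (-m) • P.osc t (-m)

/-- The coefficients of the annihilation part of an exponent. -/
def annA (e : Expo) (m : ℕ) : Module.End ℂ Fock := ∑ t, e.1 t m • P.osc t m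

lemma creCoeff_eq (e : Expo) (m : ℤ) : P.creCoeff e m = zext (expCoeff (P.creA e)) m := by
  cases m <;> rfl

lemma annCoeff_eq (e : Expo) (n : ℕ) : P.annCoeff e n = expCoeff (P.annA e) n := rfl

lemma commute_creA (e f : Expo) {i j : ℕ} (hi : i ≠ 0) (hj : j ≠ 0) :
    Commute (P.creA e i) (P.creA f j) :=
  Commute.sum_left _ _ _ fun t _ => Commute.sum_right _ _ _ fun u _ =>
    ((P.osc_cre_cre t u hi hj).smul_left _).smul_right _

lemma commute_annA (e f : Expo) {i j : ℕ} (hi : i ≠ 0) (hj : j ≠ 0) :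
    Commute (P.annA e i) (P.annA f j) :=
  Commute.sum_left _ _ _ fun t _ => Commute.sum_right _ _ _ fun u _ =>
    ((P.osc_ann_ann t u hi hj).smul_left _).smul_right _

lemma commFam_creA (e : Expo) : CommFam (P.creA e) := fun _ _ hi hj => P.commute_creA e e hi hj

lemma commFam_annA (e : Expo) : CommFam (P.annA e) := fun _ _ hi hj => P.commute_annA e e hi hj

lemma commute_creCoeff (e f : Expo) (m n : ℤ) : Commute (P.creCoeff e m) (P.creCoeff f n) := by
  rcases m with m | m
  · rcases n with n | n
    · exact expCoeff_commute_expCoeff (fun i j hi hj => P.commute_creA e f hi hj) m n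
    · exact Commute.zero_right _
  · exact Commute.zero_left _

lemma commute_annCoeff (e f : Expo) (m n : ℕ) : Commute (P.annCoeff e m) (P.annCoeff f n) :=
  expCoeff_commute_expCoeff (fun _ _ hi hj => P.commute_annA e f hi hj) m n

lemma translate_creCoeff (chg : Gh → ℤ) (e : Expo) (m : ℤ) :
    Commute (translate chg) (P.creCoeff e m) := by
  rcases m with m | m
  · exact commute_expCoeff _ (fun i hi => Commute.sum_right _ _ _ fun t _ =>
      (P.translate_osc chg t (by simpa using hi)).smul_right _) m
  · exact Commute.zero_right _

lemma translate_annCoeff (chg : Gh → ℤ) (e : Expo) (m : ℕ) :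
    Commute (translate chg) (P.annCoeff e m) :=
  commute_expCoeff _ (fun i hi => Commute.sum_right _ _ _ fun t _ =>
      (P.translate_osc chg t (by simpa using hi)).smul_right _) m

lemma creCoeff_neg (e : Expo) {m : ℤ} (h : m < 0) : P.creCoeff e m = 0 := by
  rw [creCoeff_eq, zext_neg _ h]

/-- The contraction of the annihilation part of `e` with the creation part of `f`. -/
def cn (e f : Expo) (n : ℕ) : ℂ := ∑ t, ∑ u, e.1 t n * f.1 u (-n) * P.comm0 t u n

lemma annA_creA (e f : Expo) (i j : ℕ) (hi : i ≠ 0) (hj : j ≠ 0) :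
    P.annA e i * P.creA f j
      = P.creA f j * P.annA e i + (if i = j then P.cn e f i else 0) • 1 := by
  have h : ∀ t u, (e.1 t i • P.osc t i) * (f.1 u (-j) • P.osc u (-j))
      = (f.1 u (-j) • P.osc u (-j)) * (e.1 t i • P.osc t i)
        + (if i = j then e.1 t i * f.1 u (-i) * P.comm0 t u i else 0) • 1 := by
    intro t u
    rw [smul_mul_smul_comm, smul_mul_smul_comm, P.osc_ann_cre t u hi hj, smul_add, smul_smul,
      mul_comm (e.1 t i)]
    congr 2
    split_ifs with hij
    · rw [hij]; ring
    · ring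
  rw [annA, creA, sum_mul_sum_comm h]
  congr 2
  split_ifs
  · rfl
  · simp

/-- Moving the annihilation part of one vertex operator past the creation part of another one
produces the exponential of the contraction. -/
lemma annCoeff_creCoeff (e f : Expo) (n : ℕ) (m : ℤ) :
    P.annCoeff e n * P.creCoeff f m = ∑ x ∈ antidiagonal n,
      expCoeff (P.cn e f) x.1 • (P.creCoeff f (m - x.1) * P.annCoeff e x.2) := by
  simp only [creCoeff_eq, annCoeff_eq]
  exact expCoeff_mul_expCoeff (P.commFam_annA e) (P.commFam_creA f) (P.cn e f)
    (fun i j hi hj => P.annA_creA e f i j hi hj) n m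

lemma annCoeff_shifts (e : Expo) (n : ℕ) : Shifts (P.annCoeff e n) (-n) := by
  have := expCoeff_shifts (A := P.annA e) (-1) (fun m _ => Shifts.sum fun t _ => by
    rw [neg_one_mul]; exact (P.osc_shifts t m).smul _) n
  rwa [neg_one_mul] at this

lemma creCoeff_shifts (e : Expo) (m : ℤ) : Shifts (P.creCoeff e m) m := by
  rcases m with m | m
  · have := expCoeff_shifts (A := P.creA e) 1 (fun m _ => Shifts.sum fun t _ => by
      rw [one_mul]; simpa using (P.osc_shifts t (-m)).smul _) m
    rwa [one_mul] at this
  · exact Shifts.zero _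

/-- The exponent of `z` in `z ^ (∑ e_g g_0)` on the vectors of charge `lam`. -/
def zl (e : Expo) (lam : Gh → ℤ) : ℤ := ∑ g, e.2.1 g * (g.sgn * lam g)

/-- The value of the zero mode factor of a vertex operator on the vectors of charge `lam`. -/
def zq (e : Expo) (lam : Gh → ℤ) : ℂ := qp P.lq (∑ t, e.2.2 t * P.zm t lam)

/-- The exponent of `z` in the contraction of two vertex operators. -/
def zp (e f : Expo) : ℤ := zl e f.2.1

/-- The logarithm in base `q` of the constant factor in the contraction of two vertex operators. -/
def qz (e f : Expo) : ℂ := ∑ g : Gh, e.2.2 (.inr g) * (g.sgn * f.2.1 g : ℤ)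

lemma zl_add (e f : Expo) (lam : Gh → ℤ) : zl e (lam + f.2.1) = zl e lam + zp e f := by
  simp only [zp, zl, ← Finset.sum_add_distrib, Pi.add_apply]
  exact Finset.sum_congr rfl fun g _ => by ring

lemma zp_comm (e f : Expo) : zp e f = zp f e := by
  rw [zp, zp, zl, zl]
  exact Finset.sum_congr rfl fun g _ => by ring

lemma zq_add (e f : Expo) (lam : Gh → ℤ) :
    P.zq e (lam + f.2.1) = qp P.lq (qz e f) * P.zq e lam := by
  rw [zq, zq, ← qp_add]
  congr 1
  simp only [Fintype.sum_sum_type, qz, zm, Pi.add_apply]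
  rw [← add_left_comm, ← Finset.sum_add_distrib]
  congr 1
  exact Finset.sum_congr rfl fun g _ => by push_cast; ring

/-- The vertex operator on a graded piece as a finite sum. -/
lemma vertex_apply (e : Expo) (N : ℤ) {lam : Gh → ℤ} {d : ℤ} {v : Fock} (hv : v ∈ grade lam d)
    {K : ℕ} (hK : d < K) :
    P.vertex e N v = P.zq e lam • ∑ n ∈ range K,
      P.creCoeff e (N - zl e lam + n) (translate e.2.1 (P.annCoeff e n v)) := by
  have key : ∀ p : Idx, p.1 = lam → (deg p : ℤ) = d → P.vertex e N (ket p)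
      = (P.zq e lam • ∑ n ∈ range K, P.creCoeff e (N - zl e lam + n) *
        translate e.2.1 * P.annCoeff e n : Module.End ℂ Fock) (ket p) := by
    intro p hp hd
    rw [vertex, onKets_ket, finsum_eq_sum_of_support_subset (s := range K)]
    · simp only [LinearMap.smul_apply, LinearMap.sum_apply, Module.End.mul_apply, Finset.smul_sum,
        map_smul, ← hp]
      rfl
    · intro n hn
      rw [coe_range, Set.mem_Iio]
      by_contra hc
      refine hn ?_
      have := P.annCoeff_shifts e n _ _ _ (ket_mem_grade p)
      beta_reduce
      rw [grade_neg (by omega) this]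
      simp
  rw [eqOn_grade key hv]
  simp

/-- The mode `N` of a vertex operator shifts the charge by a constant and the degree by `N` minus the
power of `z` contributed by the zero modes. -/
lemma vertex_mem (e : Expo) (N : ℤ) {lam : Gh → ℤ} {d : ℤ} {v : Fock} (hv : v ∈ grade lam d) :
    P.vertex e N v ∈ grade (lam + e.2.1) (d + (N - zl e lam)) := by
  rw [P.vertex_apply e N hv (K := d.toNat + 1) (by omega)]
  refine Submodule.smul_mem _ _ (Submodule.sum_mem _ fun n _ => ?_)
  have := P.creCoeff_shifts e (N - zl e lam + n) _ _ _
    (translate_mem e.2.1 (P.annCoeff_shifts e n _ _ _ hv))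
  convert this using 1
  ring_nf

lemma vertex_eq_zero (e : Expo) (N : ℤ) {lam : Gh → ℤ} {d : ℤ} {v : Fock} (hv : v ∈ grade lam d)
    (h : d + (N - zl e lam) < 0) : P.vertex e N v = 0 :=
  grade_neg h (P.vertex_mem e N hv)

/-- The coefficient of `z ^ M w ^ N` in the normal ordered product `:exp e(z) exp f(w):`, applied
to a basis vector. -/
def normal (e f : Expo) (M N : ℤ) (p : Idx) : Fock :=
  (P.zq e p.1 * P.zq f p.1) • ∑ n ∈ range (deg p + 1), ∑ n' ∈ range (deg p + 1),
    P.creCoeff e (M - zl e p.1 + n) (P.creCoeff f (N - zl f p.1 + n')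
      (translate (e.2.1 + f.2.1) (P.annCoeff e n (P.annCoeff f n' (ket p)))))

/-- Normally ordered products do not depend on the order of their factors. -/
lemma normal_comm (e f : Expo) (M N : ℤ) (p : Idx) :
    P.normal e f M N p = P.normal f e N M p := by
  rw [normal, normal, Finset.sum_comm, mul_comm (P.zq e p.1), add_comm e.2.1]
  congr 1
  refine Finset.sum_congr rfl fun n _ => Finset.sum_congr rfl fun n' _ => ?_
  rw [← Module.End.mul_apply, (P.commute_creCoeff e f _ _).eq, Module.End.mul_apply,
    ← Module.End.mul_apply (P.annCoeff e n'), (P.commute_annCoeff e f _ _).eq,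
    Module.End.mul_apply]

lemma normal_eq_zero_left (e f : Expo) (M N : ℤ) (p : Idx) (h : M - zl e p.1 + deg p < 0) :
    P.normal e f M N p = 0 := by
  rw [normal, Finset.sum_eq_zero, smul_zero]
  intro n hn
  rw [mem_range] at hn
  refine Finset.sum_eq_zero fun n' _ => ?_
  rw [P.creCoeff_neg e (by omega)]
  rfl

lemma normal_eq_zero_right (e f : Expo) (M N : ℤ) (p : Idx) (h : N - zl f p.1 + deg p < 0) :
    P.normal e f M N p = 0 := by
  rw [normal_comm, normal_eq_zero_left _ _ _ _ _ _ h]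

lemma translate_translate (a b : Gh → ℤ) (v : Fock) :
    translate a (translate b v) = translate (a + b) v := by
  have : translate a * translate b = translate (a + b) := op_ext fun p => by
    simp [add_assoc, add_comm b]
  rw [← this]; rfl

lemma vertex_vertex_term (e f : Expo) (M N : ℤ) (n n' : ℕ) (v : Fock) :
    P.creCoeff e (M + n) (translate e.2.1 (P.annCoeff e n
      (P.creCoeff f N (translate f.2.1 (P.annCoeff f n' v)))))
    = ∑ x ∈ antidiagonal n, expCoeff (P.cn e f) x.1 •
        P.creCoeff e (M + (x.1 + x.2)) (P.creCoeff f (N - x.1)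
          (translate (e.2.1 + f.2.1) (P.annCoeff e x.2 (P.annCoeff f n' v)))) := by
  rw [← Module.End.mul_apply (P.annCoeff e n), P.annCoeff_creCoeff, LinearMap.sum_apply, map_sum,
    map_sum]
  refine Finset.sum_congr rfl fun x hx => ?_
  have hx' : x.1 + x.2 = n := by simpa using hx
  rw [← hx', LinearMap.smul_apply, map_smul, map_smul, Module.End.mul_apply,
    ← Module.End.mul_apply (translate e.2.1), (P.translate_creCoeff _ _ _).eq,
    Module.End.mul_apply, ← Module.End.mul_apply (P.annCoeff e x.2),
    ← (P.translate_annCoeff _ _ _).eq, Module.End.mul_apply, translate_translate]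
  push_cast
  rfl

/-- The operator product expansion of two vertex operators, with the contraction given by an
exponential series. -/
lemma vertex_vertex (e f : Expo) (p : Idx) (L : ℤ) :
    IsConv (expSeries (P.cn e f)) (fun N => P.vertex e (L - N) (P.vertex f N (ket p)))
      (fun i => qp P.lq (qz e f) • P.normal e f (L - zp e f - i) i p) := fun N => by
  set K := deg p + 1
  set N' := N - zl f p.1
  refine ⟨(N' + deg p + 1).toNat, fun J hJ => ?_⟩
  have hp := ket_mem_grade p
  have hf := P.vertex_mem f N hp
  set M' := L - N - zl e (p.1 + f.2.1)
  set F : ℕ → ℕ → Fock := fun j i => ∑ n' ∈ range K, expCoeff (P.cn e f) j •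
    P.creCoeff e (M' + (j + i)) (P.creCoeff f (N' + n' - j)
      (translate (e.2.1 + f.2.1) (P.annCoeff e i (P.annCoeff f n' (ket p)))))
  have hF1 : ∀ j i, J ≤ j → F j i = 0 := fun j i hj => Finset.sum_eq_zero fun n' hn' => by
    rw [mem_range] at hn'
    rw [P.creCoeff_neg f (by omega)]
    simp
  have hF2 : ∀ j i, K ≤ i → F j i = 0 := fun j i hi => Finset.sum_eq_zero fun n' hn' => by
    have h1 := P.annCoeff_shifts e i _ _ _ (P.annCoeff_shifts f n' _ _ _ hp)
    rw [grade_neg (by omega) h1]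
    simp
  have e1 : P.vertex e (L - N) (P.vertex f N (ket p))
      = (P.zq e (p.1 + f.2.1) * P.zq f p.1) •
        ∑ j ∈ range (J + K), ∑ i ∈ range (J + K - j), F j i := by
    rw [P.vertex_apply e (L - N) hf (K := J + K) (by omega), ← Finset.sum_range_diag_flip,
      mul_smul]
    congr 1
    rw [Finset.smul_sum]
    refine Finset.sum_congr rfl fun n _ => ?_
    rw [P.vertex_apply f N hp (K := K) (by omega), map_smul, map_smul, map_smul, map_sum, map_sum,
      map_sum]
    congr 1
    rw [Finset.sum_congr rfl fun n' _ => P.vertex_vertex_term e f _ _ n n' (ket p),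
      Finset.sum_comm, Finset.Nat.sum_antidiagonal_eq_sum_range_succ_mk]
  have e2 : ∑ j ∈ range (J + K), ∑ i ∈ range (J + K - j), F j i
      = ∑ j ∈ range J, ∑ i ∈ range K, F j i := by
    symm
    refine Finset.sum_subset_zero_on_sdiff (by simp) (fun j hj => ?_) fun j hj => ?_
    · rw [mem_sdiff, mem_range, mem_range, not_lt] at hj
      exact Finset.sum_eq_zero fun i _ => hF1 j i hj.2
    · rw [mem_range] at hj
      refine Finset.sum_subset (fun i hi => ?_) fun i _ hi => ?_
      · rw [mem_range] at hi ⊢; omega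
      · rw [mem_range, not_lt] at hi
        exact hF2 j i hi
  beta_reduce
  rw [e1, e2, Finset.smul_sum]
  refine Finset.sum_congr rfl fun j _ => ?_
  rw [coeff_expSeries, normal, P.zq_add, smul_smul, smul_smul, mul_assoc, ← smul_smul,
    ← smul_smul, ← smul_smul, ← smul_smul, ← smul_smul]
  simp only [F, ← Finset.smul_sum]
  rw [smul_comm, smul_comm (expCoeff _ _)]
  rw [smul_comm (expCoeff _ _) (P.zq e p.1), smul_comm (expCoeff _ _) (P.zq f p.1)]
  rw [smul_comm (P.zq e p.1) (qp P.lq (qz e f))]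
  congr 4
  refine Finset.sum_congr rfl fun i _ => Finset.sum_congr rfl fun n' _ => ?_
  rw [show M' + ((j : ℤ) + i) = L - zp e f - (N - j) - zl e p.1 + i by
      simp only [M', zl_add]; ring,
    show N' + (n' : ℤ) - j = N - j - zl f p.1 + n' by simp only [N']; ring]

end Params

/-! ### Exchange relations and fusion of vertex operators -/

namespace Params

open Finset Polynomial

variable (P : Params)

/-- The products `V_e[L - N] V_f[N] v` of modes of fixed total degree. -/
def prodSeq (e f : Expo) (p : Idx) (L : ℤ) : ℤ → Fock := fun N =>
  P.vertex e (L - N) (P.vertex f N (ket p))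

/-- The products `V_f[N] V_e[L - N] v` of modes of fixed total degree. -/
def swapSeq (e f : Expo) (p : Idx) (L : ℤ) : ℤ → Fock := fun N =>
  P.vertex f N (P.vertex e (L - N) (ket p))

/-- The normal ordered products entering the operator product expansion of `prodSeq`. -/
def normalSeq (e f : Expo) (p : Idx) (L : ℤ) : ℤ → Fock := fun i =>
  P.normal e f (L - zp e f - i) i p

lemma swapSeq_eq (e f : Expo) (p : Idx) (L : ℤ) :
    P.swapSeq e f p L = refl L (P.prodSeq f e p L) := by
  funext N; simp [swapSeq, prodSeq, refl]

lemma normalSeq_swap (e f : Expo) (p : Idx) (L : ℤ) :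
    P.normalSeq e f p L = refl (L - zp e f) (P.normalSeq f e p L) := by
  funext N
  simp only [normalSeq, refl, zp_comm f e]
  rw [normal_comm]
  congr 1
  ring

/-- The product of two vertex operators is the expansion of a rational function with numerator
proportional to `num` times the normally ordered product and with denominator `den`. -/
lemma prodSeq_rational (e f : Expo) (p : Idx) (L : ℤ) {den num : List ℂ}
    (hg : (lin den : PowerSeries ℂ) * expSeries (P.cn e f) = lin num) :
    act (lin den) (P.prodSeq e f p L)
      = act (C (qp P.lq (qz e f)) * lin num) (P.normalSeq e f p L) := by
  rw [mul_comm, act_mul, act_C]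
  exact (P.vertex_vertex e f p L).rational hg

/-- The product in the opposite order is an expansion, in the opposite region, of a rational function
with the same normally ordered product. -/
lemma swapSeq_rational (e f : Expo) (p : Idx) (L : ℤ) {den num : List ℂ}
    (hg : (lin den : PowerSeries ℂ) * expSeries (P.cn f e) = lin num)
    (hz : zp e f = num.length - den.length) :
    act (lin' den) (P.swapSeq e f p L)
      = act (C (qp P.lq (qz f e)) * lin' num) (P.normalSeq e f p L) := by
  rw [swapSeq_eq, act_lin'_refl, P.prodSeq_rational f e p L hg, P.normalSeq_swap e f p L, act_mul,
    act_mul,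
    act_C, act_C, act_lin'_refl, hz]
  funext n
  simp only [refl, Pi.smul_apply]
  congr 2
  ring_nf

/-- On a given vector the normally ordered product has finitely many terms in each total degree. -/
lemma normalSeq_fin (e f : Expo) (p : Idx) (L : ℤ) : FinSeq (P.normalSeq e f p L) := by
  refine ⟨(|zl f p.1 - deg p| + |L - zp e f - zl e p.1 + deg p|).toNat, fun i hi => ?_⟩
  rw [normalSeq]
  by_cases h : i - zl f p.1 + deg p < 0
  · exact P.normal_eq_zero_right _ _ _ _ _ h
  · refine P.normal_eq_zero_left _ _ _ _ _ ?_
    have h1 := le_abs_self (L - zp e f - zl e p.1 + deg p)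
    have h2 := neg_abs_le (zl f p.1 - deg p)
    have h3 := abs_nonneg (L - zp e f - zl e p.1 + deg p)
    have h4 := abs_nonneg (zl f p.1 - deg p)
    rcases abs_cases i with ⟨h5, _⟩ | ⟨h5, _⟩ <;> omega

lemma prodSeq_bounded (e f : Expo) (p : Idx) (L : ℤ) :
    ∃ m, ∀ n < m, P.prodSeq e f p L n = 0 :=
  ⟨zl f p.1 - deg p, fun n hn => by
    rw [prodSeq, P.vertex_eq_zero f n (ket_mem_grade p) (by omega), map_zero]⟩

lemma swapSeq_bounded (e f : Expo) (p : Idx) (L : ℤ) :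
    ∃ m, ∀ n > m, P.swapSeq e f p L n = 0 :=
  ⟨L - zl e p.1 + deg p, fun n hn => by
    rw [swapSeq, P.vertex_eq_zero e (L - n) (ket_mem_grade p) (by omega), map_zero]⟩

/-- The exponent `e(q ^ β z)`. -/
def shiftE (β : ℂ) (e : Expo) : Expo :=
  (fun t n => qp P.lq (-β * n) * e.1 t n, e.2.1,
    fun t => e.2.2 t + Sum.elim (fun _ => 0) (fun g => β * e.2.1 g) t)

lemma creA_fuse (β : ℂ) (e f : Expo) :
    P.creA (P.shiftE β e + f) = (fun m => qp P.lq β ^ m • P.creA e m) + P.creA f := by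
  funext m
  simp only [creA, shiftE, Prod.fst_add, Pi.add_apply, add_smul, Finset.sum_add_distrib,
    Finset.smul_sum, smul_smul]
  congr 1
  refine Finset.sum_congr rfl fun t _ => ?_
  rw [← qp_mul_nat]
  push_cast
  rw [neg_mul_neg]

lemma annA_fuse (β : ℂ) (e f : Expo) :
    P.annA (P.shiftE β e + f) = (fun m => qp P.lq (-β) ^ m • P.annA e m) + P.annA f := by
  funext m
  simp only [annA, shiftE, Prod.fst_add, Pi.add_apply, add_smul, Finset.sum_add_distrib,
    Finset.smul_sum, smul_smul]
  congr 1
  refine Finset.sum_congr rfl fun t _ => ?_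
  rw [← qp_mul_nat]
  push_cast
  rfl

lemma creCoeff_fuse (β : ℂ) (e f : Expo) (n : ℕ) :
    P.creCoeff (P.shiftE β e + f) n = ∑ x ∈ antidiagonal n,
      qp P.lq β ^ x.1 • (P.creCoeff e x.1 * P.creCoeff f x.2) := by
  simp only [creCoeff_eq, zext_natCast]
  rw [creA_fuse, expCoeff_add (fun i j hi hj => ((P.commute_creA e e hi hj).smul_left _).smul_right _)
    (P.commFam_creA f) (fun i j hi hj => (P.commute_creA e f hi hj).smul_left _)]
  exact Finset.sum_congr rfl fun x _ => by rw [expCoeff_rescale, smul_mul_assoc]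

lemma annCoeff_fuse (β : ℂ) (e f : Expo) (n : ℕ) :
    P.annCoeff (P.shiftE β e + f) n = ∑ x ∈ antidiagonal n,
      qp P.lq (-β) ^ x.1 • (P.annCoeff e x.1 * P.annCoeff f x.2) := by
  simp only [annCoeff_eq]
  rw [annA_fuse, expCoeff_add (fun i j hi hj => ((P.commute_annA e e hi hj).smul_left _).smul_right _)
    (P.commFam_annA f) (fun i j hi hj => (P.commute_annA e f hi hj).smul_left _)]
  exact Finset.sum_congr rfl fun x _ => by rw [expCoeff_rescale, smul_mul_assoc]

lemma finsum_creCoeff (β : ℂ) (e f : Expo) (m : ℤ) (w : Fock) :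
    ∑ᶠ a : ℤ, qp P.lq β ^ a • P.creCoeff e a (P.creCoeff f (m - a) w)
      = P.creCoeff (P.shiftE β e + f) m w := by
  rcases lt_or_ge m 0 with hm | hm
  · rw [P.creCoeff_neg _ hm, finsum_eq_zero_of_forall_eq_zero]
    · rfl
    · intro a
      rcases lt_or_ge a 0 with ha | ha
      · rw [P.creCoeff_neg e ha]; simp
      · rw [P.creCoeff_neg f (by omega)]; simp
  · lift m to ℕ using hm
    rw [creCoeff_fuse, LinearMap.sum_apply,
      finsum_eq_sum_of_support_subset (s := (range (m + 1)).image fun i : ℕ => (i : ℤ)),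
      Finset.sum_image (fun i _ j _ h => by simpa using h),
      Finset.Nat.sum_antidiagonal_eq_sum_range_succ_mk]
    · refine Finset.sum_congr rfl fun i hi => ?_
      rw [mem_range] at hi
      rw [show (m : ℤ) - i = ((m - i : ℕ) : ℤ) by omega, zpow_natCast]
      rfl
    · intro a ha
      rw [coe_image, Set.mem_image]
      by_contra hc
      push Not at hc
      refine ha ?_
      beta_reduce
      rcases lt_or_ge a 0 with h0 | h0
      · rw [P.creCoeff_neg e h0]; simp
      · have := hc a.toNat
        rw [P.creCoeff_neg f]
        · simp
        · by_contra h1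
          exact this (by rw [coe_range, Set.mem_Iio]; omega) (by omega)

lemma zq_fuse (β : ℂ) (e f : Expo) (lam : Gh → ℤ) :
    P.zq (P.shiftE β e + f) lam = qp P.lq (β * zl e lam) * (P.zq e lam * P.zq f lam) := by
  rw [zq, zq, zq, ← qp_add, ← qp_add]
  congr 1
  simp only [shiftE, Prod.snd_add, Pi.add_apply, add_mul, Finset.sum_add_distrib, zl,
    Fintype.sum_sum_type, Sum.elim_inl, Sum.elim_inr, zm, zero_mul,
    Finset.sum_const_zero, zero_add]
  push_cast
  rw [Finset.mul_sum]
  have : ∀ x : Gh, β * (e.2.1 x : ℂ) * (x.sgn * lam x) = β * (e.2.1 x * (x.sgn * lam x)) :=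
    fun x => by ring
  simp only [this]
  ring

lemma zl_fuse (β : ℂ) (e f : Expo) (lam : Gh → ℤ) :
    zl (P.shiftE β e + f) lam = zl e lam + zl f lam := by
  simp only [zl, shiftE, Prod.snd_add, Prod.fst_add, Pi.add_apply, add_mul,
    Finset.sum_add_distrib]

/-- Setting `z = q ^ β w` in the normal ordered product `:exp e(z) exp f(w):` gives a single vertex
operator. -/
lemma evalSeq_normalSeq (β : ℂ) (e f : Expo) (p : Idx) (L : ℤ) :
    evalSeq (qp P.lq β) (P.normalSeq e f p L)
      = qp P.lq (-β * (L - zp e f : ℤ)) • P.vertex (P.shiftE β e + f) (L - zp e f) (ket p) := by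
  set b := qp P.lq β
  have hb : b ≠ 0 := qp_ne_zero _ _
  set M := L - zp e f
  set K := deg p + 1
  have hp := ket_mem_grade p
  set T := translate (e.2.1 + f.2.1)
  set G : ℕ → ℕ → Fock := fun n n' => (b⁻¹) ^ n •
    P.creCoeff (P.shiftE β e + f) (M - zl e p.1 - zl f p.1 + (n + n'))
      (T (P.annCoeff e n (P.annCoeff f n' (ket p))))
  have hsum : ∑ n ∈ range K, P.creCoeff (P.shiftE β e + f)
      (M - zl (P.shiftE β e + f) p.1 + n) (translate (P.shiftE β e + f).2.1
        (P.annCoeff (P.shiftE β e + f) n (ket p)))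
      = ∑ n ∈ range K, ∑ n' ∈ range K, G n n' := by
    have h1 : ∀ n ∈ range K, P.creCoeff (P.shiftE β e + f)
      (M - zl (P.shiftE β e + f) p.1 + n) (translate (P.shiftE β e + f).2.1
        (P.annCoeff (P.shiftE β e + f) n (ket p))) = ∑ k ∈ range (n + 1), G k (n - k) := by
      intro n _
      rw [annCoeff_fuse, ← Finset.Nat.sum_antidiagonal_eq_sum_range_succ G, LinearMap.sum_apply,
        map_sum, map_sum]
      refine Finset.sum_congr rfl fun x hx => ?_
      have hx' : x.1 + x.2 = n := by simpa using hx
      simp only [G]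
      rw [zl_fuse, ← hx', LinearMap.smul_apply, map_smul, map_smul, qp_neg, ← sub_sub]
      push_cast
      rfl
    rw [Finset.sum_congr rfl h1, Finset.sum_range_diag_flip]
    refine Finset.sum_congr rfl fun n hn => ?_
    refine Finset.sum_subset (fun i hi => ?_) fun i hi hi' => ?_
    · rw [mem_range] at hi ⊢; omega
    · rw [mem_range, not_lt] at hi'
      rw [mem_range] at hn
      simp only [G]
      have h1 := P.annCoeff_shifts e n _ _ _ (P.annCoeff_shifts f i _ _ _ hp)
      rw [grade_neg (by omega) h1]
      simp
  rw [P.vertex_apply _ _ hp (K := K) (by omega), hsum, zq_fuse, evalSeq]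
  have hterm : ∀ n n' : ℕ, ∑ᶠ i : ℤ, b ^ (-i) • P.creCoeff e (M - i - zl e p.1 + n)
      (P.creCoeff f (i - zl f p.1 + n') (T (P.annCoeff e n (P.annCoeff f n' (ket p)))))
      = (b ^ (zl e p.1 - M)) • G n n' := by
    intro n n'
    simp only [G]
    rw [← finsum_creCoeff, smul_finsum, smul_finsum,
      ← finsum_comp_equiv (Equiv.subLeft (M - zl e p.1 + n))]
    refine finsum_congr fun a => ?_
    simp only [Equiv.subLeft_apply, smul_smul]
    rw [show M - (M - zl e p.1 + n - a) - zl e p.1 + n = a by ring,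
      show M - zl e p.1 + n - a - zl f p.1 + n' = M - zl e p.1 - zl f p.1 + (n + n') - a by ring,
      inv_pow, ← zpow_natCast, ← zpow_neg, ← zpow_add₀ hb, ← zpow_add₀ hb]
    congr 2
    ring
  have hfin : ∀ n n' : ℕ, (Function.support fun i : ℤ => b ^ (-i) •
      P.creCoeff e (M - i - zl e p.1 + n) (P.creCoeff f (i - zl f p.1 + n')
        (T (P.annCoeff e n (P.annCoeff f n' (ket p)))))).Finite := by
    intro n n'
    refine (Set.finite_Icc (zl f p.1 - n') (M - zl e p.1 + n)).subset fun i hi => ?_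
    rw [Set.mem_Icc]
    constructor
    · by_contra hc
      exact hi (by beta_reduce; rw [P.creCoeff_neg f (by omega)]; simp)
    · by_contra hc
      exact hi (by beta_reduce; rw [P.creCoeff_neg e (by omega)]; simp)
  have hL : ∀ i, b ^ (-i) • P.normalSeq e f p L i = (P.zq e p.1 * P.zq f p.1) •
      ∑ n ∈ range K, ∑ n' ∈ range K, b ^ (-i) • P.creCoeff e (M - i - zl e p.1 + n)
      (P.creCoeff f (i - zl f p.1 + n') (T (P.annCoeff e n (P.annCoeff f n' (ket p))))) := by
    intro i
    rw [normalSeq, normal, smul_comm]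
    simp only [Finset.smul_sum]
    rfl
  rw [finsum_congr hL, ← smul_finsum, finsum_sum_comm]
  · have : ∀ n ∈ range K, ∑ᶠ i : ℤ, ∑ n' ∈ range K, b ^ (-i) •
        P.creCoeff e (M - i - zl e p.1 + n) (P.creCoeff f (i - zl f p.1 + n')
          (T (P.annCoeff e n (P.annCoeff f n' (ket p)))))
        = ∑ n' ∈ range K, (b ^ (zl e p.1 - M)) • G n n' := by
      intro n _
      rw [finsum_sum_comm _ _ fun n' _ => hfin n n']
      exact Finset.sum_congr rfl fun n' _ => hterm n n'
    rw [Finset.sum_congr rfl this]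
    simp only [← Finset.smul_sum, smul_smul]
    congr 1
    rw [← mul_assoc, ← qp_add, mul_comm]
    congr 1
    rw [show b = qp P.lq β from rfl, ← qp_mul_int]
    congr 1
    push_cast
    ring
  · intro n _
    refine (Set.Finite.biUnion (range K).finite_toSet fun n' _ => hfin n n').subset fun i hi => ?_
    by_contra hc
    simp only [Set.mem_iUnion, not_exists, Function.mem_support, not_not] at hc
    exact hi (Finset.sum_eq_zero fun n' hn' => hc n' hn')

end Params

/-! ### Symbolic vertex operators -/

/-- The elementary exponents from which all vertex operators below are built: the field
`g(q ^ x z; κ)`, the exponents `a^i_+(q ^ ((k+1)/2 + x) z)` and `a^i_-(q ^ (-(k+1)/2 + x) z)`, and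
the phase `√-1 π g_0`. A pair of integers `x = (a, b)` stands for the number `a + b k`. -/
inductive Piece where
  | fld (g : Gh) (x : ℤ × ℤ) (κ : ℤ)
  | ap (i : Fin 2) (x : ℤ × ℤ)
  | am (i : Fin 2) (x : ℤ × ℤ)
  | ph (g : Gh)

/-- A formal integral combination of elementary exponents. -/
abbrev Sym := List (ℤ × Piece)

namespace Sym

/-- The contraction of two elementary exponents, as a list of pairs `(m, α)` standing for
`∑ m q ^ (α n) / n`. -/
def pieceContr : Piece → Piece → List (ℤ × (ℤ × ℤ))
  | .fld g x κ, .fld g' x' κ' => if g = g' then [(-g.sgn, x' - x - (κ + κ', 0))] else []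
  | .ap i x, .am j x' =>
      [(-1, x' - x + (cartan i j, 0)), (1, x' - x + (-cartan i j, 0)),
        (1, x' - x + (cartan i j - 2, -2)), (-1, x' - x + (-cartan i j - 2, -2))]
  | _, _ => []

/-- The contraction of two symbolic exponents. -/
def contr (s t : Sym) : List (ℤ × (ℤ × ℤ)) :=
  s.flatMap fun a => t.flatMap fun b => (pieceContr a.2 b.2).map fun c => (a.1 * b.1 * c.1, c.2)

/-- The charge of an elementary exponent. -/
def pieceChg : Piece → Gh → ℤ
  | .fld g _ _, g' => if g = g' then 1 else 0
  | _, _ => 0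

/-- The charge of a symbolic exponent. -/
def chg (s : Sym) (g : Gh) : ℤ := (s.map fun a => a.1 * pieceChg a.2 g).sum

/-- The contribution of an elementary exponent to the power of `z` on charge `lam`. -/
def pieceZl (lam : Gh → ℤ) : Piece → ℤ
  | .fld g _ _ => g.sgn * lam g
  | _ => 0

/-- The power of `z` on charge `lam`. -/
def zl (s : Sym) (lam : Gh → ℤ) : ℤ := (s.map fun a => a.1 * pieceZl lam a.2).sum

/-- The contribution of an elementary exponent to the power of `q` on charge `lam`. -/
def pieceQ (lam : Gh → ℤ) : Piece → ℤ × ℤ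
  | .fld g x _ => (g.sgn * lam g) • x
  | _ => 0

/-- The power of `q` in the contraction with an exponent of charge `lam`. -/
def qe (s : Sym) (lam : Gh → ℤ) : ℤ × ℤ := (s.map fun a => a.1 • pieceQ lam a.2).sum

/-- The contribution of an elementary exponent to the sign on charge `lam`. -/
def pieceSg (lam : Gh → ℤ) : Piece → ℤ
  | .ph g => g.sgn * lam g
  | _ => 0

/-- The exponent of `-1` in the contraction with an exponent of charge `lam`. -/
def sg (s : Sym) (lam : Gh → ℤ) : ℤ := (s.map fun a => a.1 * pieceSg lam a.2).sum

/-- The substitution `z ↦ q ^ β z` in an elementary exponent. -/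
def pieceShift (β : ℤ × ℤ) : Piece → Piece
  | .fld g x κ => .fld g (x + β) κ
  | .ap i x => .ap i (x + β)
  | .am i x => .am i (x + β)
  | .ph g => .ph g

/-- The substitution `z ↦ q ^ β z`. -/
def shift (β : ℤ × ℤ) (s : Sym) : Sym := s.map fun a => (a.1, pieceShift β a.2)

/-- The negative of a symbolic exponent. -/
def neg (s : Sym) : Sym := s.map fun a => (-a.1, a.2)

end Sym

/-- The total multiplicity of `a` in a formal combination. -/
def net {ι : Type*} [DecidableEq ι] (L : List (ℤ × ι)) (a : ι) : ℤ :=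
  (L.map fun x => if x.2 = a then x.1 else 0).sum

/-- All multiplicities in a formal combination vanish. -/
def Balanced {ι : Type*} [DecidableEq ι] (L : List (ℤ × ι)) : Prop := ∀ x ∈ L, net L x.2 = 0

instance {ι : Type*} [DecidableEq ι] (L : List (ℤ × ι)) : Decidable (Balanced L) :=
  inferInstanceAs (Decidable (∀ x ∈ L, net L x.2 = 0))

/-- A formal combination in which every element has net multiplicity zero vanishes under every
evaluation. All identities between symbolic exponents are reduced to this decidable criterion. -/
lemma Balanced.sum_eq_zero {ι M : Type*} [DecidableEq ι] [AddCommGroup M] {L : List (ℤ × ι)}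
    (h : Balanced L) (F : ι → M) : (L.map fun x => x.1 • F x.2).sum = 0 := by
  set φ : ι →₀ ℤ := (L.map fun x => Finsupp.single x.2 x.1).sum with hφ
  have hnet : ∀ a, φ a = net L a := by
    intro a
    have : φ a = Finsupp.applyAddHom (M := ℤ) a φ := rfl
    rw [this, hφ, map_list_sum, List.map_map, net]
    congr 1
    refine List.map_congr_left fun x _ => ?_
    simp [Finsupp.single_apply]
  have h0 : φ = 0 := by
    ext a
    rw [hnet, Finsupp.zero_apply]
    by_cases ha : ∃ x ∈ L, x.2 = a
    · obtain ⟨x, hx, rfl⟩ := ha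
      exact h x hx
    · push Not at ha
      rw [net]
      refine List.sum_eq_zero fun y hy => ?_
      obtain ⟨x, hx, rfl⟩ := List.mem_map.1 hy
      exact if_neg (ha x hx)
  have h2 : (φ.sum fun a m => m • F a) = (L.map fun x => x.1 • F x.2).sum := by
    have : ∀ ψ : ι →₀ ℤ, (ψ.sum fun a m => m • F a)
        = Finsupp.liftAddHom (fun a => (smulAddHom ℤ M).flip (F a)) ψ := fun ψ => rfl
    rw [this, hφ, map_list_sum, List.map_map]
    congr 1
    refine List.map_congr_left fun x _ => ?_
    simp
  rw [← h2, h0, Finsupp.sum_zero_index]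

namespace Params

open Finset

variable (P : Params)

/-- `q = exp lq` is not a root of unity. -/
def Generic : Prop := ∀ n : ℕ, 0 < n → Complex.exp P.lq ^ n ≠ 1

/-- The number `a + b k`. -/
def val (x : ℤ × ℤ) : ℂ := x.1 + x.2 * P.k

lemma val_add (x y : ℤ × ℤ) : P.val (x + y) = P.val x + P.val y := by
  simp only [val, Prod.fst_add, Prod.snd_add]; push_cast; ring

lemma val_neg (x : ℤ × ℤ) : P.val (-x) = -P.val x := by
  simp only [val, Prod.fst_neg, Prod.snd_neg]; push_cast; ring

lemma val_sub (x y : ℤ × ℤ) : P.val (x - y) = P.val x - P.val y := by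
  rw [sub_eq_add_neg, val_add, val_neg, sub_eq_add_neg]

@[simp] lemma val_zero : P.val 0 = 0 := by simp [val]

lemma val_zsmul (n : ℤ) (x : ℤ × ℤ) : P.val (n • x) = n * P.val x := by
  simp only [val, Prod.smul_fst, Prod.smul_snd, smul_eq_mul]; push_cast; ring

/-- The power `q ^ (a + b k)`. -/
def qv (x : ℤ × ℤ) : ℂ := qp P.lq (P.val x)

lemma qv_add (x y : ℤ × ℤ) : P.qv (x + y) = P.qv x * P.qv y := by
  rw [qv, val_add, qp_add]; rfl

@[simp] lemma qv_zero : P.qv 0 = 1 := by simp [qv]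

lemma qv_neg (x : ℤ × ℤ) : P.qv (-x) = (P.qv x)⁻¹ := by rw [qv, val_neg, qp_neg]; rfl

lemma qv_ne_zero (x : ℤ × ℤ) : P.qv x ≠ 0 := qp_ne_zero _ _

variable {P}

lemma Generic.qp_ne (hq : P.Generic) {n : ℤ} (hn : n ≠ 0) : qp P.lq n ≠ 1 := by
  have h1 : ∀ m : ℕ, 0 < m → qp P.lq m ≠ 1 := fun m hm => by
    rw [qp, mul_comm, Complex.exp_nat_mul]; exact hq m hm
  obtain ⟨m, rfl | rfl⟩ := n.eq_nat_or_neg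
  · exact_mod_cast h1 m (by omega)
  · intro hc
    refine h1 m (by omega) ?_
    rw [← inv_inj, inv_one, ← qp_neg]
    exact_mod_cast hc

lemma Generic.sub_ne (hq : P.Generic) {n : ℤ} (hn : n ≠ 0) : qp P.lq n - qp P.lq (-n) ≠ 0 := by
  intro hc
  refine hq.qp_ne (n := 2 * n) (by omega) ?_
  rw [sub_eq_zero, qp_neg, ← mul_eq_one_iff_eq_inv₀ (qp_ne_zero _ _), ← qp_add] at hc
  push_cast
  rwa [two_mul]

lemma Generic.den_ne (hq : P.Generic) : qp P.lq 1 - qp P.lq (-1) ≠ 0 := by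
  simpa using hq.sub_ne one_ne_zero

lemma Generic.qnum_ne (hq : P.Generic) {n : ℤ} (hn : n ≠ 0) : qnum P.lq n ≠ 0 :=
  div_ne_zero (hq.sub_ne hn) hq.den_ne

lemma Generic.lq_ne (hq : P.Generic) : P.lq ≠ 0 := fun h => hq 1 one_pos (by simp [h])

variable (P)

/-- The exponent `√-1 π ∑ w_g g_0`. -/
def phE (w : Gh → ℤ) : Expo :=
  (0, 0, Sum.elim (fun _ => 0) fun g => w g * (Complex.I * Real.pi / P.lq))

/-- The exponent denoted by an elementary symbol. -/
def pieceE : Piece → Expo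
  | .fld g x κ => P.field g (P.val x) κ
  | .ap i x => P.fplus (.inl i) ((P.k + 1) / 2 + P.val x)
  | .am i x => P.fminus (.inl i) (-(P.k + 1) / 2 + P.val x)
  | .ph g => P.phE (Pi.single g 1)

/-- The exponent denoted by a symbolic exponent. -/
def symE (s : Sym) : Expo := (s.map fun a => a.1 • P.pieceE a.2).sum

lemma symE_append (s t : Sym) : P.symE (s ++ t) = P.symE s + P.symE t := by
  simp [symE]

/-- `cn` as an additive map of the first exponent. -/
def cnL (f : Expo) (n : ℕ) : Expo →+ ℂ :=
  AddMonoidHom.mk' (fun e => P.cn e f n) fun a b => by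
    simp only [cn, Prod.fst_add, Pi.add_apply, add_mul, Finset.sum_add_distrib]

/-- `cn` as an additive map of the second exponent. -/
def cnR (e : Expo) (n : ℕ) : Expo →+ ℂ :=
  AddMonoidHom.mk' (fun f => P.cn e f n) fun a b => by
    simp only [cn, Prod.fst_add, Pi.add_apply, add_mul, mul_add, Finset.sum_add_distrib]

lemma cn_single (e f : Expo) {t u : Boson} {F G : ℤ → ℂ} (he : e.1 = Pi.single t F)
    (hf : f.1 = Pi.single u G) (n : ℕ) : P.cn e f n = F n * G (-n) * P.comm0 t u n := by
  rw [cn, he, hf, Finset.sum_eq_single t, Finset.sum_eq_single u]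
  · simp
  · intro v _ hv; simp [Pi.single_eq_of_ne hv]
  · simp
  · intro v _ hv; simp [Pi.single_eq_of_ne hv]
  · simp

lemma comm0_gh {n : ℕ} (hn : n ≠ 0) (g g' : Gh) : P.comm0 (.inr g) (.inr g') n
    = if g = g' then g.sgn * qnum P.lq n ^ 2 / n else 0 := by
  simp [comm0, Nat.pos_of_ne_zero hn, comm]

lemma comm0_a {n : ℕ} (hn : n ≠ 0) (i j : Fin 2) : P.comm0 (.inl i) (.inl j) n
    = qnum P.lq (cartan i j * n) * qnum P.lq ((P.k + 1) * n) / n := by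
  simp [comm0, Nat.pos_of_ne_zero hn, comm]

lemma comm0_mix (i : Fin 2) (g : Gh) (n : ℕ) :
    P.comm0 (.inl i) (.inr g) n = 0 ∧ P.comm0 (.inr g) (.inl i) n = 0 := by
  constructor <;> (rw [comm0]; split_ifs <;> rfl)

/-- The function of `n` denoted by `α` in a contraction, `q ^ (α n) / n`. -/
def pw (n : ℕ) (α : ℤ × ℤ) : ℂ := qp P.lq (P.val α * n) / n

variable {P}

lemma cn_fld (hq : P.Generic) (g : Gh) (x x' κ κ' : ℂ) {n : ℕ} (hn : n ≠ 0) :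
    P.cn (P.field g x κ) (P.field g x' κ') n
      = -g.sgn * (qp P.lq ((x' - x - (κ + κ')) * n) / n) := by
  have hn' : (n : ℂ) ≠ 0 := Nat.cast_ne_zero.2 hn
  have hz : (n : ℤ) ≠ 0 := by exact_mod_cast hn
  have hqn := hq.qnum_ne hz
  rw [Int.cast_natCast] at hqn
  have hneg : qnum P.lq (-(n : ℂ)) = -qnum P.lq n := by simp only [qnum, neg_neg]; ring
  rw [P.cn_single (t := .inr g) (u := .inr g) _ _ rfl rfl, P.comm0_gh hn, if_pos rfl, if_neg hz,
    if_neg (neg_ne_zero.2 hz)]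
  push_cast
  rw [hneg, abs_neg, Nat.abs_cast, show (x' - x - (κ + κ')) * (n : ℂ)
      = -κ * n + -x * n + (-κ' * n + x' * n) by ring, qp_add, qp_add _ (-κ * n), qp_add _ (-κ' * n),
    show -x' * -(n : ℂ) = x' * n by ring]
  push_cast
  field_simp

lemma cn_ap_am (hq : P.Generic) (i j : Fin 2) (x x' : ℂ) {n : ℕ} (hn : n ≠ 0) :
    P.cn (P.fplus (.inl i) x) (P.fminus (.inl j) x') n
      = -qp P.lq ((x' - x) * n) / n * ((qp P.lq (cartan i j * n) - qp P.lq (-(cartan i j * n)))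
        * (qp P.lq ((P.k + 1) * n) - qp P.lq (-((P.k + 1) * n)))) := by
  have hn' : (n : ℂ) ≠ 0 := Nat.cast_ne_zero.2 hn
  have hp : (0 : ℤ) < n := by omega
  have hden := hq.den_ne
  rw [P.cn_single (t := .inl i) (u := .inl j) _ _ rfl rfl, P.comm0_a hn, if_pos hp,
    if_pos (by omega), qnum, qnum]
  push_cast
  rw [show (x' - x) * (n : ℂ) = -x * n + -x' * -n by ring, qp_add]
  field_simp

lemma cn_eq_zero_of_comm {e f : Expo} {n : ℕ} (h : ∀ t u, e.1 t n * f.1 u (-n) * P.comm0 t u n = 0) :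
    P.cn e f n = 0 := by
  rw [cn]; exact Finset.sum_eq_zero fun t _ => Finset.sum_eq_zero fun u _ => h t u

lemma cn_of_ann {e f : Expo} {n : ℕ} (h : ∀ t, e.1 t n = 0) : P.cn e f n = 0 :=
  cn_eq_zero_of_comm fun t u => by rw [h, zero_mul, zero_mul]

lemma cn_of_cre {e f : Expo} {n : ℕ} (h : ∀ t, f.1 t (-n) = 0) : P.cn e f n = 0 :=
  cn_eq_zero_of_comm fun t u => by rw [h, mul_zero, zero_mul]

lemma fplus_neg (t u : Boson) (x : ℂ) (n : ℕ) : (P.fplus t x).1 u (-n) = 0 := by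
  simp only [fplus, Pi.single_apply]
  split_ifs with h
  · exact if_neg (by omega)
  · rfl

lemma fminus_pos (t u : Boson) (x : ℂ) (n : ℕ) : (P.fminus t x).1 u n = 0 := by
  simp only [fminus, Pi.single_apply]
  split_ifs with h
  · exact if_neg (by omega)
  · rfl

/-- The symbolic contraction of two elementary exponents computes the actual one. -/
lemma cn_piece (hq : P.Generic) (a b : Piece) {n : ℕ} (hn : n ≠ 0) :
    P.cn (P.pieceE a) (P.pieceE b) n
      = ((Sym.pieceContr a b).map fun c => c.1 • P.pw n c.2).sum := by
  rcases a with ⟨g, x, κ⟩ | ⟨i, x⟩ | ⟨i, x⟩ | g <;>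
    rcases b with ⟨g', x', κ'⟩ | ⟨j, x'⟩ | ⟨j, x'⟩ | g' <;> simp only [Sym.pieceContr, List.map_nil,
      List.sum_nil, pieceE]
  · by_cases h : g = g'
    · subst h
      rw [cn_fld hq _ _ _ _ _ hn, if_pos rfl]
      simp only [List.map_cons, List.map_nil, List.sum_cons, List.sum_nil, add_zero, pw, val_sub,
        zsmul_eq_mul]
      rw [show P.val (κ + κ', 0) = κ + κ' by simp [val]]
      push_cast
      ring
    · rw [P.cn_single (t := .inr g) (u := .inr g') _ _ rfl rfl, P.comm0_gh hn, if_neg h, mul_zero,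
        if_neg h, List.map_nil, List.sum_nil]
  · exact cn_of_cre fun t => fplus_neg _ _ _ _
  · rw [P.cn_single (t := .inr g) (u := .inl j) _ _ rfl rfl, (P.comm0_mix j g n).2, mul_zero]
  · exact cn_of_cre fun t => rfl
  · rw [P.cn_single (t := .inl i) (u := .inr g') _ _ rfl rfl, (P.comm0_mix i g' n).1, mul_zero]
  · exact cn_of_cre fun t => fplus_neg _ _ _ _
  · rw [cn_ap_am hq _ _ _ _ hn]
    simp only [List.map_cons, List.map_nil, List.sum_cons, List.sum_nil, add_zero, pw, val_add,
      val_sub, zsmul_eq_mul]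
    simp only [val]
    push_cast
    have e : ∀ A B C D E F G : ℂ, D = A + B + C → E = A - B + C → F = A + B - C → 
      G = A - B - C → -qp P.lq A / n * ((qp P.lq B - qp P.lq (-B)) * (qp P.lq C - qp P.lq (-C)))
        = -1 * (qp P.lq D / n) + (1 * (qp P.lq E / n) + (1 * (qp P.lq F / n) + -1 * (qp P.lq G / n))) := by
      intro A B C D E F G h1 h2 h3 h4
      subst h1 h2 h3 h4
      simp only [sub_eq_add_neg, qp_add]
      ring
    refine e _ _ _ _ _ _ _ ?_ ?_ ?_ ?_ <;> ring
  · exact cn_of_cre fun t => rfl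
  all_goals first
    | exact cn_of_ann fun t => fminus_pos _ _ _ _
    | exact cn_of_ann fun t => rfl

end Params

/-! ### Evaluation of symbolic contractions -/

namespace Sym

/-- The list of `α`, with multiplicities, for which `1 - q ^ α x` is a factor of the denominator of
`exp` of the contraction `L`. In the product of vertex operators at `z` and `w` one has `x = w / z`, so
that this is a pole at `z = q ^ α w`. -/
def poles (L : List (ℤ × (ℤ × ℤ))) : List (ℤ × ℤ) :=
  (L.map Prod.snd).dedup.flatMap fun α => List.replicate (net L α).toNat α

/-- The list of `α`, with multiplicities, for which `1 - q ^ α x` is a factor of the numerator of `exp`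
of the contraction `L`. -/
def zeros (L : List (ℤ × (ℤ × ℤ))) : List (ℤ × ℤ) :=
  (L.map Prod.snd).dedup.flatMap fun α => List.replicate (-net L α).toNat α

/-- The contraction `L` is `exp (∑ L) = ∏_{num} (1 - q ^ α x) / ∏_{den} (1 - q ^ α x)`. -/
def HasRatio (L : List (ℤ × (ℤ × ℤ))) (den num : List (ℤ × ℤ)) : Prop :=
  Balanced (L ++ (num.map fun α => (1, α)) ++ den.map fun α => (-1, α))

instance (L : List (ℤ × (ℤ × ℤ))) (den num : List (ℤ × ℤ)) : Decidable (HasRatio L den num) :=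
  inferInstanceAs (Decidable (Balanced _))

/-- A certificate for the exchange relation
`∏_{lα} (1 - q ^ α x) φ + (-1) ^ τ ∏_{lβ} (x - q ^ β) ψ = 0`, where `φ`, `ψ` are the two rational
functions given by the products of the vertex operators of `s`, `t` in both orders. -/
def Exchange (s t : Sym) (den num den' num' lα lβ : List (ℤ × ℤ)) (τ : ℕ) : Prop :=
  HasRatio (contr s t) den num ∧ HasRatio (contr t s) den' num' ∧
  s.zl t.chg = num'.length - den'.length ∧
  (lα ++ num ++ den'.map (-·)).Perm (lβ.map (-·) ++ num'.map (-·) ++ den) ∧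
  (s.sg t.chg + t.sg s.chg + den'.length + lβ.length + num'.length + τ) % 2 = 1 ∧
  s.qe t.chg + den'.sum = lβ.sum + t.qe s.chg + num'.sum

instance (s t : Sym) (den num den' num' lα lβ : List (ℤ × ℤ)) (τ : ℕ) :
    Decidable (Exchange s t den num den' num' lα lβ τ) := by
  unfold Exchange; infer_instance

/-- The exchange relation holds without delta functions. -/
def Regular (s t : Sym) (lα lβ : List (ℤ × ℤ)) (τ : ℕ) : Prop :=
  Exchange s t (poles (contr s t)) (zeros (contr s t)) (poles (contr t s)) (zeros (contr t s))
    lα lβ τ ∧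
  (poles (contr s t) = [] ∨ poles (contr s t) = lα) ∧
  (poles (contr t s) = [] ∨ poles (contr t s) = lβ)

instance (s t : Sym) (lα lβ : List (ℤ × ℤ)) (τ : ℕ) : Decidable (Regular s t lα lβ τ) := by
  unfold Regular; infer_instance

end Sym

namespace Params

open Finset Polynomial

variable (P : Params)

lemma map_symE {M : Type*} [AddCommGroup M] (F : Expo →+ M) (s : Sym) :
    F (P.symE s) = (s.map fun a => a.1 • F (P.pieceE a.2)).sum := by
  rw [symE, map_list_sum, List.map_map]
  congr 1
  exact List.map_congr_left fun a _ => map_zsmul F _ _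

lemma symE_chg (s : Sym) : (P.symE s).2.1 = s.chg := by
  funext g
  have := P.map_symE ((Pi.evalAddMonoidHom (fun _ : Gh => ℤ) g).comp
    ((AddMonoidHom.fst _ _).comp (AddMonoidHom.snd (Boson → ℤ → ℂ) ((Gh → ℤ) × (Boson → ℂ))))) s
  refine this.trans ?_
  rw [Sym.chg]
  congr 1
  refine List.map_congr_left fun a _ => ?_
  rw [smul_eq_mul]
  congr 1
  rcases a.2 with ⟨g', x, κ⟩ | ⟨i, x⟩ | ⟨i, x⟩ | g'
  · simp [pieceE, field, Sym.pieceChg, Pi.single_apply, eq_comm]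
  all_goals rfl

lemma zl_symE (s : Sym) (lam : Gh → ℤ) : zl (P.symE s) lam = s.zl lam := by
  have := P.map_symE (AddMonoidHom.mk' (fun e : Expo => zl e lam) fun a b => by
    simp only [zl, Prod.snd_add, Prod.fst_add, Pi.add_apply, add_mul, Finset.sum_add_distrib]) s
  refine this.trans ?_
  rw [Sym.zl]
  congr 1
  refine List.map_congr_left fun a _ => ?_
  rw [smul_eq_mul]
  congr 1
  rcases a.2 with ⟨g', x, κ⟩ | ⟨i, x⟩ | ⟨i, x⟩ | g'
  · simp [pieceE, field, Sym.pieceZl, zl, Pi.single_apply]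
  all_goals simp [pieceE, fplus, fminus, phE, Sym.pieceZl, zl]

lemma zp_symE (s t : Sym) : zp (P.symE s) (P.symE t) = s.zl t.chg := by
  rw [zp, symE_chg, zl_symE]

lemma qz_symE (s : Sym) (f : Expo) : qz (P.symE s) f
    = P.val (s.qe f.2.1) + s.sg f.2.1 * (Complex.I * Real.pi / P.lq) := by
  have h : qz (P.symE s) f = (s.map fun a => a.1 • qz (P.pieceE a.2) f).sum :=
    P.map_symE (AddMonoidHom.mk' (fun e : Expo => qz e f) fun a b => by
      simp only [qz, Prod.snd_add, Pi.add_apply, add_mul, Finset.sum_add_distrib]) s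
  have key : ∀ a : Piece, qz (P.pieceE a) f = P.val (Sym.pieceQ f.2.1 a)
      + Sym.pieceSg f.2.1 a * (Complex.I * Real.pi / P.lq) := by
    rintro (⟨g', x, κ⟩ | ⟨i, x⟩ | ⟨i, x⟩ | g')
    · have : P.val (Sym.pieceQ f.2.1 (.fld g' x κ)) = (g'.sgn * f.2.1 g' : ℤ) * P.val x :=
        P.val_zsmul _ _
      rw [this, show Sym.pieceSg f.2.1 (.fld g' x κ) = 0 from rfl]
      simp [pieceE, field, qz, Pi.single_apply, mul_comm]
    · simp [pieceE, fplus, Sym.pieceQ, Sym.pieceSg, qz]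
    · simp [pieceE, fminus, Sym.pieceQ, Sym.pieceSg, qz]
    · simp [pieceE, phE, Sym.pieceQ, Sym.pieceSg, qz, Pi.single_apply, mul_comm]
  rw [h]
  clear h
  simp only [key, Sym.qe, Sym.sg]
  induction s with
  | nil => simp
  | cons a s ih =>
    rw [List.map_cons, List.sum_cons, ih, List.map_cons, List.sum_cons, List.map_cons,
      List.sum_cons, val_add, val_zsmul, zsmul_eq_mul]
    push_cast
    ring

lemma qp_qz_symE (h : P.lq ≠ 0) (s t : Sym) : qp P.lq (qz (P.symE s) (P.symE t))
    = P.qv (s.qe t.chg) * (-1) ^ (s.sg t.chg) := by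
  rw [qz_symE, symE_chg, qp_add]
  congr 1
  rw [mul_comm, qp_mul_int]
  congr 1
  rw [qp, mul_div_cancel₀ _ h, mul_comm, Complex.exp_pi_mul_I]

/-- The symbolic contraction computes the actual one. -/
lemma cn_symE {P : Params} (hq : P.Generic) (s t : Sym) {n : ℕ} (hn : n ≠ 0) :
    P.cn (P.symE s) (P.symE t) n
      = ((Sym.contr s t).map fun c => c.1 • P.pw n c.2).sum := by
  have h1 := P.map_symE (P.cnL (P.symE t) n) s
  refine h1.trans ?_
  have h2 : ∀ a, P.cnL (P.symE t) n (P.pieceE a)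
      = (t.map fun b => b.1 • P.cn (P.pieceE a) (P.pieceE b.2) n).sum :=
    fun a => P.map_symE (P.cnR (P.pieceE a) n) t
  simp only [h2, cn_piece hq _ _ hn, Sym.contr]
  rw [List.map_flatMap, List.flatMap_def, List.sum_flatten, List.map_map]
  congr 1
  refine List.map_congr_left fun a _ => ?_
  simp only [Function.comp]
  rw [List.map_flatMap, List.flatMap_def, List.sum_flatten, List.map_map, List.smul_sum,
    List.map_map]
  congr 1
  refine List.map_congr_left fun b _ => ?_
  simp only [Function.comp]
  rw [List.smul_sum, List.smul_sum, List.map_map, List.map_map, List.map_map]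
  congr 1
  refine List.map_congr_left fun c _ => ?_
  simp only [Function.comp, smul_smul, mul_assoc]

lemma commFam_comm {R : Type*} [CommRing R] [Algebra ℂ R] (A : ℕ → R) : CommFam A :=
  fun _ _ _ _ => Commute.all _ _

/-- The logarithm series of `1 - q ^ α x`. -/
lemma one_sub_eq_expSeries (α : ℤ × ℤ) :
    ((1 - C (P.qv α) * X : ℂ[X]) : PowerSeries ℂ) = expSeries fun n => -P.pw n α := by
  refine eq_expSeries (commFam_comm _) (by simp) ?_
  set b := P.qv α
  have h1 : euler (posPart fun n => -P.pw n α)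
      = PowerSeries.mk fun n => if n = 0 then 0 else -b ^ n := by
    ext n
    rw [coeff_euler, coeff_posPart, PowerSeries.coeff_mk]
    split_ifs with h
    · simp
    · have : (n : ℂ) ≠ 0 := Nat.cast_ne_zero.2 h
      rw [pw, qp_mul_nat, smul_eq_mul, mul_neg, mul_div_cancel₀ _ this]
      rfl
  rw [h1]
  have h2 : ((1 - C b * X : ℂ[X]) : PowerSeries ℂ) = 1 - PowerSeries.C b * PowerSeries.X := by simp
  rw [h2, mul_sub, mul_one]
  ext n
  rw [coeff_euler, map_sub, map_sub, PowerSeries.coeff_mk, mul_left_comm, PowerSeries.coeff_C_mul,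
    PowerSeries.coeff_C_mul]
  rcases n with _ | _ | n
  · simp
  · simp [PowerSeries.coeff_one, PowerSeries.coeff_succ_mul_X]
  · rw [PowerSeries.coeff_succ_mul_X, PowerSeries.coeff_mk, PowerSeries.coeff_X,
      PowerSeries.coeff_one]
    simp [pow_succ]
    ring

lemma lin_eq_expSeries (l : List (ℤ × ℤ)) : ((lin (l.map P.qv) : ℂ[X]) : PowerSeries ℂ)
    = expSeries fun n => (l.map fun α => -P.pw n α).sum := by
  induction l with
  | nil =>
    ext n
    rw [coeff_expSeries, expCoeff_of_zero (by simp)]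
    simp [PowerSeries.coeff_one]
  | cons α l ih =>
    rw [List.map_cons, lin_cons, Polynomial.coe_mul, ih, one_sub_eq_expSeries,
      ← expSeries_add (commFam_comm _) (commFam_comm _) fun _ _ _ _ => Commute.all _ _]
    rfl

lemma expSeries_congr {R : Type*} [Ring R] [Algebra ℂ R] {A B : ℕ → R}
    (h : ∀ m, m ≠ 0 → A m = B m) : expSeries A = expSeries B := by
  ext n; simp only [coeff_expSeries, expCoeff_congr h]

lemma list_sum_map_neg {ι M : Type*} [AddCommGroup M] (l : List ι) (F : ι → M) :
    (l.map fun x => -F x).sum = -(l.map F).sum := by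
  induction l with
  | nil => simp
  | cons a l ih => simp only [List.map_cons, List.sum_cons, ih, neg_add]

/-- If the symbolic contraction has the given poles and zeros, its exponential is the corresponding
rational function. -/
lemma lin_mul_expSeries {P : Params} (hq : P.Generic) {s t : Sym} {den num : List (ℤ × ℤ)}
    (h : Sym.HasRatio (Sym.contr s t) den num) :
    ((lin (den.map P.qv) : ℂ[X]) : PowerSeries ℂ) * expSeries (P.cn (P.symE s) (P.symE t))
      = (lin (num.map P.qv) : ℂ[X]) := by
  rw [lin_eq_expSeries, lin_eq_expSeries,
    ← expSeries_add (commFam_comm _) (commFam_comm _) fun _ _ _ _ => Commute.all _ _]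
  refine expSeries_congr fun n hn => ?_
  have hb := Balanced.sum_eq_zero h (P.pw n)
  rw [Pi.add_apply, cn_symE hq s t hn]
  simp only [List.map_append, List.sum_append, List.map_map, Function.comp_def, one_smul,
    neg_smul] at hb
  rw [list_sum_map_neg, list_sum_map_neg] at *
  linear_combination hb

lemma lin'_eq (l : List (ℤ × ℤ)) : lin' (l.map P.qv)
    = C ((-1) ^ l.length * P.qv l.sum) * lin ((l.map (-·)).map P.qv) := by
  induction l with
  | nil => simp
  | cons α l ih =>
    have hα : (X - C (P.qv α) : ℂ[X]) = C (-P.qv α) * (1 - C (P.qv (-α)) * X) := by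
      rw [qv_neg, mul_sub, mul_one, ← mul_assoc, ← C_mul, neg_mul,
        mul_inv_cancel₀ (P.qv_ne_zero α)]
      simp
      ring
    rw [List.map_cons, lin'_cons, ih, hα, List.map_cons, List.map_cons, lin_cons, List.length_cons,
      List.sum_cons, qv_add, pow_succ]
    simp only [C_mul, C_neg, C_1]
    ring

lemma lin_perm {l l' : List ℂ} (h : l.Perm l') : lin l = lin l' := (h.map _).prod_eq

lemma lin_append (l l' : List ℂ) : lin (l ++ l') = lin l * lin l' := by simp [lin]

lemma lin_ne_zero (l : List ℂ) : lin l ≠ 0 := by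
  refine List.prod_ne_zero fun h => ?_
  obtain ⟨b, _, hb⟩ := List.mem_map.1 h
  simpa using congrArg (eval 0) hb

lemma lin'_ne_zero (l : List ℂ) : lin' l ≠ 0 := by
  refine List.prod_ne_zero fun h => ?_
  obtain ⟨b, _, hb⟩ := List.mem_map.1 h
  exact X_sub_C_ne_zero b hb

/-- The polynomial identity behind an exchange relation. -/
lemma exchange_identity {P : Params} (hq : P.Generic) {s t : Sym}
    {den num den' num' lα lβ : List (ℤ × ℤ)} {τ : ℕ}
    (h : Sym.Exchange s t den num den' num' lα lβ τ) :
    lin (lα.map P.qv) * (C (qp P.lq (qz (P.symE s) (P.symE t))) * lin (num.map P.qv))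
        * lin' (den'.map P.qv)
      + C ((-1) ^ τ) * lin' (lβ.map P.qv)
        * (C (qp P.lq (qz (P.symE t) (P.symE s))) * lin' (num'.map P.qv)) * lin (den.map P.qv)
      = 0 := by
  obtain ⟨-, -, -, h1, h2, h3⟩ := h
  have h4 := lin_perm (h1.map P.qv)
  simp only [List.map_append, lin_append] at h4
  rw [P.qp_qz_symE hq.lq_ne, P.qp_qz_symE hq.lq_ne, lin'_eq, lin'_eq, lin'_eq]
  set A := lin (lα.map P.qv)
  set B := lin (num.map P.qv)
  set D := lin ((den'.map (-·)).map P.qv)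
  set A' := lin ((lβ.map (-·)).map P.qv)
  set B' := lin ((num'.map (-·)).map P.qv)
  set D' := lin (den.map P.qv)
  have h5 : P.qv (s.qe t.chg) * P.qv den'.sum = P.qv lβ.sum * P.qv (t.qe s.chg) * P.qv num'.sum := by
    rw [← qv_add, ← qv_add, ← qv_add, h3]
  have h6 : (-1 : ℂ) ^ (s.sg t.chg) * (-1) ^ den'.length
      + (-1) ^ τ * (-1) ^ lβ.length * (-1) ^ (t.sg s.chg) * (-1) ^ num'.length = 0 := by
    have hne : (-1 : ℂ) ≠ 0 := by norm_num
    simp only [← zpow_natCast, ← zpow_add₀ hne]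
    rcases Int.emod_two_eq_zero_or_one (s.sg t.chg + den'.length) with h7 | h7
    · have h8 : Odd ((τ : ℤ) + lβ.length + t.sg s.chg + num'.length) := by
        rw [Int.odd_iff]; omega
      rw [(Int.even_iff.2 h7).neg_one_zpow, h8.neg_one_zpow]; norm_num
    · have h8 : Even ((τ : ℤ) + lβ.length + t.sg s.chg + num'.length) := by
        rw [Int.even_iff]; omega
      rw [(Int.odd_iff.2 h7).neg_one_zpow, h8.neg_one_zpow]; norm_num
  have h5' := congrArg (C : ℂ → ℂ[X]) h5
  have h6' := congrArg (C : ℂ → ℂ[X]) h6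
  simp only [C_mul, C_add, C_0] at h5' h6' ⊢
  linear_combination (C (P.qv (s.qe t.chg)) * C (P.qv den'.sum) * C ((-1) ^ (s.sg t.chg))
      * C ((-1) ^ den'.length)) * h4
    - (A' * B' * D') * (C ((-1) ^ τ) * C ((-1) ^ lβ.length) * C ((-1) ^ (t.sg s.chg))
      * C ((-1) ^ num'.length)) * h5' + (A' * B' * D') * (C (P.qv (s.qe t.chg)) *
      C (P.qv den'.sum)) * h6'

lemma eval_lin (l : List ℂ) (x : ℂ) : eval x (lin l) = (l.map fun b => 1 - b * x).prod := by
  induction l with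
  | nil => simp
  | cons b l ih => rw [lin_cons, eval_mul, ih]; simp

lemma act_bounded_below {V : Type*} [AddCommGroup V] [Module ℂ V] (q : ℂ[X]) {φ : ℤ → V}
    (h : ∃ m, ∀ n < m, φ n = 0) : ∃ m, ∀ n < m, act q φ n = 0 := by
  obtain ⟨m, hm⟩ := h
  refine ⟨m, ?_⟩
  induction q using Polynomial.induction_on' with
  | add p q hp hq => intro n hn; rw [act_add, Pi.add_apply, hp n hn, hq n hn, add_zero]
  | monomial k c =>
    induction k generalizing c with
    | zero => intro n hn; rw [monomial_zero_left, act_C, Pi.smul_apply, hm n hn, smul_zero]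
    | succ k ih =>
      intro n hn
      rw [← monomial_mul_X, mul_comm, act_mul, act_X]
      exact ih c _ (by omega)

lemma act_bounded_above {V : Type*} [AddCommGroup V] [Module ℂ V] (q : ℂ[X]) {φ : ℤ → V}
    (h : ∃ m, ∀ n > m, φ n = 0) : ∃ m, ∀ n > m, act q φ n = 0 := by
  obtain ⟨m, hm⟩ := h
  induction q using Polynomial.induction_on' with
  | add p q hp hq =>
    obtain ⟨m1, h1⟩ := hp
    obtain ⟨m2, h2⟩ := hq
    exact ⟨max m1 m2, fun n hn => by
      rw [act_add, Pi.add_apply, h1 n (by omega), h2 n (by omega), add_zero]⟩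
  | monomial k c =>
    refine ⟨m + k, ?_⟩
    induction k with
    | zero => intro n hn; rw [monomial_zero_left, act_C, Pi.smul_apply, hm n (by simpa using hn),
        smul_zero]
    | succ k ih =>
      intro n hn
      rw [← monomial_mul_X, mul_comm, act_mul, act_X]
      exact ih _ (by push_cast at hn; omega)

lemma shiftE_add (β : ℂ) (e f : Expo) : P.shiftE β (e + f) = P.shiftE β e + P.shiftE β f := by
  refine Prod.ext ?_ (Prod.ext rfl ?_)
  · funext t n; simp [shiftE, mul_add]
  · funext t
    simp only [shiftE, Prod.snd_add, Pi.add_apply, Prod.fst_add]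
    rcases t with i | g <;> simp
    ring

lemma shiftE_piece (β : ℤ × ℤ) (a : Piece) :
    P.pieceE (Sym.pieceShift β a) = P.shiftE (P.val β) (P.pieceE a) := by
  have h1 : ∀ (x : ℂ) (n : ℤ), qp P.lq (-(x + P.val β) * n)
      = qp P.lq (-P.val β * n) * qp P.lq (-x * n) := fun x n => by
    rw [← qp_add]; congr 1; ring
  rcases a with ⟨g, x, κ⟩ | ⟨i, x⟩ | ⟨i, x⟩ | g
  · refine Prod.ext ?_ (Prod.ext rfl ?_)
    · funext t n
      simp only [Sym.pieceShift, pieceE, field, shiftE, Pi.single_apply]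
      split_ifs
      · beta_reduce
        split_ifs
        · simp
        · rw [val_add, h1]; ring
      · simp
    · funext t
      rcases t with i | g'
      · simp [Sym.pieceShift, pieceE, field, shiftE, Pi.single_apply]
      · by_cases h : g' = g <;>
          simp [Sym.pieceShift, pieceE, field, shiftE, Pi.single_apply, val_add, h]
  · refine Prod.ext ?_ (Prod.ext rfl ?_)
    · funext t n
      simp only [Sym.pieceShift, pieceE, fplus, shiftE, Pi.single_apply]
      split_ifs
      · beta_reduce
        split_ifs
        · rw [val_add, ← add_assoc, h1]; ring
        · simp
      · simp
    · funext t
      rcases t with i | g' <;> simp [Sym.pieceShift, pieceE, fplus, shiftE]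
  · refine Prod.ext ?_ (Prod.ext rfl ?_)
    · funext t n
      simp only [Sym.pieceShift, pieceE, fminus, shiftE, Pi.single_apply]
      split_ifs
      · beta_reduce
        split_ifs
        · rw [val_add, ← add_assoc, h1]; ring
        · simp
      · simp
    · funext t
      rcases t with i | g' <;> simp [Sym.pieceShift, pieceE, fminus, shiftE]
  · refine Prod.ext ?_ (Prod.ext rfl ?_)
    · funext t n; simp [Sym.pieceShift, pieceE, phE, shiftE]
    · funext t
      rcases t with i | g' <;> simp [Sym.pieceShift, pieceE, phE, shiftE]

lemma symE_shift (β : ℤ × ℤ) (s : Sym) : P.symE (s.shift β) = P.shiftE (P.val β) (P.symE s) := by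
  have := P.map_symE (AddMonoidHom.mk' (P.shiftE (P.val β)) (P.shiftE_add _)) s
  refine Eq.trans ?_ this.symm
  rw [symE, Sym.shift, List.map_map]
  congr 1
  refine List.map_congr_left fun a _ => ?_
  rw [Function.comp, shiftE_piece]
  rfl

variable {P}

/-- A regular exchange relation. -/
lemma exchange_regular (hq : P.Generic) {s t : Sym} {lα lβ : List (ℤ × ℤ)} {τ : ℕ}
    (h : Sym.Regular s t lα lβ τ) (p : Idx) (L : ℤ) :
    act (lin (lα.map P.qv)) (P.prodSeq (P.symE s) (P.symE t) p L)
      + act (C ((-1) ^ τ) * lin' (lβ.map P.qv)) (P.swapSeq (P.symE s) (P.symE t) p L) = 0 := by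
  obtain ⟨h, h1, h2⟩ := h
  refine exchange_seq (P.prodSeq_rational _ _ p L (lin_mul_expSeries hq h.1))
    (P.swapSeq_rational _ _ p L (lin_mul_expSeries hq h.2.1) ?_) ?_ ?_ (lin_ne_zero _)
    (lin'_ne_zero _) (exchange_identity hq h)
  · rw [zp_symE, h.2.2.1, List.length_map, List.length_map]
  · rcases h1 with h1 | h1 <;> rw [h1]
    exact one_dvd _
  · rcases h2 with h2 | h2 <;> rw [h2]
    · exact one_dvd _
    · exact dvd_mul_left _ _

/-- An exchange relation with a delta function at `z = q ^ a w`. -/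
lemma exchange_delta (hq : P.Generic) {s t : Sym} {num num' lα lβ : List (ℤ × ℤ)} {a : ℤ × ℤ}
    {τ : ℕ} (h : Sym.Exchange s t (a :: lα) num (-a :: lβ) num' lα lβ τ) (p : Idx) (L N : ℤ) :
    act (lin (lα.map P.qv)) (P.prodSeq (P.symE s) (P.symE t) p L) N
      + act (C ((-1) ^ τ) * lin' (lβ.map P.qv)) (P.swapSeq (P.symE s) (P.symE t) p L) N
    = (P.qv a ^ N * (P.qv (s.qe t.chg) * (-1) ^ (s.sg t.chg)
        * (num.map fun n => 1 - P.qv (n - a)).prod) * qp P.lq (-P.val a * (L - s.zl t.chg : ℤ))) •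
      P.vertex (P.symE (s.shift a ++ t)) (L - s.zl t.chg) (ket p) := by
  have hP := P.prodSeq_rational _ _ p L (lin_mul_expSeries hq h.1)
  have hS := P.swapSeq_rational _ _ p L (lin_mul_expSeries hq h.2.1)
    (by rw [zp_symE, h.2.2.1, List.length_map, List.length_map])
  have hid := exchange_identity hq h
  set e := P.symE s
  set f := P.symE t
  have hb := P.qv_ne_zero a
  set Q := C (qp P.lq (qz e f)) * lin (num.map P.qv)
  set Q' := C (qp P.lq (qz f e)) * lin' (num'.map P.qv)
  rw [List.map_cons, lin_cons, act_mul] at hP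
  rw [List.map_cons, lin'_cons, act_mul, qv_neg] at hS
  simp only [List.map_cons, lin_cons, lin'_cons, qv_neg] at hid
  set b := P.qv a
  set A := lin (lα.map P.qv)
  set B := lin' (lβ.map P.qv)
  have hX : (X - C b⁻¹ : ℂ[X]) = C (-b⁻¹) * (1 - C b * X) := by
    rw [mul_sub, mul_one, ← mul_assoc, ← C_mul, neg_mul, inv_mul_cancel₀ hb]
    simp
    ring
  have hne : ((1 - C b * X) * (A * B) : ℂ[X]) ≠ 0 := by
    refine mul_ne_zero (fun h0 => ?_) (mul_ne_zero (lin_ne_zero _) (lin'_ne_zero _))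
    simpa using congrArg (eval 0) h0
  have hQ : C ((-1) ^ τ) * Q' = C b⁻¹ * Q := by
    refine mul_left_cancel₀ hne ?_
    rw [hX] at hid
    simp only [C_neg] at hid
    linear_combination hid
  have hS' : act (1 - C b * X) (act (C (-(-1) ^ τ) * B) (P.swapSeq e f p L))
      = act Q (P.normalSeq e f p L) := by
    rw [← act_mul, show (1 - C b * X) * (C (-(-1) ^ τ) * B)
        = (C b * C ((-1) ^ τ)) * ((X - C b⁻¹) * B) by
      rw [hX]
      simp only [C_neg]
      have h1 : (C b * C b⁻¹ : ℂ[X]) = 1 := by rw [← C_mul, mul_inv_cancel₀ hb, C_1]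
      linear_combination ((1 - C b * X) * C ((-1) ^ τ) * B) * h1, act_mul, act_mul _ B, hS,
      ← act_mul, mul_assoc, hQ, ← mul_assoc, ← C_mul, mul_inv_cancel₀ hb, C_1, one_mul]
  have key := delta_seq hb hP hS' ((P.normalSeq_fin e f p L).act Q) ?_ ?_ N
  · rw [C_neg, neg_mul, ← zero_sub, act_sub, act_zero, zero_sub, Pi.neg_apply, sub_neg_eq_add] at key
    rw [key, evalSeq_act hb (P.normalSeq_fin e f p L), show b = qp P.lq (P.val a) from rfl,
      evalSeq_normalSeq, smul_smul, smul_smul, symE_append, symE_shift, zp_symE]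
    congr 3
    rw [← show b = qp P.lq (P.val a) from rfl, eval_mul, eval_C, P.qp_qz_symE hq.lq_ne]
    congr 1
    rw [eval_lin, List.map_map]
    congr 1
    refine List.map_congr_left fun n _ => ?_
    rw [Function.comp, sub_eq_add_neg n, qv_add, qv_neg]
  · obtain ⟨m, hm⟩ := P.prodSeq_bounded e f p L
    exact act_bounded_below A ⟨m, hm⟩
  · exact act_bounded_above _ (P.swapSeq_bounded e f p L)

end Params

/-! ### Equality of vertex operators and the terms of the currents -/

/-- Linearly independent constituents of the elementary exponents: the positive and the negative
modes `∑_{n > 0} q ^ (-y n) g_n z ^ (-n) / [n]`, `∑_{n < 0} q ^ (-y n) g_n z ^ (-n) / [n]` (up to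
sign), the charge, and the zero modes. -/
inductive Atom where
  | pos (g : Gh) (y : ℤ × ℤ)
  | neg (g : Gh) (y : ℤ × ℤ)
  | chg (g : Gh)
  | z1 (g : Gh)
  | zk (g : Gh)
  | ap (i : Fin 2) (x : ℤ × ℤ)
  | am (i : Fin 2) (x : ℤ × ℤ)
  | ph (g : Gh)
deriving DecidableEq

namespace Sym

/-- The decomposition of an elementary exponent into atoms. -/
def pieceAtoms : Piece → List (ℤ × Atom)
  | .fld g x κ => [(1, .pos g (x + (κ, 0))), (1, .neg g (x - (κ, 0))), (1, .chg g), (x.1, .z1 g),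
      (x.2, .zk g)]
  | .ap i x => [(1, .ap i x)]
  | .am i x => [(1, .am i x)]
  | .ph g => [(1, .ph g)]

/-- The decomposition of a symbolic exponent into atoms. -/
def atoms (s : Sym) : List (ℤ × Atom) :=
  s.flatMap fun a => (pieceAtoms a.2).map fun b => (a.1 * b.1, b.2)

/-- Phases with even multiplicities, chosen to cancel those of `s` if these are even. -/
def evenPhase (s : Sym) : Sym :=
  [Gh.b12, .b13, .b23, .c].map fun g => (2 * (-(net s.atoms (.ph g)) / 2), .ph g)

/-- The vertex operators of `s` and `t` coincide: the exponents agree up to even multiples of the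
phases `√-1 π g_0`. -/
def SameOp (s t : Sym) : Prop := Balanced (atoms (s ++ t.neg ++ evenPhase (s ++ t.neg)))

instance (s t : Sym) : Decidable (SameOp s t) := inferInstanceAs (Decidable (Balanced _))

end Sym

namespace Params

open Finset

variable (P : Params)

/-- The exponent denoted by an atom. -/
def atomE : Atom → Expo
  | .pos g y => (Pi.single (.inr g) fun n =>
      if 0 < n then -(qp P.lq (-P.val y * n) / qnum P.lq n) else 0, 0, 0)
  | .neg g y => (Pi.single (.inr g) fun n =>
      if n < 0 then -(qp P.lq (-P.val y * n) / qnum P.lq n) else 0, 0, 0)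
  | .chg g => (0, Pi.single g 1, 0)
  | .z1 g => (0, 0, Pi.single (.inr g) 1)
  | .zk g => (0, 0, Pi.single (.inr g) P.k)
  | .ap i x => P.pieceE (.ap i x)
  | .am i x => P.pieceE (.am i x)
  | .ph g => P.pieceE (.ph g)

lemma pieceE_eq_atoms (a : Piece) :
    P.pieceE a = ((Sym.pieceAtoms a).map fun b => b.1 • P.atomE b.2).sum := by
  rcases a with ⟨g, x, κ⟩ | ⟨i, x⟩ | ⟨i, x⟩ | g
  · simp only [Sym.pieceAtoms, List.map_cons, List.map_nil, List.sum_cons, List.sum_nil, one_smul,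
      add_zero]
    refine Prod.ext ?_ (Prod.ext ?_ ?_)
    · funext t n
      simp only [pieceE, field, atomE, Prod.fst_add, Pi.add_apply, Prod.smul_fst, smul_zero,
        add_zero, Pi.single_apply]
      split_ifs with h
      · beta_reduce
        rcases lt_trichotomy n 0 with hn | hn | hn
        · rw [if_neg hn.ne, if_neg hn.le.not_gt, if_pos hn, abs_of_neg hn, val_sub, zero_add,
            ← qp_add, show P.val (κ, 0) = κ by simp [val]]
          push_cast
          congr 4
          ring
        · simp [hn]
        · rw [if_neg hn.ne', if_neg hn.le.not_gt, if_pos hn, abs_of_pos hn, val_add, add_zero,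
            ← qp_add, show P.val (κ, 0) = κ by simp [val]]
          congr 4
          ring
      · simp
    · simp [pieceE, field, atomE]
    · funext t
      simp only [pieceE, field, atomE, Prod.snd_add, Pi.add_apply, Prod.smul_snd, Pi.zero_apply,
        zero_add, Pi.single_apply, Pi.smul_apply]
      split_ifs <;> simp [val]
  all_goals simp [Sym.pieceAtoms, atomE]

lemma symE_eq_atoms (s : Sym) : P.symE s = (s.atoms.map fun b => b.1 • P.atomE b.2).sum := by
  rw [symE, Sym.atoms, List.map_flatMap, List.flatMap_def, List.sum_flatten, List.map_map]
  congr 1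
  refine List.map_congr_left fun a _ => ?_
  simp only [Function.comp]
  rw [pieceE_eq_atoms, List.smul_sum, List.map_map, List.map_map]
  congr 1
  exact List.map_congr_left fun b _ => by simp only [Function.comp, smul_smul]

lemma phE_add (v w : Gh → ℤ) : P.phE (v + w) = P.phE v + P.phE w := by
  refine Prod.ext (by simp [phE]) (Prod.ext (by simp [phE]) ?_)
  funext t
  rcases t with i | g <;> simp [phE]
  ring

lemma phE_neg (w : Gh → ℤ) : P.phE (-w) = -P.phE w := by
  refine Prod.ext (by simp [phE]) (Prod.ext (by simp [phE]) ?_)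
  funext t
  rcases t with i | g <;> simp [phE]

lemma symE_neg (s : Sym) : P.symE s.neg = -P.symE s := by
  rw [symE, symE, Sym.neg, List.map_map, ← list_sum_map_neg]
  congr 1
  exact List.map_congr_left fun a _ => by simp [Function.comp]

lemma zq_phE (h : P.lq ≠ 0) (e : Expo) (w lam : Gh → ℤ) : P.zq (e + P.phE w) lam
    = P.zq e lam * Complex.exp (Complex.I * Real.pi * ∑ g, w g * P.zm (.inr g) lam) := by
  have : ∀ x y : ℂ, qp P.lq (x + y) = qp P.lq x * Complex.exp (P.lq * y) := fun x y => qp_add _ _ _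
  simp only [zq, Prod.snd_add, Pi.add_apply, add_mul, Finset.sum_add_distrib, this, phE,
    Fintype.sum_sum_type, Sum.elim_inl, Sum.elim_inr, zero_mul, Finset.sum_const_zero, zero_add]
  congr 2
  rw [Finset.mul_sum, Finset.mul_sum]
  refine Finset.sum_congr rfl fun g _ => ?_
  field_simp

lemma vertex_congr {e f : Expo} (h1 : ∀ t n, n ≠ 0 → e.1 t n = f.1 t n) (h2 : e.2.1 = f.2.1)
    (h3 : ∀ lam, P.zq e lam = P.zq f lam) (N : ℤ) : P.vertex e N = P.vertex f N := by
  refine op_ext fun p => ?_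
  have hp := ket_mem_grade p
  have hcre : ∀ m, P.creCoeff e m = P.creCoeff f m := fun m => by
    rw [creCoeff_eq, creCoeff_eq]
    congr 1
    funext n
    refine expCoeff_congr (fun m hm => ?_) n
    exact Finset.sum_congr rfl fun t _ => by rw [h1 t _ (by omega)]
  have hann : ∀ m, P.annCoeff e m = P.annCoeff f m := fun m => by
    rw [annCoeff_eq, annCoeff_eq]
    refine expCoeff_congr (fun m hm => ?_) m
    exact Finset.sum_congr rfl fun t _ => by rw [h1 t _ (by omega)]
  rw [P.vertex_apply e N hp (K := deg p + 1) (by omega),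
    P.vertex_apply f N hp (K := deg p + 1) (by omega), h3, zl, zl]
  simp only [hcre, hann, h2]

/-- The phase operators are absorbed into the zero modes of vertex operators. -/
lemma vertex_mul_phase (h : P.lq ≠ 0) (e : Expo) (w : Gh → ℤ) (N : ℤ) :
    P.vertex e N * P.phase w = P.vertex (e + P.phE w) N := by
  refine op_ext fun p => ?_
  have hp := ket_mem_grade p
  have h1 : (e + P.phE w).1 = e.1 := by simp [phE]
  have h2 : (e + P.phE w).2.1 = e.2.1 := by simp [phE]
  have hcre : ∀ m, P.creCoeff (e + P.phE w) m = P.creCoeff e m := fun m => by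
    rw [creCoeff_eq, creCoeff_eq]; unfold creA; rw [h1]
  have hann : ∀ m, P.annCoeff (e + P.phE w) m = P.annCoeff e m := fun m => by
    rw [annCoeff_eq, annCoeff_eq]; unfold annA; rw [h1]
  rw [Module.End.mul_apply, phase, diag_ket, map_smul,
    P.vertex_apply e N hp (K := deg p + 1) (by omega),
    P.vertex_apply _ N hp (K := deg p + 1) (by omega), P.zq_phE h, smul_smul, mul_comm (P.zq _ _)]
  simp only [hcre, hann, zl, h2]

lemma symE_evenPhase (s : Sym) : ∃ w, P.symE s.evenPhase = P.phE (2 • w) := by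
  refine ⟨fun g => -(net s.atoms (.ph g)) / 2, ?_⟩
  refine Prod.ext (by simp [symE, Sym.evenPhase, pieceE, phE])
    (Prod.ext (by simp [symE, Sym.evenPhase, pieceE, phE]) ?_)
  funext t
  rcases t with i | g
  · simp [symE, Sym.evenPhase, pieceE, phE]
  · cases g <;> simp [symE, Sym.evenPhase, pieceE, phE, Pi.single_apply]

lemma vertex_add_phE_even (h : P.lq ≠ 0) (e : Expo) (w : Gh → ℤ) (N : ℤ) :
    P.vertex (e + P.phE (2 • w)) N = P.vertex e N := by
  refine P.vertex_congr (fun t n _ => by simp [phE]) (by simp [phE]) (fun lam => ?_) N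
  rw [P.zq_phE h]
  have : Complex.I * Real.pi * ∑ g, ((2 • w) g : ℤ) * P.zm (.inr g) lam
      = (∑ g, w g * (g.sgn * lam g) : ℤ) * (2 * Real.pi * Complex.I) := by
    push_cast
    rw [Finset.mul_sum, Finset.sum_mul]
    refine Finset.sum_congr rfl fun g _ => ?_
    simp [zm]
    ring
  rw [this, Complex.exp_int_mul_two_pi_mul_I, mul_one]

/-- Vertex operators whose exponents agree up to phases `e ^ (2 π √-1 g_0 m)` coincide, since the
eigenvalues of the ghost zero modes `g_0` are integers. -/
lemma vertex_sameOp (h : P.lq ≠ 0) {s t : Sym} (hst : Sym.SameOp s t) (N : ℤ) :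
    P.vertex (P.symE s) N = P.vertex (P.symE t) N := by
  have h1 := Balanced.sum_eq_zero hst P.atomE
  rw [← symE_eq_atoms, symE_append, symE_append, symE_neg] at h1
  obtain ⟨w, hw⟩ := P.symE_evenPhase (s ++ t.neg)
  rw [hw] at h1
  rw [show P.symE t = P.symE s + P.phE (2 • w) by
    rw [← sub_eq_zero, ← neg_eq_zero, ← h1]; abel, P.vertex_add_phE_even h]

end Params

/-- A term of a current: the coefficient `m q ^ x / (q - q⁻¹) ^ r`, the exponent, and the
shift `off` between the power of `z` and minus the mode number. -/
structure Term where
  m : ℤ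
  x : ℤ × ℤ
  r : ℕ
  sym : Sym
  off : ℤ

namespace Term

open Piece

/-- First term of `X^{+,1}(z)`. -/
def p1a : Term :=
  ⟨-1, 0, 1, [(-1, fld .b12 0 (-1)), (-1, fld .c (1, 0) 0), (1, ph .c), (1, ph .b12)], 0⟩

/-- Second term of `X^{+,1}(z)`. -/
def p1b : Term :=
  ⟨1, 0, 1, [(-1, fld .b12 0 (-1)), (-1, fld .c (-1, 0) 0), (1, ph .c), (1, ph .b12)], 0⟩

/-- First term of `X^{+,2}(z)`. -/
def p2a : Term :=
  ⟨-1, 0, 0, [(-1, fld .b12 (1, 0) 1), (1, fld .b12 0 0), (-1, fld .b13 (1, 0) 1),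
    (1, fld .b13 0 0), (1, fld .b23 (1, 0) 0), (1, ph .c), (1, ph .b12), (1, ph .b13),
    (1, ph .b23)], -1⟩

/-- Second term of `X^{+,2}(z)`. -/
def p2b : Term := ⟨1, 0, 0, [(1, fld .b12 0 0), (1, fld .b13 0 0), (1, fld .c 0 0)], -1⟩

/-- First term of `X^{-,1}(z)`. -/
def m1a : Term :=
  ⟨1, 0, 1, [(1, ap 0 0), (1, fld .b12 (2, 1) 1), (1, fld .b13 (2, 1) 1),
    (-1, fld .b13 (1, 1) 0), (-1, fld .b23 (1, 1) 1), (1, fld .b23 (0, 1) 0),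
    (1, fld .c (1, 1) 0), (-1, ph .c), (-1, ph .b12)], 0⟩

/-- Second term of `X^{-,1}(z)`. -/
def m1b : Term :=
  ⟨-1, 0, 1, [(1, am 0 0), (1, fld .b12 (-2, -1) 1), (1, fld .b13 (-2, -1) 1),
    (-1, fld .b13 (-1, -1) 0), (-1, fld .b23 (-1, -1) 1), (1, fld .b23 (0, -1) 0),
    (1, fld .c (-1, -1) 0), (-1, ph .c), (-1, ph .b12)], 0⟩

/-- Third term of `X^{-,1}(z)`. -/
def m1c : Term :=
  ⟨1, (1, 1), 0, [(1, ap 0 0), (-1, fld .b13 (1, 1) 0), (1, fld .b23 (1, 1) (-1)),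
    (1, ph .b13), (1, ph .b23)], -1⟩

/-- First term of `X^{-,2}(z)`. -/
def m2a : Term :=
  ⟨1, (1, 0), 1, [(1, ap 1 0), (-1, fld .b23 (1, 1) 0), (-1, ph .c), (-1, ph .b12),
    (-1, ph .b13), (-1, ph .b23)], 0⟩

/-- Second term of `X^{-,2}(z)`. -/
def m2b : Term :=
  ⟨-1, (1, 0), 1, [(1, am 1 0), (-1, fld .b23 (-1, -1) 0), (-1, ph .c), (-1, ph .b12),
    (-1, ph .b13), (-1, ph .b23)], 0⟩

/-- Third term of `X^{-,2}(z)`. -/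
def m2c : Term :=
  ⟨-1, 0, 1, [(1, am 1 0), (-1, fld .b12 (-1, -1) 1), (-1, fld .b13 (-1, -1) 1),
    (-1, fld .c (0, -1) 0)], 0⟩

/-- Fourth term of `X^{-,2}(z)`. -/
def m2d : Term :=
  ⟨1, 0, 1, [(1, am 1 0), (-1, fld .b12 (-1, -1) 1), (-1, fld .b13 (-1, -1) 1),
    (-1, fld .c (-2, -1) 0)], 0⟩

end Term

/-- The terms of the currents `X^{±,i}(z)`. -/
def terms : PM → Fin 2 → List Term
  | .plus, 0 => [.p1a, .p1b]
  | .plus, 1 => [.p2a, .p2b]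
  | .minus, 0 => [.m1a, .m1b, .m1c]
  | .minus, 1 => [.m2a, .m2b, .m2c, .m2d]

namespace Params

variable (P : Params)

/-- The coefficient of a term. -/
def coef (T : Term) : ℂ := T.m * P.qv T.x * P.iq ^ T.r

/-- The coefficient of `z ^ N` in a term, counted such that `X_n` involves `N = -n`. -/
def term (T : Term) (N : ℤ) : Module.End ℂ Fock := P.coef T • P.vertex (P.symE T.sym) (N + T.off)

/-- `g_+` is a difference of two fields `g(·; κ)`. -/
lemma fplus_gh {P : Params} (hq : P.Generic) (g : Gh) (y y' : ℂ) (hy : y = y' + 1) :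
    P.fplus (.inr g) y = P.field g y 1 - P.field g y' 0 := by
  refine Prod.ext ?_ (Prod.ext (by simp [fplus, field]) ?_)
  · funext t n
    simp only [fplus, field, Prod.fst_sub, Pi.sub_apply, Pi.single_apply]
    split_ifs with h
    · beta_reduce
      have hden := hq.den_ne
      rcases eq_or_ne n 0 with rfl | hn
      · simp
      have hqn := hq.sub_ne hn
      rw [if_neg hn, if_neg hn, hy, neg_zero, zero_mul, qp_zero, one_mul, qnum]
      have e1 : qp P.lq (-(y' + 1) * n) = qp P.lq (-y' * n) * qp P.lq (-n) := by
        rw [← qp_add]; congr 1; ring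
      rcases lt_or_gt_of_ne hn with h0 | h0
      · rw [if_neg h0.le.not_gt, abs_of_neg h0, e1]
        have e2 : qp P.lq (-1 * ((-n : ℤ) : ℂ)) * qp P.lq (-n) = 1 := by
          rw [← qp_add]; push_cast; simp
        rw [← mul_assoc, mul_comm (qp P.lq _) (qp P.lq (-y' * n)), mul_assoc, e2, mul_one]
        ring
      · rw [if_pos h0, abs_of_pos h0, e1]
        have e2 : qp P.lq n * qp P.lq (-n) = 1 := by rw [← qp_add]; simp
        rw [neg_one_mul]
        generalize qp P.lq (-y' * n) = A
        generalize qp P.lq (-n) = B at *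
        field_simp
        linear_combination A * e2
    · simp
  · funext t
    simp only [fplus, field, Prod.snd_sub, Pi.sub_apply, Pi.single_apply]
    split_ifs <;> simp [hy]

/-- `g_-` is a difference of two fields `g(·; κ)`. -/
lemma fminus_gh {P : Params} (hq : P.Generic) (g : Gh) (y y' : ℂ) (hy : y' = y + 1) :
    P.fminus (.inr g) y = P.field g y 1 - P.field g y' 0 := by
  refine Prod.ext ?_ (Prod.ext (by simp [fminus, field]) ?_)
  · funext t n
    simp only [fminus, field, Prod.fst_sub, Pi.sub_apply, Pi.single_apply]
    split_ifs with h
    · beta_reduce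
      have hden := hq.den_ne
      rcases eq_or_ne n 0 with rfl | hn
      · simp
      have hqn := hq.sub_ne hn
      rw [if_neg hn, if_neg hn, hy, neg_zero, zero_mul, qp_zero, one_mul, qnum]
      have e1 : qp P.lq (-(y + 1) * n) = qp P.lq (-y * n) * qp P.lq (-n) := by
        rw [← qp_add]; congr 1; ring
      rcases lt_or_gt_of_ne hn with h0 | h0
      · rw [if_pos h0, abs_of_neg h0, e1]
        have e2 : qp P.lq (-1 * ((-n : ℤ) : ℂ)) = qp P.lq n := by
          push_cast; simp
        rw [e2]
        field_simp
        ring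
      · rw [if_neg h0.le.not_gt, abs_of_pos h0, e1, neg_one_mul]
        field_simp
        ring
    · simp
  · funext t
    simp only [fminus, field, Prod.snd_sub, Pi.sub_apply, Pi.single_apply]
    split_ifs <;> simp [hy]

/-- The currents in terms of symbolic vertex operators. -/
lemma current_eq {P : Params} (hq : P.Generic) (e : PM) (i : Fin 2) (n : ℤ) :
    P.current e i n = ((terms e i).map fun T => P.term T (-n)).sum := by
  have v00 : P.val 0 = 0 := by simp
  have v10 : P.val (1, 0) = 1 := by simp [val]
  have w10 : P.val (-1, 0) = -1 := by simp [val]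
  have v21 : P.val (2, 1) = P.k + 2 := by simp [val]; ring
  have v11 : P.val (1, 1) = P.k + 1 := by simp [val]; ring
  have v01 : P.val (0, 1) = P.k := by simp [val]
  have w21 : P.val (-2, -1) = -P.k - 2 := by simp [val]; ring
  have w11 : P.val (-1, -1) = -P.k - 1 := by simp [val]; ring
  have w01 : P.val (0, -1) = -P.k := by simp [val]
  have a1 : ∀ g, P.fplus (.inr g) 1 = P.field g 1 1 - P.field g 0 0 :=
    fun g => fplus_gh hq g _ _ (by ring)
  have a2 : ∀ g, P.fplus (.inr g) (P.k + 2) = P.field g (P.k + 2) 1 - P.field g (P.k + 1) 0 :=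
    fun g => fplus_gh hq g _ _ (by ring)
  have a3 : ∀ g, P.fplus (.inr g) (P.k + 1) = P.field g (P.k + 1) 1 - P.field g P.k 0 :=
    fun g => fplus_gh hq g _ _ (by ring)
  have a4 : ∀ g, P.fminus (.inr g) (-P.k - 2) = P.field g (-P.k - 2) 1 - P.field g (-P.k - 1) 0 :=
    fun g => fminus_gh hq g _ _ (by ring)
  have a5 : ∀ g, P.fminus (.inr g) (-P.k - 1) = P.field g (-P.k - 1) 1 - P.field g (-P.k) 0 :=
    fun g => fminus_gh hq g _ _ (by ring)
  have h := hq.lq_ne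
  have hqv : P.qv (1, 1) = qp P.lq (P.k + 1) := by rw [qv, v11]
  have hqv' : P.qv (1, 0) = qp P.lq 1 := by rw [qv, v10]
  cases e <;> fin_cases i
  all_goals
    simp only [current, terms, Term.p1a, Term.p1b, Term.p2a, Term.p2b, Term.m1a, Term.m1b,
      Term.m1c, Term.m2a, Term.m2b, Term.m2c, Term.m2d, List.map_cons, List.map_nil, List.sum_cons, List.sum_nil, term,
      coef, symE, pieceE, v00, v10, w10, v21, v11, v01, w21, w11, w01, add_zero,
      Fin.isValue, sub_mul, P.vertex_mul_phase h, phE_add, phE_neg, a1, a2, a3, a4, a5,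
      one_smul, neg_smul, qv_zero, hqv, hqv', pow_one, pow_zero, mul_one, Int.cast_one,
      Int.cast_neg, one_mul, Int.cast_zero]
  all_goals
    simp only [sub_eq_add_neg, neg_add, neg_neg, add_assoc]
  all_goals module

end Params

/-! ### Quadratic relations between the currents -/

/-- Sequences of operators, indexed by powers of `z`. -/
abbrev OpSeq := ℤ → Module.End ℂ Fock

/-- The coefficient of `z ^ M w ^ N` in `A(z) B(w) + σ B(w) A(z)`. -/
def brHom (σ : ℂ) (M N : ℤ) : OpSeq →+ OpSeq →+ Module.End ℂ Fock :=
  AddMonoidHom.mk' (fun A => AddMonoidHom.mk' (fun B => A M * B N + σ • (B N * A M))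
    fun B B' => by simp only [Pi.add_apply, mul_add, add_mul, smul_add]; abel)
    fun A A' => by
      ext1 B
      simp only [AddMonoidHom.mk'_apply, AddMonoidHom.add_apply, Pi.add_apply, mul_add, add_mul,
        smul_add]
      abel

lemma brHom_apply (σ : ℂ) (M N : ℤ) (A B : OpSeq) :
    brHom σ M N A B = A M * B N + σ • (B N * A M) := rfl

/-- The coefficient of `z ^ (M + 1) w ^ N` in `(z - ξ w) A(z) B(w) + (w - ξ z) B(w) A(z)`. -/
def quadHom (ξ : ℂ) (M N : ℤ) : OpSeq →+ OpSeq →+ Module.End ℂ Fock :=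
  AddMonoidHom.mk' (fun A => AddMonoidHom.mk'
    (fun B => A M * B N - ξ • (A (M + 1) * B (N - 1)) + (B (N - 1) * A (M + 1) - ξ • (B N * A M)))
    fun B B' => by simp only [Pi.add_apply, mul_add, add_mul, smul_add]; abel)
    fun A A' => by
      ext1 B
      simp only [AddMonoidHom.mk'_apply, AddMonoidHom.add_apply, Pi.add_apply, mul_add, add_mul,
        smul_add]
      abel

lemma quadHom_apply (ξ : ℂ) (M N : ℤ) (A B : OpSeq) : quadHom ξ M N A B
    = A M * B N - ξ • (A (M + 1) * B (N - 1)) + (B (N - 1) * A (M + 1) - ξ • (B N * A M)) := rfl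

lemma list_sum_apply₂ {A B G ι κ : Type*} [AddCommGroup A] [AddCommGroup B] [AddCommGroup G]
    (F : A →+ B →+ G) (f : ι → A) (g : κ → B) (l : List ι) (l' : List κ) :
    F (l.map f).sum (l'.map g).sum = (l.map fun x => (l'.map fun y => F (f x) (g y)).sum).sum := by
  induction l with
  | nil => simp
  | cons a l ih =>
    rw [List.map_cons, List.sum_cons, map_add, AddMonoidHom.add_apply, ih, List.map_cons,
      List.sum_cons, map_list_sum, List.map_map]
    rfl

namespace Params

open Finset Polynomial

variable (P : Params)

/-- The vertex operator of a symbolic exponent. -/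
def vop (s : Sym) : OpSeq := fun N => P.vertex (P.symE s) N

/-- The current `X^{±,i}(z)`, indexed such that `X_n` is the entry at `-n`. -/
def cur (e : PM) (i : Fin 2) : OpSeq := ((terms e i).map P.term).sum

lemma cur_apply {P : Params} (hq : P.Generic) (e : PM) (i : Fin 2) (N : ℤ) :
    P.cur e i N = P.current e i (-N) := by
  rw [current_eq hq, neg_neg, cur]
  have : ∀ l : List Term, (l.map P.term).sum N = (l.map fun T => P.term T N).sum := fun l => by
    induction l with
    | nil => rfl
    | cons a l ih => simp only [List.map_cons, List.sum_cons, Pi.add_apply, ih]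
  exact this _

lemma current_eq_cur {P : Params} (hq : P.Generic) (e : PM) (i : Fin 2) (n : ℤ) :
    P.current e i n = P.cur e i (-n) := by rw [cur_apply hq, neg_neg]

/-- The coefficient of the delta function in an exchange relation. -/
def dcoef (s t : Sym) (num : List (ℤ × ℤ)) (a : ℤ × ℤ) (M : ℤ) : ℂ :=
  P.qv (s.qe t.chg) * (-1) ^ (s.sg t.chg) * (num.map fun n => 1 - P.qv (n - a)).prod
    * P.qv a ^ (s.zl t.chg - M)

variable {P}

lemma dcoef_eq (s t : Sym) (num : List (ℤ × ℤ)) (a : ℤ × ℤ) (M N : ℤ) :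
    P.qv a ^ N * (P.qv (s.qe t.chg) * (-1) ^ (s.sg t.chg)
        * (num.map fun n => 1 - P.qv (n - a)).prod)
        * qp P.lq (-P.val a * (M + N - s.zl t.chg : ℤ)) = P.dcoef s t num a M := by
  rw [dcoef, qp_mul_int, qp_neg, inv_zpow, ← zpow_neg, ← qv,
    show s.zl t.chg - M = N + -(M + N - s.zl t.chg) by ring, zpow_add₀ (P.qv_ne_zero a)]
  ring

/-- The bracket of two vertex operators whose products have no poles. -/
lemma brHom_regular (hq : P.Generic) {s t : Sym} {τ : ℕ} (h : Sym.Regular s t [] [] τ)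
    (M N : ℤ) : brHom ((-1) ^ τ) M N (P.vop s) (P.vop t) = 0 := by
  refine op_ext fun p => ?_
  have := congrFun (exchange_regular hq h p (M + N)) N
  simp only [List.map_nil, lin_nil, lin'_nil, act_one, mul_one, act_C, Pi.add_apply, Pi.smul_apply,
    prodSeq, swapSeq, add_sub_cancel_right, Pi.zero_apply] at this
  simpa [brHom_apply, vop] using this

/-- The bracket of two vertex operators whose product has one pole, at `z = q ^ a w`: a delta function
times the fused vertex operator. -/
lemma brHom_delta (hq : P.Generic) {s t : Sym} {τ : ℕ} {num num' : List (ℤ × ℤ)} {a : ℤ × ℤ}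
    (h : Sym.Exchange s t [a] num [-a] num' [] [] τ) (M N : ℤ) :
    brHom ((-1) ^ τ) M N (P.vop s) (P.vop t)
      = P.dcoef s t num a M • P.vop (s.shift a ++ t) (M + N - s.zl t.chg) := by
  refine op_ext fun p => ?_
  have := exchange_delta hq h p (M + N) N
  simp only [List.map_nil, lin_nil, lin'_nil, act_one, mul_one, act_C, Pi.smul_apply,
    prodSeq, swapSeq, add_sub_cancel_right, dcoef_eq] at this
  simpa [brHom_apply, vop] using this

/-- The quadratic relation of two vertex operators whose products have at most the pole that is removed
by the factors `z - ξ w` and `w - ξ z`. -/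
lemma quadHom_regular (hq : P.Generic) {s t : Sym} {ξ : ℤ × ℤ} (h : Sym.Regular s t [ξ] [ξ] 0)
    (M N : ℤ) : quadHom (P.qv ξ) M N (P.vop s) (P.vop t) = 0 := by
  refine op_ext fun p => ?_
  have := congrFun (exchange_regular hq h p (M + N)) N
  simp only [List.map_cons, List.map_nil, lin_cons, lin'_cons, lin_nil, lin'_nil, mul_one,
    pow_zero, C_1, one_mul, Pi.add_apply, act_one_sub, act_X_sub,
    prodSeq, swapSeq, add_sub_cancel_right, Pi.zero_apply,
    show M + N - (N - 1) = M + 1 by ring] at this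
  simpa [quadHom_apply, vop] using this

/-- The quadratic relation of two vertex operators whose product has a further pole, at `z = q ^ a w`. -/
lemma quadHom_delta (hq : P.Generic) {s t : Sym} {ξ : ℤ × ℤ} {num num' : List (ℤ × ℤ)}
    {a : ℤ × ℤ} (h : Sym.Exchange s t [a, ξ] num [-a, ξ] num' [ξ] [ξ] 0) (M N : ℤ) :
    quadHom (P.qv ξ) M N (P.vop s) (P.vop t)
      = P.dcoef s t num a M • P.vop (s.shift a ++ t) (M + N - s.zl t.chg) := by
  refine op_ext fun p => ?_
  have := exchange_delta hq h p (M + N) N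
  simp only [List.map_cons, List.map_nil, lin_cons, lin'_cons, lin_nil, lin'_nil, mul_one,
    pow_zero, C_1, one_mul, act_one_sub, act_X_sub,
    prodSeq, swapSeq, add_sub_cancel_right, dcoef_eq,
    show M + N - (N - 1) = M + 1 by ring] at this
  simpa [quadHom_apply, vop] using this

lemma brHom_term (σ : ℂ) (M N : ℤ) (T U : Term) : brHom σ M N (P.term T) (P.term U)
    = (P.coef T * P.coef U) • brHom σ (M + T.off) (N + U.off) (P.vop T.sym) (P.vop U.sym) := by
  simp only [brHom_apply, term, vop, smul_mul_assoc, mul_smul_comm]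
  module

lemma quadHom_term (ξ : ℂ) (M N : ℤ) (T U : Term) : quadHom ξ M N (P.term T) (P.term U)
    = (P.coef T * P.coef U) • quadHom ξ (M + T.off) (N + U.off) (P.vop T.sym) (P.vop U.sym) := by
  rw [quadHom_apply, quadHom_apply, add_right_comm M T.off, ← sub_add_eq_add_sub N 1 U.off]
  simp only [term, vop, smul_mul_assoc, mul_smul_comm]
  module

/-- The delta functions of two exchange relations cancel. -/
lemma delta_cancel (hq : P.Generic) {s t s' t' : Sym} {o o₁ o' o₁' : ℤ} {c c' : ℂ}
    {num num' : List (ℤ × ℤ)} {a : ℤ × ℤ} (h1 : Sym.SameOp (s.shift a ++ t) (s'.shift a ++ t'))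
    (h2 : o + o₁ - s.zl t.chg = o' + o₁' - s'.zl t'.chg)
    (h3 : c * P.dcoef s t num a o + c' * P.dcoef s' t' num' a o' = 0) (M N : ℤ) :
    c • P.dcoef s t num a (M + o) • P.vop (s.shift a ++ t) (M + o + (N + o₁) - s.zl t.chg)
      + c' • P.dcoef s' t' num' a (M + o') •
        P.vop (s'.shift a ++ t') (M + o' + (N + o₁') - s'.zl t'.chg) = 0 := by
  have hM : ∀ (s t : Sym) (num : List (ℤ × ℤ)) (m : ℤ),
      P.dcoef s t num a (M + m) = P.qv a ^ (-M) * P.dcoef s t num a m := fun s t num m => by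
    rw [dcoef, dcoef, show s.zl t.chg - (M + m) = -M + (s.zl t.chg - m) by ring,
      zpow_add₀ (P.qv_ne_zero a)]
    ring
  rw [vop, vop, P.vertex_sameOp hq.lq_ne h1, smul_smul, smul_smul, hM, hM,
    show M + o + (N + o₁) - s.zl t.chg = M + o' + (N + o₁') - s'.zl t'.chg by omega, ← add_smul]
  rw [show c * (P.qv a ^ (-M) * P.dcoef s t num a o)
      + c' * (P.qv a ^ (-M) * P.dcoef s' t' num' a o')
      = P.qv a ^ (-M) * (c * P.dcoef s t num a o + c' * P.dcoef s' t' num' a o') by ring, h3,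
    mul_zero, zero_smul]

lemma brHom_term_regular (hq : P.Generic) {T U : Term} {τ : ℕ}
    (h : Sym.Regular T.sym U.sym [] [] τ) (M N : ℤ) :
    brHom ((-1) ^ τ) M N (P.term T) (P.term U) = 0 := by
  rw [brHom_term, brHom_regular hq h, smul_zero]

lemma quadHom_term_regular (hq : P.Generic) {T U : Term} {ξ : ℤ × ℤ}
    (h : Sym.Regular T.sym U.sym [ξ] [ξ] 0) (M N : ℤ) :
    quadHom (P.qv ξ) M N (P.term T) (P.term U) = 0 := by
  rw [quadHom_term, quadHom_regular hq h, smul_zero]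

lemma quadHom_cur_of_regular (hq : P.Generic) {e : PM} {i j : Fin 2} {ξ : ℤ × ℤ}
    (h : ∀ T ∈ terms e i, ∀ U ∈ terms e j, Sym.Regular T.sym U.sym [ξ] [ξ] 0) (M N : ℤ) :
    quadHom (P.qv ξ) M N (P.cur e i) (P.cur e j) = 0 := by
  rw [cur, cur, list_sum_apply₂]
  refine List.sum_eq_zero fun x hx => ?_
  obtain ⟨T, hT, rfl⟩ := List.mem_map.1 hx
  refine List.sum_eq_zero fun y hy => ?_
  obtain ⟨U, hU, rfl⟩ := List.mem_map.1 hy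
  exact quadHom_term_regular hq (h T hT U hU) M N

/-- The quadratic relations of `X^{+,1}`, which hold term by term. -/
lemma quadHom_plus (hq : P.Generic) (M N : ℤ) :
    quadHom (P.qv (2, 0)) M N (P.cur .plus 0) (P.cur .plus 0) = 0 ∧
    quadHom (P.qv (-1, 0)) M N (P.cur .plus 0) (P.cur .plus 1) = 0 :=
  ⟨quadHom_cur_of_regular hq (by decide) M N, quadHom_cur_of_regular hq (by decide) M N⟩

lemma quadHom_minus_zero (hq : P.Generic) (M N : ℤ) :
    quadHom (P.qv (-2, 0)) M N (P.cur .minus 0) (P.cur .minus 0) = 0 :=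
  quadHom_cur_of_regular hq (by decide) M N

lemma iq_eq (hq : P.Generic) :
    P.iq = P.qv (1, 0) / (P.qv (1, 0) ^ 2 - 1) ∧ P.qv (1, 0) ^ 2 - 1 ≠ 0 := by
  have h0 : P.qv (1, 0) = qp P.lq 1 := by simp [qv, val]
  have h1 : qp P.lq 1 - qp P.lq (-1) ≠ 0 := hq.den_ne
  have h2 : qp P.lq 1 ≠ 0 := qp_ne_zero _ _
  rw [h0, iq, qp_neg] at *
  have h3 : qp P.lq 1 ^ 2 - 1 ≠ 0 := fun h => h1 (by field_simp; rw [h, mul_zero])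
  refine ⟨?_, h3⟩
  field_simp

/-- The currents `X^{±,2}` anticommute with themselves, term by term. -/
lemma brHom_odd (hq : P.Generic) (e : PM) (M N : ℤ) :
    brHom 1 M N (P.cur e 1) (P.cur e 1) = 0 := by
  rw [cur, list_sum_apply₂]
  refine List.sum_eq_zero fun x hx => ?_
  obtain ⟨T, hT, rfl⟩ := List.mem_map.1 hx
  refine List.sum_eq_zero fun y hy => ?_
  obtain ⟨U, hU, rfl⟩ := List.mem_map.1 hy
  have h : ∀ e, ∀ T ∈ terms e 1, ∀ U ∈ terms e 1, Sym.Regular T.sym U.sym [] [] 0 := by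
    intro e; cases e <;> decide
  have := brHom_term_regular hq (h e T hT U hU) M N
  rwa [pow_zero] at this

/-- `q ^ (a + b k)` as a monomial in `q` and `q ^ k`. -/
lemma qv_eq (a b : ℤ) : P.qv (a, b) = P.qv (1, 0) ^ a * P.qv (0, 1) ^ b := by
  simp only [qv, ← qp_mul_int, ← qp_add, val]
  congr 1
  push_cast
  ring

section Deltas

open Term

set_option maxRecDepth 4000

/-- The residues at `z = q ^ (-3 - 2 k) w` of the two products of terms of `X^{-,1}(z)` and `X^{-,2}(w)`
that have a pole there are opposite. -/
lemma minus_mixed_coef (hq : P.Generic) :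
    P.coef m1a * P.coef m2d * P.dcoef m1a.sym m2d.sym [(-1, 0), (-1, -2)] (-3, -2) m1a.off
      + P.coef m1c * P.coef m2b * P.dcoef m1c.sym m2b.sym [(-1, 0)] (-3, -2) m1c.off = 0 := by
  rw [dcoef, dcoef, show m1a.sym.qe m2d.sym.chg = 0 by decide,
    show m1a.sym.sg m2d.sym.chg = 0 by decide, show m1a.sym.zl m2d.sym.chg = 0 by decide,
    show m1c.sym.qe m2b.sym.chg = (-1, -1) by decide,
    show m1c.sym.sg m2b.sym.chg = -1 by decide, show m1c.sym.zl m2b.sym.chg = -1 by decide]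
  obtain ⟨hi, hi'⟩ := iq_eq hq
  have h1 := P.qv_ne_zero (1, 0)
  have h2 := P.qv_ne_zero (0, 1)
  simp only [coef, m1a, m1c, m2b, m2d, List.map_cons, List.map_nil, List.prod_cons, List.prod_nil,
    Prod.mk_sub_mk, qv_zero, qv_eq (-1) (-1), qv_eq 1 1, qv_eq (-1 - -3) (0 - -2),
    qv_eq (-1 - -3) (-2 - -2), hi]
  norm_num
  field_simp
  ring

/-- The two delta functions in the quadratic relation of `X^{-,1}` and `X^{-,2}` cancel. -/
lemma minus_mixed_cancel (hq : P.Generic) (M N : ℤ) :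
    quadHom (P.qv (1, 0)) M N (P.term m1a) (P.term m2d)
      + quadHom (P.qv (1, 0)) M N (P.term m1c) (P.term m2b) = 0 := by
  rw [quadHom_term, quadHom_term,
    quadHom_delta hq (a := (-3, -2)) (num := [(-1, 0), (-1, -2)]) (num' := [(1, 2), (1, 0)])
      (s := m1a.sym) (t := m2d.sym) (by decide),
    quadHom_delta hq (a := (-3, -2)) (num := [(-1, 0)]) (num' := [(1, 0)]) (s := m1c.sym)
      (t := m2b.sym) (by decide)]
  exact delta_cancel hq (by decide) (by decide) (minus_mixed_coef hq) M N

/-- The two delta functions in the commutator of `X^{+,1}` and `X^{-,2}` cancel. -/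
lemma plus_minus_cancel (hq : P.Generic) (M N : ℤ) :
    brHom ((-1) ^ 1) M N (P.term p1a) (P.term m2d)
      + brHom ((-1) ^ 1) M N (P.term p1b) (P.term m2c) = 0 := by
  rw [brHom_term, brHom_term,
    brHom_delta hq (a := (-1, -1)) (num := [(-3, -1)]) (num' := [(3, 1)])
      (s := p1a.sym) (t := m2d.sym) (by decide),
    brHom_delta hq (a := (-1, -1)) (num := [(1, -1)]) (num' := [(-1, 1)]) (s := p1b.sym)
      (t := m2c.sym) (by decide)]
  refine delta_cancel hq (by decide) (by decide) ?_ M N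
  rw [dcoef, dcoef, show p1a.sym.qe m2d.sym.chg = (1, 0) by decide,
    show p1a.sym.sg m2d.sym.chg = 0 by decide, show p1a.sym.zl m2d.sym.chg = 0 by decide,
    show p1b.sym.qe m2c.sym.chg = (-1, 0) by decide,
    show p1b.sym.sg m2c.sym.chg = 0 by decide, show p1b.sym.zl m2c.sym.chg = 0 by decide]
  obtain ⟨hi, hi'⟩ := iq_eq hq
  have h1 := P.qv_ne_zero (1, 0)
  have h2 := P.qv_ne_zero (0, 1)
  simp only [coef, p1a, p1b, m2c, m2d, List.map_cons, List.map_nil, List.prod_cons, List.prod_nil,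
    Prod.mk_sub_mk, qv_zero, qv_eq (-1) 0, qv_eq (-3 - -1) (-1 - -1),
    qv_eq (1 - -1) (-1 - -1), hi]
  norm_num
  field_simp
  ring

/-- The two delta functions in the commutator of `X^{+,2}` and `X^{-,1}` cancel. -/
lemma minus_plus_cancel (hq : P.Generic) (M N : ℤ) :
    brHom ((-1) ^ 1) M N (P.term p2a) (P.term m1a)
      + brHom ((-1) ^ 1) M N (P.term p2b) (P.term m1c) = 0 := by
  rw [brHom_term, brHom_term,
    brHom_delta hq (a := (1, 1)) (num := [(-1, 1)]) (num' := [(1, -1)])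
      (s := p2a.sym) (t := m1a.sym) (by decide),
    brHom_delta hq (a := (1, 1)) (num := []) (num' := []) (s := p2b.sym)
      (t := m1c.sym) (by decide)]
  refine delta_cancel hq (by decide) (by decide) ?_ M N
  rw [dcoef, dcoef, show p2a.sym.qe m1a.sym.chg = (1, 0) by decide,
    show p2a.sym.sg m1a.sym.chg = 0 by decide, show p2a.sym.zl m1a.sym.chg = 0 by decide,
    show p2b.sym.qe m1c.sym.chg = 0 by decide,
    show p2b.sym.sg m1c.sym.chg = 0 by decide, show p2b.sym.zl m1c.sym.chg = -1 by decide]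
  obtain ⟨hi, hi'⟩ := iq_eq hq
  have h1 := P.qv_ne_zero (1, 0)
  have h2 := P.qv_ne_zero (0, 1)
  simp only [coef, p2a, p2b, m1a, m1c, List.map_cons, List.map_nil, List.prod_cons, List.prod_nil,
    Prod.mk_sub_mk, qv_zero, qv_eq 1 1, qv_eq (-1 - 1) (1 - 1), hi]
  norm_num
  field_simp
  ring

/-- Two of the four delta functions in the anticommutator of `X^{+,2}` and `X^{-,2}` cancel; the other
two give `ψ^{±,2}`. -/
lemma odd_cancel (hq : P.Generic) (M N : ℤ) :
    brHom ((-1) ^ 0) M N (P.term p2a) (P.term m2b)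
      + brHom ((-1) ^ 0) M N (P.term p2b) (P.term m2d) = 0 := by
  rw [brHom_term, brHom_term,
    brHom_delta hq (a := (-2, -1)) (num := []) (num' := [])
      (s := p2a.sym) (t := m2b.sym) (by decide),
    brHom_delta hq (a := (-2, -1)) (num := []) (num' := []) (s := p2b.sym)
      (t := m2d.sym) (by decide)]
  refine delta_cancel hq (by decide) (by decide) ?_ M N
  rw [dcoef, dcoef, show p2a.sym.qe m2b.sym.chg = (-1, 0) by decide,
    show p2a.sym.sg m2b.sym.chg = -1 by decide, show p2a.sym.zl m2b.sym.chg = -1 by decide,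
    show p2b.sym.qe m2d.sym.chg = 0 by decide,
    show p2b.sym.sg m2d.sym.chg = 0 by decide, show p2b.sym.zl m2d.sym.chg = -1 by decide]
  have h1 := P.qv_ne_zero (1, 0)
  simp only [coef, p2a, p2b, m2b, m2d, List.map_nil, List.prod_nil, qv_zero, qv_eq (-1) 0]
  norm_num
  field_simp
  ring

end Deltas

end Params

/-! ### Brackets of opposite currents -/

namespace Params

open Finset

variable {P : Params}

section Brackets

open Term

set_option maxRecDepth 4000

lemma quadHom_minus_mixed (hq : P.Generic) (M N : ℤ) :
    quadHom (P.qv (1, 0)) M N (P.cur .minus 0) (P.cur .minus 1) = 0 := by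
  have r : ∀ T U, Sym.Regular T.sym U.sym [(1, 0)] [(1, 0)] 0 →
      quadHom (P.qv (1, 0)) M N (P.term T) (P.term U) = 0 :=
    fun T U h => quadHom_term_regular hq h M N
  rw [cur, cur, list_sum_apply₂]
  simp only [terms, List.map_cons, List.map_nil, List.sum_cons, List.sum_nil, add_zero]
  rw [r m1a m2a (by decide), r m1a m2b (by decide), r m1a m2c (by decide), r m1b m2a (by decide),
    r m1b m2b (by decide), r m1b m2c (by decide), r m1b m2d (by decide), r m1c m2a (by decide),
    r m1c m2c (by decide), r m1c m2d (by decide)]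
  simpa using minus_mixed_cancel hq M N

lemma brHom_zero_one (hq : P.Generic) (M N : ℤ) :
    brHom ((-1) ^ 1) M N (P.cur .plus 0) (P.cur .minus 1) = 0 := by
  have r : ∀ T U, Sym.Regular T.sym U.sym [] [] 1 →
      brHom ((-1) ^ 1) M N (P.term T) (P.term U) = 0 :=
    fun T U h => brHom_term_regular hq h M N
  rw [cur, cur, list_sum_apply₂]
  simp only [terms, List.map_cons, List.map_nil, List.sum_cons, List.sum_nil, add_zero]
  rw [r p1a m2a (by decide), r p1a m2b (by decide), r p1a m2c (by decide), r p1b m2a (by decide),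
    r p1b m2b (by decide), r p1b m2d (by decide)]
  simpa only [zero_add, add_zero] using plus_minus_cancel hq M N

lemma brHom_one_zero (hq : P.Generic) (M N : ℤ) :
    brHom ((-1) ^ 1) M N (P.cur .plus 1) (P.cur .minus 0) = 0 := by
  have r : ∀ T U, Sym.Regular T.sym U.sym [] [] 1 →
      brHom ((-1) ^ 1) M N (P.term T) (P.term U) = 0 :=
    fun T U h => brHom_term_regular hq h M N
  rw [cur, cur, list_sum_apply₂]
  simp only [terms, List.map_cons, List.map_nil, List.sum_cons, List.sum_nil, add_zero]
  rw [r p2a m1b (by decide), r p2a m1c (by decide), r p2b m1a (by decide), r p2b m1b (by decide)]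
  simpa only [zero_add, add_zero] using minus_plus_cancel hq M N

end Brackets

/-- The symbol of `g_+(q ^ y z)`. -/
def _root_.SL21.Sym.fplus (g : Gh) (y : ℤ × ℤ) : Sym :=
  [(1, .fld g y 1), (-1, .fld g (y - (1, 0)) 0)]

/-- The symbol of `g_-(q ^ y z)`. -/
def _root_.SL21.Sym.fminus (g : Gh) (y : ℤ × ℤ) : Sym :=
  [(1, .fld g y 1), (-1, .fld g (y + (1, 0)) 0)]

/-- The symbol of the exponent of `ψ^{±,i}(q ^ (± k / 2) z)`. -/
def _root_.SL21.Sym.psi : PM → Fin 2 → Sym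
  | .plus, 0 => [(1, .ap 0 0)] ++ Sym.fplus .b12 (2, 1) ++ Sym.fplus .b12 (0, 1)
      ++ Sym.fplus .b13 (2, 1) ++ (Sym.fplus .b23 (1, 1)).neg
  | .plus, 1 => [(1, .ap 1 0)] ++ (Sym.fplus .b12 (1, 1)).neg ++ (Sym.fplus .b13 (1, 1)).neg
  | .minus, 0 => [(1, .am 0 0)] ++ Sym.fminus .b12 (-2, -1) ++ Sym.fminus .b12 (0, -1)
      ++ Sym.fminus .b13 (-2, -1) ++ (Sym.fminus .b23 (-1, -1)).neg
  | .minus, 1 => [(1, .am 1 0)] ++ (Sym.fminus .b12 (-1, -1)).neg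
      ++ (Sym.fminus .b13 (-1, -1)).neg

lemma add_smul_eq_sub {V : Type*} [AddCommGroup V] [Module ℂ V] {x y a b : ℂ} (v w : V)
    (h1 : x = a) (h2 : y = -b) : x • v + y • w = a • v - b • w := by
  rw [h1, h2, neg_smul, sub_eq_add_neg]

section Diagonal

open Term

set_option maxRecDepth 4000

/-- The commutator of `X^{+,1}` and `X^{-,1}`. -/
lemma brHom_zero_zero (hq : P.Generic) (M N : ℤ) :
    brHom ((-1) ^ 1) M N (P.cur .plus 0) (P.cur .minus 0)
      = P.iq • (P.qv (0, 1) ^ (-M) • P.vop (.psi .plus 0) (M + N)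
        - P.qv (0, 1) ^ M • P.vop (.psi .minus 0) (M + N)) := by
  have r : ∀ T U, Sym.Regular T.sym U.sym [] [] 1 →
      brHom ((-1) ^ 1) M N (P.term T) (P.term U) = 0 :=
    fun T U h => brHom_term_regular hq h M N
  rw [cur, cur, list_sum_apply₂]
  simp only [terms, List.map_cons, List.map_nil, List.sum_cons, List.sum_nil, add_zero]
  rw [r p1a m1b (by decide), r p1a m1c (by decide), r p1b m1a (by decide), r p1b m1c (by decide),
    brHom_term, brHom_term,
    brHom_delta hq (a := (0, 1)) (num := [(2, 1)]) (num' := [(-2, -1)])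
      (s := p1a.sym) (t := m1a.sym) (by decide),
    brHom_delta hq (a := (0, -1)) (num := [(-2, -1)]) (num' := [(2, 1)]) (s := p1b.sym)
      (t := m1b.sym) (by decide), vop, vop,
    P.vertex_sameOp hq.lq_ne (s := p1a.sym.shift (0, 1) ++ m1a.sym) (t := .psi .plus 0) (by decide),
    P.vertex_sameOp hq.lq_ne (s := p1b.sym.shift (0, -1) ++ m1b.sym) (t := .psi .minus 0) (by decide), dcoef, dcoef,
    show p1a.sym.qe m1a.sym.chg = (-1, 0) by decide,
    show p1a.sym.sg m1a.sym.chg = 0 by decide, show p1a.sym.zl m1a.sym.chg = 0 by decide,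
    show p1b.sym.qe m1b.sym.chg = (1, 0) by decide,
    show p1b.sym.sg m1b.sym.chg = 0 by decide, show p1b.sym.zl m1b.sym.chg = 0 by decide]
  have e1 : M + p1a.off + (N + m1a.off) - 0 = M + N := by
    rw [show p1a.off = 0 from rfl, show m1a.off = 0 from rfl]; ring
  have e2 : M + p1b.off + (N + m1b.off) - 0 = M + N := by
    rw [show p1b.off = 0 from rfl, show m1b.off = 0 from rfl]; ring
  rw [e1, e2]
  simp only [vop, smul_sub, smul_smul, zero_add, add_zero]
  obtain ⟨hi, hi'⟩ := iq_eq hq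
  have h1 := P.qv_ne_zero (1, 0)
  refine add_smul_eq_sub _ _ ?_ ?_
  · simp only [coef, p1a, m1a, List.map_cons, List.map_nil, List.prod_cons, List.prod_nil, Prod.mk_sub_mk,
      qv_zero, qv_eq (-1) 0, qv_eq (2 - 0) (1 - 1), hi, zero_sub]
    norm_num
    field_simp
    ring
  · simp only [coef, p1b, m1b, List.map_cons, List.map_nil, List.prod_cons, List.prod_nil, Prod.mk_sub_mk,
      qv_zero, qv_eq 0 (-1), qv_eq (-2 - 0) (-1 - -1), hi, zero_sub]
    norm_num
    field_simp

/-- The anticommutator of `X^{+,2}` and `X^{-,2}`. -/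
lemma brHom_one_one (hq : P.Generic) (M N : ℤ) :
    brHom ((-1) ^ 0) M N (P.cur .plus 1) (P.cur .minus 1)
      = P.iq • (P.qv (0, 1) ^ (-M) • P.vop (.psi .plus 1) (M + N)
        - P.qv (0, 1) ^ M • P.vop (.psi .minus 1) (M + N)) := by
  have r : ∀ T U, Sym.Regular T.sym U.sym [] [] 0 →
      brHom ((-1) ^ 0) M N (P.term T) (P.term U) = 0 :=
    fun T U h => brHom_term_regular hq h M N
  rw [cur, cur, list_sum_apply₂]
  simp only [terms, List.map_cons, List.map_nil, List.sum_cons, List.sum_nil, add_zero]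
  have hc := odd_cancel hq M N
  rw [r p2a m2c (by decide), r p2a m2d (by decide), r p2b m2a (by decide), r p2b m2b (by decide)]
  simp only [zero_add, add_zero]
  rw [add_add_add_comm, hc, add_zero, brHom_term, brHom_term,
    brHom_delta hq (a := (0, 1)) (num := []) (num' := [])
      (s := p2a.sym) (t := m2a.sym) (by decide),
    brHom_delta hq (a := (0, -1)) (num := []) (num' := []) (s := p2b.sym)
      (t := m2c.sym) (by decide), vop, vop,
    P.vertex_sameOp hq.lq_ne (s := p2a.sym.shift (0, 1) ++ m2a.sym) (t := .psi .plus 1) (by decide),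
    P.vertex_sameOp hq.lq_ne (s := p2b.sym.shift (0, -1) ++ m2c.sym) (t := .psi .minus 1) (by decide),
    dcoef, dcoef,
    show p2a.sym.qe m2a.sym.chg = (-1, 0) by decide,
    show p2a.sym.sg m2a.sym.chg = -1 by decide, show p2a.sym.zl m2a.sym.chg = -1 by decide,
    show p2b.sym.qe m2c.sym.chg = 0 by decide,
    show p2b.sym.sg m2c.sym.chg = 0 by decide, show p2b.sym.zl m2c.sym.chg = -1 by decide]
  have e1 : M + -1 + (N + 0) - -1 = M + N := by ring
  simp only [p2a, p2b, m2a, m2c, smul_sub, smul_smul, vop, e1]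
  have h1 := P.qv_ne_zero (1, 0)
  refine add_smul_eq_sub _ _ ?_ ?_
  · simp only [coef, List.map_nil, List.prod_nil, qv_zero, qv_eq (-1) 0]
    norm_num
    field_simp
  · simp only [coef, List.map_nil, List.prod_nil, qv_zero, qv_eq 0 (-1)]
    norm_num

end Diagonal

end Params

/-! ### The Heisenberg and Cartan generators -/

namespace Params

open Finset

variable (P : Params)

lemma sum_antidiagonal_single {V : Type*} [AddCommGroup V] [Module ℂ V] (m n : ℕ) (κ : ℂ)
    (F : ℕ → V) : ∑ y ∈ antidiagonal n, (if y.1 = m then κ else 0) • F y.2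
      = if m ≤ n then κ • F (n - m) else 0 := by
  rw [Finset.Nat.sum_antidiagonal_eq_sum_range_succ_mk]
  simp only [ite_smul, zero_smul]
  rw [Finset.sum_ite_eq']
  simp

lemma annA_creCoeff (e f : Expo) {m : ℕ} (hm : m ≠ 0) (j : ℤ) :
    P.annA e m * P.creCoeff f j = P.creCoeff f j * P.annA e m + P.cn e f m • P.creCoeff f (j - m) := by
  rcases lt_or_ge j 0 with hj | hj
  · rw [P.creCoeff_neg _ hj, P.creCoeff_neg _ (by omega)]; simp
  lift j to ℕ using hj
  rw [creCoeff_eq, creCoeff_eq, zext_natCast, mul_expCoeff (P.commFam_creA f) _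
    (fun i => if i = m then P.cn e f m else 0) (if_neg (Ne.symm hm)) (fun i hi => ?_),
    sum_antidiagonal_single]
  · split_ifs with h
    · rw [← Nat.cast_sub h, zext_natCast]
    · rw [zext_neg _ (by omega), smul_zero]
  · rw [P.annA_creA e f m i hm hi]
    congr 2
    by_cases h : m = i
    · simp [h]
    · simp [h, Ne.symm h]

lemma creA_annCoeff (e f : Expo) {m : ℕ} (hm : m ≠ 0) (n : ℕ) :
    P.creA e m * P.annCoeff f n = P.annCoeff f n * P.creA e m
      + if m ≤ n then -P.cn f e m • P.annCoeff f (n - m) else 0 := by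
  rw [annCoeff_eq, annCoeff_eq, mul_expCoeff (P.commFam_annA f) _
    (fun i => if i = m then -P.cn f e m else 0) (if_neg (Ne.symm hm)) (fun i hi => ?_),
    sum_antidiagonal_single]
  rw [P.annA_creA f e i m hi hm]
  by_cases h : i = m
  · simp [h]
  · simp [h]

lemma annA_mem (e : Expo) {m : ℕ} {lam : Gh → ℤ} {d : ℤ} {v : Fock}
    (hv : v ∈ grade lam d) : P.annA e m v ∈ grade lam (d - m) :=
  Shifts.sum (fun t _ => (P.osc_shifts t m).smul _) _ _ _ hv

lemma creA_mem (e : Expo) {m : ℕ} {lam : Gh → ℤ} {d : ℤ} {v : Fock}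
    (hv : v ∈ grade lam d) : P.creA e m v ∈ grade lam (d + m) := by
  have := Shifts.sum (s := univ) (S := fun t => e.1 t (-m) • P.osc t (-m))
    (fun t _ => (P.osc_shifts t (-m)).smul _) _ _ _ hv
  rwa [neg_neg] at this

lemma translate_annA (chg : Gh → ℤ) (e : Expo) {m : ℕ} (hm : m ≠ 0) :
    Commute (translate chg) (P.annA e m) :=
  Commute.sum_right _ _ _ fun t _ => (P.translate_osc chg t (by omega)).smul_right _

lemma translate_creA (chg : Gh → ℤ) (e : Expo) {m : ℕ} (hm : m ≠ 0) :
    Commute (translate chg) (P.creA e m) :=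
  Commute.sum_right _ _ _ fun t _ => (P.translate_osc chg t (by omega)).smul_right _

/-- The commutator of annihilation operators with a vertex operator. -/
lemma annA_vertex (e f : Expo) {m : ℕ} (hm : m ≠ 0) (N : ℤ) :
    P.annA e m * P.vertex f N = P.vertex f N * P.annA e m + P.cn e f m • P.vertex f (N - m) := by
  refine op_ext fun p => ?_
  have hp := ket_mem_grade p
  rw [Module.End.mul_apply, LinearMap.add_apply, Module.End.mul_apply, LinearMap.smul_apply,
    P.vertex_apply f N hp (K := deg p + 1) (by omega),
    P.vertex_apply f N (P.annA_mem e hp) (K := deg p + 1) (by omega),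
    P.vertex_apply f (N - m) hp (K := deg p + 1) (by omega), map_smul, map_sum, smul_comm, ← smul_add]
  congr 1
  rw [Finset.smul_sum, ← Finset.sum_add_distrib]
  refine Finset.sum_congr rfl fun n _ => ?_
  have hc : Commute (P.annA e m) (P.annCoeff f n) :=
    commute_expCoeff _ (fun i hi => P.commute_annA e f hm hi) n
  rw [← Module.End.mul_apply (P.annA e m), P.annA_creCoeff e f hm, LinearMap.add_apply,
    Module.End.mul_apply, LinearMap.smul_apply, ← Module.End.mul_apply (P.annA e m),
    ← (P.translate_annA f.2.1 e hm).eq, Module.End.mul_apply, ← Module.End.mul_apply (P.annA e m),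
    hc.eq, Module.End.mul_apply]
  congr 4
  ring

/-- The commutator of creation operators with a vertex operator. -/
lemma creA_vertex (e f : Expo) {m : ℕ} (hm : m ≠ 0) (N : ℤ) :
    P.creA e m * P.vertex f N = P.vertex f N * P.creA e m - P.cn f e m • P.vertex f (N + m) := by
  refine op_ext fun p => ?_
  have hp := ket_mem_grade p
  rw [Module.End.mul_apply, LinearMap.sub_apply, Module.End.mul_apply, LinearMap.smul_apply,
    P.vertex_apply f N hp (K := m + (deg p + 1)) (by push_cast; omega),
    P.vertex_apply f N (P.creA_mem e hp) (K := m + (deg p + 1)) (by push_cast; omega),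
    P.vertex_apply f (N + m) hp (K := deg p + 1) (by omega), map_smul, map_sum,
    smul_comm, ← smul_sub]
  congr 1
  have key : ∀ n : ℕ, P.creA e m (P.creCoeff f (N - zl f p.1 + n)
      (translate f.2.1 (P.annCoeff f n (ket p))))
      = P.creCoeff f (N - zl f p.1 + n) (translate f.2.1 (P.annCoeff f n (P.creA e m (ket p))))
        + if m ≤ n then -P.cn f e m • P.creCoeff f (N - zl f p.1 + n)
          (translate f.2.1 (P.annCoeff f (n - m) (ket p))) else 0 := by
    intro n
    have hc : Commute (P.creA e m) (P.creCoeff f (N - zl f p.1 + n)) := by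
      rw [creCoeff_eq]
      rcases lt_or_ge (N - zl f p.1 + n) 0 with h | h
      · rw [zext_neg _ h]; exact Commute.zero_right _
      · lift N - zl f p.1 + n to ℕ using h with j
        exact commute_expCoeff _ (fun i hi => P.commute_creA e f hm hi) j
    rw [← Module.End.mul_apply (P.creA e m), hc.eq, Module.End.mul_apply,
      ← Module.End.mul_apply (P.creA e m), ← (P.translate_creA f.2.1 e hm).eq, Module.End.mul_apply,
      ← Module.End.mul_apply (P.creA e m), P.creA_annCoeff e f hm, LinearMap.add_apply,
      Module.End.mul_apply, map_add, map_add]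
    congr 1
    split_ifs
    · simp only [LinearMap.smul_apply, map_smul]
    · simp
  have h2 : ∑ n ∈ range (m + (deg p + 1)), (if m ≤ n then
      -P.cn f e m • P.creCoeff f (N - zl f p.1 + n)
          (translate f.2.1 (P.annCoeff f (n - m) (ket p))) else 0)
      = -(P.cn f e m • ∑ n ∈ range (deg p + 1), P.creCoeff f (N + m - zl f p.1 + n)
          (translate f.2.1 (P.annCoeff f n (ket p)))) := by
    rw [Finset.sum_range_add, Finset.sum_eq_zero fun n hn => if_neg (by rw [mem_range] at hn; omega),
      zero_add, Finset.smul_sum, ← Finset.sum_neg_distrib]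
    refine Finset.sum_congr rfl fun n _ => ?_
    rw [if_pos (by omega), Nat.add_sub_cancel_left, neg_smul]
    congr 4
    push_cast
    ring
  rw [Finset.sum_congr rfl fun n _ => key n, Finset.sum_add_distrib, h2, ← sub_eq_add_neg]

lemma annA_add (e f : Expo) (m : ℕ) : P.annA (e + f) m = P.annA e m + P.annA f m := by
  simp only [annA, Prod.fst_add, Pi.add_apply, add_smul, Finset.sum_add_distrib]

lemma annA_neg (e : Expo) (m : ℕ) : P.annA (-e) m = -P.annA e m := by
  simp only [annA, Prod.fst_neg, Pi.neg_apply, neg_smul, Finset.sum_neg_distrib]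

lemma creA_add (e f : Expo) (m : ℕ) : P.creA (e + f) m = P.creA e m + P.creA f m := by
  simp only [creA, Prod.fst_add, Pi.add_apply, add_smul, Finset.sum_add_distrib]

lemma creA_neg (e : Expo) (m : ℕ) : P.creA (-e) m = -P.creA e m := by
  simp only [creA, Prod.fst_neg, Pi.neg_apply, neg_smul, Finset.sum_neg_distrib]

lemma annA_fplus (t : Boson) (y : ℂ) {m : ℕ} (hm : m ≠ 0) : P.annA (P.fplus t y) m
    = ((qp P.lq 1 - qp P.lq (-1)) * qp P.lq (-y * m)) • P.osc t m := by
  rw [annA, Finset.sum_eq_single t]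
  · simp [fplus, Nat.pos_of_ne_zero hm]
  · intro u _ hu; simp [fplus, Pi.single_eq_of_ne hu]
  · simp

lemma creA_fminus (t : Boson) (y : ℂ) {m : ℕ} (hm : m ≠ 0) : P.creA (P.fminus t y) m
    = -((qp P.lq 1 - qp P.lq (-1)) * qp P.lq (y * m)) • P.osc t (-m) := by
  rw [creA, Finset.sum_eq_single t]
  · simp [fminus, Nat.pos_of_ne_zero hm]
  · intro u _ hu; simp [fminus, Pi.single_eq_of_ne hu]
  · simp

variable {P}

lemma symE_fplus (hq : P.Generic) (g : Gh) (y : ℤ × ℤ) :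
    P.symE (Sym.fplus g y) = P.fplus (.inr g) (P.val y) := by
  rw [fplus_gh hq g (P.val y) (P.val (y - (1, 0))) (by rw [val_sub]; simp [val])]
  simp [symE, Sym.fplus, pieceE, sub_eq_add_neg]

lemma symE_fminus (hq : P.Generic) (g : Gh) (y : ℤ × ℤ) :
    P.symE (Sym.fminus g y) = P.fminus (.inr g) (P.val y) := by
  rw [fminus_gh hq g (P.val y) (P.val (y + (1, 0))) (by rw [val_add]; simp [val])]
  simp [symE, Sym.fminus, pieceE, sub_eq_add_neg]

lemma symE_single (a : Piece) : P.symE [(1, a)] = P.pieceE a := by simp [symE]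

lemma symE_psi_plus (hq : P.Generic) (i : Fin 2) : P.symE (.psi .plus i) = match i with
    | 0 => P.fplus (.inl 0) ((P.k + 1) / 2) + P.fplus (.inr .b12) (P.k + 2)
      + P.fplus (.inr .b12) P.k + P.fplus (.inr .b13) (P.k + 2) + -P.fplus (.inr .b23) (P.k + 1)
    | 1 => P.fplus (.inl 1) ((P.k + 1) / 2) + -P.fplus (.inr .b12) (P.k + 1)
      + -P.fplus (.inr .b13) (P.k + 1) := by
  have v21 : P.val (2, 1) = P.k + 2 := by simp [val]; ring
  have v11 : P.val (1, 1) = P.k + 1 := by simp [val]; ring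
  have v01 : P.val (0, 1) = P.k := by simp [val]
  fin_cases i <;>
    simp only [Sym.psi, symE_append, symE_neg, symE_fplus hq, symE_single, pieceE, v21, v11, v01,
      val_zero, add_zero]

lemma symE_psi_minus (hq : P.Generic) (i : Fin 2) : P.symE (.psi .minus i) = match i with
    | 0 => P.fminus (.inl 0) (-(P.k + 1) / 2) + P.fminus (.inr .b12) (-(P.k + 2))
      + P.fminus (.inr .b12) (-P.k) + P.fminus (.inr .b13) (-(P.k + 2))
      + -P.fminus (.inr .b23) (-(P.k + 1))
    | 1 => P.fminus (.inl 1) (-(P.k + 1) / 2) + -P.fminus (.inr .b12) (-(P.k + 1))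
      + -P.fminus (.inr .b13) (-(P.k + 1)) := by
  have v21 : P.val (-2, -1) = -(P.k + 2) := by simp [val]
  have v11 : P.val (-1, -1) = -(P.k + 1) := by simp [val]
  have v01 : P.val (0, -1) = -P.k := by simp [val]
  fin_cases i <;>
    simp only [Sym.psi, symE_append, symE_neg, symE_fminus hq, symE_single, pieceE, v21, v11, v01,
      val_zero, add_zero]

/-- The factor relating the modes of the exponent of `ψ(q ^ (± k / 2) z)` to `h_m`. -/
def hfac (P : Params) (m : ℕ) : ℂ := (qp P.lq 1 - qp P.lq (-1)) * qp P.lq (-P.k * m / 2)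

/-- The positive modes of the exponent of `ψ^{+,i}` are multiples of `h^i_m`, so that the relations of
`h^i_m` follow from contractions with `ψ^{+,i}`. -/
lemma annA_psi (hq : P.Generic) (i : Fin 2) {m : ℕ} (hm : m ≠ 0) :
    P.annA (P.symE (.psi .plus i)) m = P.hfac m • P.hmode i m := by
  have e0 : qp P.lq (-((P.k + 1) / 2) * m) = qp P.lq (-P.k * m / 2) * qp P.lq (-m / 2) := by
    rw [← qp_add]; congr 1; ring
  have e1 : qp P.lq (-(P.k + 2) * m) = qp P.lq (-P.k * m / 2) *
      (qp P.lq (-(P.k / 2 + 1) * m) * qp P.lq (-m)) := by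
    rw [← qp_add, ← qp_add]; congr 1; ring
  have e2 : qp P.lq (-P.k * m) = qp P.lq (-P.k * m / 2) *
      (qp P.lq (-(P.k / 2 + 1) * m) * qp P.lq m) := by
    rw [← qp_add, ← qp_add]; congr 1; ring
  have e3 : qp P.lq (-(P.k + 1) * m) = qp P.lq (-P.k * m / 2) * qp P.lq (-(P.k / 2 + 1) * m) := by
    rw [← qp_add]; congr 1; ring
  have e4 : qp P.lq (-(P.k / 2 + 2) * m) = qp P.lq (-(P.k / 2 + 1) * m) * qp P.lq (-m) := by
    rw [← qp_add]; congr 1; ring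
  rw [symE_psi_plus hq]
  fin_cases i <;>
    simp only [annA_add, annA_neg, P.annA_fplus _ _ hm, hmode, Nat.abs_cast, Int.cast_natCast, e0,
      e1, e2, e3, e4, hfac] <;> module

/-- The negative modes of the exponent of `ψ^{-,i}` are multiples of `h^i_{-m}`. -/
lemma creA_psi (hq : P.Generic) (i : Fin 2) {m : ℕ} (hm : m ≠ 0) :
    P.creA (P.symE (.psi .minus i)) m = -P.hfac m • P.hmode i (-m) := by
  have e0 : qp P.lq (-(P.k + 1) / 2 * m) = qp P.lq (-P.k * m / 2) * qp P.lq (-m / 2) := by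
    rw [← qp_add]; congr 1; ring
  have e1 : qp P.lq (-(P.k + 2) * m) = qp P.lq (-P.k * m / 2) *
      (qp P.lq (-(P.k / 2 + 1) * m) * qp P.lq (-m)) := by
    rw [← qp_add, ← qp_add]; congr 1; ring
  have e2 : qp P.lq (-P.k * m) = qp P.lq (-P.k * m / 2) *
      (qp P.lq (-(P.k / 2 + 1) * m) * qp P.lq m) := by
    rw [← qp_add, ← qp_add]; congr 1; ring
  have e3 : qp P.lq (-(P.k + 1) * m) = qp P.lq (-P.k * m / 2) * qp P.lq (-(P.k / 2 + 1) * m) := by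
    rw [← qp_add]; congr 1; ring
  have e4 : qp P.lq (-(P.k / 2 + 2) * m) = qp P.lq (-(P.k / 2 + 1) * m) * qp P.lq (-m) := by
    rw [← qp_add]; congr 1; ring
  rw [symE_psi_minus hq]
  fin_cases i <;>
    simp only [creA_add, creA_neg, P.creA_fminus _ _ hm, hmode, abs_neg, Nat.abs_cast,
      Int.cast_natCast, e0, e1, e2, e3, e4, hfac] <;> module

lemma hfac_ne (hq : P.Generic) (m : ℕ) : P.hfac m ≠ 0 := mul_ne_zero hq.den_ne (qp_ne_zero _ _)

/-- The contraction data `∑ (q ^ (a n) - q ^ (-a n)) q ^ (b k n) / n`. -/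
def _root_.SL21.Sym.cartanContr (a b : ℤ) : List (ℤ × (ℤ × ℤ)) := [(1, (a, b)), (-1, (-a, b))]

/-- A contraction can be read off from any combination `L` that is symbolically equal to it. -/
lemma cn_of_balanced (hq : P.Generic) {s t : Sym} {L : List (ℤ × (ℤ × ℤ))}
    (h : Balanced (Sym.contr s t ++ L.map fun x => (-x.1, x.2))) {n : ℕ} (hn : n ≠ 0) :
    P.cn (P.symE s) (P.symE t) n = (L.map fun c => c.1 • P.pw n c.2).sum := by
  have := h.sum_eq_zero (P.pw n)
  rw [List.map_append, List.sum_append, List.map_map] at this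
  simp only [Function.comp_def, neg_smul, list_sum_map_neg] at this
  rw [cn_symE hq s t hn]
  exact add_neg_eq_zero.1 this

end Params

/-! ### The relations of the Heisenberg generators -/

namespace Params

open Finset

variable {P : Params}

lemma cur_sum (e : PM) (j : Fin 2) (N : ℤ) :
    P.cur e j N = ((terms e j).map fun T => P.term T N).sum := by
  have : ∀ l : List Term, (l.map P.term).sum N = (l.map fun T => P.term T N).sum := fun l => by
    induction l with
    | nil => rfl
    | cons a l ih => simp only [List.map_cons, List.sum_cons, Pi.add_apply, ih]
  exact this _

lemma commutator_list {ι R : Type*} [Ring R] [Algebra ℂ R] {x : R} {l : List ι} {f g : ι → R}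
    {c : ℂ} (h : ∀ T ∈ l, x * f T - f T * x = c • g T) :
    x * (l.map f).sum - (l.map f).sum * x = c • (l.map g).sum := by
  induction l with
  | nil => simp
  | cons a l ih =>
    rw [List.map_cons, List.sum_cons, List.map_cons, List.sum_cons, mul_add, add_mul, smul_add,
      ← h a (by simp), ← ih fun T hT => h T (List.mem_cons_of_mem _ hT)]
    abel

/-- The power of `q ^ k` in the contraction of `ψ^{±}(q ^ (± k / 2) z)` with `X^{±}(w)`. -/
def _root_.SL21.PM.shift : PM → ℤ
  | .plus => -1
  | .minus => 0

lemma sum_cartanContr (a b : ℤ) (n : ℕ) :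
    ((Sym.cartanContr a b).map fun c => c.1 • P.pw n c.2).sum
      = (qp P.lq (a * n) - qp P.lq (-(a * n))) * qp P.lq (b * P.k * n) / n := by
  simp only [Sym.cartanContr, List.map_cons, List.map_nil, List.sum_cons, List.sum_nil, pw, val]
  rw [sub_mul, ← qp_add, ← qp_add]
  push_cast
  rw [show ((a : ℂ) + b * P.k) * n = a * n + b * P.k * n by ring,
    show (-(a : ℂ) + b * P.k) * n = -(a * n) + b * P.k * n by ring]
  simp
  ring

lemma hfac_inv_mul (hq : P.Generic) (e : PM) (a : ℤ) (n : ℕ) : (P.hfac n)⁻¹ *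
    ((qp P.lq ((e.toInt * a : ℤ) * n) - qp P.lq (-((e.toInt * a : ℤ) * n)))
      * qp P.lq (e.shift * P.k * n) / n)
    = e.toInt * qnum P.lq (a * n) / n * qp P.lq (-(e.toInt * n) * P.k / 2) := by
  have h1 := hq.den_ne
  have h2 := qp_ne_zero P.lq (-P.k * n / 2)
  rw [hfac, qnum]
  cases e
  · rw [show ((PM.plus.shift : ℤ) : ℂ) * P.k * n = -P.k * n / 2 + -P.k * n / 2 by
      simp [PM.shift], qp_add]
    simp only [PM.toInt, one_mul, Int.cast_one]
    rw [show -(n : ℂ) * P.k / 2 = -P.k * n / 2 by ring]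
    field_simp
  · have h3 : qp P.lq (-P.k * n / 2) * qp P.lq (n * P.k / 2) = 1 := by
      rw [← qp_add, ← qp_zero P.lq]; congr 1; ring
    simp only [PM.toInt, PM.shift, Int.cast_zero, zero_mul, qp_zero, mul_one]
    push_cast
    rw [show (-1 * (a : ℂ)) * n = -(a * n) by ring, neg_neg,
      show -(-1 * (n : ℂ)) * P.k / 2 = n * P.k / 2 by ring]
    generalize qp P.lq (n * P.k / 2) = B at *
    generalize qp P.lq (-P.k * n / 2) = A at *
    have hA : A⁻¹ = B := inv_eq_of_mul_eq_one_right h3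
    rw [mul_inv, hA]
    ring

set_option maxRecDepth 4000 in
/-- The contraction of the exponent of `ψ^{±,i}` with a term of `X^{±,j}` is the same for all terms of
the current and is given by the Cartan matrix. -/
lemma psi_contr (e : PM) (i j : Fin 2) : ∀ T ∈ terms e j,
    Balanced (Sym.contr (.psi .plus i) T.sym ++
      (Sym.cartanContr (e.toInt * cartan i j) e.shift).map fun x => (-x.1, x.2)) ∧
    Balanced (Sym.contr T.sym (.psi .minus i) ++
      (Sym.cartanContr (e.toInt * cartan i j) e.shift).map fun x => (-x.1, x.2)) := by
  cases e <;> fin_cases i <;> fin_cases j <;> decide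

/-- The relation between `h^i_m`, `m > 0`, and the currents. -/
lemma hmode_cur (hq : P.Generic) (e : PM) (i j : Fin 2) {m : ℕ} (hm : m ≠ 0) (N : ℤ) :
    P.hmode i m * P.cur e j N - P.cur e j N * P.hmode i m
      = (e.toInt * qnum P.lq (cartan i j * m) / m * qp P.lq (-(e.toInt * m) * P.k / 2))
        • P.cur e j (N - m) := by
  rw [cur_sum, cur_sum]
  refine commutator_list fun T hT => ?_
  have h : P.hmode i m = (P.hfac m)⁻¹ • P.annA (P.symE (.psi .plus i)) m := by
    rw [annA_psi hq i hm, smul_smul, inv_mul_cancel₀ (hfac_ne hq m), one_smul]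
  rw [h, term, smul_mul_smul_comm, P.annA_vertex _ _ hm, smul_mul_smul_comm,
    mul_comm (P.coef T), ← smul_sub, add_sub_cancel_left, cn_of_balanced hq (psi_contr e i j T hT).1 hm,
    sum_cartanContr, ← hfac_inv_mul hq, term, smul_smul, smul_smul, sub_add_eq_add_sub]
  congr 1
  ring

/-- The relation between `h^i_{-m}`, `m > 0`, and the currents. -/
lemma hmode_neg_cur (hq : P.Generic) (e : PM) (i j : Fin 2) {m : ℕ} (hm : m ≠ 0) (N : ℤ) :
    P.hmode i (-m) * P.cur e j N - P.cur e j N * P.hmode i (-m)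
      = (e.toInt * qnum P.lq (cartan i j * m) / m * qp P.lq (-(e.toInt * m) * P.k / 2))
        • P.cur e j (N + m) := by
  rw [cur_sum, cur_sum]
  refine commutator_list fun T hT => ?_
  have h : P.hmode i (-m) = (-(P.hfac m)⁻¹) • P.creA (P.symE (.psi .minus i)) m := by
    rw [creA_psi hq i hm, smul_smul, neg_mul_neg, inv_mul_cancel₀ (hfac_ne hq m), one_smul]
  rw [h, term, smul_mul_smul_comm, P.creA_vertex _ _ hm, smul_mul_smul_comm,
    mul_comm (P.coef T), ← smul_sub, sub_sub_cancel_left, cn_of_balanced hq (psi_contr e i j T hT).2 hm,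
    sum_cartanContr, ← hfac_inv_mul hq, term, ← neg_smul, smul_smul, smul_smul, add_right_comm]
  congr 1
  ring

lemma hmode_pos (hq : P.Generic) (i : Fin 2) {m : ℕ} (hm : m ≠ 0) :
    P.hmode i m = (P.hfac m)⁻¹ • P.annA (P.symE (.psi .plus i)) m := by
  rw [annA_psi hq i hm, smul_smul, inv_mul_cancel₀ (hfac_ne hq m), one_smul]

lemma hmode_neg (hq : P.Generic) (i : Fin 2) {m : ℕ} (hm : m ≠ 0) :
    P.hmode i (-m) = (-(P.hfac m)⁻¹) • P.creA (P.symE (.psi .minus i)) m := by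
  rw [creA_psi hq i hm, smul_smul, neg_mul_neg, inv_mul_cancel₀ (hfac_ne hq m), one_smul]

lemma psi_psi_contr (i j : Fin 2) :
    Balanced (Sym.contr (.psi .plus i) (.psi .minus j) ++
      (Sym.cartanContr (cartan i j) (-2) ++ Sym.cartanContr (-cartan i j) 0).map
        fun x => (-x.1, x.2)) := by
  fin_cases i <;> fin_cases j <;> decide

/-- The Heisenberg relation between `h^i_m` and `h^j_{-n}`, `m, n > 0`. -/
lemma hmode_hmode (hq : P.Generic) (i j : Fin 2) {m n : ℕ} (hm : m ≠ 0) (hn : n ≠ 0) :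
    P.hmode i m * P.hmode j (-n) - P.hmode j (-n) * P.hmode i m
      = if m = n then (qnum P.lq (cartan i j * m) / m * qnum P.lq (m * P.k)) • 1 else 0 := by
  rw [hmode_pos hq i hm, hmode_neg hq j hn, smul_mul_smul_comm, smul_mul_smul_comm,
    mul_comm (-(P.hfac n)⁻¹), ← smul_sub, P.annA_creA _ _ _ _ hm hn, add_sub_cancel_left, smul_smul]
  split_ifs with h
  · subst h
    congr 1
    rw [cn_of_balanced hq (psi_psi_contr i j) hm, List.map_append, List.sum_append,
      sum_cartanContr, sum_cartanContr, hfac]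
    have h1 := hq.den_ne
    have h2 := qp_ne_zero P.lq (-P.k * m / 2)
    have e1 : qp P.lq ((-2 : ℤ) * P.k * m)
        = qp P.lq (-P.k * m / 2) * qp P.lq (-P.k * m / 2) * qp P.lq (-(m * P.k)) := by
      rw [← qp_add, ← qp_add]; congr 1; push_cast; ring
    have e2 : (1 : ℂ) = qp P.lq (-P.k * m / 2) * qp P.lq (-P.k * m / 2) * qp P.lq (m * P.k) := by
      rw [← qp_add, ← qp_add, ← qp_zero P.lq]; congr 1; ring
    rw [e1, qnum, qnum, show ((0 : ℤ) : ℂ) * P.k * m = 0 by simp, qp_zero]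
    push_cast
    rw [show -(cartan i j : ℂ) * m = -(cartan i j * m) by ring, neg_neg]
    have hm' : (m : ℂ) ≠ 0 := Nat.cast_ne_zero.2 hm
    generalize qp P.lq (-P.k * m / 2) = A at *
    generalize qp P.lq (m * P.k) = B at *
    generalize qp P.lq (-(m * P.k)) = B' at *
    generalize qp P.lq ((cartan i j : ℂ) * m) = D at *
    generalize qp P.lq (-((cartan i j : ℂ) * m)) = D' at *
    field_simp
    linear_combination (D - D') * e2
  · simp

end Params

/-! ### Zero modes, the derivation and the Cartan currents -/

lemma diag_grade {f : Idx → ℂ} {lam : Gh → ℤ} {d : ℤ} {c : ℂ}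
    (h : ∀ p : Idx, p.1 = lam → (deg p : ℤ) = d → f p = c) {v : Fock} (hv : v ∈ grade lam d) :
    diag f v = c • v :=
  eqOn_grade (T := c • (1 : Module.End ℂ Fock)) (fun p h1 h2 => by
    rw [diag_ket, h p h1 h2]; rfl) hv

/-- Moving a diagonal operator past an operator that is homogeneous on basis vectors. -/
lemma diag_mul_eq {f g : Idx → ℂ} {T : Module.End ℂ Fock} (h : ∀ p, ∃ lam d, T (ket p) ∈ grade lam d ∧
    ∀ p' : Idx, p'.1 = lam → (deg p' : ℤ) = d → f p' = g p) : diag f * T = T * diag g :=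
  op_ext fun p => by
    obtain ⟨lam, d, h1, h2⟩ := h p
    rw [Module.End.mul_apply, diag_grade h2 h1, Module.End.mul_apply, diag_ket, map_smul]

lemma diag_mul_diag (f g : Idx → ℂ) : diag f * diag g = diag fun p => f p * g p :=
  op_ext fun p => by
    simp only [Module.End.mul_apply, diag_ket, map_smul, smul_smul, mul_comm]

lemma diag_add_const (f : Idx → ℂ) (c : ℂ) : diag (fun p => f p + c) = diag f + c • 1 :=
  op_ext fun p => by
    simp only [diag_ket, LinearMap.add_apply, LinearMap.smul_apply, Module.End.one_apply, add_smul]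

lemma diag_smul (f : Idx → ℂ) (c : ℂ) : diag (fun p => c * f p) = c • diag f :=
  op_ext fun p => by simp only [diag_ket, LinearMap.smul_apply, smul_smul]

lemma diag_one : diag (fun _ => 1) = 1 := op_ext fun p => by simp

lemma Shifts.add {S T : Module.End ℂ Fock} {m : ℤ} (hS : Shifts S m) (hT : Shifts T m) :
    Shifts (S + T) m := fun _ _ _ hv => Submodule.add_mem _ (hS _ _ _ hv) (hT _ _ _ hv)

lemma Shifts.sub {S T : Module.End ℂ Fock} {m : ℤ} (hS : Shifts S m) (hT : Shifts T m) :
    Shifts (S - T) m := fun _ _ _ hv => Submodule.sub_mem _ (hS _ _ _ hv) (hT _ _ _ hv)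

lemma smul_sum_list {ι : Type*} (l : List ι) (x : Module.End ℂ Fock) (c : ℂ)
    (f : ι → Module.End ℂ Fock) (h : ∀ T ∈ l, x * f T = c • (f T * x)) :
    x * (l.map f).sum = c • ((l.map f).sum * x) := by
  induction l with
  | nil => simp
  | cons a l ih =>
    rw [List.map_cons, List.sum_cons, mul_add, add_mul, smul_add, h a (by simp),
      ih fun T hT => h T (List.mem_cons_of_mem _ hT)]

namespace Params

open Finset

variable (P : Params)

lemma hmode_shifts (i : Fin 2) (n : ℤ) : Shifts (P.hmode i n) (-n) := by
  have h := fun t c => (P.osc_shifts t n).smul c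
  fin_cases i
  · exact (((h _ _).add (h _ _)).add (h _ _)).sub (h _ _)
  · exact ((h _ _).sub (h _ _)).sub (h _ _)

/-- The eigenvalue of `h^i_0` on a shift of charge. -/
def hchg (i : Fin 2) (c : Gh → ℤ) : ℤ :=
  match i with
  | 0 => -2 * c .b12 + c .b13 - c .b23
  | 1 => c .b12 - c .b13

lemma hzero_add (i : Fin 2) {p p' : Idx} {c : Gh → ℤ} (h : p'.1 = p.1 + c) :
    P.hzero i p' = P.hzero i p + hchg i c := by
  fin_cases i <;>
    simp only [hzero, zm, h, hchg, Pi.add_apply, Gh.sgn] <;>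
    push_cast <;> ring

/-- The operator `q ^ {h^i_0}`. -/
def kop (i : Fin 2) : Module.End ℂ Fock := diag fun p => qp P.lq (P.hzero i p)

lemma kop_hmode (i j : Fin 2) (m : ℤ) : P.kop i * P.hmode j m = P.hmode j m * P.kop i :=
  diag_mul_eq fun p => ⟨_, _, P.hmode_shifts j m _ _ _ (ket_mem_grade p), fun p' h1 _ => by
    have h := P.hzero_add i (p := p) (p' := p') (c := 0) (by rw [h1, add_zero])
    have h0 : hchg i 0 = 0 := by fin_cases i <;> rfl
    rw [h, h0, Int.cast_zero, add_zero]⟩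

/-- All terms of `X^{±,j}` have the weight prescribed by the Cartan matrix. -/
lemma hchg_terms (e : PM) (i j : Fin 2) :
    ∀ T ∈ terms e j, hchg i T.sym.chg = e.toInt * cartan i j := by
  cases e <;> fin_cases i <;> fin_cases j <;> decide

lemma kop_cur (e : PM) (i j : Fin 2) (N : ℤ) : P.kop i * P.cur e j N
    = qp P.lq (e.toInt * cartan i j) • (P.cur e j N * P.kop i) := by
  rw [cur_sum]
  refine smul_sum_list _ _ _ _ fun T hT => ?_
  rw [term, mul_smul_comm, smul_mul_assoc, smul_comm]
  congr 1
  rw [kop, ← mul_smul_comm, ← diag_smul]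
  refine diag_mul_eq fun p => ⟨_, _, P.vertex_mem _ _ (ket_mem_grade p), fun p' h1 _ => ?_⟩
  rw [P.hzero_add i h1, qp_add, mul_comm, symE_chg, hchg_terms e i j T hT]
  push_cast
  rfl

lemma dval_eq (p : Idx) : P.dval p
    = (P.zm (.inl 0) p.1 * P.zm (.inl 1) p.1 + P.zm (.inl 1) p.1 ^ 2 + P.zm (.inl 0) p.1
        + 3 * P.zm (.inl 1) p.1) / (P.k + 1)
      - (∑ g : Gh, g.sgn * (p.1 g * (p.1 g + 1)) : ℤ) / 2 - deg p := by
  have h : (p.2.sum fun tn e => ((tn.2 : ℕ) : ℂ) * e) = deg p := by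
    simp only [deg, Finsupp.sum]; push_cast; rfl
  rw [dval, h]
  have : (univ : Finset Gh) = {.b12, .b13, .b23, .c} := rfl
  rw [this]
  simp only [zm, Gh.sgn, Finset.sum_insert, Finset.mem_insert, Finset.mem_singleton,
    Finset.sum_singleton, reduceCtorEq, or_self, not_false_iff]
  push_cast
  ring

/-- The change of the eigenvalue of `d` under a mode of a vertex operator. -/
lemma dval_add {p p' : Idx} {e : Expo} {N : ℤ} (h1 : p'.1 = p.1 + e.2.1)
    (h2 : (deg p' : ℤ) = deg p + (N - zl e p.1)) : P.dval p'
    = P.dval p + -((N : ℂ) + (∑ g : Gh, g.sgn * (e.2.1 g * (e.2.1 g + 1)) : ℤ) / 2) := by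
  have h3 : (deg p' : ℂ) = deg p + (N - zl e p.1 : ℤ) := by exact_mod_cast congrArg (Int.cast : ℤ → ℂ) h2
  have h4 : (∑ g : Gh, g.sgn * (p'.1 g * (p'.1 g + 1)))
      = (∑ g : Gh, g.sgn * (p.1 g * (p.1 g + 1))) + 2 * zl e p.1
        + ∑ g : Gh, g.sgn * (e.2.1 g * (e.2.1 g + 1)) := by
    rw [h1, zl, Finset.mul_sum, ← Finset.sum_add_distrib, ← Finset.sum_add_distrib]
    refine Finset.sum_congr rfl fun g _ => ?_
    rw [Pi.add_apply]; ring
  have h5 : ∀ i, P.zm (.inl i) p'.1 = P.zm (.inl i) p.1 := fun i => rfl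
  rw [dval_eq, dval_eq, h4, h3, h5, h5]
  push_cast
  ring

/-- All terms of a current have the same conformal weight: the shift of the modes of a term makes up for
the quadratic function of its charge. -/
lemma off_terms (e : PM) (j : Fin 2) : ∀ T ∈ terms e j,
    ∑ g : Gh, g.sgn * (T.sym.chg g * (T.sym.chg g + 1)) = -2 * T.off := by
  cases e <;> fin_cases j <;> decide

/-- The operator `d`. -/
def dop : Module.End ℂ Fock := diag P.dval

lemma dop_hmode (j : Fin 2) (m : ℤ) :
    P.dop * P.hmode j m - P.hmode j m * P.dop = (m : ℂ) • P.hmode j m := by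
  have : P.dop * P.hmode j m = P.hmode j m * diag fun p => P.dval p + m :=
    diag_mul_eq fun p => ⟨_, _, P.hmode_shifts j m _ _ _ (ket_mem_grade p), fun p' h1 h2 => by
      rw [P.dval_add (e := 0) (N := -m) (by simpa using h1) (by simpa [zl] using h2)]
      simp⟩
  rw [this, diag_add_const, mul_add, mul_smul_comm, mul_one, dop, add_sub_cancel_left]

lemma dop_cur (e : PM) (j : Fin 2) (N : ℤ) :
    P.dop * P.cur e j N - P.cur e j N * P.dop = (-N : ℂ) • P.cur e j N := by
  rw [cur_sum]
  refine commutator_list fun T hT => ?_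
  have : P.dop * P.vertex (P.symE T.sym) (N + T.off)
      = P.vertex (P.symE T.sym) (N + T.off) * diag fun p => P.dval p + -N :=
    diag_mul_eq fun p => ⟨_, _, P.vertex_mem _ _ (ket_mem_grade p), fun p' h1 h2 => by
      rw [P.dval_add h1 h2, symE_chg, off_terms e j T hT]
      push_cast
      ring⟩
  rw [term, mul_smul_comm, this, diag_add_const, mul_add, mul_smul_comm, mul_one, smul_mul_assoc,
    dop]
  module

lemma dop_kop (i : Fin 2) : P.dop * P.kop i = P.kop i * P.dop := by
  rw [dop, kop, diag_mul_diag, diag_mul_diag]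
  simp only [mul_comm]

lemma kop_kop (i j : Fin 2) : P.kop i * P.kop j = P.kop j * P.kop i := by
  rw [kop, kop, diag_mul_diag, diag_mul_diag]
  simp only [mul_comm]

lemma translate_zero : translate 0 = 1 := op_ext fun p => by simp

/-- A vertex operator of charge `0` without creation modes. -/
lemma vertex_of_creA_eq_zero {e : Expo} (h0 : e.2.1 = 0) (h : ∀ m, m ≠ 0 → P.creA e m = 0)
    (N : ℤ) : P.vertex e N
      = if N ≤ 0 then (diag fun p => P.zq e p.1) * P.annCoeff e N.natAbs else 0 := by
  have hd : (diag fun p => P.zq e p.1) * P.annCoeff e N.natAbs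
      = P.annCoeff e N.natAbs * diag fun p => P.zq e p.1 :=
    diag_mul_eq fun p => ⟨_, _, P.annCoeff_shifts e _ _ _ _ (ket_mem_grade p), fun p' h1 _ => by
      rw [h1]⟩
  rw [hd]
  refine op_ext fun p => ?_
  rw [P.vertex_apply e N (ket_mem_grade p) (K := deg p + 1 + N.natAbs) (by omega)]
  have hz : zl e p.1 = 0 := by simp [zl, h0]
  have hc : ∀ m : ℤ, P.creCoeff e m = if m = 0 then 1 else 0 := fun m => by
    rw [creCoeff_eq]
    rcases m with m | m
    · change expCoeff (P.creA e) m = _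
      rw [expCoeff_of_zero h]
      simp
    · rfl
  simp only [hz, sub_zero, hc, h0, translate_zero, Module.End.one_apply]
  split_ifs with hN
  · rw [Finset.sum_eq_single N.natAbs]
    · rw [if_pos (by omega), Module.End.mul_apply, diag_ket, map_smul]; rfl
    · intro n _ hn
      rw [if_neg (by omega)]; rfl
    · intro hn; rw [mem_range] at hn; omega
  · rw [Finset.sum_eq_zero fun n _ => ?_, smul_zero]
    · rfl
    · rw [if_neg (by omega)]; rfl

/-- A vertex operator of charge `0` without annihilation modes. -/
lemma vertex_of_annA_eq_zero {e : Expo} (h0 : e.2.1 = 0) (h : ∀ m, m ≠ 0 → P.annA e m = 0)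
    (N : ℤ) : P.vertex e N = (diag fun p => P.zq e p.1) * P.creCoeff e N := by
  have hd : (diag fun p => P.zq e p.1) * P.creCoeff e N
      = P.creCoeff e N * diag fun p => P.zq e p.1 :=
    diag_mul_eq fun p => ⟨_, _, P.creCoeff_shifts e _ _ _ _ (ket_mem_grade p), fun p' h1 _ => by
      rw [h1]⟩
  rw [hd]
  refine op_ext fun p => ?_
  rw [P.vertex_apply e N (ket_mem_grade p) (K := deg p + 1) (by omega), Finset.sum_range_succ',
    Finset.sum_eq_zero fun n _ => ?_]
  · have hz : zl e p.1 = 0 := by simp [zl, h0]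
    rw [annCoeff_eq, expCoeff_zero, h0, translate_zero, hz, Module.End.mul_apply, diag_ket, map_smul]
    simp
  · rw [annCoeff_eq, expCoeff_of_zero h, if_neg (by omega)]
    simp

variable {P}

lemma symE_psi_chg (e : PM) (i : Fin 2) : (P.symE (.psi e i)).2.1 = 0 := by
  rw [symE_chg]
  cases e <;> fin_cases i <;> decide

lemma zq_psi_plus (hq : P.Generic) (i : Fin 2) (p : Idx) :
    P.zq (P.symE (.psi .plus i)) p.1 = qp P.lq (P.hzero i p) := by
  rw [zq, symE_psi_plus hq]
  congr 1
  have : (univ : Finset Gh) = {.b12, .b13, .b23, .c} := rfl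
  fin_cases i <;>
    simp [fplus, hzero, Fintype.sum_sum_type, this, Pi.single_apply] <;> ring

lemma zq_psi_minus (hq : P.Generic) (i : Fin 2) (p : Idx) :
    P.zq (P.symE (.psi .minus i)) p.1 = qp P.lq (-P.hzero i p) := by
  rw [zq, symE_psi_minus hq]
  congr 1
  have : (univ : Finset Gh) = {.b12, .b13, .b23, .c} := rfl
  fin_cases i <;>
    simp [fminus, hzero, Fintype.sum_sum_type, this, Pi.single_apply] <;> ring

lemma creA_psi_plus (hq : P.Generic) (i : Fin 2) (m : ℕ) :
    P.creA (P.symE (.psi .plus i)) m = 0 := by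
  have h : ∀ t y, P.creA (P.fplus t y) m = 0 := fun t y => by
    refine Finset.sum_eq_zero fun u _ => ?_
    rcases eq_or_ne u t with rfl | hu
    · simp [fplus]
    · simp [fplus, Pi.single_eq_of_ne hu]
  rw [symE_psi_plus hq]
  fin_cases i <;> simp [creA_add, creA_neg, h]

lemma annA_psi_minus (hq : P.Generic) (i : Fin 2) (m : ℕ) :
    P.annA (P.symE (.psi .minus i)) m = 0 := by
  have h : ∀ t y, P.annA (P.fminus t y) m = 0 := fun t y => by
    refine Finset.sum_eq_zero fun u _ => ?_
    rcases eq_or_ne u t with rfl | hu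
    · simp [fminus]
    · simp [fminus, Pi.single_eq_of_ne hu]
  rw [symE_psi_minus hq]
  fin_cases i <;> simp [annA_add, annA_neg, h]

lemma hfac_eq (m : ℕ) : P.hfac m = qp P.lq (-P.k / 2) ^ m * (qp P.lq 1 - qp P.lq (-1)) := by
  rw [hfac, ← qp_mul_nat, mul_comm]
  congr 2
  ring

lemma vop_psi_plus (hq : P.Generic) (i : Fin 2) (N : ℤ) : P.vop (.psi .plus i) N
    = if N ≤ 0 then qp P.lq (-P.k / 2) ^ N.natAbs • (P.kop i *
        expCoeff (fun m => (qp P.lq 1 - qp P.lq (-1)) • P.hmode i m) N.natAbs) else 0 := by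
  rw [vop, P.vertex_of_creA_eq_zero (symE_psi_chg _ _) fun m _ => creA_psi_plus hq i m]
  simp only [zq_psi_plus hq]
  refine if_congr Iff.rfl ?_ rfl
  rw [annCoeff_eq, expCoeff_congr (B := fun m => qp P.lq (-P.k / 2) ^ m •
    (qp P.lq 1 - qp P.lq (-1)) • P.hmode i m) fun m hm => by
      rw [annA_psi hq i hm, hfac_eq, smul_smul], expCoeff_rescale, mul_smul_comm]
  rfl

lemma vop_psi_minus (hq : P.Generic) (i : Fin 2) (N : ℤ) : P.vop (.psi .minus i) N
    = if 0 ≤ N then qp P.lq (-P.k / 2) ^ N.natAbs • ((diag fun p => qp P.lq (-P.hzero i p)) *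
        expCoeff (fun m => (-(qp P.lq 1 - qp P.lq (-1))) • P.hmode i (-m)) N.natAbs) else 0 := by
  rw [vop, P.vertex_of_annA_eq_zero (symE_psi_chg _ _) fun m _ => annA_psi_minus hq i m]
  simp only [zq_psi_minus hq]
  rw [creCoeff_eq]
  split_ifs with h
  · obtain ⟨n, rfl⟩ := Int.eq_ofNat_of_zero_le h
    rw [zext_natCast, expCoeff_congr (B := fun m => qp P.lq (-P.k / 2) ^ m •
    (-(qp P.lq 1 - qp P.lq (-1))) • P.hmode i (-m)) fun m hm => by
      rw [creA_psi hq i hm, hfac_eq, smul_smul, mul_neg], expCoeff_rescale, mul_smul_comm]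
    rfl
  · rw [zext_neg _ (by omega), mul_zero]

end Params

namespace Params

open Finset

variable (P : Params)

/-! ### The defining relations -/

/-- The action of the free algebra on the Drinfeld generators. -/
def rep : FA →ₐ[ℂ] Module.End ℂ Fock := FreeAlgebra.lift ℂ P.bos

lemma rep_ι (g : Gen) : P.rep (FreeAlgebra.ι ℂ g) = P.bos g := FreeAlgebra.lift_ι_apply _ _

lemma rep_h (i : Fin 2) {m : ℤ} (hm : m ≠ 0) : P.rep (FA.h i m) = P.hmode i m := by
  rw [FA.h, dif_pos hm, rep_ι]; rfl

lemma rep_K (i : Fin 2) : P.rep (FA.K i) = P.kop i := P.rep_ι _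

lemma rep_Kinv (i : Fin 2) : P.rep (FA.Kinv i) = diag fun p => qp P.lq (-P.hzero i p) := P.rep_ι _

lemma rep_d : P.rep FA.d = P.dop := P.rep_ι _

lemma rep_C (n : ℤ) : P.rep (FA.C n) = qp P.lq (n * P.k / 2) • 1 := by
  rw [FA.C]
  split_ifs with h
  · obtain ⟨m, rfl⟩ := Int.eq_ofNat_of_zero_le h
    rw [map_pow, rep_ι, bos, smul_pow, one_pow, ← qp_mul_nat, Int.natAbs_natCast]
    congr 2
    push_cast
    ring
  · obtain ⟨m, rfl⟩ := Int.exists_eq_neg_ofNat (by omega : n ≤ 0)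
    rw [map_pow, rep_ι, bos, smul_pow, one_pow, ← qp_mul_nat, Int.natAbs_neg, Int.natAbs_natCast]
    congr 2
    push_cast
    ring

lemma rep_X {P : Params} (hq : P.Generic) (e : PM) (i : Fin 2) (m : ℤ) :
    P.rep (FA.X e i m) = P.cur e i (-m) := by
  rw [FA.X, rep_ι, bos, current_eq_cur hq]

lemma rep_br (p : ℕ) (ξ : ℂ) (x y : FA) :
    P.rep (FA.br p ξ x y) = P.rep x * P.rep y - ((-1) ^ p * ξ) • (P.rep y * P.rep x) := by
  rw [FA.br, map_sub, map_mul, map_smul, map_mul]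

lemma kop_mul_inv (i : Fin 2) : P.kop i * (diag fun p => qp P.lq (-P.hzero i p)) = 1 := by
  rw [kop, diag_mul_diag, ← diag_one]
  simp only [← qp_add, add_neg_cancel, qp_zero]

lemma inv_mul_kop (i : Fin 2) : (diag fun p => qp P.lq (-P.hzero i p)) * P.kop i = 1 := by
  rw [kop, diag_mul_diag, ← diag_one]
  simp only [← qp_add, neg_add_cancel, qp_zero]

lemma qnum_neg (lq x : ℂ) : qnum lq (-x) = -qnum lq x := by
  rw [qnum, qnum, neg_neg, ← neg_div, neg_sub]

lemma rep_qnumC (n : ℤ) : P.rep (FA.qnumC P.lq n) = qnum P.lq (n * P.k) • 1 := by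
  rw [FA.qnumC, map_smul, map_sub, rep_C, rep_C, ← sub_smul, smul_smul, qnum, div_eq_inv_mul _ (_ - _),
    show ((2 * n : ℤ) : ℂ) * P.k / 2 = n * P.k by push_cast; ring,
    show ((-(2 * n) : ℤ) : ℂ) * P.k / 2 = -(n * P.k) by push_cast; ring]

variable {P}

lemma cartan_comm (i j : Fin 2) : cartan i j = cartan j i := by
  fin_cases i <;> fin_cases j <;> rfl

lemma hmode_commutator (hq : P.Generic) (i j : Fin 2) {m n : ℤ} (hm : m ≠ 0) (hn : n ≠ 0) :
    P.hmode i m * P.hmode j n - P.hmode j n * P.hmode i m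
      = if m + n = 0 then (qnum P.lq (cartan i j * m) / m * qnum P.lq (m * P.k)) • 1 else 0 := by
  obtain ⟨a, rfl | rfl⟩ := m.eq_nat_or_neg <;> obtain ⟨b, rfl | rfl⟩ := n.eq_nat_or_neg
  · have ha : a ≠ 0 := by omega
    have hb : b ≠ 0 := by omega
    rw [if_neg (by omega), hmode_pos hq i ha, hmode_pos hq j hb, sub_eq_zero]
    exact (((P.commute_annA _ _ ha hb).smul_left _).smul_right _).eq
  · rw [hmode_hmode hq i j (by omega) (by omega)]
    refine if_congr (by omega) ?_ rfl
    push_cast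
    rfl
  · have h := hmode_hmode hq j i (m := b) (n := a) (by omega) (by omega)
    rw [← neg_sub, h]
    split_ifs with h1 h2 h2
    · subst h1
      rw [cartan_comm j i]
      push_cast
      rw [mul_neg, qnum_neg, neg_mul, qnum_neg, ← neg_smul, neg_div_neg_eq, mul_neg]
    · omega
    · omega
    · simp
  · have ha : a ≠ 0 := by omega
    have hb : b ≠ 0 := by omega
    rw [if_neg (by omega), hmode_neg hq i ha, hmode_neg hq j hb, sub_eq_zero]
    exact (((P.commute_creA _ _ ha hb).smul_left _).smul_right _).eq

lemma hmode_cur_commutator (hq : P.Generic) (e : PM) (i j : Fin 2) {m : ℤ} (hm : m ≠ 0) (N : ℤ) :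
    P.hmode i m * P.cur e j N - P.cur e j N * P.hmode i m
      = (e.toInt * qnum P.lq (cartan i j * m) / m * qp P.lq (-(e.toInt * |m|) * P.k / 2))
        • P.cur e j (N - m) := by
  obtain ⟨a, rfl | rfl⟩ := m.eq_nat_or_neg
  · rw [hmode_cur hq e i j (by omega), Nat.abs_cast]
    simp only [Int.cast_natCast]
  · rw [hmode_neg_cur hq e i j (by omega), sub_neg_eq_add, abs_neg, Nat.abs_cast]
    push_cast
    rw [mul_neg, qnum_neg, mul_neg, neg_div_neg_eq]

lemma rep_psi_plus (i : Fin 2) (n : ℤ) : P.rep (FA.psi P.lq .plus i n) = if 0 ≤ n then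
    P.kop i * expCoeff (fun m => (qp P.lq 1 - qp P.lq (-1)) • P.hmode i m) n.natAbs else 0 := by
  rw [FA.psi]
  split_ifs
  · rw [map_mul, rep_K, map_expCoeff]
    congr 1
    refine expCoeff_congr (fun m hm => ?_) _
    rw [map_smul, rep_h _ _ (by exact_mod_cast hm)]
  · exact map_zero _

lemma rep_psi_minus (i : Fin 2) (n : ℤ) : P.rep (FA.psi P.lq .minus i n) = if n ≤ 0 then
    (diag fun p => qp P.lq (-P.hzero i p)) *
      expCoeff (fun m => (-(qp P.lq 1 - qp P.lq (-1))) • P.hmode i (-m)) n.natAbs else 0 := by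
  rw [FA.psi]
  split_ifs
  · rw [map_mul, rep_Kinv, map_expCoeff]
    congr 1
    refine expCoeff_congr (fun m hm => ?_) _
    rw [map_smul, rep_h _ _ (by simpa using hm)]
  · exact map_zero _

lemma vop_psi_plus_eq (hq : P.Generic) (i : Fin 2) (n : ℤ) : P.vop (.psi .plus i) (-n)
    = qp P.lq (-(n * P.k / 2)) • P.rep (FA.psi P.lq .plus i n) := by
  rw [vop_psi_plus hq, rep_psi_plus]
  by_cases h : 0 ≤ n
  · obtain ⟨m, rfl⟩ := Int.eq_ofNat_of_zero_le h
    rw [if_pos (by omega), if_pos h, Int.natAbs_neg, Int.natAbs_natCast, ← qp_mul_nat]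
    congr 2
    push_cast
    ring
  · rw [if_neg (by omega), if_neg h, smul_zero]

lemma vop_psi_minus_eq (hq : P.Generic) (i : Fin 2) (n : ℤ) : P.vop (.psi .minus i) (-n)
    = qp P.lq (n * P.k / 2) • P.rep (FA.psi P.lq .minus i n) := by
  rw [vop_psi_minus hq, rep_psi_minus]
  by_cases h : n ≤ 0
  · obtain ⟨m, rfl⟩ := Int.exists_eq_neg_ofNat h
    rw [if_pos (by omega), if_pos h, neg_neg, Int.natAbs_neg, Int.natAbs_natCast, ← qp_mul_nat]
    congr 2
    push_cast
    ring
  · rw [if_neg (by omega), if_neg h, smul_zero]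

/-- The relation between `X^{+,i}` and `X^{-,j}`. -/
lemma rep_X_X (hq : P.Generic) (i j : Fin 2) (m n : ℤ) :
    P.rep (FA.br (i.val * j.val) 1 (FA.X .plus i m) (FA.X .minus j n))
      = P.rep (if i = j then (qp P.lq 1 - qp P.lq (-1))⁻¹ •
          (FA.C (m - n) * FA.psi P.lq .plus j (m + n)
            - FA.C (n - m) * FA.psi P.lq .minus j (m + n)) else 0) := by
  have hdiag : ∀ i : Fin 2,
      P.iq • (P.qv (0, 1) ^ (-(-m)) • P.vop (.psi .plus i) (-m + -n)
        - P.qv (0, 1) ^ (-m) • P.vop (.psi .minus i) (-m + -n))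
      = P.rep ((qp P.lq 1 - qp P.lq (-1))⁻¹ •
          (FA.C (m - n) * FA.psi P.lq .plus i (m + n)
            - FA.C (n - m) * FA.psi P.lq .minus i (m + n))) := fun i => by
    rw [← neg_add, vop_psi_plus_eq hq, vop_psi_minus_eq hq, map_smul, map_sub, map_mul, map_mul,
      rep_C, rep_C, smul_mul_assoc, smul_mul_assoc, one_mul, one_mul, smul_smul, smul_smul, qv,
      ← qp_mul_int, ← qp_mul_int, ← qp_add, ← qp_add]
    have e1 : P.val (0, 1) * ((-(-m) : ℤ) : ℂ) + -(((m + n : ℤ) : ℂ) * P.k / 2)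
        = ((m - n : ℤ) : ℂ) * P.k / 2 := by
      simp only [val]; push_cast; ring
    have e2 : P.val (0, 1) * ((-m : ℤ) : ℂ) + ((m + n : ℤ) : ℂ) * P.k / 2
        = ((n - m : ℤ) : ℂ) * P.k / 2 := by
      simp only [val]; push_cast; ring
    rw [e1, e2]
    rfl
  have hoff : ∀ p : ℕ, brHom (-(-1) ^ p) (-m) (-n) (P.cur .plus i) (P.cur .minus j)
      = P.rep (FA.br p 1 (FA.X .plus i m) (FA.X .minus j n)) := fun p => by
    rw [rep_br, rep_X hq, rep_X hq, brHom_apply, mul_one, neg_smul, sub_eq_add_neg]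
  rw [← hoff]
  fin_cases i <;> fin_cases j
  · have := brHom_zero_zero hq (-m) (-n)
    rw [pow_one] at this
    simp only [Fin.zero_eta, if_true, mul_zero, pow_zero]
    rw [this, hdiag]
  · have := brHom_zero_one hq (-m) (-n)
    rw [pow_one] at this
    simp only [Fin.zero_eta, Fin.mk_one, zero_ne_one, if_false, zero_mul, pow_zero,
      map_zero]
    exact this
  · have := brHom_one_zero hq (-m) (-n)
    rw [pow_one] at this
    simp only [Fin.zero_eta, Fin.mk_one, one_ne_zero, if_false, mul_zero, pow_zero,
      map_zero]
    exact this
  · have := brHom_one_one hq (-m) (-n)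
    rw [pow_zero] at this
    simp only [Fin.mk_one, if_true, mul_one, pow_one, neg_neg]
    rw [this, hdiag]

lemma qp_eq_qv (n : ℤ) : qp P.lq n = P.qv (n, 0) := by simp [qv, val]

lemma quadHom_cur (hq : P.Generic) (e : PM) (j : Fin 2) (M N : ℤ) :
    quadHom (qp P.lq (e.toInt * cartan 0 j)) M N (P.cur e 0) (P.cur e j) = 0 := by
  have h : (e.toInt * cartan 0 j : ℂ) = ((e.toInt * cartan 0 j : ℤ) : ℂ) := by push_cast; rfl
  rw [h, qp_eq_qv]
  cases e <;> fin_cases j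
  · exact (quadHom_plus hq M N).1
  · exact (quadHom_plus hq M N).2
  · exact quadHom_minus_zero hq M N
  · exact quadHom_minus_mixed hq M N

/-- The quadratic relations. Exchanging the two currents leads back to one of the three relations with
`i = 1`, since `a_{22} = 0` is excluded. -/
lemma rep_quad (hq : P.Generic) (e : PM) (i j : Fin 2) (hij : cartan i j ≠ 0) (m n : ℤ) :
    P.rep (FA.br (i.val * j.val) (qp P.lq (e.toInt * cartan i j)) (FA.X e i (m + 1)) (FA.X e j n)
      + FA.br (i.val * j.val) (qp P.lq (e.toInt * cartan i j)) (FA.X e j (n + 1)) (FA.X e i m))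
      = 0 := by
  have hp : (-1 : ℂ) ^ (i.val * j.val) = 1 := by
    fin_cases i <;> fin_cases j <;> first | exact absurd rfl hij | simp
  rw [map_add, rep_br, rep_br, hp, one_mul, rep_X hq, rep_X hq, rep_X hq, rep_X hq]
  fin_cases i
  · have := quadHom_cur hq e j (-(m + 1)) (-n)
    rw [quadHom_apply, show -(m + 1) + 1 = -m by ring, show -n - 1 = -(n + 1) by ring] at this
    rw [← this]
    dsimp only [Fin.zero_eta]
    abel
  · fin_cases j
    · have := quadHom_cur hq e 1 (-(n + 1)) (-m)
      rw [quadHom_apply, show -(n + 1) + 1 = -n by ring, show -m - 1 = -(m + 1) by ring,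
        cartan_comm] at this
      rw [← this]
      dsimp only [Fin.zero_eta, Fin.mk_one]
      abel
    · exact absurd rfl hij

end Params

/-! ### Serre relations from quadratic relations -/

section Serre

open Finset Polynomial

variable {V : Type*} [AddCommGroup V] [Module ℂ V]

lemma seq_eq_zero_of_bounded_above {ξ : ℂ} {d : ℤ → V} (h : ∀ n, d (n - 1) = ξ • d n) {a : ℤ}
    (ha : ∀ n > a, d n = 0) (n : ℤ) : d n = 0 := by
  have : ∀ k : ℕ, d (a + 1 - k) = 0 := fun k => by
    induction k with
    | zero => exact ha _ (by simp)
    | succ k ih => rw [show a + 1 - ((k + 1 : ℕ) : ℤ) = a + 1 - k - 1 by push_cast; ring, h, ih,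
        smul_zero]
  rcases lt_or_ge a n with hn | hn
  · exact ha n hn
  · rw [show n = a + 1 - ((a + 1 - n).toNat : ℕ) by omega]
    exact this _

lemma seq_eq_zero_of_bounded_below {ξ : ℂ} {d : ℤ → V} (h : ∀ n, d n = ξ • d (n - 1)) {a : ℤ}
    (ha : ∀ n < a, d n = 0) (n : ℤ) : d n = 0 := by
  have := seq_eq_zero_of_bounded_above (ξ := ξ) (d := fun n => d (-n)) (a := -a)
    (fun n => by rw [h, show -(n - 1) - 1 = -n by ring]) (fun n hn => ha _ (by omega)) (-n)
  simpa using this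

/-- The convolution of `f(x) g(y)` with the restriction of `E` to the square `s × s`. -/
def boxSum (s : Finset ℤ) (E : ℤ → ℤ → V) (f g : ℤ → ℂ) (i j : ℤ) : V :=
  ∑ k ∈ s, ∑ l ∈ s, (f (i - k) * g (j - l)) • E k l

variable (s : Finset ℤ) (E : ℤ → ℤ → V)

lemma boxSum_left (f g : ℤ → ℂ) (a b : ℂ) (i j : ℤ) :
    a • boxSum s E f g (i - 1) j - b • boxSum s E f g i j
      = boxSum s E (fun n => a * f (n - 1) - b * f n) g i j := by
  simp only [boxSum, smul_sum, ← sum_sub_distrib]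
  refine sum_congr rfl fun k _ => sum_congr rfl fun l _ => ?_
  rw [smul_smul, smul_smul, ← sub_smul, sub_right_comm i 1 k]
  congr 1
  ring

lemma boxSum_right (f g : ℤ → ℂ) (a b : ℂ) (i j : ℤ) :
    a • boxSum s E f g i (j - 1) - b • boxSum s E f g i j
      = boxSum s E f (fun n => a * g (n - 1) - b * g n) i j := by
  simp only [boxSum, smul_sum, ← sum_sub_distrib]
  refine sum_congr rfl fun k _ => sum_congr rfl fun l _ => ?_
  rw [smul_smul, smul_smul, ← sub_smul, sub_right_comm j 1 l]
  congr 1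
  ring

/-- The coefficients of `1`. -/
def unitSeq (n : ℤ) : ℂ := if n = 0 then 1 else 0

/-- The coefficients of the expansion of `1 / (x - ξ)` at infinity. -/
def outSeq (ξ : ℂ) (n : ℤ) : ℂ := if n < 0 then ξ ^ (-n - 1) else 0

/-- The coefficients of the expansion of `1 / (ξ x - 1)` at zero. -/
def inSeq (ξ : ℂ) (n : ℤ) : ℂ := if 0 ≤ n then -ξ ^ n else 0

lemma outSeq_rec {ξ : ℂ} (hξ : ξ ≠ 0) (n : ℤ) :
    outSeq ξ (n - 1) - ξ * outSeq ξ n = unitSeq n := by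
  simp only [outSeq, unitSeq]
  rcases lt_trichotomy n 0 with h | rfl | h
  · rw [if_pos (by omega), if_pos h, if_neg h.ne, show -(n - 1) - 1 = 1 + (-n - 1) by ring,
      zpow_add₀ hξ, zpow_one, sub_self]
  · simp
  · rw [if_neg (by omega), if_neg (by omega), if_neg h.ne']; simp

lemma inSeq_rec {ξ : ℂ} (hξ : ξ ≠ 0) (n : ℤ) :
    ξ * inSeq ξ (n - 1) - inSeq ξ n = unitSeq n := by
  simp only [inSeq, unitSeq]
  rcases lt_trichotomy n 0 with h | rfl | h
  · rw [if_neg (by omega), if_neg (by omega), if_neg h.ne]; simp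
  · simp
  · rw [if_pos (by omega), if_pos h.le, if_neg h.ne']
    have : ξ ^ n = ξ ^ (n - 1) * ξ := by rw [← zpow_add_one₀ hξ, sub_add_cancel]
    rw [this]
    ring

lemma boxSum_out_left {ξ : ℂ} (hξ : ξ ≠ 0) (g : ℤ → ℂ) (i j : ℤ) :
    boxSum s E (outSeq ξ) g (i - 1) j - ξ • boxSum s E (outSeq ξ) g i j
      = boxSum s E unitSeq g i j := by
  have := boxSum_left s E (outSeq ξ) g 1 ξ i j
  simpa only [one_smul, one_mul, outSeq_rec hξ] using this

lemma boxSum_out_right {ξ : ℂ} (hξ : ξ ≠ 0) (f : ℤ → ℂ) (i j : ℤ) :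
    boxSum s E f (outSeq ξ) i (j - 1) - ξ • boxSum s E f (outSeq ξ) i j
      = boxSum s E f unitSeq i j := by
  have := boxSum_right s E f (outSeq ξ) 1 ξ i j
  simpa only [one_smul, one_mul, outSeq_rec hξ] using this

lemma boxSum_in_left {ξ : ℂ} (hξ : ξ ≠ 0) (g : ℤ → ℂ) (i j : ℤ) :
    ξ • boxSum s E (inSeq ξ) g (i - 1) j - boxSum s E (inSeq ξ) g i j
      = boxSum s E unitSeq g i j := by
  have := boxSum_left s E (inSeq ξ) g ξ 1 i j
  simpa only [one_smul, one_mul, inSeq_rec hξ] using this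

lemma boxSum_in_right {ξ : ℂ} (hξ : ξ ≠ 0) (f : ℤ → ℂ) (i j : ℤ) :
    ξ • boxSum s E f (inSeq ξ) i (j - 1) - boxSum s E f (inSeq ξ) i j
      = boxSum s E f unitSeq i j := by
  have := boxSum_right s E f (inSeq ξ) ξ 1 i j
  simpa only [one_smul, one_mul, inSeq_rec hξ] using this

variable {s E}

lemma boxSum_unit (hE : ∀ k l, k ∉ s ∨ l ∉ s → E k l = 0) (i j : ℤ) :
    boxSum s E unitSeq unitSeq i j = E i j := by
  rw [boxSum]
  by_cases h : i ∈ s ∧ j ∈ s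
  · rw [sum_eq_single i, sum_eq_single j]
    · simp [unitSeq]
    · intro l _ hl; rw [unitSeq, unitSeq, if_neg (sub_ne_zero.2 hl.symm), mul_zero, zero_smul]
    · exact fun hj => absurd h.2 hj
    · intro k _ hk
      refine sum_eq_zero fun l _ => ?_
      rw [unitSeq, if_neg (sub_ne_zero.2 hk.symm), zero_mul, zero_smul]
    · exact fun hi => absurd h.1 hi
  · rw [hE i j (by tauto)]
    refine sum_eq_zero fun k hk => sum_eq_zero fun l hl => ?_
    by_cases hki : i = k
    · have : j ≠ l := fun hjl => h ⟨hki ▸ hk, hjl ▸ hl⟩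
      rw [unitSeq, unitSeq, if_neg (sub_ne_zero.2 this), mul_zero, zero_smul]
    · rw [unitSeq, if_neg (sub_ne_zero.2 hki), zero_mul, zero_smul]

lemma boxSum_eq_zero_left {f g : ℤ → ℂ} {i j : ℤ} (h : ∀ k ∈ s, f (i - k) = 0) :
    boxSum s E f g i j = 0 :=
  sum_eq_zero fun k hk => sum_eq_zero fun l _ => by rw [h k hk, zero_mul, zero_smul]

lemma boxSum_eq_zero_right {f g : ℤ → ℂ} {i j : ℤ} (h : ∀ l ∈ s, g (j - l) = 0) :
    boxSum s E f g i j = 0 :=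
  sum_eq_zero fun k _ => sum_eq_zero fun l hl => by rw [h l hl, mul_zero, zero_smul]

/-- Two factors `x - ξ`, `y - ξ` are inverted on functions bounded above. -/
lemma eq_boxSum_out_out {ξ : ℂ} (hξ : ξ ≠ 0) {lo hi : ℤ} {E A : ℤ → ℤ → V}
    (hE : ∀ k l, k ∉ Icc lo hi ∨ l ∉ Icc lo hi → E k l = 0)
    (h : ∀ i j, A (i - 1) (j - 1) - ξ • A (i - 1) j - ξ • (A i (j - 1) - ξ • A i j) = E i j)
    {a : ℤ} (h1 : ∀ i j, i > a → A i j = 0) (h2 : ∀ i j, i + j > a → A i j = 0) (i j : ℤ) :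
    A i j = boxSum (Icc lo hi) E (outSeq ξ) (outSeq ξ) i j := by
  have hout : ∀ n > hi, ∀ k ∈ Icc lo hi, outSeq ξ (n - k) = 0 := fun n hn k hk => by
    rw [mem_Icc] at hk; exact if_neg (by omega)
  have e1 : ∀ i j, A i (j - 1) - ξ • A i j - boxSum (Icc lo hi) E (outSeq ξ) unitSeq i j = 0 := by
    intro i j
    refine seq_eq_zero_of_bounded_above (ξ := ξ) (a := max a hi) (d := fun i =>
      A i (j - 1) - ξ • A i j - boxSum (Icc lo hi) E (outSeq ξ) unitSeq i j) (fun i => ?_)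
      (fun i hi' => ?_) i
    · have := boxSum_out_left (Icc lo hi) E hξ unitSeq i j
      rw [boxSum_unit hE, ← h] at this
      linear_combination (norm := module) -this
    · have h3 := le_max_left a hi
      have h4 := le_max_right a hi
      rw [h1 _ _ (by omega), h1 _ _ (by omega), boxSum_eq_zero_left (hout i (by omega))]
      simp
  rw [← sub_eq_zero]
  refine seq_eq_zero_of_bounded_above (ξ := ξ) (a := max (a - i) hi) (d := fun j =>
    A i j - boxSum (Icc lo hi) E (outSeq ξ) (outSeq ξ) i j) (fun j => ?_) (fun j hj => ?_) j
  · have := boxSum_out_right (Icc lo hi) E hξ (outSeq ξ) i j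
    linear_combination (norm := module) e1 i j - this
  · have h3 := le_max_left (a - i) hi
    have h4 := le_max_right (a - i) hi
    rw [h2 _ _ (by omega), boxSum_eq_zero_right (hout j (by omega)), sub_zero]

/-- The factors `x - ξ`, `ξ y - 1` are inverted on functions bounded above in `x` and below in `y`. -/
lemma eq_boxSum_out_in {ξ : ℂ} (hξ : ξ ≠ 0) {lo hi : ℤ} {E A : ℤ → ℤ → V}
    (hE : ∀ k l, k ∉ Icc lo hi ∨ l ∉ Icc lo hi → E k l = 0)
    (h : ∀ i j, ξ • A (i - 1) (j - 1) - A (i - 1) j - ξ • (ξ • A i (j - 1) - A i j) = E i j)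
    {a c : ℤ} (h1 : ∀ i j, i > a → A i j = 0) (h2 : ∀ i j, j < c → A i j = 0) (i j : ℤ) :
    A i j = boxSum (Icc lo hi) E (outSeq ξ) (inSeq ξ) i j := by
  have hout : ∀ n > hi, ∀ k ∈ Icc lo hi, outSeq ξ (n - k) = 0 := fun n hn k hk => by
    rw [mem_Icc] at hk; exact if_neg (by omega)
  have hin : ∀ n < lo, ∀ k ∈ Icc lo hi, inSeq ξ (n - k) = 0 := fun n hn k hk => by
    rw [mem_Icc] at hk; exact if_neg (by omega)
  have e1 : ∀ i j, ξ • A i (j - 1) - A i j - boxSum (Icc lo hi) E (outSeq ξ) unitSeq i j = 0 := by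
    intro i j
    refine seq_eq_zero_of_bounded_above (ξ := ξ) (a := max a hi) (d := fun i =>
      ξ • A i (j - 1) - A i j - boxSum (Icc lo hi) E (outSeq ξ) unitSeq i j) (fun i => ?_)
      (fun i hi' => ?_) i
    · have := boxSum_out_left (Icc lo hi) E hξ unitSeq i j
      rw [boxSum_unit hE, ← h] at this
      linear_combination (norm := module) -this
    · have h3 := le_max_left a hi
      have h4 := le_max_right a hi
      rw [h1 _ _ (by omega), h1 _ _ (by omega), boxSum_eq_zero_left (hout i (by omega))]
      simp
  rw [← sub_eq_zero]
  refine seq_eq_zero_of_bounded_below (ξ := ξ) (a := min c lo) (d := fun j =>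
    A i j - boxSum (Icc lo hi) E (outSeq ξ) (inSeq ξ) i j) (fun j => ?_) (fun j hj => ?_) j
  · have := boxSum_in_right (Icc lo hi) E hξ (outSeq ξ) i j
    linear_combination (norm := module) this - e1 i j
  · have h3 := min_le_left c lo
    have h4 := min_le_right c lo
    rw [h2 _ _ (by omega), boxSum_eq_zero_right (hin j (by omega)), sub_zero]

/-- Two factors `ξ x - 1`, `ξ y - 1` are inverted on functions bounded below. -/
lemma eq_boxSum_in_in {ξ : ℂ} (hξ : ξ ≠ 0) {lo hi : ℤ} {E A : ℤ → ℤ → V}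
    (hE : ∀ k l, k ∉ Icc lo hi ∨ l ∉ Icc lo hi → E k l = 0)
    (h : ∀ i j, ξ • (ξ • A (i - 1) (j - 1) - A i (j - 1)) - (ξ • A (i - 1) j - A i j) = E i j)
    {c : ℤ} (h1 : ∀ i j, j < c → A i j = 0) (h2 : ∀ i j, i + j < c → A i j = 0) (i j : ℤ) :
    A i j = boxSum (Icc lo hi) E (inSeq ξ) (inSeq ξ) i j := by
  have hin : ∀ n < lo, ∀ k ∈ Icc lo hi, inSeq ξ (n - k) = 0 := fun n hn k hk => by
    rw [mem_Icc] at hk; exact if_neg (by omega)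
  have e1 : ∀ i j, ξ • A (i - 1) j - A i j - boxSum (Icc lo hi) E unitSeq (inSeq ξ) i j = 0 := by
    intro i j
    refine seq_eq_zero_of_bounded_below (ξ := ξ) (a := min c lo) (d := fun j =>
      ξ • A (i - 1) j - A i j - boxSum (Icc lo hi) E unitSeq (inSeq ξ) i j) (fun j => ?_)
      (fun j hj => ?_) j
    · have := boxSum_in_right (Icc lo hi) E hξ unitSeq i j
      rw [boxSum_unit hE, ← h] at this
      linear_combination (norm := module) this
    · have h3 := min_le_left c lo
      have h4 := min_le_right c lo
      rw [h1 _ _ (by omega), h1 _ _ (by omega), boxSum_eq_zero_right (hin j (by omega))]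
      simp
  rw [← sub_eq_zero]
  refine seq_eq_zero_of_bounded_below (ξ := ξ) (a := min (c - j) lo) (d := fun i =>
    A i j - boxSum (Icc lo hi) E (inSeq ξ) (inSeq ξ) i j) (fun i => ?_) (fun i hi' => ?_) i
  · have := boxSum_in_left (Icc lo hi) E hξ (inSeq ξ) i j
    linear_combination (norm := module) this - e1 i j
  · have h3 := min_le_left (c - j) lo
    have h4 := min_le_right (c - j) lo
    rw [h2 _ _ (by omega), boxSum_eq_zero_left (hin i (by omega)), sub_zero]

end Serre

section Serre

open Finset Polynomial

variable {V : Type*} [AddCommGroup V] [Module ℂ V]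

/-- The kernel `ξ / (ξ x - 1) - 1 / (x - ξ)`, where the two fractions are expanded at zero and at
infinity. -/
def kerSeq (ξ : ℂ) (n : ℤ) : ℂ := ξ * inSeq ξ n - outSeq ξ n

lemma kerSeq_sub_one {ξ : ℂ} (hξ : ξ ≠ 0) (n : ℤ) :
    kerSeq ξ (n - 1) = inSeq ξ n - ξ * outSeq ξ n := by
  rw [kerSeq]
  linear_combination inSeq_rec hξ n - outSeq_rec hξ n

lemma kerSeq_of_nonneg {ξ : ℂ} (hξ : ξ ≠ 0) {n : ℤ} (h : 0 ≤ n) : kerSeq ξ n = -ξ ^ (n + 1) := by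
  rw [kerSeq, inSeq, outSeq, if_pos h, if_neg (by omega), zpow_add_one₀ hξ]
  ring

lemma kerSeq_of_neg {ξ : ℂ} {n : ℤ} (h : n < 0) : kerSeq ξ n = -ξ ^ (-n - 1) := by
  rw [kerSeq, inSeq, outSeq, if_neg (by omega), if_pos h]
  ring

/-- The two-variable kernel of the Serre relation divided by `x - p ^ 2 y`. -/
lemma boxSum_kernel {p ξ : ℂ} (h : p * ξ = 1) (s : Finset ℤ) (E : ℤ → ℤ → V) (i j : ℤ) :
    (boxSum s E (kerSeq ξ) (kerSeq ξ) (i - 1) j - p ^ 2 • boxSum s E (kerSeq ξ) (kerSeq ξ) i (j - 1))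
      = (ξ - p) • (boxSum s E (outSeq ξ) (outSeq ξ) i j
        - (p + ξ) • boxSum s E (outSeq ξ) (inSeq ξ) i j + boxSum s E (inSeq ξ) (inSeq ξ) i j) := by
  have hξ : ξ ≠ 0 := right_ne_zero_of_mul_eq_one h
  simp only [boxSum, smul_sum, ← sum_sub_distrib, ← sum_add_distrib]
  refine sum_congr rfl fun k _ => sum_congr rfl fun l _ => ?_
  simp only [smul_smul, ← sub_smul, ← add_smul]
  rw [sub_right_comm i 1 k, sub_right_comm j 1 l, kerSeq_sub_one hξ, kerSeq_sub_one hξ, kerSeq,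
    kerSeq]
  congr 1
  generalize inSeq ξ (i - k) = t1
  generalize inSeq ξ (j - l) = t2
  generalize outSeq ξ (i - k) = u1
  generalize outSeq ξ (j - l) = u2
  linear_combination (-p * t1 * t2 + (p * ξ + 1) * t1 * u2 - p * u1 * u2) * h

lemma evalSeq_eq_sum {b : ℂ} {ν : ℤ → V} {s : Finset ℤ} (h : ∀ i, i ∉ s → ν i = 0) :
    evalSeq b ν = ∑ i ∈ s, b ^ (-i) • ν i :=
  finsum_eq_sum_of_support_subset _ fun i hi => by
    by_contra hc
    exact hi (by simp [h i hc])

lemma finSeq_of_bounds {ν : ℤ → V} {a b : ℤ} (h1 : ∀ n < a, ν n = 0) (h2 : ∀ n > b, ν n = 0) :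
    FinSeq ν := ⟨(|a| + |b|).toNat, fun i hi => by
  by_cases h : i < a
  · exact h1 i h
  · refine h2 i ?_
    have h3 := neg_abs_le a
    have h4 := le_abs_self b
    have h5 := abs_nonneg a
    have h6 := abs_nonneg b
    rcases abs_choice i with h7 | h7 <;> omega⟩

/-- The Serre relation for three functions `F`, `G`, `H` on `ℤ × ℤ`, the coefficients of
`x ^ i y ^ j`, up to a monomial factor, in the products `X(x) X(y) Y(1)`, `X(x) Y(1) X(y)`,
`Y(1) X(x) X(y)`, which are related by quadratic exchange relations and have bounded supports.

The functions `(x - ξ) (y - ξ) (x - p ^ 2 y) F`, `(x - ξ) (ξ y - 1) (x - p ^ 2 y) G` and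
`(ξ x - 1) (ξ y - 1) (x - p ^ 2 y) H` are equal to one function `E`, which is antisymmetric and has
finite support. The sequence `R` is the value of `(y - ξ) F` at `y = p`; the hypothesis on it forces `E`
to vanish at `(x, y) = (ξ, p)`. Therefore `x - p ^ 2 y` can be cancelled in the combination
`F - (p + ξ) G + H`, which becomes a multiple of `E κ(x) κ(y)` with `κ = ξ / (ξ x - 1) - 1 / (x - ξ)`.
This is antisymmetric in `x` and `y`. -/
theorem serre_of_quadratic {p ξ : ℂ} (h : p * ξ = 1) (hp : ξ ≠ p) {F G H : ℤ → ℤ → V} {a c : ℤ}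
    (hXX : ∀ i j, F (i - 1) j - p ^ 2 • F i (j - 1) + (F (j - 1) i - p ^ 2 • F j (i - 1)) = 0)
    (hXY : ∀ i j, F i (j - 1) - ξ • F i j = ξ • G i (j - 1) - G i j)
    (hYX : ∀ i j, G (i - 1) j - ξ • G i j = ξ • H (i - 1) j - H i j)
    (hF1 : ∀ i j, i > a → F i j = 0) (hF2 : ∀ i j, i + j > a → F i j = 0)
    (hG1 : ∀ i j, i > a → G i j = 0) (hG2 : ∀ i j, j < c → G i j = 0)
    (hH1 : ∀ i j, j < c → H i j = 0) (hH2 : ∀ i j, i + j < c → H i j = 0)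
    {R : ℤ → V} (hR : ∀ i, evalSeq ξ (fun j => F i (j - 1) - ξ • F i j) = R i) {b : ℤ}
    (hb : ∀ i < b, R (i - 1) - p ^ 3 • R i = 0) (i j : ℤ) :
    (F i j - (p + ξ) • G i j + H i j) + (F j i - (p + ξ) • G j i + H j i) = 0 := by
  have hξ : ξ ≠ 0 := right_ne_zero_of_mul_eq_one h
  have hp0 : p ≠ 0 := left_ne_zero_of_mul_eq_one h
  have hpξ : p = ξ⁻¹ := eq_inv_of_mul_eq_one_left h
  -- the factor `x - p ^ 2 y`
  let D : (ℤ → ℤ → V) → ℤ → ℤ → V := fun F i j => F (i - 1) j - p ^ 2 • F i (j - 1)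
  -- the common numerator
  let E : ℤ → ℤ → V := fun i j =>
    D F (i - 1) (j - 1) - ξ • D F (i - 1) j - ξ • (D F i (j - 1) - ξ • D F i j)
  have hEF : ∀ i j, E i j
      = D F (i - 1) (j - 1) - ξ • D F (i - 1) j - ξ • (D F i (j - 1) - ξ • D F i j) :=
    fun i j => rfl
  have hFG : ∀ i j, D F i (j - 1) - ξ • D F i j = ξ • D G i (j - 1) - D G i j := fun i j => by
    have h1 := hXY (i - 1) j
    have h2 := hXY i (j - 1)
    simp only [D]
    linear_combination (norm := module) h1 - p ^ 2 • h2
  have hGH : ∀ i j, D G (i - 1) j - ξ • D G i j = ξ • D H (i - 1) j - D H i j := fun i j => by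
    have h1 := hYX (i - 1) j
    have h2 := hYX i (j - 1)
    simp only [D]
    linear_combination (norm := module) h1 - p ^ 2 • h2
  have hEG : ∀ i j, E i j
      = ξ • D G (i - 1) (j - 1) - D G (i - 1) j - ξ • (ξ • D G i (j - 1) - D G i j) := fun i j => by
    rw [hEF, hFG, hFG]
  have hEH : ∀ i j, E i j
      = ξ • (ξ • D H (i - 1) (j - 1) - D H i (j - 1)) - (ξ • D H (i - 1) j - D H i j) :=
    fun i j => by
      rw [hEG]
      linear_combination (norm := module) ξ • hGH i (j - 1) - hGH i j
  -- by `hXX` the numerator changes its sign under exchange of `x` and `y`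
  have hanti : ∀ i j, E i j = -E j i := fun i j => by
    simp only [E, D]
    linear_combination (norm := module) hXX (i - 1) (j - 1) - ξ • hXX (i - 1) j - ξ • hXX i (j - 1)
      + ξ ^ 2 • hXX i j
  have hDF1 : ∀ i j, i > a + 1 → D F i j = 0 := fun i j hi => by
    simp only [D]; rw [hF1 _ _ (by omega), hF1 _ _ (by omega)]; simp
  have hDF2 : ∀ i j, i + j > a + 1 → D F i j = 0 := fun i j hi => by
    simp only [D]; rw [hF2 _ _ (by omega), hF2 _ _ (by omega)]; simp
  have hDG1 : ∀ i j, i > a + 1 → D G i j = 0 := fun i j hi => by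
    simp only [D]; rw [hG1 _ _ (by omega), hG1 _ _ (by omega)]; simp
  have hDG2 : ∀ i j, j < c → D G i j = 0 := fun i j hi => by
    simp only [D]; rw [hG2 _ _ (by omega), hG2 _ _ (by omega)]; simp
  have hDH1 : ∀ i j, j < c → D H i j = 0 := fun i j hi => by
    simp only [D]; rw [hH1 _ _ (by omega), hH1 _ _ (by omega)]; simp
  have hDH2 : ∀ i j, i + j < c → D H i j = 0 := fun i j hi => by
    simp only [D]; rw [hH2 _ _ (by omega), hH2 _ _ (by omega)]; simp
  have hE1 : ∀ i j, i > a + 2 → E i j = 0 := fun i j hi => by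
    rw [hEF, hDF1 _ _ (by omega), hDF1 _ _ (by omega), hDF1 _ _ (by omega), hDF1 _ _ (by omega)]
    simp
  have hE2 : ∀ i j, j < c → E i j = 0 := fun i j hi => by
    rw [hEH, hDH1 _ _ (by omega), hDH1 _ _ (by omega), hDH1 _ _ (by omega), hDH1 _ _ (by omega)]
    simp
  -- `F` bounds the support of the numerator from above in `x`, `H` bounds it from below in `y`, and
  -- antisymmetry yields the other two bounds
  have hE : ∀ k l, k ∉ Icc c (a + 2) ∨ l ∉ Icc c (a + 2) → E k l = 0 := by
    intro k l hkl
    simp only [mem_Icc] at hkl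
    by_cases h1 : k > a + 2
    · exact hE1 _ _ h1
    by_cases h2 : l < c
    · exact hE2 _ _ h2
    by_cases h3 : l > a + 2
    · rw [hanti, hE1 _ _ h3, neg_zero]
    by_cases h4 : k < c
    · rw [hanti, hE2 _ _ h4, neg_zero]
    omega
  set s := Icc c (a + 2)
  -- the boundedness of the supports singles out the regions of expansion
  have kF := eq_boxSum_out_out hξ hE (A := D F) (fun i j => rfl) hDF1 hDF2
  have kG := eq_boxSum_out_in hξ hE (A := D G) (fun i j => (hEG i j).symm) hDG1 hDG2
  have kH := eq_boxSum_in_in hξ hE (A := D H) (fun i j => (hEH i j).symm) hDH1 hDH2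
  have hξp : ξ - p ≠ 0 := sub_ne_zero.2 hp
  -- the numerator vanishes at `(x, y) = (ξ, p)`
  have hwheel : ∑ k ∈ s, ∑ l ∈ s, (p ^ (-k) * ξ ^ (-l)) • E k l = 0 := by
    let F' : ℤ → ℤ → V := fun i j => F i (j - 1) - ξ • F i j
    have hF'fin : ∀ i, FinSeq (F' i) := fun i => by
      refine finSeq_of_bounds (a := c) (b := a + 1 - i) (fun j hj => ?_) (fun j hj => ?_)
      · change F i (j - 1) - ξ • F i j = 0
        rw [hXY, hG2 _ _ (by omega), hG2 _ _ hj]; simp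
      · change F i (j - 1) - ξ • F i j = 0
        rw [hF2 _ _ (by omega), hF2 _ _ (by omega)]; simp
    -- at `y = p` the factor `x - p ^ 2 y` becomes `x - p ^ 3`
    have hrow : ∀ i, evalSeq ξ (E i) = act (X - C ξ) (fun i => R (i - 1) - p ^ 3 • R i) i := by
      intro i
      have e1 : E i = act (1 : ℂ[X]) (F' (i - 1 - 1)) + act (C (-p ^ 2) * X + C (-ξ)) (F' (i - 1))
          + act (C (ξ * p ^ 2) * X) (F' i) := by
        funext j
        simp only [act_one, Pi.add_apply, act_C_mul_X, act_add, act_C, Pi.smul_apply, E, D, F']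
        module
      rw [e1, evalSeq_add _ (((hF'fin _).act _).add ((hF'fin _).act _)) ((hF'fin _).act _),
        evalSeq_add _ ((hF'fin _).act _) ((hF'fin _).act _), evalSeq_act hξ (hF'fin _),
        evalSeq_act hξ (hF'fin _), evalSeq_act hξ (hF'fin _), hR, hR, hR, ← hpξ, act_X_sub]
      simp only [eval_one, eval_add, eval_mul, eval_C, eval_X]
      module
    -- the remaining factor `x - ξ` can only be evaluated at `x = ξ` because the sequence is finite
    have hQ : FinSeq fun i => R (i - 1) - p ^ 3 • R i := by
      have hR0 : ∀ i > a, R i = 0 := fun i hi => by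
        rw [← hR, show (fun j => F i (j - 1) - ξ • F i j) = 0 by
          funext j; rw [hF1 _ _ hi, hF1 _ _ hi]; simp]
        simp [evalSeq]
      exact finSeq_of_bounds (a := b) (b := a + 1) hb fun i hi => by
        rw [hR0 _ (by omega), hR0 _ (by omega)]; simp
    have h1 : evalSeq p (fun i => evalSeq ξ (E i)) = 0 := by
      rw [funext hrow, evalSeq_act hp0 hQ, eval_sub, eval_X, eval_C, hpξ, inv_inv, sub_self,
        zero_smul]
    rw [evalSeq_eq_sum (s := s) fun k hk => by
      rw [evalSeq_eq_sum (s := s) fun l _ => hE k l (Or.inl hk)]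
      exact sum_eq_zero fun l _ => by rw [hE k l (Or.inl hk), smul_zero]] at h1
    rw [← h1]
    refine sum_congr rfl fun k _ => ?_
    rw [evalSeq_eq_sum (s := s) fun l hl => hE k l (Or.inr hl), smul_sum]
    exact sum_congr rfl fun l _ => by rw [smul_smul]
  -- by antisymmetry it also vanishes at `(x, y) = (p, ξ)`
  have hwheel' : ∑ k ∈ s, ∑ l ∈ s, (ξ ^ (-k) * p ^ (-l)) • E k l = 0 := by
    rw [sum_comm, ← neg_eq_zero, ← hwheel, ← sum_neg_distrib]
    refine sum_congr rfl fun k _ => ?_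
    rw [← sum_neg_distrib]
    refine sum_congr rfl fun l _ => ?_
    rw [hanti k l, smul_neg, mul_comm]
  let K : ℤ → ℤ → V := fun i j => (ξ - p)⁻¹ • boxSum s E (kerSeq ξ) (kerSeq ξ) i j
  let S : ℤ → ℤ → V := fun i j => F i j - (p + ξ) • G i j + H i j
  have hSK : ∀ i j, D S i j = D K i j := fun i j => by
    have e1 : D K i j = (ξ - p)⁻¹ • (boxSum s E (kerSeq ξ) (kerSeq ξ) (i - 1) j
        - p ^ 2 • boxSum s E (kerSeq ξ) (kerSeq ξ) i (j - 1)) := by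
      simp only [D, K]; module
    have e2 : D S i j = D F i j - (p + ξ) • D G i j + D H i j := by
      simp only [D, S]; module
    rw [e1, boxSum_kernel h, smul_smul, inv_mul_cancel₀ hξp, one_smul, e2, kF, kG, kH]
  -- both sides vanish for large `i` on the line where `i + j` is constant: the kernel because it is
  -- there a multiple of the value of `E` at `(x, y) = (p, ξ)`
  have hS : ∀ i j, S i j = K i j := fun i j => by
    rw [← sub_eq_zero]
    have := seq_eq_zero_of_bounded_above (ξ := p ^ 2) (d := fun n => S n (i + j - n) - K n (i + j - n))
      (a := max (max a (i + j - c)) (max (a + 2) (i + j - c))) (fun n => ?_) (fun n hn => ?_) i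
    · simpa using this
    · have h1 := hSK n (i + j - (n - 1))
      simp only [D] at h1
      rw [show i + j - (n - 1) - 1 = i + j - n by ring] at h1
      linear_combination (norm := module) h1
    · have h3 := le_max_left (max a (i + j - c)) (max (a + 2) (i + j - c))
      have h4 := le_max_right (max a (i + j - c)) (max (a + 2) (i + j - c))
      have h5 := le_max_left a (i + j - c)
      have h6 := le_max_right a (i + j - c)
      have h7 := le_max_left (a + 2) (i + j - c)
      have hS0 : S n (i + j - n) = 0 := by
        simp only [S]
        rw [hF1 _ _ (by omega), hG1 _ _ (by omega), hH1 _ _ (by omega)]; simp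
      have hK0 : K n (i + j - n) = 0 := by
        have e1 : boxSum s E (kerSeq ξ) (kerSeq ξ) n (i + j - n)
            = ξ ^ (n + 1 - (i + j - n) - 1) • ∑ k ∈ s, ∑ l ∈ s, (ξ ^ (-k) * p ^ (-l)) • E k l := by
          rw [boxSum, smul_sum]
          refine sum_congr rfl fun k hk => ?_
          rw [smul_sum]
          refine sum_congr rfl fun l hl => ?_
          rw [mem_Icc] at hk hl
          rw [smul_smul, kerSeq_of_nonneg hξ (by omega), kerSeq_of_neg (by omega), hpξ, inv_zpow,
            ← zpow_neg, neg_neg, ← zpow_add₀ hξ, ← zpow_add₀ hξ, neg_mul_neg, ← zpow_add₀ hξ]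
          congr 2
          ring
        simp only [K]
        rw [e1, hwheel', smul_zero, smul_zero]
      rw [hS0, hK0, sub_zero]
  -- the kernel is symmetric and `E` is antisymmetric
  change S i j + S j i = 0
  rw [hS, hS]
  simp only [K]
  rw [← smul_add]
  have : boxSum s E (kerSeq ξ) (kerSeq ξ) j i = -boxSum s E (kerSeq ξ) (kerSeq ξ) i j := by
    rw [boxSum, sum_comm, boxSum, ← sum_neg_distrib]
    refine sum_congr rfl fun k _ => ?_
    rw [← sum_neg_distrib]
    refine sum_congr rfl fun l _ => ?_
    rw [hanti l k, smul_neg, mul_comm]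
  rw [this, add_neg_cancel, smul_zero]

end Serre

/-! ### Evaluation of products of currents -/

section Sequences

open Finset Polynomial

variable {V : Type*} [AddCommGroup V] [Module ℂ V]

lemma act_translate (q : ℂ[X]) (φ : ℤ → V) (o : ℤ) :
    act q (fun n => φ (n + o)) = fun n => act q φ (n + o) := by
  induction q using Polynomial.induction_on' with
  | add p q hp hq => rw [act_add, act_add, hp, hq]; rfl
  | monomial k c =>
    induction k generalizing c with
    | zero => rw [monomial_zero_left, act_C, act_C]; rfl
    | succ k ih =>
      rw [← monomial_mul_X, mul_comm, act_mul, ih]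
      funext n
      rw [act_X, act_mul, act_X, sub_add_eq_add_sub]

lemma evalSeq_translate {b : ℂ} (hb : b ≠ 0) (φ : ℤ → V) (o : ℤ) :
    evalSeq b (fun n => φ (n + o)) = b ^ o • evalSeq b φ := by
  rw [evalSeq, evalSeq, smul_finsum,
    ← finsum_comp_equiv (Equiv.addRight o) (f := fun i => b ^ o • b ^ (-i) • φ i)]
  refine finsum_congr fun n => ?_
  rw [Equiv.coe_addRight, smul_smul, ← zpow_add₀ hb]
  congr 2
  ring

lemma evalSeq_reflect {b : ℂ} (hb : b ≠ 0) (φ : ℤ → V) (K : ℤ) :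
    evalSeq b⁻¹ (fun n => φ (K - n)) = b ^ K • evalSeq b φ := by
  rw [evalSeq, evalSeq, smul_finsum, ← finsum_comp_equiv (Equiv.subLeft K)]
  refine finsum_congr fun n => ?_
  rw [Equiv.subLeft_apply, sub_sub_cancel, smul_smul, inv_zpow', ← zpow_add₀ hb]
  congr 2
  ring

lemma map_evalSeq (T : Module.End ℂ V) {φ : ℤ → V} (h : FinSeq φ) (b : ℂ) :
    evalSeq b (fun n => T (φ n)) = T (evalSeq b φ) := by
  have h2 := AddMonoidHom.map_finsum (f := fun i => b ^ (-i) • φ i) T.toAddMonoidHom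
    (h.finite.subset fun i hi hc => hi (by simp [hc]))
  refine Eq.trans (finsum_congr fun i => ?_) h2.symm
  exact (map_smul T _ _).symm

lemma FinSeq.translate {φ : ℤ → V} (h : FinSeq φ) (o : ℤ) : FinSeq fun n => φ (n + o) := by
  obtain ⟨B, hB⟩ := h
  refine ⟨B + o.natAbs, fun i hi => hB _ ?_⟩
  have := abs_sub_abs_le_abs_sub i (-o)
  rw [abs_neg, sub_neg_eq_add] at this
  push_cast at hi
  omega

/-- The sequence `φ` has finite support, and its value at `x = b⁻¹` is `v`. -/
def HasEval (b : ℂ) (φ : ℤ → V) (v : V) : Prop := FinSeq φ ∧ evalSeq b φ = v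

lemma HasEval.add {b : ℂ} {φ ψ : ℤ → V} {v w : V} (h : HasEval b φ v) (h' : HasEval b ψ w) :
    HasEval b (φ + ψ) (v + w) :=
  ⟨h.1.add h'.1, by rw [evalSeq_add b h.1 h'.1, h.2, h'.2]⟩

/-- The sequence vanishes for large indices. -/
def BddSupp (φ : ℤ → V) : Prop := ∃ m, ∀ n > m, φ n = 0

lemma BddSupp.add {φ ψ : ℤ → V} (h : BddSupp φ) (h' : BddSupp ψ) : BddSupp (φ + ψ) := by
  obtain ⟨m, hm⟩ := h
  obtain ⟨n, hn⟩ := h'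
  exact ⟨max m n, fun i hi => by
    rw [Pi.add_apply, hm i (lt_of_le_of_lt (le_max_left _ _) hi),
      hn i (lt_of_le_of_lt (le_max_right _ _) hi), add_zero]⟩

lemma FinSeq.bddSupp {φ : ℤ → V} (h : FinSeq φ) : BddSupp φ := by
  obtain ⟨B, hB⟩ := h
  exact ⟨B, fun i hi => hB i (lt_of_lt_of_le hi (le_abs_self i))⟩

/-- The inverse of the factor `1 - b x` can be evaluated away from the pole. If `a = b`, the factor
cancels instead. -/
lemma hasEval_of_act {a b : ℂ} (hb : b ≠ 0) {φ μ : ℤ → V} (hφ : FinSeq φ)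
    (hμ : FinSeq μ) (h : act (1 - C a * X) φ = act (1 - C b * X) μ) (h0 : evalSeq a μ = 0) :
    HasEval b φ 0 := by
  refine ⟨hφ, ?_⟩
  by_cases hab : a = b
  · subst hab
    have : φ = μ := by
      refine act_one_sub_injective h ?_ ?_
      · obtain ⟨B, hB⟩ := hφ
        exact ⟨-B, fun n hn => hB n (by have := neg_abs_le n; omega)⟩
      · obtain ⟨B, hB⟩ := hμ
        exact ⟨-B, fun n hn => hB n (by have := neg_abs_le n; omega)⟩
    rw [this, h0]
  · have h1 := congrArg (evalSeq b) h
    rw [evalSeq_act hb hφ, evalSeq_act hb hμ] at h1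
    simp only [eval_sub, eval_one, eval_mul, eval_C, eval_X, mul_inv_cancel₀ hb, sub_self,
      zero_smul] at h1
    refine (smul_eq_zero.1 h1).resolve_left fun h2 => hab ?_
    rw [sub_eq_zero, ← div_eq_mul_inv, eq_comm, div_eq_one_iff_eq hb] at h2
    exact h2

/-- A simple pole at which the residue vanishes is no pole. -/
lemma finSeq_of_evalSeq_eq_zero {b : ℂ} (hb : b ≠ 0) {φ ρ : ℤ → V}
    (h : act (1 - C b * X) φ = ρ) (hρ : FinSeq ρ) (h0 : evalSeq b ρ = 0)
    (h1 : ∃ m, ∀ n < m, φ n = 0) : FinSeq φ := by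
  obtain ⟨B, hB⟩ := hρ.bddSupp
  have hstep : ∀ K : ℕ, φ (B + K) = b ^ K • φ B := fun K => by
    rw [seq_telescope h, sum_eq_zero, add_zero]
    intro i hi
    rw [hB _ (by have := mem_range.1 hi; omega), smul_zero]
  have hgt : ∀ n ≥ B, φ n = b ^ n • b ^ (-B) • φ B := fun n hn => by
    obtain ⟨K, rfl⟩ := Int.le.dest hn
    rw [hstep, smul_smul, ← zpow_add₀ hb, show B + K + -B = (K : ℤ) by ring, zpow_natCast]
  -- the tail of `φ` is geometric; without it, `φ` solves the same equation
  have key := delta_seq hb (ψ := fun n => φ n - b ^ n • b ^ (-B) • φ B) h ?_ hρ h1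
    ⟨B, fun n hn => sub_eq_zero.2 (hgt n hn.le)⟩ B
  · rw [h0, smul_zero, sub_sub_cancel, ← hgt B le_rfl] at key
    obtain ⟨m, hm⟩ := h1
    refine finSeq_of_bounds hm (b := B) fun n hn => ?_
    rw [hgt n hn.le, key, smul_zero, smul_zero]
  · rw [← h]
    funext n
    rw [act_one_sub, act_one_sub]
    have : b ^ n = b * b ^ (n - 1) := by rw [mul_comm, ← zpow_add_one₀ hb, sub_add_cancel]
    rw [this]
    module

end Sequences

/-- The products `A[L - N] B[N] v` of modes of fixed total degree. -/
def prodHom (L : ℤ) (v : Fock) : OpSeq →+ OpSeq →+ (ℤ → Fock) :=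
  AddMonoidHom.mk' (fun A => AddMonoidHom.mk' (fun B N => A (L - N) (B N v))
    fun B B' => by funext N; simp)
    fun A A' => by ext1 B; funext N; simp

lemma prodHom_apply (L : ℤ) (v : Fock) (A B : OpSeq) (N : ℤ) :
    prodHom L v A B N = A (L - N) (B N v) := rfl

namespace Params

open Finset Polynomial

variable (P : Params)

/-- A multiple of a vertex operator with shifted modes. -/
def opt (c : ℂ) (s : Sym) (o : ℤ) : OpSeq := fun N => c • P.vertex (P.symE s) (N + o)

lemma prodHom_opt (L : ℤ) (p : Idx) (c c' : ℂ) (s t : Sym) (o o' : ℤ) :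
    prodHom L (ket p) (P.opt c s o) (P.opt c' t o') = (c * c') • fun N =>
      P.prodSeq (P.symE s) (P.symE t) p (L + o + o') (N + o') := by
  funext N
  simp only [prodHom_apply, opt, LinearMap.smul_apply, map_smul, prodSeq, Pi.smul_apply, smul_smul]
  rw [show L + o + o' - (N + o') = L - N + o by ring, mul_comm c']

variable {P}

/-- The dcoef factor arises from evaluating a product of two vertex operators. -/
lemma eval_normalSeq (hq : P.Generic) (s t : Sym) (num : List (ℤ × ℤ)) (a : ℤ × ℤ) (p : Idx)
    (L o o' : ℤ) : P.qv a ^ o' • evalSeq (P.qv a) (act (C (qp P.lq (qz (P.symE s) (P.symE t)))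
        * lin (num.map P.qv)) (P.normalSeq (P.symE s) (P.symE t) p (L + o + o')))
      = (P.qv a ^ (-L) * P.dcoef s t num a o) •
        P.vop (s.shift a ++ t) (L + (o + o' - s.zl t.chg)) (ket p) := by
  have hb := P.qv_ne_zero a
  rw [evalSeq_act hb (P.normalSeq_fin _ _ _ _), show P.qv a = qp P.lq (P.val a) from rfl,
    evalSeq_normalSeq, smul_smul, smul_smul, vop, symE_append, symE_shift, zp_symE,
    ← show P.qv a = qp P.lq (P.val a) from rfl, eval_mul, eval_C, P.qp_qz_symE hq.lq_ne, eval_lin,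
    List.map_map, show L + (o + o' - s.zl t.chg) = L + o + o' - s.zl t.chg by ring, dcoef,
    qp_mul_int, qp_neg, inv_zpow, ← zpow_neg, ← show P.qv a = qp P.lq (P.val a) from rfl]
  congr 1
  have e1 : (num.map ((fun b => 1 - b * (P.qv a)⁻¹) ∘ P.qv)).prod
      = (num.map fun n => 1 - P.qv (n - a)).prod := by
    congr 1
    refine List.map_congr_left fun n _ => ?_
    rw [Function.comp, sub_eq_add_neg n, qv_add, qv_neg]
  have e2 : P.qv a ^ o' * P.qv a ^ (-(L + o + o' - s.zl t.chg))
      = P.qv a ^ (-L) * P.qv a ^ (s.zl t.chg - o) := by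
    rw [← zpow_add₀ hb, ← zpow_add₀ hb]; congr 1; ring
  rw [e1]
  linear_combination (P.qv (s.qe t.chg) * (-1) ^ s.sg t.chg
    * (num.map fun n => 1 - P.qv (n - a)).prod) * e2

lemma lin_ratio (hq : P.Generic) {s t : Sym} {den num : List (ℤ × ℤ)}
    (h : Sym.HasRatio (Sym.contr s t) den num) (L : ℤ) (p : Idx) (c c' : ℂ) (o o' : ℤ) :
    act (lin (den.map P.qv)) (prodHom L (ket p) (P.opt c s o) (P.opt c' t o'))
      = (c * c') • fun N => act (C (qp P.lq (qz (P.symE s) (P.symE t))) * lin (num.map P.qv))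
          (P.normalSeq (P.symE s) (P.symE t) p (L + o + o')) (N + o') := by
  rw [prodHom_opt, map_smul, act_translate,
    P.prodSeq_rational _ _ p (L + o + o') (lin_mul_expSeries hq h)]

lemma finSeq_smul_translate {c : ℂ} {V : Type*} [AddCommGroup V] [Module ℂ V] {φ : ℤ → V}
    (h : FinSeq φ) (o : ℤ) : FinSeq (c • fun N => φ (N + o)) := (h.translate o).smul c

/-- The product of two vertex operators with a single pole, multiplied by the pole, can be evaluated
at `z = q ^ a w`. -/
lemma hasEval_opt (hq : P.Generic) {s t : Sym} {den num : List (ℤ × ℤ)}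
    (h : Sym.HasRatio (Sym.contr s t) den num) (a : ℤ × ℤ) (L : ℤ) (p : Idx) (c c' : ℂ)
    (o o' : ℤ) : HasEval (P.qv a)
      (act (lin (den.map P.qv)) (prodHom L (ket p) (P.opt c s o) (P.opt c' t o')))
      (P.qv a ^ (-L) • P.opt (c * c' * P.dcoef s t num a o) (s.shift a ++ t)
        (o + o' - s.zl t.chg) L (ket p)) := by
  rw [lin_ratio hq h]
  refine ⟨finSeq_smul_translate ((P.normalSeq_fin _ _ _ _).act _) o', ?_⟩
  rw [evalSeq_smul, evalSeq_translate (P.qv_ne_zero a), eval_normalSeq hq, opt, vop,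
    LinearMap.smul_apply, smul_smul, smul_smul]
  congr 1
  ring

/-- The evaluation vanishes at a zero of the contraction. -/
lemma hasEval_opt_zero (hq : P.Generic) {s t : Sym} {den num : List (ℤ × ℤ)} {a : ℤ × ℤ}
    (h : Sym.HasRatio (Sym.contr s t) den num ∧ a ∈ num) (L : ℤ) (p : Idx) (c c' : ℂ)
    (o o' : ℤ) : HasEval (P.qv a)
      (act (lin (den.map P.qv)) (prodHom L (ket p) (P.opt c s o) (P.opt c' t o'))) 0 := by
  have := hasEval_opt hq h.1 a L p c c' o o'
  have h0 : P.dcoef s t num a o = 0 := by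
    rw [dcoef, List.prod_eq_zero (List.mem_map.2 ⟨a, h.2, by rw [sub_self, qv_zero, sub_self]⟩)]
    ring
  rw [h0] at this
  simpa [opt] using this

lemma bddSupp_opt (hq : P.Generic) {s t : Sym} {den num : List (ℤ × ℤ)}
    (h : Sym.HasRatio (Sym.contr s t) den num) (L : ℤ) (p : Idx) (c c' : ℂ) (o o' : ℤ) :
    BddSupp (act (lin (den.map P.qv)) (prodHom L (ket p) (P.opt c s o) (P.opt c' t o'))) :=
  (hasEval_opt hq h 0 L p c c' o o').1.bddSupp

/-- Two products with an additional pole at `q ^ a`, such that the residues cancel. -/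
lemma finSeq_pair (hq : P.Generic) {s t s' t' : Sym} {θ a : ℤ × ℤ}
    {num num' : List (ℤ × ℤ)} {o o₁ o' o₁' : ℤ} {c c₁ c' c₁' : ℂ}
    (h : Sym.HasRatio (Sym.contr s t) [a, θ] num)
    (h' : Sym.HasRatio (Sym.contr s' t') [a, θ] num')
    (h1 : Sym.SameOp (s.shift a ++ t) (s'.shift a ++ t'))
    (h2 : o + o₁ - s.zl t.chg = o' + o₁' - s'.zl t'.chg)
    (h3 : c * c₁ * P.dcoef s t num a o + c' * c₁' * P.dcoef s' t' num' a o' = 0) (L : ℤ)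
    (p : Idx) : FinSeq (act (lin [P.qv θ]) (prodHom L (ket p) (P.opt c s o) (P.opt c₁ t o₁))
      + act (lin [P.qv θ]) (prodHom L (ket p) (P.opt c' s' o') (P.opt c₁' t' o₁'))) := by
  have hb := P.qv_ne_zero a
  have hlow : ∀ (s t : Sym) (o o₁ : ℤ) (c c₁ : ℂ), ∃ m, ∀ n < m,
      act (lin [P.qv θ]) (prodHom L (ket p) (P.opt c s o) (P.opt c₁ t o₁)) n = 0 :=
    fun s t o o₁ c c₁ => by
      obtain ⟨m, hm⟩ := act_bounded_below (lin [P.qv θ])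
        (P.prodSeq_bounded (P.symE s) (P.symE t) p (L + o + o₁))
      refine ⟨m - o₁, fun n hn => ?_⟩
      rw [prodHom_opt, map_smul, act_translate, Pi.smul_apply, hm _ (by omega), smul_zero]
  have e := hasEval_opt hq h a L p c c₁ o o₁
  have e' := hasEval_opt hq h' a L p c' c₁' o' o₁'
  refine finSeq_of_evalSeq_eq_zero hb ?_ (e.1.add e'.1) ?_ ?_
  · rw [map_add, ← act_mul, ← act_mul]
    rfl
  · rw [(e.add e').2, ← smul_add, opt, opt, P.vertex_sameOp hq.lq_ne h1, ← h2,
      LinearMap.smul_apply, LinearMap.smul_apply, ← add_smul, h3, zero_smul, smul_zero]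
  · obtain ⟨m, hm⟩ := hlow s t o o₁ c c₁
    obtain ⟨m', hm'⟩ := hlow s' t' o' o₁' c' c₁'
    exact ⟨min m m', fun n hn => by
      rw [Pi.add_apply, hm n (by omega), hm' n (by omega), add_zero]⟩

/-- The sum of two products with an additional pole at `q ^ a` vanishes at their common zero. -/
lemma hasEval_pair (hq : P.Generic) {s t s' t' : Sym} {θ a b : ℤ × ℤ}
    {num num' : List (ℤ × ℤ)} {o o₁ o' o₁' : ℤ} {c c₁ c' c₁' : ℂ}
    (h : Sym.HasRatio (Sym.contr s t) [a, θ] (b :: num))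
    (h' : Sym.HasRatio (Sym.contr s' t') [a, θ] (b :: num'))
    (h1 : Sym.SameOp (s.shift a ++ t) (s'.shift a ++ t'))
    (h2 : o + o₁ - s.zl t.chg = o' + o₁' - s'.zl t'.chg)
    (h3 : c * c₁ * P.dcoef s t num a o + c' * c₁' * P.dcoef s' t' num' a o' = 0) (L : ℤ)
    (p : Idx) : HasEval (P.qv b)
      (act (lin [P.qv θ]) (prodHom L (ket p) (P.opt c s o) (P.opt c₁ t o₁))
        + act (lin [P.qv θ]) (prodHom L (ket p) (P.opt c' s' o') (P.opt c₁' t' o₁'))) 0 := by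
  have hfin := finSeq_pair hq h h' h1 h2 (c := c) (c₁ := c₁) (c' := c') (c₁' := c₁') (by
    simp only [dcoef, List.map_cons, List.prod_cons] at h3 ⊢
    linear_combination (1 - P.qv (b - a)) * h3) L p
  let μ : Sym → Sym → List (ℤ × ℤ) → ℤ → ℤ → ℂ → ℤ → Fock := fun s t num o o₁ c =>
    c • fun N => act (C (qp P.lq (qz (P.symE s) (P.symE t))) * lin (num.map P.qv))
      (P.normalSeq (P.symE s) (P.symE t) p (L + o + o₁)) (N + o₁)
  have hμ : ∀ s t num o o₁ c, FinSeq (μ s t num o o₁ c) := fun s t num o o₁ c =>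
    finSeq_smul_translate ((P.normalSeq_fin _ _ _ _).act _) o₁
  have hact : ∀ (s t : Sym) (num : List (ℤ × ℤ)) (o o₁ : ℤ) (c c₁ : ℂ),
      Sym.HasRatio (Sym.contr s t) [a, θ] (b :: num) →
      act (1 - C (P.qv a) * X)
        (act (lin [P.qv θ]) (prodHom L (ket p) (P.opt c s o) (P.opt c₁ t o₁)))
      = act (1 - C (P.qv b) * X) (μ s t num o o₁ (c * c₁)) := by
    intro s t num o o₁ c c₁ h
    have := lin_ratio hq h L p c c₁ o o₁
    rw [← act_mul, show (1 - C (P.qv a) * X) * lin [P.qv θ] = lin ([a, θ].map P.qv) from rfl, this]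
    simp only [μ]
    rw [map_smul, act_translate, ← act_mul, List.map_cons, lin_cons]
    rw [show C (qp P.lq (qz (P.symE s) (P.symE t))) * ((1 - C (P.qv b) * X) * lin (num.map P.qv))
      = (1 - C (P.qv b) * X) * (C (qp P.lq (qz (P.symE s) (P.symE t))) * lin (num.map P.qv)) by ring]
  have heval : ∀ (s t : Sym) (num : List (ℤ × ℤ)) (o o₁ : ℤ) (c : ℂ),
      evalSeq (P.qv a) (μ s t num o o₁ c) = (c • P.dcoef s t num a (L + o) •
        P.vop (s.shift a ++ t) (L + o + (0 + o₁) - s.zl t.chg)) (ket p) := by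
    intro s t num o o₁ c
    simp only [μ]
    rw [evalSeq_smul, evalSeq_translate (P.qv_ne_zero a), eval_normalSeq hq]
    simp only [LinearMap.smul_apply]
    rw [show L + (o + o₁ - s.zl t.chg) = L + o + (0 + o₁) - s.zl t.chg by ring]
    congr 2
    rw [dcoef, dcoef, show s.zl t.chg - (L + o) = -L + (s.zl t.chg - o) by ring,
      zpow_add₀ (P.qv_ne_zero a)]
    ring
  refine hasEval_of_act (a := P.qv a) (P.qv_ne_zero b) hfin
    ((hμ s t num o o₁ (c * c₁)).add (hμ s' t' num' o' o₁' (c' * c₁'))) ?_ ?_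
  · rw [map_add, map_add, hact s t num o o₁ c c₁ h, hact s' t' num' o' o₁' c' c₁' h']
  · rw [evalSeq_add _ (hμ _ _ _ _ _ _) (hμ _ _ _ _ _ _), heval, heval]
    exact LinearMap.congr_fun (delta_cancel (P := P) hq h1 h2 h3 L 0) (ket p)

end Params

namespace Params

open Finset Polynomial

variable {P : Params}

/-! ### The Serre relations -/

/-- The term of `(z - ξ w) X(z) Y(w)` at `z = q ^ a w` that comes from two given terms of `X` and
`Y`; the list `num` describes the zeros of their contraction. -/
def merged (P : Params) (T U : Term) (num : List (ℤ × ℤ)) (a : ℤ × ℤ) : OpSeq :=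
  P.opt (P.coef T * P.coef U * P.dcoef T.sym U.sym num a T.off) (T.sym.shift a ++ U.sym)
    (T.off + U.off - T.sym.zl U.sym.chg)

lemma hasEval_term (hq : P.Generic) {T U : Term} {ξ : ℤ × ℤ} (num : List (ℤ × ℤ)) (a : ℤ × ℤ)
    (h : Sym.HasRatio (Sym.contr T.sym U.sym) [ξ] num) (L : ℤ) (p : Idx) :
    HasEval (P.qv a) (act (lin [P.qv ξ]) (prodHom L (ket p) (P.term T) (P.term U)))
      (P.qv a ^ (-L) • P.merged T U num a L (ket p)) :=
  hasEval_opt hq h a L p _ _ _ _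

lemma hasEval_term_zero (hq : P.Generic) {T U : Term} {ξ : ℤ × ℤ} {num : List (ℤ × ℤ)}
    {a : ℤ × ℤ} (h : Sym.HasRatio (Sym.contr T.sym U.sym) [ξ] num ∧ a ∈ num) (L : ℤ) (p : Idx) :
    HasEval (P.qv a) (act (lin [P.qv ξ]) (prodHom L (ket p) (P.term T) (P.term U))) 0 :=
  hasEval_opt_zero hq h L p _ _ _ _

lemma bddSupp_merged (hq : P.Generic) {S T U : Term} {θ a : ℤ × ℤ} {num : List (ℤ × ℤ)}
    (num' : List (ℤ × ℤ)) (h : Sym.HasRatio (Sym.contr S.sym (T.sym.shift a ++ U.sym)) [θ] num')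
    (L : ℤ) (p : Idx) :
    BddSupp (act (lin [P.qv θ]) (prodHom L (ket p) (P.term S) (P.merged T U num a))) :=
  bddSupp_opt hq h L p _ _ _ _

section Wheel

open Term

set_option maxRecDepth 4000

/-- The wheel condition for the positive currents: with `Z(w)` the value of `(z - q⁻¹ w) X^{+,1}(z) X^{+,2}(w)`
at `z = q w`, the product of `X^{+,1}(z)` and `Z(w)` has at most a simple pole, at `z = q ^ 3 w`. All
products of terms have the pole `z = q⁻¹ w`, and those with a zero at `z = q w` drop out of `Z`. -/
lemma wheel_plus (hq : P.Generic) : ∃ Z : OpSeq,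
    (∀ L p, HasEval (P.qv (1, 0))
      (act (lin [P.qv (-1, 0)]) (prodHom L (ket p) (P.cur .plus 0) (P.cur .plus 1)))
      (P.qv (1, 0) ^ (-L) • Z L (ket p))) ∧
    ∀ L p, BddSupp (act (lin [P.qv (3, 0)]) (prodHom L (ket p) (P.cur .plus 0) Z)) := by
  refine ⟨P.merged p1a p2a [(-1, 0)] (1, 0) + P.merged p1b p2a [(-1, 0)] (1, 0)
    + P.merged p1b p2b [(-1, 0)] (1, 0), fun L p => ?_, fun L p => ?_⟩
  · have h := (((hasEval_term hq (T := p1a) (U := p2a) (ξ := (-1, 0)) [(-1, 0)] (1, 0)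
        (by decide) L p).add
      (hasEval_term hq (T := p1b) (U := p2a) (ξ := (-1, 0)) [(-1, 0)] (1, 0) (by decide) L p)).add
      (hasEval_term hq (T := p1b) (U := p2b) (ξ := (-1, 0)) [(-1, 0)] (1, 0) (by decide) L p)).add
      (hasEval_term_zero hq (T := p1a) (U := p2b) (ξ := (-1, 0)) (num := [(1, 0)]) (a := (1, 0))
        (by decide) L p)
    rw [cur, cur]
    simp only [terms, List.map_cons, List.map_nil, List.sum_cons, List.sum_nil, add_zero, map_add,
      AddMonoidHom.add_apply, Pi.add_apply, LinearMap.add_apply, smul_add]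
    convert h using 1
    · abel
    · rw [add_zero]
  · have r : ∀ S T U num num', Sym.HasRatio (Sym.contr S.sym (T.sym.shift (1, 0) ++ U.sym)) [(3, 0)]
        num' → BddSupp (act (lin [P.qv (3, 0)])
          (prodHom L (ket p) (P.term S) (P.merged T U num (1, 0)))) :=
      fun S T U num num' h => bddSupp_merged hq num' h L p
    rw [cur]
    simp only [terms, List.map_cons, List.map_nil, List.sum_cons, List.sum_nil, add_zero, map_add,
      AddMonoidHom.add_apply]
    exact (((r p1a p1a p2a _ [(1, 0)] (by decide)).add (r p1b p1a p2a _ [(3, 0)] (by decide))).add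
      ((r p1a p1b p2a _ [(-1, 0)] (by decide)).add (r p1b p1b p2a _ [(1, 0)] (by decide)))).add
      ((r p1a p1b p2b _ [(1, 0)] (by decide)).add (r p1b p1b p2b _ [(1, 0)] (by decide)))

/-- The products of `X^{-,1}` and `X^{-,2}` that have a pole at `z = q ^ (-3 - 2 k) w`: the poles cancel
in the sum, which does not contribute at `z = q⁻¹ w`. -/
lemma hasEval_minus_pair (hq : P.Generic) (L : ℤ) (p : Idx) : HasEval (P.qv (-1, 0))
    (act (lin [P.qv (1, 0)]) (prodHom L (ket p) (P.term m1a) (P.term m2d))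
      + act (lin [P.qv (1, 0)]) (prodHom L (ket p) (P.term m1c) (P.term m2b))) 0 := by
  refine hasEval_pair hq (a := (-3, -2)) (b := (-1, 0)) (s := m1a.sym) (t := m2d.sym)
    (s' := m1c.sym) (t' := m2b.sym) (num := [(-1, -2)]) (num' := []) (by decide) (by decide)
    (by decide) (by decide) ?_ L p
  rw [dcoef, dcoef, show m1a.sym.qe m2d.sym.chg = 0 by decide,
    show m1a.sym.sg m2d.sym.chg = 0 by decide, show m1a.sym.zl m2d.sym.chg = 0 by decide,
    show m1c.sym.qe m2b.sym.chg = (-1, -1) by decide,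
    show m1c.sym.sg m2b.sym.chg = -1 by decide, show m1c.sym.zl m2b.sym.chg = -1 by decide]
  obtain ⟨hi, hi'⟩ := iq_eq hq
  have h1 := P.qv_ne_zero (1, 0)
  have h2 := P.qv_ne_zero (0, 1)
  simp only [coef, m1a, m1c, m2b, m2d, List.map_cons, List.map_nil, List.prod_cons, List.prod_nil,
    Prod.mk_sub_mk, qv_zero, qv_eq (-1) (-1), qv_eq 1 1, qv_eq (-1 - -3) (-2 - -2), hi]
  norm_num
  field_simp
  ring

/-- The products of a term of `X^{-,1}` with a fused term that have a pole at `z = q ^ (-3 - 2 k) w`: the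
poles cancel in the sum. -/
lemma bddSupp_wheel_pair (hq : P.Generic) (L : ℤ) (p : Idx) : BddSupp
    (act (lin [P.qv (-3, 0)])
        (prodHom L (ket p) (P.term m1a) (P.merged m1b m2d [(1, 0)] (-1, 0)))
      + act (lin [P.qv (-3, 0)])
        (prodHom L (ket p) (P.term m1c) (P.merged m1b m2b [(1, 0)] (-1, 0)))) := by
  refine (finSeq_pair hq (a := (-3, -2)) (s := m1a.sym)
    (t := m1b.sym.shift (-1, 0) ++ m2d.sym) (s' := m1c.sym)
    (t' := m1b.sym.shift (-1, 0) ++ m2b.sym) (num := [(-1, 0), (-1, -2)])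
    (num' := [(-1, 0)]) (by decide) (by decide)
    (by decide) (by decide) ?_ L p).bddSupp
  rw [dcoef, dcoef, dcoef, dcoef,
    show m1b.sym.qe m2d.sym.chg = 0 by decide,
    show m1b.sym.sg m2d.sym.chg = 0 by decide, show m1b.sym.zl m2d.sym.chg = 0 by decide,
    show m1b.sym.qe m2b.sym.chg = (-1, 0) by decide,
    show m1b.sym.sg m2b.sym.chg = 0 by decide, show m1b.sym.zl m2b.sym.chg = 0 by decide,
    show m1a.sym.qe (m1b.sym.shift (-1, 0) ++ m2d.sym).chg = (-1, 0) by decide,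
    show m1a.sym.sg (m1b.sym.shift (-1, 0) ++ m2d.sym).chg = 0 by decide,
    show m1a.sym.zl (m1b.sym.shift (-1, 0) ++ m2d.sym).chg = 0 by decide,
    show m1c.sym.qe (m1b.sym.shift (-1, 0) ++ m2b.sym).chg = (-1, -1) by decide,
    show m1c.sym.sg (m1b.sym.shift (-1, 0) ++ m2b.sym).chg = -1 by decide,
    show m1c.sym.zl (m1b.sym.shift (-1, 0) ++ m2b.sym).chg = -1 by decide]
  obtain ⟨hi, hi'⟩ := iq_eq hq
  have h1 := P.qv_ne_zero (1, 0)
  have h2 := P.qv_ne_zero (0, 1)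
  simp only [coef, m1a, m1b, m1c, m2b, m2d, List.map_cons, List.map_nil, List.prod_cons,
    List.prod_nil, Prod.mk_sub_mk, qv_zero, qv_eq (-1) (-1), qv_eq (-1) 0, qv_eq 1 1,
    qv_eq (-1 - -3) (0 - -2), qv_eq (-1 - -3) (-2 - -2), qv_eq (1 - -1) (0 - 0), hi]
  norm_num
  field_simp
  ring

/-- The wheel condition for the negative currents, with `q` replaced by `q⁻¹`. -/
lemma wheel_minus (hq : P.Generic) : ∃ Z : OpSeq,
    (∀ L p, HasEval (P.qv (-1, 0))
      (act (lin [P.qv (1, 0)]) (prodHom L (ket p) (P.cur .minus 0) (P.cur .minus 1)))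
      (P.qv (-1, 0) ^ (-L) • Z L (ket p))) ∧
    ∀ L p, BddSupp (act (lin [P.qv (-3, 0)]) (prodHom L (ket p) (P.cur .minus 0) Z)) := by
  refine ⟨P.merged m1b m2a [(1, 0)] (-1, 0) + P.merged m1b m2b [(1, 0)] (-1, 0)
    + P.merged m1b m2d [(1, 0)] (-1, 0) + P.merged m1c m2a [] (-1, 0), fun L p => ?_,
    fun L p => ?_⟩
  · have e : ∀ T U num, Sym.HasRatio (Sym.contr T.sym U.sym) [(1, 0)] num →
        HasEval (P.qv (-1, 0)) (act (lin [P.qv (1, 0)]) (prodHom L (ket p) (P.term T) (P.term U)))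
          (P.qv (-1, 0) ^ (-L) • P.merged T U num (-1, 0) L (ket p)) :=
      fun T U num h => hasEval_term hq num (-1, 0) h L p
    have z : ∀ T U num, (Sym.HasRatio (Sym.contr T.sym U.sym) [(1, 0)] num ∧ (-1, 0) ∈ num) →
        HasEval (P.qv (-1, 0)) (act (lin [P.qv (1, 0)]) (prodHom L (ket p) (P.term T) (P.term U)))
          0 := fun T U num h => hasEval_term_zero hq h L p
    have h := (((((e m1b m2a [(1, 0)] (by decide)).add (e m1b m2b [(1, 0)] (by decide))).add
      (e m1b m2d [(1, 0)] (by decide))).add (e m1c m2a [] (by decide))).add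
      (hasEval_minus_pair hq L p)).add
      ((((z m1a m2a [(-1, 0)] (by decide)).add (z m1a m2b [(-1, 0)] (by decide))).add
      ((z m1a m2c [(-1, 0)] (by decide)).add (z m1b m2c [(-1, 0)] (by decide)))).add
      ((z m1c m2c [(-1, 0), (-1, -2)] (by decide)).add
        (z m1c m2d [(-1, 0), (-1, -2)] (by decide))))
    rw [cur, cur]
    simp only [terms, List.map_cons, List.map_nil, List.sum_cons, List.sum_nil, add_zero, map_add,
      AddMonoidHom.add_apply, Pi.add_apply, LinearMap.add_apply, smul_add]
    convert h using 1
    · abel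
    · simp only [add_zero]
  · have r : ∀ S T U num num', Sym.HasRatio (Sym.contr S.sym (T.sym.shift (-1, 0) ++ U.sym))
        [(-3, 0)] num' → BddSupp (act (lin [P.qv (-3, 0)])
          (prodHom L (ket p) (P.term S) (P.merged T U num (-1, 0)))) :=
      fun S T U num num' h => bddSupp_merged hq num' h L p
    have h := ((((((r m1a m1b m2a [(1, 0)] [(-1, 0)] (by decide)).add
      (r m1b m1b m2a [(1, 0)] [(-1, 0)] (by decide))).add
      (r m1c m1b m2a [(1, 0)] [] (by decide))).add
      ((r m1a m1b m2b [(1, 0)] [(-1, 0)] (by decide)).add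
      (r m1b m1b m2b [(1, 0)] [(-1, 0)] (by decide)))).add
      ((r m1b m1b m2d [(1, 0)] [(-1, 0)] (by decide)).add
      (r m1c m1b m2d [(1, 0)] [(-1, 0), (-1, -2)] (by decide)))).add
      (((r m1a m1c m2a [] [(-1, 0)] (by decide)).add
      (r m1b m1c m2a [] [(-3, 0)] (by decide))).add
      (r m1c m1c m2a [] [(-3, 0), (-1, 0)] (by decide)))).add (bddSupp_wheel_pair hq L p)
    rw [cur]
    simp only [terms, List.map_cons, List.map_nil, List.sum_cons, List.sum_nil, add_zero, map_add,
      AddMonoidHom.add_apply]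
    convert h using 1
    abel

end Wheel

end Params

namespace Params

open Finset Polynomial

variable {P : Params}

lemma exists_bound_vop (T U : Term) (p : Idx) : ∃ c : ℤ, (∀ n < c, P.term U n (ket p) = 0) ∧
    ∀ m n, m + n < c → P.term T m (P.term U n (ket p)) = 0 := by
  set e := P.symE T.sym
  set f := P.symE U.sym
  have hU : ∀ n, P.term U n (ket p) ∈ grade (p.1 + f.2.1) (deg p + (n + U.off - zl f p.1)) :=
    fun n => Submodule.smul_mem _ _ (P.vertex_mem f _ (ket_mem_grade p))
  refine ⟨min (zl f p.1 - deg p - U.off)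
    (zl f p.1 + zl e (p.1 + f.2.1) - deg p - U.off - T.off), fun n hn => ?_, fun m n hn => ?_⟩
  · exact grade_neg (by have := lt_min_iff.1 hn; omega) (hU n)
  · rw [term, LinearMap.smul_apply, P.vertex_eq_zero e _ (hU n), smul_zero]
    have := lt_min_iff.1 hn
    omega

/-- Products of two modes of currents vanish on a given vector if the total degree is too small. -/
lemma exists_bound (e e' : PM) (i j : Fin 2) (p : Idx) :
    ∃ c : ℤ, (∀ n < c, P.cur e' j n (ket p) = 0) ∧
      ∀ m n, m + n < c → P.cur e i m (P.cur e' j n (ket p)) = 0 := by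
  have h1 : ∀ (U : Term) (l : List Term), ∃ c : ℤ, (∀ n < c, P.term U n (ket p) = 0) ∧
      ∀ m n, m + n < c → (l.map P.term).sum m (P.term U n (ket p)) = 0 := fun U l => by
    induction l with
    | nil =>
      obtain ⟨c, hc, -⟩ := exists_bound_vop (P := P) U U p
      exact ⟨c, hc, fun m n _ => rfl⟩
    | cons T l ih =>
      obtain ⟨c, hc, hc'⟩ := ih
      obtain ⟨b, -, hb'⟩ := exists_bound_vop (P := P) T U p
      refine ⟨min b c, fun n hn => hc n (lt_min_iff.1 hn).2, fun m n hn => ?_⟩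
      rw [List.map_cons, List.sum_cons, Pi.add_apply, LinearMap.add_apply,
        hb' m n (lt_min_iff.1 hn).1, hc' m n (lt_min_iff.1 hn).2, add_zero]
  have h2 : ∀ l l' : List Term, ∃ c : ℤ, (∀ n < c, (l'.map P.term).sum n (ket p) = 0) ∧
      ∀ m n, m + n < c → (l.map P.term).sum m ((l'.map P.term).sum n (ket p)) = 0 := by
    intro l l'
    induction l' with
    | nil => exact ⟨0, fun n _ => rfl, fun m n _ => map_zero _⟩
    | cons U l' ih' =>
      obtain ⟨c, hc, hc'⟩ := h1 U l
      obtain ⟨b, hb, hb'⟩ := ih'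
      refine ⟨min b c, fun n hn => ?_, fun m n hn => ?_⟩ <;>
        rw [List.map_cons, List.sum_cons, Pi.add_apply, LinearMap.add_apply]
      · rw [hb n (lt_min_iff.1 hn).1, hc n (lt_min_iff.1 hn).2, add_zero]
      · rw [map_add, hb' m n (lt_min_iff.1 hn).1, hc' m n (lt_min_iff.1 hn).2, add_zero]
  exact h2 _ _

/-- The Serre relation for currents, from the quadratic relations and a wheel condition. -/
lemma serre_of_wheel {X Y Z : OpSeq} {p : ℂ} (hp0 : p ≠ 0) (hp : p⁻¹ ≠ p)
    (hXX : ∀ M N, quadHom (p ^ 2) M N X X = 0) (hXY : ∀ M N, quadHom p⁻¹ M N X Y = 0)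
    (hZ : ∀ L v, HasEval p (act (lin [p⁻¹]) (prodHom L (ket v) X Y)) (p ^ (-L) • Z L (ket v)))
    (hW : ∀ L v, BddSupp (act (lin [p ^ 3]) (prodHom L (ket v) X Z)))
    (hb : ∀ v, ∃ c : ℤ, (∀ n < c, X n (ket v) = 0) ∧ (∀ n < c, Y n (ket v) = 0) ∧
      (∀ m n, m + n < c → X m (X n (ket v)) = 0) ∧ (∀ m n, m + n < c → X m (Y n (ket v)) = 0) ∧
      ∀ m n, m + n < c → Y m (X n (ket v)) = 0) (i j m : ℤ) :
    X i * X j * Y m - (p + p⁻¹) • (X i * Y m * X j) + Y m * X i * X j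
      + (X j * X i * Y m - (p + p⁻¹) • (X j * Y m * X i) + Y m * X j * X i) = 0 := by
  refine op_ext fun v => ?_
  obtain ⟨c, c1, c2, c3, c4, c5⟩ := hb v
  set L := i + j + m
  set w := ket v
  have hXY' : ∀ (M N : ℤ) (u : Fock), X M (Y N u) - p⁻¹ • X (M + 1) (Y (N - 1) u)
      + (Y (N - 1) (X (M + 1) u) - p⁻¹ • Y N (X M u)) = 0 := fun M N u =>
    LinearMap.congr_fun (hXY M N) u
  obtain ⟨b, hb⟩ := hW L v
  have key := serre_of_quadratic (p := p) (ξ := p⁻¹) (mul_inv_cancel₀ hp0) hp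
    (F := fun i j => X i (X j (Y (L - i - j) w))) (G := fun i j => X i (Y (L - i - j) (X j w)))
    (H := fun i j => Y (L - i - j) (X i (X j w))) (a := L - c) (c := c) ?_ ?_ ?_
    (fun i j h => ?_) (fun i j h => ?_) (fun i j h => ?_) (fun i j h => ?_) (fun i j h => ?_)
    (fun i j h => ?_) (R := fun i => p • X i (Z (L - i) w)) (fun i => ?_) (b := L - b + 1)
    (fun i h => ?_) i j
  · rw [LinearMap.zero_apply, ← key]
    simp only [show L - i - j = m by simp only [L]; ring, show L - j - i = m by simp only [L]; ring]
    rfl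
  · intro i j
    have := LinearMap.congr_fun (hXX (i - 1) j) (Y (L - i - j + 1) w)
    simp only [quadHom_apply, sub_add_cancel] at this
    simp only [show L - (i - 1) - j = L - i - j + 1 by ring,
      show L - i - (j - 1) = L - i - j + 1 by ring, show L - (j - 1) - i = L - i - j + 1 by ring,
      show L - j - (i - 1) = L - i - j + 1 by ring]
    exact this
  · intro i j
    have := congrArg (X i) (hXY' (j - 1) (L - i - j + 1) w)
    simp only [sub_add_cancel, add_sub_cancel_right, map_add, map_sub, map_smul, map_zero] at this
    simp only [show L - i - (j - 1) = L - i - j + 1 by ring]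
    linear_combination (norm := module) this
  · intro i j
    have := hXY' (i - 1) (L - i - j + 1) (X j w)
    simp only [sub_add_cancel, add_sub_cancel_right] at this
    simp only [show L - (i - 1) - j = L - i - j + 1 by ring]
    linear_combination (norm := module) this
  · rw [c4 _ _ (by omega), map_zero]
  · rw [c2 _ (by omega), map_zero, map_zero]
  · rw [c5 _ _ (by omega), map_zero]
  · rw [c1 _ (by omega), map_zero, map_zero]
  · rw [c1 _ (by omega), map_zero, map_zero]
  · rw [c3 _ _ (by omega), map_zero]
  · obtain ⟨h1, h2⟩ := hZ (L - i) v
    rw [show (fun j => X i (X (j - 1) (Y (L - i - (j - 1)) w)) - p⁻¹ • X i (X j (Y (L - i - j) w)))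
      = fun j => X i (act (lin [p⁻¹]) (prodHom (L - i) w X Y) (L - i + 1 - j)) by
        funext j
        rw [lin_cons, lin_nil, mul_one, act_one_sub, prodHom_apply, prodHom_apply, map_sub, map_smul,
          show L - i - (L - i + 1 - j) = j - 1 by ring, show L - i + 1 - j - 1 = L - i - j by ring,
          show L - i - (L - i - j) = j by ring, show L - i + 1 - j = L - i - (j - 1) by ring],
      evalSeq_reflect hp0 (fun n => X i (act (lin [p⁻¹]) (prodHom (L - i) w X Y) n)),
      map_evalSeq _ h1, h2, map_smul, smul_smul, ← zpow_add₀ hp0,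
      show L - i + 1 + -(L - i) = 1 by ring, zpow_one]
  · have := hb (L - i + 1) (by omega)
    rw [lin_cons, lin_nil, mul_one, act_one_sub, prodHom_apply, prodHom_apply,
      show L - (L - i + 1) = i - 1 by ring, show L - i + 1 - 1 = L - i by ring,
      show L - (L - i) = i by ring] at this
    rw [show L - (i - 1) = L - i + 1 by ring]
    linear_combination (norm := module) p • this

lemma exists_bound_serre (e : PM) (p : Idx) : ∃ c : ℤ, (∀ n < c, P.cur e 0 n (ket p) = 0) ∧
    (∀ n < c, P.cur e 1 n (ket p) = 0) ∧
    (∀ m n, m + n < c → P.cur e 0 m (P.cur e 0 n (ket p)) = 0) ∧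
    (∀ m n, m + n < c → P.cur e 0 m (P.cur e 1 n (ket p)) = 0) ∧
    ∀ m n, m + n < c → P.cur e 1 m (P.cur e 0 n (ket p)) = 0 := by
  obtain ⟨a, a1, a2⟩ := exists_bound (P := P) e e 0 0 p
  obtain ⟨b, b1, b2⟩ := exists_bound (P := P) e e 0 1 p
  obtain ⟨c, -, c2⟩ := exists_bound (P := P) e e 1 0 p
  refine ⟨min a (min b c), fun n h => a1 n ?_, fun n h => b1 n ?_, fun m n h => a2 m n ?_,
    fun m n h => b2 m n ?_, fun m n h => c2 m n ?_⟩ <;>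
  · simp only [lt_min_iff] at h
    omega

lemma serre_cur (hq : P.Generic) (e : PM) (i j m : ℤ) :
    P.cur e 0 i * P.cur e 0 j * P.cur e 1 m
      - (qp P.lq 1 + qp P.lq (-1)) • (P.cur e 0 i * P.cur e 1 m * P.cur e 0 j)
      + P.cur e 1 m * P.cur e 0 i * P.cur e 0 j
      + (P.cur e 0 j * P.cur e 0 i * P.cur e 1 m
      - (qp P.lq 1 + qp P.lq (-1)) • (P.cur e 0 j * P.cur e 1 m * P.cur e 0 i)
      + P.cur e 1 m * P.cur e 0 j * P.cur e 0 i) = 0 := by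
  have h1 : qp P.lq 1 = P.qv (1, 0) := by simpa using qp_eq_qv (P := P) 1
  have h2 : qp P.lq (-1) = P.qv (-1, 0) := by simpa using qp_eq_qv (P := P) (-1)
  have hne : P.qv (1, 0) ≠ P.qv (-1, 0) := by
    rw [← h1, ← h2]
    exact sub_ne_zero.1 hq.den_ne
  have e1 : P.qv (-1, 0) = (P.qv (1, 0))⁻¹ := by rw [← qv_neg]; rfl
  have e2 : P.qv (2, 0) = P.qv (1, 0) ^ 2 := by rw [qv_eq 2 0]; simp
  have e3 : P.qv (3, 0) = P.qv (1, 0) ^ 3 := by rw [qv_eq 3 0]; simp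
  have e4 : P.qv (-2, 0) = P.qv (-1, 0) ^ 2 := by rw [e1, qv_eq (-2) 0]; simp
  have e5 : P.qv (-3, 0) = P.qv (-1, 0) ^ 3 := by rw [e1, qv_eq (-3) 0]; simp
  have e6 : P.qv (1, 0) = (P.qv (-1, 0))⁻¹ := by rw [e1, inv_inv]
  rw [h1, h2]
  cases e
  · obtain ⟨Z, hZ, hW⟩ := wheel_plus hq
    rw [e1] at hne ⊢
    refine serre_of_wheel (P.qv_ne_zero _) hne.symm (fun M N => ?_) (fun M N => ?_) ?_ ?_
      (exists_bound_serre .plus) i j m (Z := Z)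
    · rw [← e2]; exact (quadHom_plus hq M N).1
    · rw [← e1]; exact (quadHom_plus hq M N).2
    · rw [← e1]; exact hZ
    · rw [← e3]; exact hW
  · obtain ⟨Z, hZ, hW⟩ := wheel_minus hq
    have := serre_of_wheel (P.qv_ne_zero (-1, 0)) (by rw [← e6]; exact hne)
      (fun M N => by rw [← e4]; exact quadHom_minus_zero hq M N)
      (fun M N => by rw [← e6]; exact quadHom_minus_mixed hq M N)
      (fun L p => by rw [← e6]; exact hZ L p) (fun L p => by rw [← e5]; exact hW L p)
      (exists_bound_serre .minus) i j m
    rwa [← e6, add_comm (P.qv (-1, 0))] at this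

/-- The Serre relations of `U_q`. -/
lemma rep_serre (hq : P.Generic) (e : PM) (n₁ n₂ m : ℤ) :
    P.rep (FA.br 0 (qp P.lq 1) (FA.X e 0 n₁) (FA.br 0 (qp P.lq (-1)) (FA.X e 0 n₂) (FA.X e 1 m))
      + FA.br 0 (qp P.lq 1) (FA.X e 0 n₂)
        (FA.br 0 (qp P.lq (-1)) (FA.X e 0 n₁) (FA.X e 1 m))) = 0 := by
  have h := serre_cur hq e (-n₁) (-n₂) (-m)
  have h0 : qp P.lq 1 * qp P.lq (-1) = 1 := by rw [← qp_add, add_neg_cancel, qp_zero]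
  rw [map_add]
  simp only [rep_br, rep_X hq, pow_zero, one_mul]
  rw [← h]
  simp only [mul_sub, sub_mul, mul_smul_comm, smul_mul_assoc, smul_sub, smul_smul, h0, one_smul,
    mul_assoc]
  module

end Params

namespace Params

variable {P : Params}

/-! ### The representation -/

/-- The bosonized generators satisfy the defining relations. -/
theorem rep_rel (hq : P.Generic) {x y : FA} (h : Rel P.lq x y) : P.rep x = P.rep y := by
  have hKX : ∀ i j e m, P.kop i * P.cur e j (-m) * (diag fun p => qp P.lq (-P.hzero i p))
      = qp P.lq (e.toInt * cartan i j) • P.cur e j (-m) := fun i j e m => by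
    rw [kop_cur, smul_mul_assoc, mul_assoc, kop_mul_inv, mul_one]
  have hC1 : qp P.lq ((1 : ℤ) * P.k / 2) * qp P.lq ((-1 : ℤ) * P.k / 2) = 1 := by
    rw [← qp_add, ← qp_zero P.lq]; congr 1; push_cast; ring
  cases h with
  | C_Cinv => rw [map_mul, rep_C, rep_C, smul_mul_smul_comm, hC1, one_smul, mul_one, map_one]
  | Cinv_C =>
    rw [map_mul, rep_C, rep_C, smul_mul_smul_comm, mul_comm (qp _ _), hC1, one_smul, mul_one,
      map_one]
  | C_central g => rw [map_mul, map_mul, rep_C, smul_mul_assoc, one_mul, mul_smul_comm, mul_one]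
  | K_Kinv i => rw [map_mul, rep_K, rep_Kinv, kop_mul_inv, map_one]
  | Kinv_K i => rw [map_mul, rep_K, rep_Kinv, inv_mul_kop, map_one]
  | K_K i j => rw [map_mul, map_mul, rep_K, rep_K, kop_kop]
  | K_h i j m hm => rw [map_mul, map_mul, rep_K, rep_h _ _ hm, kop_hmode]
  | d_K i => rw [map_mul, map_mul, rep_K, rep_d, dop_kop]
  | d_h j m hm => rw [map_sub, map_mul, map_mul, map_smul, rep_h _ _ hm, rep_d, dop_hmode]
  | h_h i j m n hm hn =>
    rw [map_sub, map_mul, map_mul, rep_h _ _ hm, rep_h _ _ hn, hmode_commutator hq i j hm hn]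
    split_ifs
    · rw [map_smul, rep_qnumC, smul_smul]
    · rw [map_zero]
  | K_X i j e m => rw [map_mul, map_mul, map_smul, rep_K, rep_Kinv, rep_X hq, hKX]
  | d_X e j m =>
    rw [map_sub, map_mul, map_mul, map_smul, rep_X hq, rep_d, dop_cur]
    simp
  | h_X i j e m n hm =>
    rw [map_sub, map_mul, map_mul, map_smul, map_mul, rep_h _ _ hm, rep_X hq, rep_X hq,
      hmode_cur_commutator hq e i j hm, rep_C, smul_mul_assoc, one_mul, smul_smul, neg_add,
      ← sub_eq_add_neg]
    push_cast
    rfl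
  | X_X i j m n => exact rep_X_X hq i j m n
  | X2_X2 e m n =>
    have := brHom_odd hq e (-m) (-n)
    rw [brHom_apply] at this
    rw [rep_br, rep_X hq, rep_X hq, map_zero, ← this]
    simp
  | quad e i j hij m n => rw [rep_quad hq e i j hij m n, map_zero]
  | serre e n₁ n₂ m => rw [rep_serre hq, map_zero]

/-! ### The ghost system -/

/-- The current `η(z)` as a symbolic vertex operator. -/
def etaT : Term := ⟨1, 0, 0, [(1, .fld .c 0 0)], 0⟩

/-- The current `ξ(z)` as a symbolic vertex operator. -/
def xiT : Term := ⟨1, 0, 0, [(-1, .fld .c 0 0)], 0⟩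

lemma eta_eq : P.eta 0 = P.term etaT (-1) := by
  rw [eta, term]
  simp [coef, etaT, symE, pieceE]

lemma xi_eq : P.xi 0 = P.term xiT 0 := by
  rw [xi, term]
  simp [coef, xiT, symE, pieceE]

/-- `η(z)` anticommutes with itself. -/
lemma eta_mul_eta (hq : P.Generic) : P.eta 0 * P.eta 0 = 0 := by
  have h := brHom_term_regular hq (T := etaT) (U := etaT) (τ := 0) (by decide) (-1) (-1)
  rw [brHom_apply, pow_zero, one_smul, ← two_smul ℂ, ← eta_eq] at h
  exact (smul_eq_zero.1 h).resolve_left two_ne_zero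

lemma xi_mul_xi (hq : P.Generic) : P.xi 0 * P.xi 0 = 0 := by
  have h := brHom_term_regular hq (T := xiT) (U := xiT) (τ := 0) (by decide) 0 0
  rw [brHom_apply, pow_zero, one_smul, ← two_smul ℂ, ← xi_eq] at h
  exact (smul_eq_zero.1 h).resolve_left two_ne_zero

lemma vertex_zero : P.vertex 0 0 = 1 := by
  rw [P.vertex_of_annA_eq_zero rfl fun m _ => by simp [annA]]
  rw [creCoeff_eq]
  change _ * zext (expCoeff (P.creA 0)) ((0 : ℕ) : ℤ) = _
  rw [zext_natCast, expCoeff_zero, mul_one, ← diag_one]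
  congr 1
  funext p
  simp [zq]

/-- The anticommutator of `η(z)` and `ξ(w)` is the delta function at `z = w`, where the exponents of the
two vertex operators cancel. -/
lemma eta_xi_add (hq : P.Generic) : P.eta 0 * P.xi 0 + P.xi 0 * P.eta 0 = 1 := by
  have h := brHom_delta hq (s := etaT.sym) (t := xiT.sym) (τ := 0) (num := []) (num' := [])
    (a := 0) (by decide) (-1) 0
  have h0 : P.vop (Sym.shift 0 etaT.sym ++ xiT.sym) 0 = 1 := by
    rw [vop, P.vertex_sameOp hq.lq_ne (t := []) (by decide)]
    exact vertex_zero
  have e1 : ∀ N, P.term etaT N = P.vop etaT.sym N := fun N => by simp [term, coef, etaT, vop]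
  have e2 : ∀ N, P.term xiT N = P.vop xiT.sym N := fun N => by simp [term, coef, xiT, vop]
  rw [show etaT.sym.zl xiT.sym.chg = -1 by decide, show (-1 + 0 - -1 : ℤ) = 0 by rfl, h0, dcoef,
    show etaT.sym.zl xiT.sym.chg = -1 by decide, show etaT.sym.qe xiT.sym.chg = 0 by decide,
    show etaT.sym.sg xiT.sym.chg = 0 by decide, brHom_apply] at h
  rw [eta_eq, xi_eq, e1, e2]
  simpa using h

set_option maxRecDepth 4000 in
/-- The commutator of `η(z)` with `X^{+,1}(w)` is a difference of delta functions, which has no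
zero mode in `z`. -/
lemma eta_plus_cancel (hq : P.Generic) (N : ℤ) :
    brHom ((-1) ^ 1) (-1) N (P.term etaT) (P.term .p1a)
      + brHom ((-1) ^ 1) (-1) N (P.term etaT) (P.term .p1b) = 0 := by
  rw [brHom_term, brHom_term,
    brHom_delta hq (a := (1, 0)) (num := []) (num' := []) (s := etaT.sym) (t := Term.p1a.sym)
      (by decide),
    brHom_delta hq (a := (-1, 0)) (num := []) (num' := []) (s := etaT.sym) (t := Term.p1b.sym)
      (by decide), vop, vop, P.vertex_sameOp hq.lq_ne (s := Sym.shift (1, 0) etaT.sym ++ Term.p1a.sym)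
      (t := Sym.shift (-1, 0) etaT.sym ++ Term.p1b.sym) (by decide), dcoef, dcoef,
    show etaT.sym.zl Term.p1a.sym.chg = -1 by decide, show etaT.sym.zl Term.p1b.sym.chg = -1 by decide,
    show etaT.sym.qe Term.p1a.sym.chg = 0 by decide, show etaT.sym.sg Term.p1a.sym.chg = 0 by decide,
    show etaT.sym.qe Term.p1b.sym.chg = 0 by decide, show etaT.sym.sg Term.p1b.sym.chg = 0 by decide]
  simp [coef, Term.p1a, Term.p1b, etaT]

set_option maxRecDepth 4000 in
/-- The anticommutator of `η(z)` with `X^{-,2}(w)` is a difference of delta functions, which has no zero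
mode in `z`. -/
lemma eta_minus_cancel (hq : P.Generic) (N : ℤ) :
    brHom ((-1) ^ 0) (-1) N (P.term etaT) (P.term .m2c)
      + brHom ((-1) ^ 0) (-1) N (P.term etaT) (P.term .m2d) = 0 := by
  rw [brHom_term, brHom_term,
    brHom_delta hq (a := (0, -1)) (num := []) (num' := []) (s := etaT.sym) (t := Term.m2c.sym)
      (by decide),
    brHom_delta hq (a := (-2, -1)) (num := []) (num' := []) (s := etaT.sym) (t := Term.m2d.sym)
      (by decide), vop, vop, P.vertex_sameOp hq.lq_ne (s := Sym.shift (0, -1) etaT.sym ++ Term.m2c.sym)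
      (t := Sym.shift (-2, -1) etaT.sym ++ Term.m2d.sym) (by decide), dcoef, dcoef,
    show etaT.sym.zl Term.m2c.sym.chg = -1 by decide, show etaT.sym.zl Term.m2d.sym.chg = -1 by decide,
    show etaT.sym.qe Term.m2c.sym.chg = 0 by decide, show etaT.sym.sg Term.m2c.sym.chg = 0 by decide,
    show etaT.sym.qe Term.m2d.sym.chg = 0 by decide, show etaT.sym.sg Term.m2d.sym.chg = 0 by decide]
  simp [coef, Term.m2c, Term.m2d, etaT]

set_option maxRecDepth 4000 in
open Term in
/-- The zero mode `η_0` commutes with `X^{±,1}` and anticommutes with `X^{±,2}`. -/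
lemma eta_cur (hq : P.Generic) (e : PM) (i : Fin 2) (N : ℤ) :
    P.eta 0 * P.cur e i N = (-1 : ℂ) ^ i.val • (P.cur e i N * P.eta 0) := by
  have key : ∀ τ : ℕ, (-1 : ℂ) ^ i.val = -(-1) ^ τ →
      brHom ((-1) ^ τ) (-1) N (P.term etaT) (P.cur e i) = 0 →
      P.eta 0 * P.cur e i N = (-1 : ℂ) ^ i.val • (P.cur e i N * P.eta 0) := fun τ h1 h2 => by
    rw [brHom_apply] at h2
    rw [eta_eq, h1, neg_smul, eq_neg_iff_add_eq_zero, h2]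
  have r : ∀ U τ, Sym.Regular etaT.sym U.sym [] [] τ →
      brHom ((-1) ^ τ) (-1) N (P.term etaT) (P.term U) = 0 :=
    fun U τ h => brHom_term_regular hq h _ N
  cases e <;> fin_cases i
  · refine key 1 (by simp) ?_
    rw [cur]
    simp only [terms, List.map_cons, List.map_nil, List.sum_cons, List.sum_nil,
      add_zero, map_add]
    exact eta_plus_cancel hq N
  · refine key 0 (by simp) ?_
    rw [cur]
    simp only [terms, List.map_cons, List.map_nil, List.sum_cons, List.sum_nil,
      add_zero, map_add]
    rw [r p2a 0 (by decide), r p2b 0 (by decide), add_zero]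
  · refine key 1 (by simp) ?_
    rw [cur]
    simp only [terms, List.map_cons, List.map_nil, List.sum_cons, List.sum_nil,
      add_zero, map_add]
    rw [r m1a 1 (by decide), r m1b 1 (by decide), r m1c 1 (by decide), add_zero, add_zero]
  · refine key 0 (by simp) ?_
    rw [cur]
    simp only [terms, List.map_cons, List.map_nil, List.sum_cons, List.sum_nil,
      add_zero, map_add]
    rw [r m2a 0 (by decide), r m2b 0 (by decide), eta_minus_cancel hq N, add_zero, add_zero]

lemma psi_eta_contr (i : Fin 2) :
    Balanced (Sym.contr (.psi .plus i) etaT.sym ++ ([] : List (ℤ × ℤ × ℤ)).map fun x => (-x.1, x.2)) ∧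
    Balanced (Sym.contr etaT.sym (.psi .minus i) ++ ([] : List (ℤ × ℤ × ℤ)).map fun x => (-x.1, x.2)) := by
  fin_cases i <;> decide

lemma hmode_eta (hq : P.Generic) (i : Fin 2) {m : ℤ} (hm : m ≠ 0) :
    P.eta 0 * P.hmode i m = P.hmode i m * P.eta 0 := by
  rw [eta_eq, term, eq_comm]
  obtain ⟨a, rfl | rfl⟩ := m.eq_nat_or_neg
  · have ha : a ≠ 0 := by omega
    rw [hmode_pos hq i ha, smul_mul_smul_comm, smul_mul_smul_comm, P.annA_vertex _ _ ha,
      cn_of_balanced hq (psi_eta_contr i).1 ha, mul_comm]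
    simp
  · have ha : a ≠ 0 := by omega
    rw [hmode_neg hq i ha, smul_mul_smul_comm, smul_mul_smul_comm, P.creA_vertex _ _ ha,
      cn_of_balanced hq (psi_eta_contr i).2 ha, mul_comm]
    simp

lemma diag_eta {f : Idx → ℂ} (h : ∀ p p' : Idx, p'.1 = p.1 + etaT.sym.chg →
    (deg p' : ℤ) = deg p + (-1 - zl (P.symE etaT.sym) p.1) → f p' = f p) :
    P.eta 0 * diag f = diag f * P.eta 0 := by
  have key : diag f * P.vertex (P.symE etaT.sym) (-1) = P.vertex (P.symE etaT.sym) (-1) * diag f :=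
    diag_mul_eq fun p => ⟨_, _, P.vertex_mem _ _ (ket_mem_grade p), fun p' h1 h2 =>
      h p p' (by rw [h1, symE_chg]) h2⟩
  have e : P.eta 0 = P.coef etaT • P.vertex (P.symE etaT.sym) (-1) := eta_eq
  rw [e, smul_mul_assoc, mul_smul_comm, key]

lemma hzero_eta (i : Fin 2) {p p' : Idx} (h : p'.1 = p.1 + etaT.sym.chg) :
    P.hzero i p' = P.hzero i p := by
  rw [P.hzero_add i h, show hchg i etaT.sym.chg = 0 by fin_cases i <;> decide, Int.cast_zero,
    add_zero]

/-- `η_0` has conformal weight zero. -/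
lemma dop_eta : P.eta 0 * P.dop = P.dop * P.eta 0 :=
  diag_eta fun p p' h1 h2 => by
    rw [P.dval_add (h1.trans (by rw [symE_chg])) h2, symE_chg,
      show ∑ g : Gh, g.sgn * (etaT.sym.chg g * (etaT.sym.chg g + 1)) = 2 by decide]
    norm_num

/-- The (anti)commutation of `η_0` with the generators. -/
lemma eta_bos (hq : P.Generic) (g : Gen) :
    P.eta 0 * P.bos g = (-1 : ℂ) ^ g.parity.val • (P.bos g * P.eta 0) := by
  cases g with
  | X e i m =>
    rw [bos, current_eq_cur hq, eta_cur hq]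
    congr 2
    fin_cases i <;> rfl
  | h i n => rw [bos, hmode_eta hq i n.2]; simp [Gen.parity]
  | K i =>
    change _ = (-1 : ℂ) ^ 0 • _
    rw [pow_zero, one_smul]
    exact diag_eta fun p p' h _ => by rw [hzero_eta i h]
  | Kinv i =>
    change _ = (-1 : ℂ) ^ 0 • _
    rw [pow_zero, one_smul]
    exact diag_eta fun p p' h _ => by rw [hzero_eta i h]
  | C => simp [bos, Gen.parity]
  | Cinv => simp [bos, Gen.parity]
  | d =>
    change _ = (-1 : ℂ) ^ 0 • _
    rw [pow_zero, one_smul]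
    exact dop_eta

/-! ### The sectors of the Fock space -/

lemma grade_le_sector {lam : Gh → ℤ} {d s : ℤ} (h : lam .c = lam .b12 + s) :
    grade lam d ≤ sector s := by
  refine Submodule.span_mono (Set.image_mono ?_)
  rintro p ⟨rfl, -⟩
  exact h

lemma map_sector {T : Module.End ℂ Fock} {s : ℤ} {W : Submodule ℂ Fock}
    (h : ∀ p : Idx, p.1 .c = p.1 .b12 + s → T (ket p) ∈ W) {v : Fock} (hv : v ∈ sector s) :
    T v ∈ W := by
  have : sector s ≤ W.comap T := by
    refine Submodule.span_le.2 ?_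
    rintro _ ⟨p, hp, rfl⟩
    exact h p hp
  exact this hv

lemma term_sector (T : Term) (N : ℤ) {s : ℤ} {v : Fock} (hv : v ∈ sector s) :
    P.term T N v ∈ sector (s + (T.sym.chg .c - T.sym.chg .b12)) := by
  refine map_sector (fun p hp => ?_) hv
  refine Submodule.smul_mem _ _ (grade_le_sector ?_ (P.vertex_mem _ _ (ket_mem_grade p)))
  rw [symE_chg, Pi.add_apply, Pi.add_apply, hp]
  ring

lemma eta_sector {s : ℤ} {v : Fock} (hv : v ∈ sector s) : P.eta 0 v ∈ sector (s + 1) := by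
  rw [eta_eq]
  exact term_sector etaT (-1) hv

lemma xi_sector {s : ℤ} {v : Fock} (hv : v ∈ sector s) : P.xi 0 v ∈ sector (s - 1) := by
  rw [xi_eq]
  exact term_sector xiT 0 hv

lemma shifts_sector {T : Module.End ℂ Fock} {m s : ℤ} (h : Shifts T m) {v : Fock}
    (hv : v ∈ sector s) : T v ∈ sector s :=
  map_sector (fun p hp => grade_le_sector hp (h _ _ _ (ket_mem_grade p))) hv

lemma diag_sector (f : Idx → ℂ) {s : ℤ} {v : Fock} (hv : v ∈ sector s) : diag f v ∈ sector s :=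
  map_sector (fun p hp => by
    rw [diag_ket]; exact Submodule.smul_mem _ _ (grade_le_sector hp (ket_mem_grade p))) hv

/-- Each term of a current changes the charges of `c` and `b^{12}` by the same amount, so that the currents
preserve the sectors. -/
lemma chg_terms (e : PM) (i : Fin 2) : ∀ T ∈ terms e i, T.sym.chg .c = T.sym.chg .b12 := by
  cases e <;> fin_cases i <;> decide

lemma cur_sector (e : PM) (i : Fin 2) (N : ℤ) {s : ℤ} {v : Fock} (hv : v ∈ sector s) :
    P.cur e i N v ∈ sector s := by
  rw [cur_sum]
  have h := chg_terms e i
  generalize terms e i = l at h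
  induction l with
  | nil => exact Submodule.zero_mem _
  | cons T l ih =>
    rw [List.map_cons, List.sum_cons, LinearMap.add_apply]
    refine Submodule.add_mem _ ?_ (ih fun T hT => h T (List.mem_cons_of_mem _ hT))
    have := term_sector (P := P) T N hv
    rwa [h T (by simp), sub_self, add_zero] at this

lemma bos_sector (hq : P.Generic) (g : Gen) {s : ℤ} {v : Fock} (hv : v ∈ sector s) :
    P.bos g v ∈ sector s := by
  cases g with
  | X e i m => rw [bos, current_eq_cur hq]; exact cur_sector e i _ hv
  | h i n => exact shifts_sector (P.hmode_shifts i n.1) hv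
  | K i => exact diag_sector _ hv
  | Kinv i => exact diag_sector _ hv
  | C => exact Submodule.smul_mem _ _ hv
  | Cinv => exact Submodule.smul_mem _ _ hv
  | d => exact diag_sector _ hv

end Params

/-! ### Invariant subspaces -/

section Invariant

variable {A V : Type*} [Ring A] [Algebra ℂ A] [AddCommGroup V] [Module ℂ V]

/-- The action on an invariant subspace. -/
def restrictHom (ρ : A →ₐ[ℂ] Module.End ℂ V) (W : Submodule ℂ V)
    (h : ∀ a, ∀ v ∈ W, ρ a v ∈ W) : A →ₐ[ℂ] Module.End ℂ W :=
  AlgHom.ofLinearMap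
    { toFun := fun a => (ρ a).restrict (h a)
      map_add' := fun a b => by ext v; simp
      map_smul' := fun c a => by ext v; simp }
    (by ext v; simp) fun a b => by ext v; simp

/-- The action on the quotient by an invariant subspace. -/
def quotientHom (ρ : A →ₐ[ℂ] Module.End ℂ V) (W : Submodule ℂ V)
    (h : ∀ a, ∀ v ∈ W, ρ a v ∈ W) : A →ₐ[ℂ] Module.End ℂ (V ⧸ W) :=
  AlgHom.ofLinearMap
    { toFun := fun a => W.mapQ W (ρ a) (h a)
      map_add' := fun a b => by ext v; simp
      map_smul' := fun c a => by ext v; simp }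
    (by ext v; simp) fun a b => by ext v; simp

lemma restrictHom_apply (ρ : A →ₐ[ℂ] Module.End ℂ V) (W : Submodule ℂ V)
    (h : ∀ a, ∀ v ∈ W, ρ a v ∈ W) (a : A) (v : W) : (restrictHom ρ W h a v : V) = ρ a v := rfl

lemma quotientHom_apply (ρ : A →ₐ[ℂ] Module.End ℂ V) (W : Submodule ℂ V)
    (h : ∀ a, ∀ v ∈ W, ρ a v ∈ W) (a : A) (v : V) :
    quotientHom ρ W h a (W.mkQ v) = W.mkQ (ρ a v) := rfl

end Invariant

/-- A square-zero pair of operators with `E X + X E = 1`, of degree `±1` with respect to a family of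
subspaces, splits each of the subspaces. -/
lemma ghost_splitting {V : Type*} [AddCommGroup V] [Module ℂ V] {E X : Module.End ℂ V}
    (hE : E * E = 0) (hX : X * X = 0) (h : E * X + X * E = 1) {S : ℤ → Submodule ℂ V}
    (hES : ∀ s, ∀ v ∈ S s, E v ∈ S (s + 1)) (hXS : ∀ s, ∀ v ∈ S s, X v ∈ S (s - 1)) (s : ℤ) :
    LinearMap.ker E ⊓ S s = (S s).map (E * X) ∧
      Disjoint ((S s).map (E * X)) ((S s).map (X * E)) ∧
      (S s).map (E * X) ⊔ (S s).map (X * E) = S s := by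
  have hE' : ∀ v, E (E v) = 0 := LinearMap.congr_fun hE
  have hX' : ∀ v, X (X v) = 0 := LinearMap.congr_fun hX
  have h' : ∀ v, E (X v) + X (E v) = v := LinearMap.congr_fun h
  have hEX : ∀ v ∈ S s, E (X v) ∈ S s := fun v hv => by
    simpa using hES _ _ (hXS _ _ hv)
  have hXE : ∀ v ∈ S s, X (E v) ∈ S s := fun v hv => by
    simpa using hXS _ _ (hES _ _ hv)
  refine ⟨le_antisymm ?_ ?_, ?_, le_antisymm (sup_le ?_ ?_) fun v hv => ?_⟩
  · rintro v ⟨hv, hs⟩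
    refine ⟨v, hs, ?_⟩
    have := h' v
    rwa [LinearMap.mem_ker.1 hv, map_zero, add_zero] at this
  · rintro _ ⟨v, hv, rfl⟩
    exact ⟨hE' _, hEX v hv⟩
  · rw [Submodule.disjoint_def]
    rintro _ ⟨v, -, rfl⟩ ⟨w, -, hw⟩
    have h1 : X (E (X v)) = X v := by have := h' (X v); rwa [hX', map_zero, zero_add] at this
    have h2 : X (X (E w)) = X (E (X v)) := congrArg X hw
    rw [hX', h1] at h2
    rw [Module.End.mul_apply, ← h2, map_zero]
  · rintro _ ⟨v, hv, rfl⟩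
    exact hEX v hv
  · rintro _ ⟨v, hv, rfl⟩
    exact hXE v hv
  · rw [← h' v]
    exact Submodule.add_mem_sup ⟨v, hv, rfl⟩ ⟨v, hv, rfl⟩

namespace Params

variable {P : Params}

/-- The representation of `U_q` on the Fock space. -/
def action (hq : P.Generic) : Uq P.lq →ₐ[ℂ] Module.End ℂ Fock :=
  RingQuot.liftAlgHom ℂ ⟨P.rep, fun _ _ h => rep_rel hq h⟩

lemma action_gen (hq : P.Generic) (g : Gen) : action hq (Uq.gen P.lq g) = P.bos g := by
  rw [action, Uq.gen, RingQuot.liftAlgHom_mkAlgHom_apply, rep_ι]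

lemma action_mem (hq : P.Generic) {W : Submodule ℂ Fock} (h : ∀ g, ∀ v ∈ W, P.bos g v ∈ W)
    (u : Uq P.lq) : ∀ v ∈ W, action hq u v ∈ W := by
  obtain ⟨x, rfl⟩ := RingQuot.mkAlgHom_surjective ℂ (Rel P.lq) u
  rw [action, RingQuot.liftAlgHom_mkAlgHom_apply]
  induction x using FreeAlgebra.induction with
  | grade0 c => intro v hv; rw [AlgHom.commutes]; exact W.smul_mem c hv
  | grade1 g => rw [rep_ι]; exact h g
  | mul a b ha hb => intro v hv; rw [map_mul]; exact ha _ (hb _ hv)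
  | add a b ha hb => intro v hv; rw [map_add]; exact W.add_mem (ha _ hv) (hb _ hv)

/-- The (anti)commutation of `η_0` with homogeneous elements. -/
lemma eta_action (hq : P.Generic) (p : ZMod 2) (u : Uq P.lq) (hu : u ∈ Uq.part P.lq p) :
    P.eta 0 * action hq u = (-1 : ℂ) ^ p.val • (action hq u * P.eta 0) := by
  have hsign : ∀ a b : ZMod 2, (-1 : ℂ) ^ (a + b).val = (-1) ^ a.val * (-1) ^ b.val := fun a b => by
    rw [ZMod.val_add, ← pow_add, ← neg_one_pow_eq_pow_mod_two]
  induction hu using Submodule.span_induction with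
  | mem x hx =>
    obtain ⟨l, rfl, rfl⟩ := hx
    induction l with
    | nil => simp
    | cons g l ih =>
      rw [List.map_cons, List.map_cons, List.sum_cons, List.prod_cons, map_mul, ← mul_assoc,
        action_gen, eta_bos hq, smul_mul_assoc, mul_assoc, ih, mul_smul_comm, smul_smul, hsign,
        mul_assoc]
  | zero => simp
  | add x y _ _ hx hy => rw [map_add, mul_add, add_mul, hx, hy, smul_add]
  | smul c x _ hx => rw [map_smul, mul_smul_comm, hx, smul_mul_assoc, smul_comm]

lemma eta_bos_eq_zero (hq : P.Generic) (g : Gen) {v : Fock} (hv : P.eta 0 v = 0) :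
    P.eta 0 (P.bos g v) = 0 := by
  have := LinearMap.congr_fun (eta_bos hq g) v
  rwa [Module.End.mul_apply, LinearMap.smul_apply, Module.End.mul_apply, hv, map_zero,
    smul_zero] at this

end Params

end SL21

end

theorem proposition4 (P : SL21.Params)
    (hq : ∀ n : ℕ, 0 < n → Complex.exp P.lq ^ n ≠ 1)
    (hk0 : P.k ≠ 0) (hk1 : P.k ≠ -1) :
    -- the ghost zero modes split `F_{(β,γ)}`, which identifies the kernel and the cokernel
    (LinearMap.ker (P.eta 0) ⊓ SL21.sector 0 = (SL21.sector 0).map (P.eta 0 * P.xi 0) ∧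
      Disjoint ((SL21.sector 0).map (P.eta 0 * P.xi 0)) ((SL21.sector 0).map (P.xi 0 * P.eta 0)) ∧
      (SL21.sector 0).map (P.eta 0 * P.xi 0) ⊔ (SL21.sector 0).map (P.xi 0 * P.eta 0)
        = SL21.sector 0) ∧
    -- the action of `U_q` on the Fock spaces
    ∃ ρ : SL21.Uq P.lq →ₐ[ℂ] Module.End ℂ SL21.Fock,
      (∀ g : SL21.Gen, ρ (SL21.Uq.gen P.lq g) = P.bos g) ∧
      -- `η_0` commutes with the even and anticommutes with the odd elements
      (∀ (p : ZMod 2), ∀ u ∈ SL21.Uq.part P.lq p,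
        P.eta 0 * ρ u = (-1 : ℂ) ^ p.val • (ρ u * P.eta 0)) ∧
      -- `F_{(β,γ)}`, `Ker η_0` and `Coker η_0` are modules with the induced action
      ∃ ρF : SL21.Uq P.lq →ₐ[ℂ] Module.End ℂ (SL21.sector 0),
        (∀ u v, (ρF u v : SL21.Fock) = ρ u v) ∧
        (∃ ρK : SL21.Uq P.lq →ₐ[ℂ] Module.End ℂ P.kerEta,
          ∀ u v, (ρK u v : SL21.sector 0) = ρF u v) ∧
        (∃ ρC : SL21.Uq P.lq →ₐ[ℂ] Module.End ℂ P.cokerEta,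
          ∀ u v, ρC u (P.kerEta.mkQ v) = P.kerEta.mkQ (ρF u v)) := by
  have hF : ∀ u, ∀ v ∈ SL21.sector 0, SL21.Params.action hq u v ∈ SL21.sector 0 :=
    SL21.Params.action_mem hq fun g _ hv => SL21.Params.bos_sector hq g hv
  have hK : ∀ u, ∀ v ∈ P.kerEta, SL21.restrictHom (SL21.Params.action hq) _ hF u v ∈ P.kerEta :=
    fun u v hv => SL21.Params.action_mem hq (W := LinearMap.ker (P.eta 0))
      (fun g _ h => SL21.Params.eta_bos_eq_zero hq g h) u v hv
  refine ⟨SL21.ghost_splitting (S := SL21.sector) (SL21.Params.eta_mul_eta hq) (SL21.Params.xi_mul_xi hq)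
      (SL21.Params.eta_xi_add hq) (fun _ _ hv => SL21.Params.eta_sector hv)
      (fun _ _ hv => SL21.Params.xi_sector hv) 0,
    SL21.Params.action hq, SL21.Params.action_gen hq, SL21.Params.eta_action hq,
    SL21.restrictHom _ _ hF, SL21.restrictHom_apply _ _ hF, ⟨SL21.restrictHom _ _ hK, ?_⟩,
    SL21.quotientHom _ _ hK, ?_⟩
  · exact SL21.restrictHom_apply _ _ hK
  · exact SL21.quotientHom_apply _ _ hK
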